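/- Let $A=(a_{i,j})_{i,j\in I}$ be a generalized Cartan matrix ($I$ finite) and $r_i\in\mathbb Z_{>0}$ such that $b_{i,j}=r_ia_{i,j}$ is symmetric. Fix a realization of $A$ over $\mathbb C$ with Cartan subalgebra $\mathfrak h$, simple roots $\alpha_i$ and simple coroots $\alpha_i^\vee$. Put $v_i=v^{r_i}$, $[m]_u=\frac{u^{-m}-u^m}{u^{-1}-u}$, and let $\begin{bmatrix} r\\k\end{bmatrix}_u$ be the corresponding Gaussian binomials. Let $U_v(\mathcal L\mathfrak g)$ be the quantum loop algebra: the $\mathbb C(v)$-algebra generated by $E_{i,l},F_{i,l}$ ($i\in I$, $l\in\mathbb Z$), $H_{i,s}$ ($i\in I$, $s\in\mathbb Z\setminus\{0\}$) and $K_h$ (for those $h\in\mathfrak h$ with $\alpha_j(h)\in\mathbb Z$ for all $j$), with the relations $K_hK_{h'}=K_{h+h'}$, $K_0=1$, $[K_h,H_{j,s}]=0$, $[H_{i,s},H_{j,t}]=0$, $K_hE_{j,l}K_{-h}=v^{-\alpha_j(h)}E_{j,l}$, $K_hF_{j,l}K_{-h}=v^{\alpha_j(h)}F_{j,l}$, $[H_{i,s},E_{j,l}]=\frac{[sb_{i,j}]_v}{s}E_{j,s+l}$,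 $[H_{i,s},F_{j,l}]=-\frac{[sb_{i,j}]_v}{s}F_{j,s+l}$, $[E_{i,l},F_{j,m}]=\delta_{i,j}\frac{\phi^+_{i,l+m}-\phi^-_{i,l+m}}{v_i^{-1}-v_i}$, where $\sum_{s\ge0}\phi^\pm_{i,\pm s}z^{\pm s}=K_{\pm r_i\alpha_i^\vee}\exp\big(\pm(v^{-1}-v)\sum_{s\ge1}H_{i,\pm s}z^{\pm s}\big)$ and $\phi^\pm_{i,\pm s}=0$ for $s<0$; the quadratic relations $$v^{b_{i,j}}E_{i,l+1}E_{j,m}-E_{j,m}E_{i,l+1}=E_{i,l}E_{j,m+1}-v^{b_{i,j}}E_{j,m+1}E_{i,l};$$ for $i\ne j$, $r=1-a_{i,j}$, $l_1,\dots,l_r,l'\in\mathbb Z$, the loop Serre relations $$\sum_{\sigma\in\mathfrak S_r}\sum_{k=0}^r(-1)^k\begin{bmatrix} r\\k\end{bmatrix}_{v_i}E_{i,l_{\sigma(1)}}\cdots E_{i,l_{\sigma(k)}}E_{j,l'}E_{i,l_{\sigma(k+1)}}\cdots E_{i,l_{\sigma(r)}}=0;$$ and the same quadratic and Serre relations for the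 $F_{i,l}$, with $v^{-b_{i,j}}$ in place of $v^{b_{i,j}}$. Let $U^+$ be the subalgebra generated by all $E_{i,l}$ and all $H_{i,s}$ with $s>0$, and $U_v(\mathcal L\mathfrak n)\subset U^+$ the subalgebra generated by all $E_{i,l}$. Let $\sum_{s\ge0}\theta^+_{i,s}z^s=\exp\big((v^{-1}-v)\sum_{s\ge1}H_{i,s}z^s\big)$. Grade $U^+$ by the root lattice ($\mathrm{wt}\,E_{i,l}=\alpha_i$, $\mathrm{wt}\,H_{i,s}=0$), with $(\alpha_i,\alpha_j)=b_{i,j}$, and let $U^+\hat\otimes U^+$ be the completed tensor square (allowing infinite sums of tensors whose first factors have loop degree tending to $+\infty$, where $E_{i,l}$ and $H_{i,l}$ have loop degree $l$) with the product $(x_1\otimes x_2)(y_1\otimes y_2)=v^{-(\mathrm{wt}\,x_2,\mathrm{wt}\,y_1)}x_1y_1\otimes x_2y_2$ for homogeneous factors. Then there are a $\mathbb C(v)$-algebra homomorphism $\Delta':U^+\to U^+\hat\otimes U^+$ with $$\Delta'(E_{i,n})=E_{i,n}\otimes1+\sum_{t\ge0}\theta^+_{i,t}\otimes E_{i,n-t},\qquad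 \Delta'(\theta^+_{i,m})=\sum_{0\le t\le m}\theta^+_{i,m-t}\otimes\theta^+_{i,t},$$ and a symmetric bilinear form $(\,,):U^+\times U^+\to\mathbb C(v)$ with $(1,1)=1$, $$(E_{i,k},E_{j,l})=\frac{\delta_{i,j}\delta_{k,l}}{v^{-2}-1},\qquad (H_{i,m},H_{j,n})=\delta_{m,n}\frac{[m\,b_{i,j}]_v}{m(v^{-1}-v)},\qquad(E_{i,k},H_{j,m})=0,$$ which is a Hopf pairing: $(x,yz)=(\Delta'(x),y\otimes z)$, where $(x_1\otimes x_2,y\otimes z)=(x_1,y)(x_2,z)$ and the right-hand side is a finite sum. For any such $\Delta'$ and $(\,,)$, writing $\Delta'(x)=\sum x_{(1)}\otimes x_{(2)}$, the formula $$F'_{i,n}(x)=\sum(v^{-2}-1)(E_{i,n},x_{(1)})\,x_{(2)}$$ is a finite sum for every $x\in U_v(\mathcal L\mathfrak n)$ and defines linear operators $F'_{i,n}$ ($i\in I$, $n\in\mathbb Z$) on $U_v(\mathcal L\mathfrak n)$, which satisfy the following relations. For all $i,j\in I$ and $l,m\in\mathbb Z$, $$F'_{i,l+1}F'_{j,m}-v^{b_{i,j}}F'_{j,m}F'_{i,l+1}=v^{b_{i,j}}F'_{i,l}F'_{j,m+1}-F'_{j,m+1}F'_{i,l}.$$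 For all $i\ne j$ in $I$, $r=1-a_{i,j}$, and all integers $l_1,\dots,l_r,l'$, $$\sum_{\sigma\in\mathfrak S_r}\sum_{k=0}^r(-1)^k\begin{bmatrix} r\\k\end{bmatrix}_{v_i}F'_{i,l_{\sigma(1)}}\cdots F'_{i,l_{\sigma(k)}}F'_{j,l'}F'_{i,l_{\sigma(k+1)}}\cdots F'_{i,l_{\sigma(r)}}=0.$$ -/

import Mathlib

open scoped TensorProduct

noncomputable section

namespace QuantumLoop

/-- The ground field `ℂ(v)`. -/
abbrev Scalar : Type := RatFunc ℂ

/-- The indeterminate `v`. -/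
def v : Scalar := RatFunc.X

/-- The quantum integer `[m]_u = (u⁻ᵐ - uᵐ) / (u⁻¹ - u)`. -/
def qint (u : Scalar) (m : ℤ) : Scalar := (u ^ (-m) - u ^ m) / (u⁻¹ - u)

/-- The quantum factorial `[n]_u!`. -/
def qfactorial (u : Scalar) (n : ℕ) : Scalar := ∏ k ∈ Finset.range n, qint u ((k : ℤ) + 1)

/-- The Gaussian binomial coefficient. -/
def qbinom (u : Scalar) (n k : ℕ) : Scalar :=
  qfactorial u n / (qfactorial u k * qfactorial u (n - k))

/-! ### Two expressions in an arbitrary algebra -/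

section Expressions

variable {S : Type*} [Ring S] [Algebra Scalar S]

/-- The coefficient of `z ^ s` in `exp (∑_{m ≥ 1} x_m z ^ m)`. The terms `f ^ k / k!` with `k > s` do
not contribute, because `f` has no constant term. -/
def expCoeff (x : ℕ → S) (s : ℕ) : S :=
  ∑ k ∈ Finset.range (s + 1), ((k.factorial : Scalar)⁻¹) •
    PowerSeries.coeff s ((PowerSeries.mk fun m => if m = 0 then 0 else x m) ^ k)

/-- The left-hand side of the loop Serre relation,
`∑_σ ∑_k (-1)^k [r, k]_u X_{l_σ(1)} ⋯ X_{l_σ(k)} y X_{l_σ(k+1)} ⋯ X_{l_σ(r)}`. -/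
def serreSum (u : Scalar) (X : ℤ → S) (y : S) (r : ℕ) (l : Fin r → ℤ) : S :=
  ∑ σ : Equiv.Perm (Fin r), ∑ k ∈ Finset.range (r + 1), ((-1) ^ k * qbinom u r k) •
    (((List.ofFn fun a => X (l (σ a))).take k).prod * y *
      ((List.ofFn fun a => X (l (σ a))).drop k).prod)

end Expressions

/-! ### Cartan data -/

section Cartan

variable {ι : Type*}

/-- `A` is a generalized Cartan matrix and `diag(d)` is a symmetrizer of it. -/
structure IsSymmetrizableGCM (A : Matrix ι ι ℤ) (d : ι → ℕ) : Prop where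
  diag : ∀ i, A i i = 2
  off_diag : ∀ i j, i ≠ j → A i j ≤ 0
  zero_iff : ∀ i j, A i j = 0 ↔ A j i = 0
  pos : ∀ i, 0 < d i
  symm : ∀ i j, (d i : ℤ) * A i j = (d j : ℤ) * A j i

/-- The entries `b_{i,j} = d_i a_{i,j}` of the symmetrized matrix. -/
def bMat (A : Matrix ι ι ℤ) (d : ι → ℕ) (i j : ι) : ℤ := (d i : ℤ) * A i j

/-- The form `(α_i, α_j) = b_{i,j}` on the root lattice, an element of which is given by its
coordinates with respect to the simple roots. -/
def rootForm [Fintype ι] (A : Matrix ι ι ℤ) (d : ι → ℕ) (α β : ι → ℤ) : ℤ :=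
  ∑ i, ∑ j, α i * bMat A d i j * β j

/-- A realization of `A` over `ℂ`, with Cartan subalgebra `V`. -/
structure Realization [Fintype ι] [DecidableEq ι] (A : Matrix ι ι ℤ)
    (V : Type*) [AddCommGroup V] [Module ℂ V] where
  finiteDimensional : FiniteDimensional ℂ V
  root : ι → Module.Dual ℂ V
  coroot : ι → V
  linearIndependent_root : LinearIndependent ℂ root
  linearIndependent_coroot : LinearIndependent ℂ coroot
  root_coroot : ∀ i j, root j (coroot i) = (A i j : ℂ)
  finrank_add_rank :
    Module.finrank ℂ V + (A.map fun a : ℤ => (a : ℂ)).rank = 2 * Fintype.card ι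

end Cartan

section Algebra

variable {ι : Type*} [Fintype ι] [DecidableEq ι] {A : Matrix ι ι ℤ} {V : Type*} [AddCommGroup V]
  [Module ℂ V]

/-- The elements `h` of the Cartan subalgebra for which every `v ^ α_j(h)` is an element of `ℂ(v)`,
that is, for which all `α_j(h)` are integers. -/
def Realization.lattice (R : Realization A V) : AddSubgroup V where
  carrier := {h | ∀ j, ∃ m : ℤ, R.root j h = (m : ℂ)}
  zero_mem' := fun _ => ⟨0, by simp⟩
  add_mem' := by
    intro a b ha hb j
    obtain ⟨m, hm⟩ := ha j
    obtain ⟨n, hn⟩ := hb j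
    exact ⟨m + n, by simp [hm, hn]⟩
  neg_mem' := by
    intro a ha j
    obtain ⟨m, hm⟩ := ha j
    exact ⟨-m, by simp [hm]⟩

/-- The element `d_i α_i^∨` of the lattice. -/
def Realization.scaledCoroot (R : Realization A V) (d : ι → ℕ) (i : ι) : R.lattice :=
  ⟨d i • R.coroot i, fun j => ⟨(d i : ℤ) * A i j, by simp [R.root_coroot]⟩⟩

/-! ### The quantum loop algebra -/

/-- The generators `E_{i,l}`, `F_{i,l}`, `K_h` and `H_{i,s}`, `s ≠ 0`. -/
inductive Gen (R : Realization A V) : Type _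
  | E (i : ι) (l : ℤ) : Gen R
  | F (i : ι) (l : ℤ) : Gen R
  | K (h : R.lattice) : Gen R
  | H (i : ι) (s : {s : ℤ // s ≠ 0}) : Gen R

/-- The free algebra on the generators. -/
abbrev Free (R : Realization A V) : Type _ := FreeAlgebra Scalar (Gen R)

namespace Free

variable (R : Realization A V) (d : ι → ℕ)

def E (i : ι) (l : ℤ) : Free R := FreeAlgebra.ι Scalar (Gen.E i l)

def F (i : ι) (l : ℤ) : Free R := FreeAlgebra.ι Scalar (Gen.F i l)

def K (h : R.lattice) : Free R := FreeAlgebra.ι Scalar (Gen.K h)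

def H (i : ι) (s : {s : ℤ // s ≠ 0}) : Free R := FreeAlgebra.ι Scalar (Gen.H i s)

/-- `φ⁺_{i,m}`, the coefficient of `z ^ m` in
`K_{d_i α_i^∨} exp ((v⁻¹ - v) ∑_{s ≥ 1} H_{i,s} z ^ s)`. -/
def phiPlus (i : ι) (m : ℤ) : Free R :=
  if 0 ≤ m then
    K R (R.scaledCoroot d i) *
      expCoeff (fun s : ℕ => if hs : (s : ℤ) ≠ 0 then (v⁻¹ - v) • H R i ⟨(s : ℤ), hs⟩ else 0) m.toNat
  else 0

/-- `φ⁻_{i,m}`, the coefficient of `z ^ m` in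
`K_{-d_i α_i^∨} exp (-(v⁻¹ - v) ∑_{s ≥ 1} H_{i,-s} z ^ {-s})`. -/
def phiMinus (i : ι) (m : ℤ) : Free R :=
  if m ≤ 0 then
    K R (-R.scaledCoroot d i) *
      expCoeff (fun s : ℕ => if hs : -(s : ℤ) ≠ 0 then (-(v⁻¹ - v)) • H R i ⟨-(s : ℤ), hs⟩ else 0)
        (-m).toNat
  else 0

end Free

open Free in
/-- The defining relations of the quantum loop algebra. -/
inductive Rel (d : ι → ℕ) (R : Realization A V) : Free R → Free R → Prop
  | K_add (h h' : R.lattice) : Rel d R (K R h * K R h') (K R (h + h'))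
  | K_zero : Rel d R (K R 0) 1
  | K_H (h : R.lattice) (j : ι) (s : {s : ℤ // s ≠ 0}) : Rel d R (K R h * H R j s) (H R j s * K R h)
  | H_H (i j : ι) (s t : {s : ℤ // s ≠ 0}) : Rel d R (H R i s * H R j t) (H R j t * H R i s)
  | K_E (h : R.lattice) (j : ι) (l m : ℤ) (hm : R.root j (h : V) = (m : ℂ)) :
      Rel d R (K R h * E R j l * K R (-h)) (v ^ (-m) • E R j l)
  | K_F (h : R.lattice) (j : ι) (l m : ℤ) (hm : R.root j (h : V) = (m : ℂ)) :
      Rel d R (K R h * F R j l * K R (-h)) (v ^ m • F R j l)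
  | H_E (i j : ι) (s : {s : ℤ // s ≠ 0}) (l : ℤ) :
      Rel d R (H R i s * E R j l - E R j l * H R i s)
        ((qint v ((s : ℤ) * bMat A d i j) / ((s : ℤ) : Scalar)) • E R j ((s : ℤ) + l))
  | H_F (i j : ι) (s : {s : ℤ // s ≠ 0}) (l : ℤ) :
      Rel d R (H R i s * F R j l - F R j l * H R i s)
        ((-(qint v ((s : ℤ) * bMat A d i j) / ((s : ℤ) : Scalar))) • F R j ((s : ℤ) + l))
  | E_F_same (i : ι) (l m : ℤ) :
      Rel d R (E R i l * F R i m - F R i m * E R i l)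
        (((v ^ d i)⁻¹ - v ^ d i)⁻¹ • (phiPlus R d i (l + m) - phiMinus R d i (l + m)))
  | E_F_ne (i j : ι) (hij : i ≠ j) (l m : ℤ) : Rel d R (E R i l * F R j m - F R j m * E R i l) 0
  | E_E (i j : ι) (l m : ℤ) :
      Rel d R (v ^ bMat A d i j • (E R i (l + 1) * E R j m) - E R j m * E R i (l + 1))
        (E R i l * E R j (m + 1) - v ^ bMat A d i j • (E R j (m + 1) * E R i l))
  | F_F (i j : ι) (l m : ℤ) :
      Rel d R (v ^ (-bMat A d i j) • (F R i (l + 1) * F R j m) - F R j m * F R i (l + 1))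
        (F R i l * F R j (m + 1) - v ^ (-bMat A d i j) • (F R j (m + 1) * F R i l))
  | serre_E (i j : ι) (hij : i ≠ j) (r : ℕ) (hr : (r : ℤ) = 1 - A i j) (l : Fin r → ℤ) (l' : ℤ) :
      Rel d R (serreSum (v ^ d i) (E R i) (E R j l') r l) 0
  | serre_F (i j : ι) (hij : i ≠ j) (r : ℕ) (hr : (r : ℤ) = 1 - A i j) (l : Fin r → ℤ) (l' : ℤ) :
      Rel d R (serreSum (v ^ d i) (F R i) (F R j l') r l) 0

/-- The quantum loop algebra. -/
def LoopAlg (d : ι → ℕ) (R : Realization A V) : Type _ := RingQuot (Rel d R)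

instance (d : ι → ℕ) (R : Realization A V) : Ring (LoopAlg d R) :=
  inferInstanceAs (Ring (RingQuot (Rel d R)))

instance (d : ι → ℕ) (R : Realization A V) : Algebra Scalar (LoopAlg d R) :=
  inferInstanceAs (Algebra Scalar (RingQuot (Rel d R)))

variable (d : ι → ℕ) (R : Realization A V)

/-- The quotient map from the free algebra to the quantum loop algebra. -/
def proj : Free R →ₐ[Scalar] LoopAlg d R := RingQuot.mkAlgHom Scalar (Rel d R)

/-- The subalgebra generated by all `E_{i,l}` and by the `H_{i,s}` with `s > 0`. -/
def Uplus : Subalgebra Scalar (LoopAlg d R) :=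
  Algebra.adjoin Scalar
    ({x | ∃ i l, x = proj d R (Free.E R i l)} ∪
      {x | ∃ i, ∃ s : {s : ℤ // s ≠ 0}, 0 < (s : ℤ) ∧ x = proj d R (Free.H R i s)})

/-- `E_{i,l}` as an element of `Uplus`. -/
def Eplus (i : ι) (l : ℤ) : Uplus d R :=
  ⟨proj d R (Free.E R i l), Algebra.subset_adjoin (Or.inl ⟨i, l, rfl⟩)⟩

/-- `H_{i,s}` with `s > 0` as an element of `Uplus`. -/
def Hplus (i : ι) (s : ℕ) (hs : 0 < s) : Uplus d R :=
  ⟨proj d R (Free.H R i ⟨(s : ℤ), by omega⟩),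
    Algebra.subset_adjoin (Or.inr ⟨i, ⟨(s : ℤ), by omega⟩, by simpa using hs, rfl⟩)⟩

/-- `θ⁺_{i,s}`, the coefficient of `z ^ s` in `exp ((v⁻¹ - v) ∑_{m ≥ 1} H_{i,m} z ^ m)`. -/
def thetaPlus (i : ι) (s : ℕ) : Uplus d R :=
  expCoeff (fun m : ℕ => if hm : 0 < m then (v⁻¹ - v) • Hplus d R i m hm else 0) s

/-- The subalgebra of `Uplus` generated by all `E_{i,l}`. -/
def Un : Subalgebra Scalar (Uplus d R) :=
  Algebra.adjoin Scalar {x | ∃ i l, x = Eplus d R i l}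

/-! ### The weight decomposition -/

/-- The weight of a generator, in the root lattice. -/
def Gen.weight {R : Realization A V} : Gen R → (ι → ℤ)
  | .E i _ => Pi.single i 1
  | .F i _ => -Pi.single i 1
  | .K _ => 0
  | .H _ _ => 0

/-- The map from the free algebra that sends a monomial `x` of weight `α` to `x` placed in
degree `α`. -/
def weightFree : Free R →ₐ[Scalar] AddMonoidAlgebra (LoopAlg d R) (ι → ℤ) :=
  FreeAlgebra.lift Scalar fun g =>
    AddMonoidAlgebra.single g.weight (proj d R (FreeAlgebra.ι Scalar g))

theorem map_expCoeff {S T : Type*} [Ring S] [Algebra Scalar S] [Ring T] [Algebra Scalar T]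
    (f : S →ₐ[Scalar] T) (x : ℕ → S) (s : ℕ) :
    f (expCoeff x s) = expCoeff (fun m => f (x m)) s := by
  simp only [expCoeff, map_sum, map_smul]
  refine Finset.sum_congr rfl fun k _ => ?_
  congr 1
  have h := PowerSeries.coeff_map (f : S →+* T) s
    ((PowerSeries.mk fun m => if m = 0 then 0 else x m) ^ k)
  rw [map_pow] at h
  have e : PowerSeries.map (f : S →+* T) (PowerSeries.mk fun m => if m = 0 then 0 else x m)
      = PowerSeries.mk fun m => if m = 0 then 0 else f (x m) := by
    ext m
    by_cases hm : m = 0 <;> simp [hm]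
  rw [e] at h
  exact h.symm

/-- `x` is homogeneous of weight `α`. -/
def Homog (α : ι → ℤ) (x : Free R) : Prop :=
  weightFree d R x = AddMonoidAlgebra.single α (proj d R x)

section Homog

variable {d R}

theorem Homog.gen (g : Gen R) : Homog d R g.weight (FreeAlgebra.ι Scalar g) := by
  simp [Homog, weightFree]

theorem Homog.zero (α : ι → ℤ) : Homog d R α 0 := by
  simp [Homog]

theorem Homog.one : Homog d R 0 1 := by
  simp [Homog, AddMonoidAlgebra.one_def]

theorem Homog.add {α : ι → ℤ} {x y : Free R} (hx : Homog d R α x) (hy : Homog d R α y) :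
    Homog d R α (x + y) := by
  simp only [Homog, map_add] at *
  rw [hx, hy, AddMonoidAlgebra.single_add]

theorem Homog.smul {α : ι → ℤ} {x : Free R} (c : Scalar) (hx : Homog d R α x) :
    Homog d R α (c • x) := by
  simp only [Homog, map_smul] at *
  rw [hx, AddMonoidAlgebra.smul_single]

theorem Homog.sub {α : ι → ℤ} {x y : Free R} (hx : Homog d R α x) (hy : Homog d R α y) :
    Homog d R α (x - y) := by
  have := hx.add (hy.smul (-1))
  rwa [neg_one_smul, ← sub_eq_add_neg] at this

theorem Homog.mul {α β : ι → ℤ} {x y : Free R} (hx : Homog d R α x) (hy : Homog d R β y) :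
    Homog d R (α + β) (x * y) := by
  simp only [Homog, map_mul] at *
  rw [hx, hy, AddMonoidAlgebra.single_mul_single]

theorem Homog.mul' {α β γ : ι → ℤ} {x y : Free R} (hx : Homog d R α x) (hy : Homog d R β y)
    (h : α + β = γ) : Homog d R γ (x * y) :=
  h ▸ hx.mul hy

theorem Homog.sum {κ : Type*} {α : ι → ℤ} (s : Finset κ) {f : κ → Free R}
    (hf : ∀ a ∈ s, Homog d R α (f a)) : Homog d R α (∑ a ∈ s, f a) := by
  classical
  induction s using Finset.induction_on with
  | empty => simpa using Homog.zero α
  | insert a s ha ih =>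
    rw [Finset.sum_insert ha]
    exact (hf a (by simp)).add (ih fun b hb => hf b (by simp [hb]))

theorem Homog.list_prod {α : ι → ℤ} (L : List (Free R)) (hL : ∀ x ∈ L, Homog d R α x) :
    Homog d R (L.length • α) L.prod := by
  induction L with
  | nil => simpa using Homog.one
  | cons a L ih =>
    rw [List.prod_cons]
    refine (hL a (by simp)).mul' (ih fun x hx => hL x (by simp [hx])) ?_
    rw [List.length_cons, add_smul, one_smul, add_comm]

theorem Homog.expCoeff {x : ℕ → Free R} (hx : ∀ m, Homog d R 0 (x m)) (s : ℕ) :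
    Homog d R 0 (expCoeff x s) := by
  have h0 : ∀ m, weightFree d R (x m)
      = (AddMonoidAlgebra.singleZeroAlgHom (R := Scalar) (A := LoopAlg d R) (M := ι → ℤ))
        (proj d R (x m)) := fun m => hx m
  unfold Homog
  rw [map_expCoeff (weightFree d R), funext h0, ← map_expCoeff (AddMonoidAlgebra.singleZeroAlgHom (R := Scalar) (A := LoopAlg d R)
    (M := ι → ℤ)), ← map_expCoeff]
  rfl

theorem Homog.serreSum (u : Scalar) {α β : ι → ℤ} {X : ℤ → Free R} {y : Free R}
    (hX : ∀ l, Homog d R α (X l)) (hy : Homog d R β y) (r : ℕ) (l : Fin r → ℤ) :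
    Homog d R (r • α + β) (serreSum u X y r l) := by
  refine Homog.sum _ fun σ _ => Homog.sum _ fun k hk => Homog.smul _ ?_
  have hL : ∀ x ∈ List.ofFn fun a => X (l (σ a)), Homog d R α x := by
    intro x hx
    obtain ⟨a, rfl⟩ := (List.mem_ofFn' _ _).1 hx
    exact hX _
  have h1 := Homog.list_prod (α := α) ((List.ofFn fun a => X (l (σ a))).take k)
    fun x hx => hL x (List.mem_of_mem_take hx)
  have h2 := Homog.list_prod (α := α) ((List.ofFn fun a => X (l (σ a))).drop k)
    fun x hx => hL x (List.mem_of_mem_drop hx)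
  refine (h1.mul hy).mul' h2 ?_
  have hk' : k ≤ r := by
    have := Finset.mem_range.1 hk
    omega
  rw [List.length_take, List.length_drop, List.length_ofFn, Nat.min_eq_left hk', add_right_comm,
    ← add_smul, Nat.add_sub_cancel' hk']

theorem Homog.phi (i : ι) (m : ℤ) :
    Homog d R 0 (Free.phiPlus R d i m) ∧ Homog d R 0 (Free.phiMinus R d i m) := by
  constructor
  · unfold Free.phiPlus
    split_ifs
    · refine (Homog.gen (Gen.K _)).mul' (Homog.expCoeff (fun s => ?_) _) (add_zero _)
      split_ifs
      · exact (Homog.gen (Gen.H _ _)).smul _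
      · exact Homog.zero _
    · exact Homog.zero _
  · unfold Free.phiMinus
    split_ifs
    · refine (Homog.gen (Gen.K _)).mul' (Homog.expCoeff (fun s => ?_) _) (add_zero _)
      split_ifs
      · exact (Homog.gen (Gen.H _ _)).smul _
      · exact Homog.zero _
    · exact Homog.zero _

theorem Rel.exists_homog {x y : Free R} (h : Rel d R x y) :
    ∃ α, Homog d R α x ∧ Homog d R α y := by
  have hE : ∀ i l, Homog d R (Pi.single i 1) (Free.E R i l) := fun i l => Homog.gen (Gen.E i l)
  have hF : ∀ i l, Homog d R (-Pi.single i 1) (Free.F R i l) := fun i l => Homog.gen (Gen.F i l)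
  have hK : ∀ h, Homog d R 0 (Free.K R h) := fun h => Homog.gen (Gen.K h)
  have hH : ∀ i s, Homog d R 0 (Free.H R i s) := fun i s => Homog.gen (Gen.H i s)
  cases h with
  | K_add h h' => exact ⟨0, (hK _).mul' (hK _) (by simp), hK _⟩
  | K_zero => exact ⟨0, hK _, Homog.one⟩
  | K_H h j s => exact ⟨0, (hK _).mul' (hH _ _) (by simp), (hH _ _).mul' (hK _) (by simp)⟩
  | H_H i j s t => exact ⟨0, (hH _ _).mul' (hH _ _) (by simp), (hH _ _).mul' (hH _ _) (by simp)⟩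
  | K_E h j l m hm =>
    exact ⟨_, ((hK _).mul (hE j l)).mul' (hK _) (by simp), (hE j l).smul _⟩
  | K_F h j l m hm =>
    exact ⟨_, ((hK _).mul (hF j l)).mul' (hK _) (by simp), (hF j l).smul _⟩
  | H_E i j s l =>
    exact ⟨_, ((hH _ _).mul' (hE _ _) (by simp)).sub ((hE _ _).mul' (hH _ _) (by simp)),
      (hE j _).smul _⟩
  | H_F i j s l =>
    exact ⟨_, ((hH _ _).mul' (hF _ _) (by simp)).sub ((hF _ _).mul' (hH _ _) (by simp)),
      (hF j _).smul _⟩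
  | E_F_same i l m =>
    exact ⟨0, ((hE _ _).mul' (hF _ _) (by simp)).sub ((hF _ _).mul' (hE _ _) (by simp)),
      ((Homog.phi i _).1.sub (Homog.phi i _).2).smul _⟩
  | E_F_ne i j hij l m =>
    exact ⟨_, ((hE _ _).mul (hF _ _)).sub ((hF _ _).mul' (hE _ _) (add_comm _ _)), Homog.zero _⟩
  | E_E i j l m =>
    exact ⟨_, (((hE _ _).mul (hE _ _)).smul _).sub ((hE _ _).mul' (hE _ _) (add_comm _ _)),
      ((hE _ _).mul (hE _ _)).sub (((hE _ _).mul' (hE _ _) (add_comm _ _)).smul _)⟩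
  | F_F i j l m =>
    exact ⟨_, (((hF _ _).mul (hF _ _)).smul _).sub ((hF _ _).mul' (hF _ _) (add_comm _ _)),
      ((hF _ _).mul (hF _ _)).sub (((hF _ _).mul' (hF _ _) (add_comm _ _)).smul _)⟩
  | serre_E i j hij r hr l l' =>
    exact ⟨_, Homog.serreSum _ (hE i) (hE j l') r l, Homog.zero _⟩
  | serre_F i j hij r hr l l' =>
    exact ⟨_, Homog.serreSum _ (hF i) (hF j l') r l, Homog.zero _⟩

end Homog

/-- The weight grading of the quantum loop algebra by the root lattice, as the algebra map
`x ↦ ∑_α x_α` placed in degree `α`, where `x_α` is the component of `x` of weight `α`. -/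
def weightHom : LoopAlg d R →ₐ[Scalar] AddMonoidAlgebra (LoopAlg d R) (ι → ℤ) :=
  RingQuot.liftAlgHom Scalar ⟨weightFree d R, by
    intro x y h
    obtain ⟨α, hx, hy⟩ := Rel.exists_homog h
    have hp : proj d R x = proj d R y := RingQuot.mkAlgHom_rel Scalar h
    rw [hx, hy, hp]⟩

theorem weightHom_gen (g : Gen R) :
    weightHom d R (proj d R (FreeAlgebra.ι Scalar g))
      = AddMonoidAlgebra.single g.weight (proj d R (FreeAlgebra.ι Scalar g)) := by
  refine (RingQuot.liftAlgHom_mkAlgHom_apply (S := Scalar) (weightFree d R) _ _).trans ?_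
  simp [weightFree]

/-- The weight components of an element of `Uplus` lie in `Uplus`. -/
theorem weightHom_mem (x : LoopAlg d R) (hx : x ∈ Uplus d R) :
    ∀ α, (weightHom d R x).coeff α ∈ Uplus d R := by
  suffices h : Uplus d R ≤ (AlgHom.range (AddMonoidAlgebra.mapAlgHom (M := ι → ℤ)
      (Uplus d R).val)).comap (weightHom d R) by
    intro α
    obtain ⟨y, hy⟩ := h hx
    have hy' : (weightHom d R) x
      = AddMonoidAlgebra.mapAlgHom (M := ι → ℤ) (Uplus d R).val y := hy.symm
    rw [hy']
    simp
  refine Algebra.adjoin_le ?_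
  rintro x (⟨i, l, rfl⟩ | ⟨i, s, hs, rfl⟩)
  · refine ⟨AddMonoidAlgebra.single (Gen.weight (Gen.E (R := R) i l)) (Eplus d R i l), ?_⟩
    refine (AddMonoidAlgebra.mapAlgHom_single ..).trans ?_
    exact (weightHom_gen d R (Gen.E i l)).symm
  · refine ⟨AddMonoidAlgebra.single (Gen.weight (Gen.H (R := R) i s))
      ⟨_, Algebra.subset_adjoin (Or.inr ⟨i, s, hs, rfl⟩)⟩, ?_⟩
    refine (AddMonoidAlgebra.mapAlgHom_single ..).trans ?_
    exact (weightHom_gen d R (Gen.H i s)).symm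

/-- The decomposition of an element of `Uplus` into its weight components. -/
def weightComponents : Uplus d R →ₗ[Scalar] (ι → ℤ) →₀ Uplus d R where
  toFun x :=
    { support := (weightHom d R x).coeff.support
      toFun := fun α => ⟨(weightHom d R x).coeff α, weightHom_mem d R x x.2 α⟩
      mem_support_toFun := fun α => by
        rw [Finsupp.mem_support_iff, Ne, Ne, Subtype.ext_iff]
        rfl }
  map_add' x y := by
    ext α
    simp
  map_smul' c x := by
    ext α
    simp

/-! ### The twisted tensor square and its completion -/

/-- The braiding `x ⊗ y ↦ v ^ {-(wt x, wt y)} y ⊗ x` (for homogeneous `x` and `y`). -/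
def braiding : Uplus d R ⊗[Scalar] Uplus d R →ₗ[Scalar] Uplus d R ⊗[Scalar] Uplus d R :=
  TensorProduct.lift
    ((Finsupp.lsum Scalar fun β : ι → ℤ =>
        LinearMap.flip (Finsupp.lsum Scalar fun α : ι → ℤ =>
          v ^ (-rootForm A d β α) • TensorProduct.mk Scalar (Uplus d R) (Uplus d R))).compl₁₂
      (weightComponents d R) (weightComponents d R))

/-- The tensor square of `Uplus` with the twisted product
`(x₁ ⊗ x₂) (y₁ ⊗ y₂) = v ^ {-(wt x₂, wt y₁)} x₁ y₁ ⊗ x₂ y₂`. -/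
def TwistedSquare : Type _ := Uplus d R ⊗[Scalar] Uplus d R

instance : AddCommGroup (TwistedSquare d R) :=
  inferInstanceAs (AddCommGroup (Uplus d R ⊗[Scalar] Uplus d R))

instance : Module Scalar (TwistedSquare d R) :=
  inferInstanceAs (Module Scalar (Uplus d R ⊗[Scalar] Uplus d R))

/-- The pure tensor `x ⊗ y`. -/
def tens (x y : Uplus d R) : TwistedSquare d R := x ⊗ₜ[Scalar] y

/-- The twisted product as a linear map on the tensor product of two tensor squares. -/
def twistedMul :
    (Uplus d R ⊗[Scalar] Uplus d R) ⊗[Scalar] (Uplus d R ⊗[Scalar] Uplus d R) →ₗ[Scalar]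
      Uplus d R ⊗[Scalar] Uplus d R :=
  TensorProduct.map (LinearMap.mul' Scalar (Uplus d R)) (LinearMap.mul' Scalar (Uplus d R)) ∘ₗ
    (TensorProduct.tensorTensorTensorAssoc Scalar
      (Uplus d R) (Uplus d R) (Uplus d R) (Uplus d R)).symm.toLinearMap ∘ₗ
    TensorProduct.map (TensorProduct.map LinearMap.id (braiding d R)) LinearMap.id ∘ₗ
    (TensorProduct.tensorTensorTensorAssoc Scalar
      (Uplus d R) (Uplus d R) (Uplus d R) (Uplus d R)).toLinearMap

instance : NonUnitalNonAssocRing (TwistedSquare d R) :=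
  { (inferInstance : AddCommGroup (TwistedSquare d R)) with
    mul := fun S T => twistedMul d R (TensorProduct.tmul Scalar S T)
    left_distrib := fun S T T' =>
      (congrArg (twistedMul d R) (TensorProduct.tmul_add S T T')).trans (LinearMap.map_add _ _ _)
    right_distrib := fun S S' T =>
      (congrArg (twistedMul d R) (TensorProduct.add_tmul S S' T)).trans (LinearMap.map_add _ _ _)
    zero_mul := fun T =>
      (congrArg (twistedMul d R) (TensorProduct.zero_tmul _ T)).trans (LinearMap.map_zero _)
    mul_zero := fun S =>
      (congrArg (twistedMul d R) (TensorProduct.tmul_zero _ S)).trans (LinearMap.map_zero _) }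

/-- The completed tensor square, in which infinite sums of tensors are allowed whose first factors
have loop degrees tending to `+∞` (`E_{i,l}` has loop degree `l`, and `H_{i,s}` has loop degree `s`).
Such a sum is written as the family of its parts indexed by the loop degree `p ∈ ℤ` of the first
factor; the parts vanish for `p ≪ 0`, and the product is convolution. -/
abbrev CompletedSquare : Type _ := HahnSeries ℤ (TwistedSquare d R)

/-! ### Coproduct, pairing and the operators -/

variable {d R}

/-- `Δ` is the algebra homomorphism from `Uplus` to its completed twisted tensor square with
`Δ(E_{i,n}) = E_{i,n} ⊗ 1 + ∑_{t ≥ 0} θ⁺_{i,t} ⊗ E_{i,n-t}` and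
`Δ(θ⁺_{i,m}) = ∑_{0 ≤ t ≤ m} θ⁺_{i,m-t} ⊗ θ⁺_{i,t}`. -/
structure IsTwistedCoproduct (Δ : Uplus d R →ₗ[Scalar] CompletedSquare d R) : Prop where
  map_one : Δ 1 = HahnSeries.single 0 (tens d R 1 1)
  map_mul : ∀ x y, Δ (x * y) = Δ x * Δ y
  map_E : ∀ (i : ι) (n p : ℤ), (Δ (Eplus d R i n)).coeff p =
    (if p = n then tens d R (Eplus d R i n) 1 else 0) +
      (if 0 ≤ p then tens d R (thetaPlus d R i p.toNat) (Eplus d R i (n - p)) else 0)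
  map_theta : ∀ (i : ι) (m : ℕ) (p : ℤ), (Δ (thetaPlus d R i m)).coeff p =
    if 0 ≤ p ∧ p ≤ (m : ℤ) then
      tens d R (thetaPlus d R i p.toNat) (thetaPlus d R i (m - p.toNat)) else 0

/-- The linear form `x₁ ⊗ x₂ ↦ (x₁, y) (x₂, z)`. -/
def pairTens (B : Uplus d R →ₗ[Scalar] Uplus d R →ₗ[Scalar] Scalar) (y z : Uplus d R) :
    TwistedSquare d R →ₗ[Scalar] Scalar :=
  TensorProduct.lift ((LinearMap.mul Scalar Scalar).compl₁₂ (B.flip y) (B.flip z))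

/-- `B` is the symmetric bilinear form on `Uplus` with the given values on the generators that is a
Hopf pairing with respect to `Δ`: `(x, y z) = (Δ(x), y ⊗ z)`, where the right-hand side is a finite
sum. -/
structure IsHopfPairing (Δ : Uplus d R →ₗ[Scalar] CompletedSquare d R)
    (B : Uplus d R →ₗ[Scalar] Uplus d R →ₗ[Scalar] Scalar) : Prop where
  symm : ∀ x y, B x y = B y x
  one_one : B 1 1 = 1
  E_E : ∀ (i j : ι) (k l : ℤ), B (Eplus d R i k) (Eplus d R j l) =
    if i = j ∧ k = l then 1 / (v ^ (-2 : ℤ) - 1) else 0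
  H_H : ∀ (i j : ι) (m n : ℕ) (hm : 0 < m) (hn : 0 < n),
    B (Hplus d R i m hm) (Hplus d R j n hn) =
      if m = n then qint v ((m : ℤ) * bMat A d i j) / ((m : Scalar) * (v⁻¹ - v)) else 0
  E_H : ∀ (i j : ι) (k : ℤ) (m : ℕ) (hm : 0 < m), B (Eplus d R i k) (Hplus d R j m hm) = 0
  finite : ∀ x y z, {p : ℤ | pairTens B y z ((Δ x).coeff p) ≠ 0}.Finite
  hopf : ∀ x y z, B x (y * z) = ∑ᶠ p : ℤ, pairTens B y z ((Δ x).coeff p)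

/-- The linear map `x₁ ⊗ x₂ ↦ f(x₁) x₂`. -/
def contractFirst (f : Uplus d R →ₗ[Scalar] Scalar) : TwistedSquare d R →ₗ[Scalar] Uplus d R :=
  TensorProduct.lift ((LinearMap.lsmul Scalar (Uplus d R)).comp f)

/-- The linear operator `T` on `Un` is `x ↦ ∑ (v⁻² - 1) (E_{i,n}, x₁) x₂`, where
`Δ(x) = ∑ x₁ ⊗ x₂`; only finitely many degrees contribute to the sum. -/
def IsFPrime (Δ : Uplus d R →ₗ[Scalar] CompletedSquare d R)
    (B : Uplus d R →ₗ[Scalar] Uplus d R →ₗ[Scalar] Scalar) (i : ι) (n : ℤ)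
    (T : Module.End Scalar (Un d R)) : Prop :=
  ∀ x : Un d R,
    {p : ℤ | contractFirst (B (Eplus d R i n)) ((Δ (x : Uplus d R)).coeff p) ≠ 0}.Finite ∧
      (T x : Uplus d R) = (v ^ (-2 : ℤ) - 1) •
        ∑ᶠ p : ℤ, contractFirst (B (Eplus d R i n)) ((Δ (x : Uplus d R)).coeff p)

end Algebra

end QuantumLoop

end

/-! Up to a scalar, `F'_{i,n}` ought to be the adjoint of left multiplication by `E_{i,n}` under the
Hopf pairing. Nondegeneracy of the pairing is not available, so the relations cannot be obtained by
transposing those of the `E_{i,l}`. Instead the coproduct, the operators and the pairing are built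
explicitly, the relations are checked on the explicit operators, and a uniqueness argument shows
that every admissible pair of a coproduct and a pairing yields these same operators.

One principle carries most of the work: a current `ψ` that vanishes far out in one direction and
satisfies the quadratic relations with the `X_j` satisfies the Serre relations for free, both as the
last letter and to first order as the repeated letter (`diagSerre_eq_zero`,
`diagSerreDeriv_eq_zero`). Such a `ψ` can be moved through `X` by solving the quadratic relation.
The generating series of `ψ` is carried to one end, and what remains is an identity in a quantum
plane `a a' = u ^ 2 a' a` (`plane_serre`, `plane_serre_deriv`). Consequently `X_j ↦ X_j + ε δ_{ij}
ψ` respects all relations over the dual numbers (`IsCurrents.deform`), which produces operators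
whose commutators with the `E_{j,l}` are prescribed one-sided currents.

The principle is used three times. On a Fock space, the algebra presented by the `E_{i,l}` tensored
with a polynomial ring, it produces the `F_{i,m}` and so a representation of the whole quantum loop
algebra. This representation shows that `Uplus` is presented by the evident relations among the
`E_{i,l}` and the `H_{i,s}` with `s > 0` (`IsPlus.injective`, `Uplus.exists_lift`), and
homomorphisms out of `Uplus` become available.

For the coproduct, the proposed images of the `E_{i,l}` must satisfy the Serre relations. The Serre
expression, viewed as an operator on a tensor product, commutes with suitable annihilation
operators. Applied to the vacuum it gives a vector killed by all of them, and such a vector has no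
letters of the relevant kind left (`mem_of_annihilated`). A projection then reduces the claim to the
Serre relation in a single tensor factor (`serre_left`, `serre_right`).

The operators `F'` are defined by their behaviour under right multiplication, `F'_{i,n}(x E_{j,l}) =
F'_{i,n}(x) E_{j,l} + δ_{ij} coTheta_{i,n-l}(x)`, where `coTheta` is again one-sided. Their
relations follow by bracketing with right multiplications (`isCurrents_op_FPrime`). The rescaled
`F'` together with the derivations `der` represent the opposite algebra. Followed by the counit,
this representation is the pairing. Its symmetry comes from the left Leibniz rules and its Hopf
property from `FPrime_mul`.

For uniqueness, the coproduct is determined on generators because the `θ` determine the `H` by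
taking logarithms. A Hopf pairing is forced when one argument is `E_{i,n}` (`pairing_E`).
Contracting the coproduct with `E_{i,n}` gives the constructed operator (`contractFirst_form_E`),
and this preserves the subalgebra of the `E_{i,l}`. -/

open scoped TensorProduct

noncomputable section

namespace QuantumLoop

namespace Shortcut

/-- This instance takes precedence over `RatFunc.instAlgebraOfPolynomial`. -/
scoped instance algebraNatScalar : Algebra ℕ Scalar := Semiring.toNatAlgebra

/-- This instance takes precedence over `RatFunc.instAlgebraOfPolynomial`. -/
scoped instance algebraIntScalar : Algebra ℤ Scalar := Ring.toIntAlgebra _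

end Shortcut

open scoped Shortcut

/-! ### Gaussian binomials at a generic parameter -/

/-- `u` is neither zero nor a root of unity. -/
structure Generic (u : Scalar) : Prop where
  ne_zero : u ≠ 0
  pow_ne_one : ∀ m : ℕ, 0 < m → u ^ m ≠ 1

namespace Generic

variable {u : Scalar} (hu : Generic u)
include hu

theorem qint_den_ne : u⁻¹ - u ≠ 0 := by
  intro h
  have h0 := hu.ne_zero
  apply hu.pow_ne_one 2 (by norm_num)
  field_simp at h
  linear_combination -h

theorem qint_ne_zero {m : ℕ} (hm : 0 < m) : qint u m ≠ 0 := by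
  have h0 := hu.ne_zero
  refine div_ne_zero (fun h => hu.pow_ne_one (2 * m) (by omega) ?_) hu.qint_den_ne
  rw [zpow_neg, zpow_natCast] at h
  field_simp at h
  rw [mul_comm 2 m, pow_mul]
  linear_combination -h

theorem qfactorial_ne_zero (n : ℕ) : qfactorial u n ≠ 0 :=
  Finset.prod_ne_zero_iff.2 fun k _ => by exact_mod_cast hu.qint_ne_zero (Nat.succ_pos k)

omit hu in
theorem _root_.QuantumLoop.qfactorial_succ (u : Scalar) (n : ℕ) :
    qfactorial u (n + 1) = qfactorial u n * qint u (n + 1 : ℕ) := by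
  rw [qfactorial, Finset.prod_range_succ]
  simp [qfactorial]

theorem qbinom_zero (n : ℕ) : qbinom u n 0 = 1 := by
  rw [qbinom, Nat.sub_zero, show qfactorial u 0 = 1 from Finset.prod_range_zero _, one_mul]
  exact div_self (hu.qfactorial_ne_zero n)

theorem qbinom_self (n : ℕ) : qbinom u n n = 1 := by
  rw [qbinom, Nat.sub_self, show qfactorial u 0 = 1 from Finset.prod_range_zero _, mul_one]
  exact div_self (hu.qfactorial_ne_zero n)

theorem qbinom_succ_succ_mul {n k : ℕ} :
    qbinom u (n + 1) (k + 1) * qint u (k + 1 : ℕ) = qint u (n + 1 : ℕ) * qbinom u n k := by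
  have h1 := hu.qfactorial_ne_zero k
  have h2 := hu.qfactorial_ne_zero (n - k)
  have h3 := hu.qint_ne_zero (Nat.succ_pos k)
  rw [qbinom, qbinom, qfactorial_succ, qfactorial_succ, Nat.add_sub_add_right]
  simp only [Nat.succ_eq_add_one] at h3
  field_simp

theorem qbinom_succ_mul {n k : ℕ} (hk : k ≤ n) :
    qbinom u (n + 1) k * qint u (n + 1 - k : ℕ) = qint u (n + 1 : ℕ) * qbinom u n k := by
  obtain ⟨m, rfl⟩ := Nat.exists_eq_add_of_le hk
  have h1 := hu.qfactorial_ne_zero k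
  have h2 := hu.qfactorial_ne_zero m
  have h3 := hu.qint_ne_zero (Nat.succ_pos m)
  have e1 : k + m + 1 - k = m + 1 := by omega
  have e2 : k + m - k = m := by omega
  rw [qbinom, qbinom, e1, e2, qfactorial_succ, qfactorial_succ]
  simp only [Nat.succ_eq_add_one] at h3
  field_simp

theorem qbinom_succ_right_mul {n k : ℕ} (hk : k < n) :
    qbinom u n (k + 1) * qint u (k + 1 : ℕ) = qbinom u n k * qint u (n - k : ℕ) := by
  obtain ⟨m, rfl⟩ := Nat.exists_eq_add_of_lt hk
  have h1 := hu.qfactorial_ne_zero k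
  have h2 := hu.qfactorial_ne_zero m
  have h3 := hu.qint_ne_zero (Nat.succ_pos m)
  have h4 := hu.qint_ne_zero (Nat.succ_pos k)
  have e1 : k + m + 1 - k = m + 1 := by omega
  have e2 : k + m + 1 - (k + 1) = m := by omega
  rw [qbinom, qbinom, e1, e2, qfactorial_succ, qfactorial_succ u m, qfactorial_succ]
  simp only [Nat.succ_eq_add_one] at h3 h4
  field_simp

theorem qint_add (m n : ℕ) :
    qint u (m + n : ℕ) = u ^ m * qint u n + (u ^ n)⁻¹ * qint u m := by
  have h := hu.qint_den_ne
  have h0 := hu.ne_zero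
  simp only [qint, zpow_neg, zpow_natCast, pow_add]
  rw [mul_div_assoc', mul_div_assoc', ← add_div]
  congr 1
  field_simp
  ring

/-- After multiplication by `[k + 1]` both binomials become multiples of `qbinom u n k`, and the
claim is the splitting of `[(k + 1) + (n - k)]` given by `qint_add`. -/
theorem qbinom_pascal {n k : ℕ} (hk : k < n) :
    qbinom u (n + 1) (k + 1) =
      u ^ (k + 1) * qbinom u n (k + 1) + (u ^ (n - k))⁻¹ * qbinom u n k := by
  have h3 := hu.qint_ne_zero (Nat.succ_pos k)
  simp only [Nat.succ_eq_add_one] at h3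
  apply mul_right_cancel₀ h3
  rw [hu.qbinom_succ_succ_mul, add_mul, mul_assoc, hu.qbinom_succ_right_mul hk]
  have e : n + 1 = (k + 1) + (n - k) := by omega
  conv_lhs => rw [e, hu.qint_add]
  ring

/-- The prefactor is `u ^ (k - 1)`, written without a truncated exponent so that `k = 0` is
included. -/
theorem geom_sum_eq_qint (k : ℕ) :
    ∑ j ∈ Finset.range k, (u ^ 2) ^ j = u * (u ^ k * u⁻¹ ^ 2) * qint u k := by
  have h := hu.qint_den_ne
  have h0 := hu.ne_zero
  have h1 : u ^ 2 - 1 ≠ 0 := sub_ne_zero.2 (hu.pow_ne_one 2 (by norm_num))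
  have h2 : (1 : Scalar) - u ^ 2 ≠ 0 := by
    rw [← neg_sub]; exact neg_ne_zero.2 h1
  rw [geom_sum_eq (hu.pow_ne_one 2 (by norm_num)), div_eq_iff h1, qint, zpow_neg, zpow_natCast]
  have e : u⁻¹ - u = (1 - u ^ 2) / u := by field_simp
  rw [e]
  field_simp
  ring

theorem geom_sum_ne_zero {k : ℕ} (hk : 0 < k) : ∑ j ∈ Finset.range k, u ^ j ≠ 0 := by
  have h1 : u - 1 ≠ 0 := sub_ne_zero.2 (by simpa using hu.pow_ne_one 1 one_pos)
  intro h
  have := geom_sum_mul u k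
  rw [h, zero_mul] at this
  exact hu.pow_ne_one k hk (sub_eq_zero.1 this.symm)

theorem inv : Generic u⁻¹ where
  ne_zero := inv_ne_zero hu.ne_zero
  pow_ne_one m hm h := hu.pow_ne_one m hm (by simpa using h)

theorem pow {d : ℕ} (hd : 0 < d) : Generic (u ^ d) where
  ne_zero := pow_ne_zero _ hu.ne_zero
  pow_ne_one m hm := by rw [← pow_mul]; exact hu.pow_ne_one _ (Nat.mul_pos hd hm)

end Generic

theorem generic_v : Generic v where
  ne_zero := RatFunc.X_ne_zero
  pow_ne_one m hm h := by
    have h1 : (algebraMap (Polynomial ℂ) (RatFunc ℂ)) (Polynomial.X ^ m) =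
        algebraMap (Polynomial ℂ) (RatFunc ℂ) 1 := by
      rw [map_pow, RatFunc.algebraMap_X, map_one]; exact h
    have h2 := RatFunc.algebraMap_injective ℂ h1
    have h3 := congrArg Polynomial.natDegree h2
    simp at h3
    omega

/-! ### Identities in the quantum plane -/

section Plane

variable {S : Type*} [Ring S] [Algebra Scalar S] {u : Scalar} {a a' b b' : S}

/-- `∑_{p < k} x ^ p w y ^ (k - 1 - p)`. -/
def sandwich (x w y : S) (k : ℕ) : S := ∑ p ∈ Finset.range k, x ^ p * w * y ^ (k - 1 - p)

omit [Algebra Scalar S] in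
theorem sandwich_succ (x w y : S) (k : ℕ) :
    sandwich x w y (k + 1) = x * sandwich x w y k + w * y ^ k := by
  rw [sandwich, Finset.sum_range_succ', sandwich, Finset.mul_sum]
  congr 1
  · refine Finset.sum_congr rfl fun p hp => ?_
    have : k + 1 - 1 - (p + 1) = k - 1 - p := by omega
    rw [this, pow_succ']
    simp only [mul_assoc]
  · simp

/-- The induction step is `(a - q a') (a - Q a') = (a - q Q a') (a - a')` for every scalar `Q`: the
two sides differ by `(1 - Q) (a a' - q a' a)`. -/
theorem plane_pow_right {q : Scalar} (h : a * a' = q • (a' * a)) (m : ℕ) :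
    (a - q • a') ^ (m + 1) = (a - q ^ (m + 1) • a') * (a - a') ^ m := by
  induction m with
  | zero => simp
  | succ m ih =>
    rw [pow_succ', ih, ← mul_assoc, pow_succ' (a - a') m, ← mul_assoc]
    congr 1
    simp only [mul_sub, sub_mul, smul_mul_assoc, mul_smul_comm, h]
    module

theorem plane_pow_left {q : Scalar} (h : a * a' = q • (a' * a)) (m : ℕ) :
    (q • a - a') ^ (m + 1) = (a - a') ^ m * (q ^ (m + 1) • a - a') := by
  induction m with
  | zero => simp
  | succ m ih =>
    rw [pow_succ, ih, mul_assoc, pow_succ (a - a') m, mul_assoc]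
    congr 1
    simp only [mul_sub, sub_mul, smul_mul_assoc, mul_smul_comm, h]
    module

/-- This evaluates the derivative of a `k`-th power once the direction of differentiation has been
carried to the right end, which turns the right-hand letters `q a - a'` into `a - q a'`. -/
theorem plane_sandwich {q : Scalar} (h : a * a' = q • (a' * a)) (k : ℕ) :
    sandwich (q • a - a') 1 (a - q • a') (k + 1)
      = (∑ j ∈ Finset.range (k + 1), q ^ j) • (a - a') ^ k := by
  induction k with
  | zero => simp [sandwich]
  | succ k ih =>
    rw [sandwich_succ, ih, plane_pow_right h, one_mul, mul_smul_comm, ← smul_mul_assoc, ← add_mul,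
      pow_succ' (a - a') k, ← smul_mul_assoc]
    congr 1
    rw [Finset.sum_range_succ _ (k + 1)]
    have h1 : q * ∑ j ∈ Finset.range (k + 1), q ^ j
        = ∑ j ∈ Finset.range (k + 1), q ^ j + q ^ (k + 1) - 1 := by
      have := geom_sum_mul q (k + 1)
      linear_combination this
    rw [smul_sub, smul_smul, mul_comm, h1]
    module

/-- Induction on `n`. Pascal's rule gathers neighbouring terms into `x ^ k (y - u ^ (-(n + 1)) x) y
^ (n + 1 - k)`, whose middle factor is a scalar multiple of `a`. Carrying `a` to the left replaces
`a'` by `u ^ (-2) a'` inside `x`; after rescaling, what remains is the identity for `n` with `u⁻¹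
a'` in place of `a'`. -/
theorem plane_serre (hu : Generic u) (n : ℕ) (a a' : S) (h : a * a' = u ^ 2 • (a' * a)) :
    ∑ k ∈ Finset.range (n + 2), ((-1) ^ k * qbinom u (n + 1) k) •
      (((u ^ n)⁻¹ • a - a') ^ k * (a - (u ^ n)⁻¹ • a') ^ (n + 1 - k)) = 0 := by
  have h0 := hu.ne_zero
  induction n generalizing a' with
  | zero =>
    rw [Finset.sum_range_succ, Finset.sum_range_one]
    simp [hu.qbinom_zero, hu.qbinom_self]
  | succ n ih =>
    set x := (u ^ (n + 1))⁻¹ • a - a' with hx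
    set y := a - (u ^ (n + 1))⁻¹ • a' with hy
    have key : ∑ k ∈ Finset.range (n + 1 + 2), ((-1) ^ k * qbinom u (n + 1 + 1) k) •
        (x ^ k * y ^ (n + 1 + 1 - k)) =
        ∑ k ∈ Finset.range (n + 2), ((-1) ^ k * qbinom u (n + 1) k * u ^ k) •
          (x ^ k * (y - (u ^ (n + 1))⁻¹ • x) * y ^ (n + 1 - k)) := by
      have e1 : ∀ k ∈ Finset.range (n + 1), ((-1) ^ (k + 1) * qbinom u (n + 1 + 1) (k + 1)) •
          (x ^ (k + 1) * y ^ (n + 1 + 1 - (k + 1))) =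
          ((-1) ^ (k + 1) * qbinom u (n + 1) (k + 1) * u ^ (k + 1)) •
            (x ^ (k + 1) * y * y ^ (n + 1 - (k + 1))) -
          ((-1) ^ k * qbinom u (n + 1) k * u ^ k) •
            (x ^ k * ((u ^ (n + 1))⁻¹ • x) * y ^ (n + 1 - k)) := by
        intro k hk
        have hk' : k < n + 1 := Finset.mem_range.1 hk
        rw [hu.qbinom_pascal hk', mul_smul_comm, ← pow_succ, smul_mul_assoc, mul_assoc (x ^ (k + 1)),
          ← pow_succ']
        have e2 : n + 1 - (k + 1) + 1 = n + 1 - k := by omega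
        have e3 : n + 1 + 1 - (k + 1) = n + 1 - k := by omega
        rw [e2, e3, smul_smul, ← sub_smul]
        congr 1
        have e4 : u ^ (n + 1) = u ^ (n + 1 - k) * u ^ k := by
          rw [← pow_add]; congr 1; omega
        rw [e4]
        field_simp
        ring
      have e5 : ((-1) ^ (n + 1) * qbinom u (n + 1) (n + 1) * u ^ (n + 1)) •
          (x ^ (n + 1) * ((u ^ (n + 1))⁻¹ • x) * y ^ (n + 1 - (n + 1))) =
          -(((-1) ^ (n + 1 + 1) * qbinom u (n + 1 + 1) (n + 1 + 1)) •
            (x ^ (n + 1 + 1) * y ^ (n + 1 + 1 - (n + 1 + 1)))) := by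
        rw [hu.qbinom_self, hu.qbinom_self, Nat.sub_self, Nat.sub_self, mul_smul_comm, ← pow_succ,
          pow_zero, mul_one, mul_one, smul_smul, mul_assoc, mul_one, mul_one,
          mul_inv_cancel₀ (pow_ne_zero _ h0), pow_succ _ (n + 1)]
        module
      have e6 : ∀ k, x ^ k * (y - (u ^ (n + 1))⁻¹ • x) * y ^ (n + 1 - k) =
          x ^ k * y * y ^ (n + 1 - k) - x ^ k * ((u ^ (n + 1))⁻¹ • x) * y ^ (n + 1 - k) := by
        intro k
        rw [mul_sub, sub_mul]
      rw [Finset.sum_range_succ, Finset.sum_range_succ', Finset.sum_congr rfl e1,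
        Finset.sum_sub_distrib]
      simp only [e6, smul_sub]
      rw [Finset.sum_sub_distrib, Finset.sum_range_succ' _ (n + 1), Finset.sum_range_succ _ (n + 1),
        e5]
      simp only [hu.qbinom_zero, pow_zero, one_mul, Nat.sub_zero, one_smul, pow_succ' y (n + 1),
        mul_one]
      abel
    have hc : y - (u ^ (n + 1))⁻¹ • x = (1 - (u ^ (n + 1))⁻¹ ^ 2) • a := by
      rw [hx, hy]; module
    have hxa : ∀ k, x ^ k * a = a * ((u ^ (n + 1))⁻¹ • a - (u ^ 2)⁻¹ • a') ^ k := by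
      intro k
      induction k with
      | zero => simp
      | succ k ihk =>
        have : x * a = a * ((u ^ (n + 1))⁻¹ • a - (u ^ 2)⁻¹ • a') := by
          rw [hx, sub_mul, mul_sub, mul_smul_comm, mul_smul_comm, h, smul_smul,
            inv_mul_cancel₀ (pow_ne_zero 2 h0), one_smul, smul_mul_assoc]
        rw [pow_succ, mul_assoc, this, ← mul_assoc, ihk, mul_assoc, ← pow_succ]
    rw [key]
    have h2 := ih (u⁻¹ • a') (by
      rw [mul_smul_comm, h, smul_mul_assoc, smul_smul, smul_smul, mul_comm])
    calc _ = (1 - (u ^ (n + 1))⁻¹ ^ 2) • (a * ∑ k ∈ Finset.range (n + 2),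
          ((-1) ^ k * qbinom u (n + 1) k) •
            (((u ^ n)⁻¹ • a - u⁻¹ • a') ^ k * (a - (u ^ n)⁻¹ • u⁻¹ • a') ^ (n + 1 - k))) := by
          rw [Finset.mul_sum, Finset.smul_sum]
          refine Finset.sum_congr rfl fun k _ => ?_
          have e : (u ^ n)⁻¹ • a - u⁻¹ • a' = u • ((u ^ (n + 1))⁻¹ • a - (u ^ 2)⁻¹ • a') := by
            rw [smul_sub, smul_smul, smul_smul]
            congr 2
            · field_simp
              ring
            · field_simp
          have e' : (u ^ n)⁻¹ • u⁻¹ • a' = (u ^ (n + 1))⁻¹ • a' := by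
            rw [smul_smul, pow_succ, mul_inv]
          rw [hc, e, e', smul_pow, mul_smul_comm, hxa, ← hy]
          simp only [smul_mul_assoc, mul_smul_comm, smul_smul, mul_assoc]
          congr 1
          ring
      _ = 0 := by rw [h2]; simp

/-- With `w = u ^ k` and `z = u ^ (n - k)` this is the `k`-th term of the telescoping sum in
`plane_serre_deriv`, stripped of the outer powers of `a - a'`. No commutation relation is involved.
The next two identities are the ends `w = 1` and `z = 1`, where one outer factor is absent. -/
theorem plane_bracket {w z : Scalar} (hw : w ≠ 0) (hz : z ≠ 0) (a a' b b' : S) :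
    (-w) • ((a - a') * (b - (w * z)⁻¹ • b') * (a - z ^ 2 • a')) +
      z • ((w ^ 2 • a - a') * ((w * z)⁻¹ • b - b') * (a - a')) =
    (w * (w * z * (1 - (w ^ 2)⁻¹))) • (((w * z)⁻¹ • (a' * b) - a * b') * (a - a')) -
      (w * (1 - z ^ 2)) • ((a - a') * (b * a' - (w * z)⁻¹ • (b' * a))) := by
  simp only [mul_sub, sub_mul, smul_mul_assoc, mul_smul_comm, smul_sub, mul_assoc]
  match_scalars <;> field_simp <;> ring

theorem plane_bracket_left {z : Scalar} (hz : z ≠ 0) (a a' b b' : S) :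
    -((b - z⁻¹ • b') * (a - z ^ 2 • a')) + z • ((z⁻¹ • b - b') * (a - a')) =
      -((1 - z ^ 2) • (b * a' - z⁻¹ • (b' * a))) := by
  simp only [mul_sub, sub_mul, smul_mul_assoc, mul_smul_comm, smul_sub]
  match_scalars <;> field_simp <;> ring

theorem plane_bracket_right {w : Scalar} (hw : w ≠ 0) (a a' b b' : S) :
    (-w) • ((a - a') * (b - w⁻¹ • b')) + (w ^ 2 • a - a') * (w⁻¹ • b - b') =
      (w * (w * (1 - (w ^ 2)⁻¹))) • (w⁻¹ • (a' * b) - a * b') := by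
  simp only [mul_sub, sub_mul, smul_mul_assoc, mul_smul_comm, smul_sub]
  match_scalars <;> field_simp <;> ring

/-- The derivative of `∑_k (-1)^k [r, k] x ^ k y x ^ (r - k)` along `x ↦ w`, when `w x = x' w` and
`w y = y' w`, with `w` cancelled. -/
theorem plane_serre_deriv (hu : Generic u) (n : ℕ) (h : a * a' = u ^ 2 • (a' * a))
    (hb : (u ^ n)⁻¹ • (a' * b) - a * b' = b * a' - (u ^ n)⁻¹ • (b' * a)) :
    ∑ k ∈ Finset.range (n + 2), ((-1) ^ k * qbinom u (n + 1) k) •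
      (sandwich (u ^ 2 • a - a') 1 (a - u ^ 2 • a') k * (b - (u ^ n)⁻¹ • b') *
          (a - u ^ 2 • a') ^ (n + 1 - k) +
        (u ^ 2 • a - a') ^ k * ((u ^ n)⁻¹ • b - b') *
          sandwich (u ^ 2 • a - a') 1 (a - u ^ 2 • a') (n + 1 - k)) = 0 := by
  have h0 := hu.ne_zero
  set c := a - a' with hc
  set P := (u ^ n)⁻¹ • (a' * b) - a * b' with hP
  -- The cut-off makes `T 0` and `T (n + 1)` vanish, so that the telescoping sum is zero.
  set T : ℕ → S := fun k => if 1 ≤ k ∧ k ≤ n then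
    ((-1) ^ k * qbinom u n k * u ^ k * (u ^ n * (1 - (u ^ 2)⁻¹ ^ k))) •
      (c ^ (k - 1) * P * c ^ (n - k)) else 0 with hT
  -- The relation `hb` identifies the two brackets produced by `plane_bracket` with one and the same
  -- `P`; this is what makes each term a difference.
  have step : ∀ k ∈ Finset.range (n + 1),
      ((-1) ^ k * qbinom u n k) • ((-u ^ k) • (c ^ k * (b - (u ^ n)⁻¹ • b') *
        (a - u ^ 2 • a') ^ (n - k)) + u ^ (n - k) • ((u ^ 2 • a - a') ^ k *
          ((u ^ n)⁻¹ • b - b') * c ^ (n - k))) = T k - T (k + 1) := by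
    intro k hk
    have hk' : k ≤ n := Nat.lt_succ_iff.1 (Finset.mem_range.1 hk)
    obtain ⟨m, rfl⟩ := Nat.exists_eq_add_of_le hk'
    have hT1 : k + 1 ≤ k + m → T (k + 1) =
        ((-1) ^ k * qbinom u (k + m) k * u ^ k * (1 - (u ^ 2) ^ m)) •
          (c ^ k * P * c ^ (m - 1)) := by
      intro hkm
      have e1 : k + m - (k + 1) = m - 1 := by omega
      simp only [hT]
      rw [if_pos ⟨by omega, hkm⟩, Nat.add_sub_cancel, e1]
      congr 1
      have h2 := hu.qbinom_succ_right_mul (n := k + m) (k := k) (by omega)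
      have h3 := hu.qint_den_ne
      have e2 : k + m - k = m := by omega
      rw [e2] at h2
      simp only [qint, zpow_neg, zpow_natCast] at h2
      rw [mul_div_assoc', mul_div_assoc', div_left_inj' h3] at h2
      have h4 : qbinom u (k + m) (k + 1) * u ^ (k + 1) * (1 - (u ^ 2)⁻¹ ^ (k + 1)) =
          -(qbinom u (k + m) k * ((u ^ m)⁻¹ - u ^ m)) := by
        rw [← h2, inv_pow]
        field_simp
        ring
      calc _ = (-1) ^ (k + 1) * u ^ (k + m) *
            (qbinom u (k + m) (k + 1) * u ^ (k + 1) * (1 - (u ^ 2)⁻¹ ^ (k + 1))) := by ring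
        _ = _ := by
          rw [h4]
          field_simp
          ring
    have e0 : k + m - k = m := by omega
    have hu1 : u ^ k ≠ 0 := pow_ne_zero _ h0
    have hu2 : u ^ m ≠ 0 := pow_ne_zero _ h0
    rw [e0]
    have hq1 : ∀ j, (u ^ 2) ^ j = (u ^ j) ^ 2 := fun j => by rw [← pow_mul, ← pow_mul, mul_comm]
    rcases Nat.eq_zero_or_pos m with rfl | hm
    · have hT2 : T (k + 1) = 0 := by
        simp only [hT]; rw [if_neg (by omega)]
      rw [hT2]
      rcases k with - | k
      · simp [hT]
      · have key := congrArg (fun t => ((-1) ^ (k + 1) * qbinom u (k + 1) (k + 1)) • (c ^ k * t))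
          (plane_bracket_right hu1 a a' b b')
        simp only [← hc] at key
        simp only [hT]
        rw [if_pos ⟨by omega, by omega⟩, plane_pow_left h, ← hc, hP]
        simp only [add_zero, Nat.add_sub_cancel, Nat.sub_self, pow_zero, mul_one, sub_zero,
          inv_pow, hq1, pow_succ c k]
        simp only [mul_sub, sub_mul, smul_mul_assoc, mul_smul_comm, smul_sub, mul_assoc, mul_add,
          smul_add] at key ⊢
        linear_combination (norm := module) key
    · obtain ⟨m, rfl⟩ : ∃ m', m = m' + 1 := ⟨m - 1, by omega⟩
      rw [hT1 (by omega), plane_pow_right h, ← hc]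
      rcases k with - | k
      · have key := congrArg (fun t => t * c ^ m) (plane_bracket_left hu2 a a' b b')
        simp only [← hc] at key
        simp only [zero_add] at hb
        simp only [hT]
        rw [if_neg (by omega), hb]
        simp only [zero_add, pow_zero, mul_one, one_mul, hu.qbinom_zero, one_smul, hq1,
          Nat.add_sub_cancel, pow_succ' c m]
        simp only [mul_sub, sub_mul, smul_mul_assoc, mul_smul_comm, smul_sub, mul_assoc,
          add_mul, neg_mul] at key ⊢
        linear_combination (norm := module) key
      · have key := congrArg (fun t => ((-1) ^ (k + 1) * qbinom u (k + 1 + (m + 1)) (k + 1)) •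
          (c ^ k * t * c ^ m)) (plane_bracket hu1 hu2 a a' b b')
        rw [← pow_add, ← hb, ← hP, ← hc] at key
        simp only [hT]
        have e7 : k + 1 + (m + 1) - (k + 1) = m + 1 := by omega
        rw [if_pos ⟨by omega, by omega⟩, plane_pow_left h, ← hc, e7]
        simp only [Nat.add_sub_cancel, inv_pow, hq1, pow_succ c k, pow_succ' c m]
        rw [pow_add u (k + 1) (m + 1)] at key ⊢
        clear_value P c
        simp only [mul_sub, sub_mul, smul_mul_assoc, mul_smul_comm, smul_sub, mul_assoc, mul_add,
          smul_add, add_mul] at key ⊢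
        linear_combination (norm := module) key
  have hGl : ∀ k, sandwich (u ^ 2 • a - a') 1 (a - u ^ 2 • a') (k + 1) =
      (u ^ k * qint u (k + 1 : ℕ)) • c ^ k := by
    intro k
    rw [plane_sandwich h, hu.geom_sum_eq_qint]
    congr 1
    field_simp
    ring
  have h0' : sandwich (u ^ 2 • a - a') 1 (a - u ^ 2 • a') 0 = 0 := by simp [sandwich]
  simp only [smul_add]
  -- The empty sandwiches at `k = 0` and `k = n + 1` drop out. Pairing the first half at `k + 1`
  -- with the second half at `k` gives both the common factor `[n + 1]` times `qbinom u n k`.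
  rw [Finset.sum_add_distrib, Finset.sum_range_succ', Finset.sum_range_succ _ (n + 1), Nat.sub_self,
    h0', mul_zero, smul_zero, zero_mul, zero_mul, smul_zero, add_zero, add_zero,
    ← Finset.sum_add_distrib]
  clear_value c P
  rw [Finset.sum_congr rfl (g := fun k => qint u (n + 1 : ℕ) • (T k - T (k + 1))),
    ← Finset.smul_sum, Finset.sum_range_sub']
  · simp [hT]
  · intro k hk
    have hk' : k ≤ n := Nat.lt_succ_iff.1 (Finset.mem_range.1 hk)
    rw [← step k hk, hGl, Nat.add_sub_add_right]
    have e : n + 1 - k = (n - k) + 1 := by omega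
    rw [e, hGl]
    have h1 := hu.qbinom_succ_succ_mul (n := n) (k := k)
    have h2 := hu.qbinom_succ_mul hk'
    rw [e] at h2
    simp only [smul_mul_assoc, mul_smul_comm, smul_smul, smul_add]
    congr 2
    · linear_combination (-1) ^ (k + 1) * u ^ k * h1
    · linear_combination (-1) ^ k * u ^ (n - k) * h2

end Plane

/-! ### Quadratic relations between currents -/

section Quad

variable {S : Type*} [Ring S] [Algebra Scalar S] {c : Scalar} {X Y Z : ℤ → S}

/-- The quadratic relation between two currents. -/
def Quad (c : Scalar) (X Y : ℤ → S) : Prop :=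
  ∀ l m : ℤ, c • (X (l + 1) * Y m) - Y m * X (l + 1) = X l * Y (m + 1) - c • (Y (m + 1) * X l)

namespace Quad

theorem symm (h : Quad c X Y) : Quad c Y X := fun l m => by
  have := h m l
  linear_combination (norm := module) this

theorem shift (h : Quad c X Y) (s : ℤ) : Quad c (fun l => X (l + s)) Y := fun l m => by
  have := h (l + s) m
  rwa [add_right_comm] at this

theorem add (h : Quad c X Y) (h' : Quad c Z Y) : Quad c (X + Z) Y := fun l m => by
  have h1 := h l m
  have h2 := h' l m
  simp only [Pi.add_apply, add_mul, mul_add]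
  linear_combination (norm := module) h1 + h2

theorem smul (h : Quad c X Y) (a : Scalar) : Quad c (a • X) Y := fun l m => by
  have h1 := congrArg (a • ·) (h l m)
  simp only [Pi.smul_apply, smul_mul_assoc, mul_smul_comm] at h1 ⊢
  linear_combination (norm := module) h1

theorem neg (h : Quad c X Y) : Quad c (-X) Y := by
  simpa using h.smul (-1)

theorem sub (h : Quad c X Y) (h' : Quad c Z Y) : Quad c (X - Z) Y := by
  rw [sub_eq_add_neg]; exact h.add h'.neg

theorem sum {κ : Type*} (s : Finset κ) {f : κ → ℤ → S} (h : ∀ a ∈ s, Quad c (f a) Y) :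
    Quad c (fun l => ∑ a ∈ s, f a l) Y := by
  classical
  induction s using Finset.induction_on with
  | empty => intro l m; simp
  | insert a s ha ih =>
    have := (h a (by simp)).add (ih fun b hb => h b (by simp [hb]))
    simp only [Finset.sum_insert ha]
    exact this

theorem map {T : Type*} [Ring T] [Algebra Scalar T] (f : S →ₐ[Scalar] T) (h : Quad c X Y) :
    Quad c (fun l => f (X l)) (fun l => f (Y l)) := fun l m => by
  have := congrArg f (h l m)
  simpa only [map_sub, map_smul, map_mul] using this

/-- Reversing products and degrees together keeps the parameter, so currents bounded below can be
traded for currents bounded above. -/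
theorem op_neg (h : Quad c X Y) :
    Quad c (fun l => MulOpposite.op (X (-l))) (fun l => MulOpposite.op (Y (-l))) := fun l m => by
  have := h (-(l + 1)) (-(m + 1))
  have e1 : -(l + 1) + 1 = -l := by ring
  have e2 : -(m + 1) + 1 = -m := by ring
  rw [e1, e2] at this
  simp only [← MulOpposite.op_mul, ← MulOpposite.op_smul, ← MulOpposite.op_sub]
  congr 1
  linear_combination (norm := module) this

theorem neg_index (hc : c ≠ 0) (h : Quad c X Y) :
    Quad c⁻¹ (fun l => X (-l)) (fun l => Y (-l)) := fun l m => by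
  have := congrArg (c⁻¹ • ·) (h (-(l + 1)) (-(m + 1)))
  have e1 : -(l + 1) + 1 = -l := by ring
  have e2 : -(m + 1) + 1 = -m := by ring
  rw [e1, e2] at this
  simp only [smul_sub, smul_smul, inv_mul_cancel₀ hc, one_smul] at this
  linear_combination (norm := module) -this

theorem op (hc : c ≠ 0) (h : Quad c X Y) :
    Quad c⁻¹ (fun l => MulOpposite.op (X l)) (fun l => MulOpposite.op (Y l)) := by
  simpa using (h.neg_index hc).op_neg

end Quad

end Quad

/-! ### The Serre expression as a symmetric multilinear map -/

section Serre

variable {S : Type*} [Ring S] [Algebra Scalar S] {T : Type*} [Ring T] [Algebra Scalar T]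

/-- The left-hand side of the Serre relation, multilinear in `x`. -/
def serreForm (u : Scalar) (r : ℕ) (x : Fin r → S) (y : S) : S :=
  ∑ σ : Equiv.Perm (Fin r), ∑ k ∈ Finset.range (r + 1), ((-1) ^ k * qbinom u r k) •
    (((List.ofFn fun a => x (σ a)).take k).prod * y * ((List.ofFn fun a => x (σ a)).drop k).prod)

theorem serreSum_eq (u : Scalar) (X : ℤ → S) (y : S) (r : ℕ) (l : Fin r → ℤ) :
    serreSum u X y r l = serreForm u r (fun a => X (l a)) y := rfl

/-- The Serre expression on the diagonal (divided by `r!`). -/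
def diagSerre (u : Scalar) (r : ℕ) (x y : S) : S :=
  ∑ k ∈ Finset.range (r + 1), ((-1) ^ k * qbinom u r k) • (x ^ k * y * x ^ (r - k))

/-- The derivative of `diagSerre u r x y` along `x ↦ w`. -/
def diagSerreDeriv (u : Scalar) (r : ℕ) (w x y : S) : S :=
  ∑ k ∈ Finset.range (r + 1), ((-1) ^ k * qbinom u r k) •
    (sandwich x w x k * y * x ^ (r - k) + x ^ k * y * sandwich x w x (r - k))

theorem map_serreForm (f : S →ₐ[Scalar] T) (u : Scalar) (r : ℕ) (x : Fin r → S) (y : S) :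
    f (serreForm u r x y) = serreForm u r (fun a => f (x a)) (f y) := by
  simp only [serreForm, map_sum, map_smul, map_mul, map_list_prod, List.map_take, List.map_drop,
    List.map_ofFn, Function.comp_def]

theorem map_serreSum (f : S →ₐ[Scalar] T) (u : Scalar) (X : ℤ → S) (y : S) (r : ℕ)
    (l : Fin r → ℤ) : f (serreSum u X y r l) = serreSum u (fun n => f (X n)) (f y) r l := by
  rw [serreSum_eq, serreSum_eq, map_serreForm]

theorem serreForm_add_right (u : Scalar) (r : ℕ) (x : Fin r → S) (y y' : S) :
    serreForm u r x (y + y') = serreForm u r x y + serreForm u r x y' := by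
  simp only [serreForm, mul_add, add_mul, smul_add, Finset.sum_add_distrib]

theorem serreForm_zero_right (u : Scalar) (r : ℕ) (x : Fin r → S) : serreForm u r x 0 = 0 := by
  simp [serreForm]

omit [Algebra Scalar S] in
theorem commute_prod_map {κ : Type*} (c : κ → S) (hc : ∀ a b, Commute (c a) b) (L : List κ)
    (b : S) : Commute (L.map c).prod b := by
  induction L with
  | nil => exact Commute.one_left b
  | cons a L ih =>
    rw [List.map_cons, List.prod_cons]
    exact (hc a b).mul_left ih

omit [Algebra Scalar S] in
theorem list_prod_map_mul {κ : Type*} (L : List κ) (c x : κ → S) (hc : ∀ a b, Commute (c a) b) :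
    (L.map fun a => c a * x a).prod = (L.map c).prod * (L.map x).prod := by
  induction L with
  | nil => simp
  | cons a L ih =>
    rw [List.map_cons, List.map_cons, List.map_cons, List.prod_cons, List.prod_cons, List.prod_cons,
      ih, mul_assoc, ← mul_assoc (x a), ← (commute_prod_map c hc L (x a)).eq]
    simp only [mul_assoc]

omit [Algebra Scalar S] in
theorem word_central_mul {κ : Type*} (L M : List κ) (c x : κ → S) (e y : S)
    (hc : ∀ a b, Commute (c a) b) (he : ∀ b, Commute e b) :
    (L.map fun a => c a * x a).prod * (e * y) * (M.map fun a => c a * x a).prod =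
      ((L ++ M).map c).prod * e * ((L.map x).prod * y * (M.map x).prod) := by
  rw [list_prod_map_mul _ c _ hc, list_prod_map_mul _ c _ hc, List.map_append, List.prod_append]
  have h1 := commute_prod_map c hc M
  generalize (L.map c).prod = p at *
  generalize (M.map c).prod = q at *
  generalize (L.map x).prod = s at *
  generalize (M.map x).prod = t at *
  calc p * s * (e * y) * (q * t) = p * (s * e) * (y * q) * t := by simp only [mul_assoc]
    _ = p * (e * s) * (q * y) * t := by rw [(he s).eq, (h1 y).eq]
    _ = p * e * (s * q) * y * t := by simp only [mul_assoc]
    _ = p * e * (q * s) * y * t := by rw [(h1 s).eq]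
    _ = p * (e * q) * s * y * t := by simp only [mul_assoc]
    _ = p * (q * e) * s * y * t := by rw [(he q).eq]
    _ = _ := by simp only [mul_assoc]

omit [Algebra Scalar S] in
theorem prod_ofFn_perm {r : ℕ} (c : Fin r → S) (hc : ∀ a b, Commute (c a) b)
    (σ : Equiv.Perm (Fin r)) : (List.ofFn fun a => c (σ a)).prod = (List.ofFn c).prod := by
  refine List.Perm.prod_eq' (Equiv.Perm.ofFn_comp_perm σ c) ?_
  rw [List.pairwise_ofFn]
  exact fun i j _ => hc _ _

/-- Central factors can be pulled out of the Serre expression. -/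
theorem serreForm_central_mul (u : Scalar) (r : ℕ) (c x : Fin r → S) (e y : S)
    (hc : ∀ a b, Commute (c a) b) (he : ∀ b, Commute e b) :
    serreForm u r (fun a => c a * x a) (e * y) =
      ((List.ofFn c).prod * e) * serreForm u r x y := by
  rw [serreForm, serreForm, Finset.mul_sum]
  refine Finset.sum_congr rfl fun σ _ => ?_
  rw [Finset.mul_sum]
  refine Finset.sum_congr rfl fun k _ => ?_
  rw [mul_smul_comm]
  congr 1
  rw [← prod_ofFn_perm c hc σ]
  simp only [List.ofFn_eq_map, ← List.map_take, ← List.map_drop]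
  have := word_central_mul ((List.finRange r).take k) ((List.finRange r).drop k)
    (fun a => c (σ a)) (fun a => x (σ a)) e y (fun a => hc _) he
  rw [List.take_append_drop] at this
  exact this

omit [Algebra Scalar S] in
theorem prod_ofFn_insertNth {r : ℕ} (p : Fin (r + 1)) (y : S) (x : Fin r → S) :
    (List.ofFn (p.insertNth y x : Fin (r + 1) → S)).prod =
      ((List.ofFn x).take p).prod * y * ((List.ofFn x).drop p).prod := by
  induction r with
  | zero =>
    obtain rfl : p = 0 := Fin.fin_one_eq_zero p
    simp [Fin.insertNth_zero']
  | succ r ih =>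
    induction p using Fin.cases with
    | zero => simp [Fin.insertNth_zero', Fin.cons]
    | succ p =>
      obtain ⟨a, x, rfl⟩ : ∃ a x', x = Fin.cons a x' := ⟨x 0, Fin.tail x, (Fin.cons_self_tail x).symm⟩
      rw [Fin.insertNth_succ_cons, List.ofFn_cons, List.prod_cons, ih, List.ofFn_cons]
      simp [mul_assoc]

/-- The word `x_1 ⋯ x_p y x_{p+1} ⋯ x_r` as a multilinear map in `x`. -/
def wordForm (r : ℕ) (p : Fin (r + 1)) (y : S) :
    MultilinearMap Scalar (fun _ : Fin r => S) S :=
  (MultilinearMap.mkPiAlgebraFin Scalar (r + 1) S).curryMid p y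

theorem wordForm_apply (r : ℕ) (p : Fin (r + 1)) (y : S) (x : Fin r → S) :
    wordForm r p y x = ((List.ofFn x).take p).prod * y * ((List.ofFn x).drop p).prod := by
  rw [wordForm, MultilinearMap.curryMid_apply_apply, MultilinearMap.mkPiAlgebraFin_apply,
    prod_ofFn_insertNth]

/-- Inclusion–exclusion: expanding the diagonal values gives a sum over all maps `p`, and the signs
over the sets `t` disjoint from the image of `p` cancel unless `p` is surjective, hence a
permutation. -/
theorem multilinear_polarization {r : ℕ} (f : MultilinearMap Scalar (fun _ : Fin r => S) T)
    (x : Fin r → S) :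
    ∑ σ : Equiv.Perm (Fin r), f (fun a => x (σ a)) =
      ∑ t : Finset (Fin r), (-1 : ℤ) ^ t.card • f (fun _ => ∑ a ∈ tᶜ, x a) := by
  have h1 : ∀ t : Finset (Fin r), f (fun _ => ∑ a ∈ tᶜ, x a) =
      ∑ p : Fin r → Fin r, if Disjoint t (Finset.univ.image p) then f (fun a => x (p a)) else 0 := by
    intro t
    rw [MultilinearMap.map_sum_finset f (fun _ a => x a) (fun _ => tᶜ), ← Finset.sum_filter]
    refine Finset.sum_congr ?_ fun _ _ => rfl
    ext p
    simp [Finset.disjoint_right]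
  simp only [h1, Finset.smul_sum, smul_ite, smul_zero]
  rw [Finset.sum_comm]
  have h2 : ∀ p : Fin r → Fin r, (∑ t : Finset (Fin r),
      if Disjoint t (Finset.univ.image p) then (-1 : ℤ) ^ t.card • f (fun a => x (p a)) else 0) =
      if Function.Bijective p then f (fun a => x (p a)) else 0 := by
    intro p
    have h3 : (Finset.univ.filter fun t : Finset (Fin r) => Disjoint t (Finset.univ.image p)) =
        ((Finset.univ.image p)ᶜ).powerset := by
      ext t
      simp [Finset.subset_compl_iff_disjoint_right]
    rw [← Finset.sum_filter, h3, ← Finset.sum_smul, Finset.sum_powerset_neg_one_pow_card]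
    have h4 : (Finset.univ.image p)ᶜ = ∅ ↔ Function.Bijective p := by
      rw [Finset.compl_eq_empty_iff, ← Finite.surjective_iff_bijective, Finset.eq_univ_iff_forall]
      simp [Function.Surjective]
    by_cases hp : Function.Bijective p
    · rw [if_pos (h4.2 hp), if_pos hp, one_smul]
    · rw [if_neg (fun h => hp (h4.1 h)), if_neg hp, zero_smul]
  rw [Finset.sum_congr rfl fun p _ => h2 p, ← Finset.sum_filter]
  refine Finset.sum_bij (fun σ _ => (σ : Fin r → Fin r)) ?_ ?_ ?_ ?_
  · intro σ _; exact Finset.mem_filter.2 ⟨Finset.mem_univ _, σ.bijective⟩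
  · intro σ _ τ _ h; exact DFunLike.coe_injective h
  · intro p hp
    exact ⟨Equiv.ofBijective p (Finset.mem_filter.1 hp).2, Finset.mem_univ _, rfl⟩
  · intro σ _; rfl

theorem serreForm_eq_wordForm (u : Scalar) (r : ℕ) (x : Fin r → S) (y : S) :
    serreForm u r x y = ∑ k : Fin (r + 1), ((-1) ^ (k : ℕ) * qbinom u r k) •
      ∑ σ : Equiv.Perm (Fin r), wordForm r k y (fun a => x (σ a)) := by
  simp only [serreForm, Finset.sum_range, wordForm_apply, Finset.smul_sum]
  rw [Finset.sum_comm]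

theorem serreForm_polarization (u : Scalar) (r : ℕ) (x : Fin r → S) (y : S) :
    serreForm u r x y =
      ∑ t : Finset (Fin r), (-1 : ℤ) ^ t.card • diagSerre u r (∑ a ∈ tᶜ, x a) y := by
  simp only [serreForm_eq_wordForm, multilinear_polarization, diagSerre, Finset.sum_range,
    Finset.smul_sum]
  rw [Finset.sum_comm]
  refine Finset.sum_congr rfl fun t _ => Finset.sum_congr rfl fun k _ => ?_
  rw [smul_comm, wordForm_apply]
  congr 3
  have hk : (k : ℕ) ≤ r := Nat.lt_succ_iff.1 k.2
  · simp [List.ofFn_const, Nat.min_eq_left hk]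
  · simp [List.ofFn_const]

/-- Only equal arguments remain to be treated. For a current this is no restriction, since a finite
sum of its shifts is again a current with the same quadratic relations. -/
theorem serreForm_eq_zero_of_diag (u : Scalar) (r : ℕ) (x : Fin r → S) (y : S)
    (h : ∀ t : Finset (Fin r), diagSerre u r (∑ a ∈ t, x a) y = 0) : serreForm u r x y = 0 := by
  rw [serreForm_polarization]
  exact Finset.sum_eq_zero fun t _ => by rw [h, smul_zero]

end Serre

/-! ### One-sided currents satisfy the Serre relations automatically -/

section OneSided

variable {S : Type*} [Ring S] [Algebra Scalar S]

omit [Algebra Scalar S] in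
theorem sandwich_zero_mid (x y : S) (k : ℕ) : sandwich x 0 y k = 0 := by simp [sandwich]

theorem diagSerreDeriv_zero (u : Scalar) (r : ℕ) (x y : S) : diagSerreDeriv u r 0 x y = 0 := by
  simp [diagSerreDeriv, sandwich_zero_mid]

/-- A current that vanishes in all sufficiently large or in all sufficiently small degrees. -/
def OneSided (ψ : ℤ → S) : Prop :=
  (∃ N : ℤ, ∀ m, N < m → ψ m = 0) ∨ (∃ N : ℤ, ∀ m, m < N → ψ m = 0)

omit [Algebra Scalar S] in
theorem OneSided.sum_shift {ψ : ℤ → S} (h : OneSided ψ) {κ : Type*} (s : Finset κ) (l : κ → ℤ) :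
    OneSided fun m => ∑ a ∈ s, ψ (m + l a) := by
  rcases h with ⟨N, hN⟩ | ⟨N, hN⟩
  · refine Or.inl ⟨N + ∑ a ∈ s, |l a|, fun m hm => Finset.sum_eq_zero fun a ha => hN _ ?_⟩
    have h1 := Finset.single_le_sum (f := fun a => |l a|) (fun _ _ => abs_nonneg _) ha
    have h2 := neg_abs_le (l a)
    linarith
  · refine Or.inr ⟨N - ∑ a ∈ s, |l a|, fun m hm => Finset.sum_eq_zero fun a ha => hN _ ?_⟩
    have h1 := Finset.single_le_sum (f := fun a => |l a|) (fun _ _ => abs_nonneg _) ha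
    have h2 := le_abs_self (l a)
    linarith

/-- The solved exchange relation of a current that vanishes in large degrees. -/
theorem Quad.exchange {c : Scalar} {ψ X : ℤ → S} (h : Quad c ψ X) {N : ℤ}
    (hN : ∀ m, N < m → ψ m = 0) (t : ℕ) (m : ℤ) :
    ψ (N - t) * X m = c • (X m * ψ (N - t)) +
      ∑ i ∈ Finset.range t, (c ^ i * (c ^ 2 - 1)) • (X (m - 1 - i) * ψ (N - t + 1 + i)) := by
  induction t generalizing m with
  | zero =>
    -- Since `ψ (N + 1) = 0`, only two terms of the quadratic relation survive, and the top
    -- coefficient `ψ N` is merely scaled when it passes `X`.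
    have h1 := h N (m - 1)
    rw [hN (N + 1) (by omega), sub_add_cancel] at h1
    simp only [zero_mul, smul_zero, mul_zero, sub_zero] at h1
    simp only [Nat.cast_zero, sub_zero, Finset.range_zero, Finset.sum_empty, add_zero]
    exact sub_eq_zero.1 h1.symm
  | succ t ih =>
    have h1 := h (N - (t + 1 : ℕ)) (m - 1)
    have e1 : N - ((t + 1 : ℕ) : ℤ) + 1 = N - t := by push_cast; ring
    rw [sub_add_cancel, e1, ih (m - 1)] at h1
    rw [Finset.sum_range_succ', e1]
    have e2 : ∀ i : ℕ, X (m - 1 - ((i + 1 : ℕ) : ℤ)) * ψ (N - t + ((i + 1 : ℕ) : ℤ)) =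
        X (m - 1 - 1 - i) * ψ (N - t + 1 + i) := by
      intro i
      congr 2 <;> push_cast <;> ring
    simp only [e2]
    rw [smul_add, smul_smul, Finset.smul_sum] at h1
    simp only [smul_smul, ← mul_assoc, ← pow_succ'] at h1
    simp only [Nat.cast_zero, sub_zero, add_zero, pow_zero, one_mul]
    linear_combination (norm := module) -h1

/-- `∑_t -c ^ t X_{-1-t} U ^ {t+1}`. -/
def halfShift (c : Scalar) (X : ℤ → S) : PowerSeries S :=
  PowerSeries.X * PowerSeries.mk fun t => -(c ^ t • X (-1 - t))

/-- `∑_t -c ^ t X_{-t} U ^ t`. -/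
def half (c : Scalar) (X : ℤ → S) : PowerSeries S := PowerSeries.mk fun t => -(c ^ t • X (-t))

/-- The two half-currents differ by a shift, so everything except the constant term cancels. With `a
= halfShift c X` and `a' = half c X` a single mode of `X` becomes `c a - a'`. -/
theorem C_eq_half (c : Scalar) (X : ℤ → S) :
    PowerSeries.C (X 0) = c • halfShift c X - half c X := by
  ext t
  rcases t with - | t
  · simp [halfShift, half]
  · have e : -((t : ℤ) + 1) = -1 - t := by ring
    simp [halfShift, half, PowerSeries.coeff_succ_X_mul, smul_smul, pow_succ',
      e]

/-- The generating-function form of `Quad.exchange`. Read with `C_eq_half`, it says that passing the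
series of `ψ` turns `c a - a'` into `a - c a'`, the substitution underlying the quantum plane
identities. -/
theorem mk_mul_C_eq {c : Scalar} {ψ X : ℤ → S} (h : Quad c ψ X) {N : ℤ}
    (hN : ∀ m, N < m → ψ m = 0) :
    (PowerSeries.mk fun t => ψ (N - t)) * PowerSeries.C (X 0) =
      (halfShift c X - c • half c X) * PowerSeries.mk fun t => ψ (N - t) := by
  ext t
  rw [PowerSeries.coeff_mul_C, PowerSeries.coeff_mk, h.exchange hN t 0, PowerSeries.coeff_mul,
    Finset.Nat.sum_antidiagonal_eq_sum_range_succ_mk, Finset.sum_range_succ', add_comm]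
  congr 1
  · refine Finset.sum_congr rfl fun i hi => ?_
    have hi' := Finset.mem_range.1 hi
    have e : N - ((t - (i + 1) : ℕ) : ℤ) = N - t + 1 + i := by
      rw [Nat.cast_sub (by omega)]; push_cast; ring
    have e2 : -((i : ℤ) + 1) = -1 - i := by ring
    simp only [halfShift, half, map_sub, PowerSeries.coeff_succ_X_mul, PowerSeries.coeff_mk,
      PowerSeries.coeff_smul, e, zero_sub]
    push_cast
    rw [e2, sub_mul, neg_mul, smul_neg, neg_mul, smul_smul, smul_mul_assoc, smul_mul_assoc]
    module
  · simp [halfShift, half]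

/-- The quadratic relation at the indices `-1 - s` and `-1 - t`, weighted by `β ^ s γ ^ t` and
summed over `s + t` fixed. -/
theorem half_relation {c β γ : Scalar} {X Y : ℤ → S} (h : Quad c X Y) :
    c • (half β X * halfShift γ Y) - halfShift β X * half γ Y =
      halfShift γ Y * half β X - c • (half γ Y * halfShift β X) := by
  have e : ∀ f g : PowerSeries S, f * (PowerSeries.X * g) = PowerSeries.X * (f * g) := by
    intro f g
    rw [← mul_assoc, (PowerSeries.commute_X f).eq, mul_assoc]
  simp only [halfShift, half, e]
  ext t
  rcases t with - | t
  · simp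
  · simp only [map_sub, PowerSeries.coeff_smul, mul_assoc, PowerSeries.coeff_succ_X_mul]
    simp only [PowerSeries.coeff_mul, PowerSeries.coeff_mk]
    rw [← Finset.Nat.sum_antidiagonal_swap (n := t)
        (f := fun p => -(γ ^ p.1 • Y (-1 - p.1)) * -(β ^ p.2 • X (-p.2))),
      ← Finset.Nat.sum_antidiagonal_swap (n := t)
        (f := fun p => -(γ ^ p.1 • Y (-p.1)) * -(β ^ p.2 • X (-1 - p.2))),
      Finset.smul_sum, Finset.smul_sum, ← Finset.sum_sub_distrib, ← Finset.sum_sub_distrib]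
    refine Finset.sum_congr rfl fun p _ => ?_
    have h1 := congrArg ((β ^ p.1 * γ ^ p.2) • ·) (h (-1 - p.1) (-1 - p.2))
    have e1 : -1 - (p.1 : ℤ) + 1 = -p.1 := by ring
    have e2 : -1 - (p.2 : ℤ) + 1 = -p.2 := by ring
    simp only [e1, e2] at h1
    simp only [Prod.fst_swap, Prod.snd_swap, neg_mul_neg, smul_mul_assoc, mul_smul_comm]
    linear_combination (norm := module) h1

/-- For equal currents and equal parameters the two sides of `half_relation` are negatives of each
other, so both vanish because `2` is invertible. -/
theorem half_plane {c β : Scalar} {X : ℤ → S} (h : Quad c X X) :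
    halfShift β X * half β X = c • (half β X * halfShift β X) := by
  have h1 := congrArg ((2 : Scalar)⁻¹ • ·) (half_relation (β := β) (γ := β) h)
  have h2 : (2 : Scalar)⁻¹ * 2 = 1 := inv_mul_cancel₀ two_ne_zero
  rw [← sub_eq_zero] at h1 ⊢
  rw [← neg_eq_zero, ← h1]
  generalize halfShift β X * half β X = p
  generalize half β X * halfShift β X = q
  have : (2 : Scalar)⁻¹ • (c • q - p) - (2 : Scalar)⁻¹ • (p - c • q) =
      ((2 : Scalar)⁻¹ * 2) • (c • q - p) := by
    rw [mul_comm, ← smul_smul, two_smul, smul_sub (2 : Scalar)⁻¹ p, smul_sub (2 : Scalar)⁻¹ (c • q)]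
    abel
  rw [this, h2]
  module

omit [Algebra Scalar S] in
theorem mul_pow_eq_of_mul_eq {w x x' : S} (h : w * x = x' * w) (k : ℕ) : w * x ^ k = x' ^ k * w := by
  induction k with
  | zero => simp
  | succ k ih => rw [pow_succ, ← mul_assoc, ih, mul_assoc, h, ← mul_assoc, pow_succ]

omit [Algebra Scalar S] in
theorem sandwich_of_mul_eq {w x x' : S} (h : w * x = x' * w) (k : ℕ) :
    sandwich x w x k = sandwich x 1 x' k * w := by
  simp only [sandwich, Finset.sum_mul, mul_one]
  refine Finset.sum_congr rfl fun p _ => ?_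
  rw [mul_assoc, mul_pow_eq_of_mul_eq h, mul_assoc]

theorem coeff_diagSerreDeriv (u : Scalar) (r : ℕ) (f : PowerSeries S) (x y : S) (t : ℕ) :
    PowerSeries.coeff t (diagSerreDeriv u r f (PowerSeries.C x) (PowerSeries.C y)) =
      diagSerreDeriv u r (PowerSeries.coeff t f) x y := by
  simp only [diagSerreDeriv, sandwich, ← map_pow, map_sum, PowerSeries.coeff_smul, map_add,
    Finset.sum_mul, Finset.mul_sum, mul_assoc, PowerSeries.coeff_C_mul, ← map_mul,
    PowerSeries.coeff_mul_C]

theorem coeff_diagSerre (u : Scalar) (r : ℕ) (f : PowerSeries S) (x : S) (t : ℕ) :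
    PowerSeries.coeff t (diagSerre u r (PowerSeries.C x) f) =
      diagSerre u r x (PowerSeries.coeff t f) := by
  simp only [diagSerre, ← map_pow, map_sum, PowerSeries.coeff_smul,
    PowerSeries.coeff_mul_C, PowerSeries.coeff_C_mul]

theorem qbinom_symm (u : Scalar) {r k : ℕ} (hk : k ≤ r) : qbinom u r (r - k) = qbinom u r k := by
  rw [qbinom, qbinom, Nat.sub_sub_self hk, mul_comm]

omit [Algebra Scalar S] in
theorem op_sandwich (x w y : S) (k : ℕ) :
    MulOpposite.op (sandwich x w y k) =
      sandwich (MulOpposite.op y) (MulOpposite.op w) (MulOpposite.op x) k := by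
  rw [sandwich, sandwich, ← Finset.sum_range_reflect, Finset.op_sum]
  refine Finset.sum_congr rfl fun p hp => ?_
  have : k - 1 - (k - 1 - p) = p := by have := Finset.mem_range.1 hp; omega
  simp [this, mul_assoc]

theorem op_diagSerreDeriv (u : Scalar) (r : ℕ) (w x y : S) :
    MulOpposite.op (diagSerreDeriv u r w x y) = (-1 : Scalar) ^ r •
      diagSerreDeriv u r (MulOpposite.op w) (MulOpposite.op x) (MulOpposite.op y) := by
  rw [diagSerreDeriv, diagSerreDeriv, ← Finset.sum_range_reflect, Finset.op_sum, Finset.smul_sum]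
  refine Finset.sum_congr rfl fun k hk => ?_
  have hk' : k ≤ r := Nat.lt_succ_iff.1 (Finset.mem_range.1 hk)
  have e : r + 1 - 1 - k = r - k := by omega
  have e2 : (-1 : Scalar) ^ (r - k) = (-1) ^ r * (-1) ^ k := by
    obtain ⟨m, rfl⟩ := Nat.exists_eq_add_of_le hk'
    rw [Nat.add_sub_cancel_left, pow_add, mul_right_comm, ← mul_pow]
    simp
  rw [e, qbinom_symm u hk', Nat.sub_sub_self hk', e2]
  simp only [MulOpposite.op_smul, MulOpposite.op_add, MulOpposite.op_mul, op_sandwich,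
    MulOpposite.op_pow, smul_smul, mul_assoc]
  rw [add_comm]

theorem op_diagSerre (u : Scalar) (r : ℕ) (x y : S) :
    MulOpposite.op (diagSerre u r x y) = (-1 : Scalar) ^ r •
      diagSerre u r (MulOpposite.op x) (MulOpposite.op y) := by
  rw [diagSerre, diagSerre, ← Finset.sum_range_reflect, Finset.op_sum, Finset.smul_sum]
  refine Finset.sum_congr rfl fun k hk => ?_
  have hk' : k ≤ r := Nat.lt_succ_iff.1 (Finset.mem_range.1 hk)
  have e : r + 1 - 1 - k = r - k := by omega
  have e2 : (-1 : Scalar) ^ (r - k) = (-1) ^ r * (-1) ^ k := by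
    obtain ⟨m, rfl⟩ := Nat.exists_eq_add_of_le hk'
    rw [Nat.add_sub_cancel_left, pow_add, mul_right_comm, ← mul_pow]
    simp
  rw [e, qbinom_symm u hk', Nat.sub_sub_self hk', e2]
  simp only [MulOpposite.op_smul, MulOpposite.op_mul, MulOpposite.op_pow, smul_smul, mul_assoc]

/-- All modes of `ψ` are treated at once: their series `Ψ` is moved to the right end of every word,
and the remaining factor is a combination of half-currents that `plane_serre_deriv` annihilates. The
Serre relation between `X` and `Y` plays no role. -/
theorem diagSerreDeriv_eq_zero_of_bounded {u : Scalar} (hu : Generic u) (n : ℕ) {ψ X Y : ℤ → S}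
    (hXX : Quad (u ^ 2) X X) (hXY : Quad (u ^ n)⁻¹ X Y) (hψX : Quad (u ^ 2) ψ X)
    (hψY : Quad (u ^ n)⁻¹ ψ Y) {N : ℤ} (hN : ∀ m, N < m → ψ m = 0) (m : ℤ) :
    diagSerreDeriv u (n + 1) (ψ m) (X 0) (Y 0) = 0 := by
  rcases lt_or_ge N m with hm | hm
  · rw [hN m hm, diagSerreDeriv_zero]
  obtain ⟨t, rfl⟩ : ∃ t : ℕ, m = N - t := ⟨(N - m).toNat, by omega⟩
  set Ψ : PowerSeries S := PowerSeries.mk fun t => ψ (N - t) with hΨ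
  have h1 := mk_mul_C_eq hψX hN
  have h2 := mk_mul_C_eq hψY hN
  rw [← hΨ] at h1 h2
  have key : diagSerreDeriv u (n + 1) Ψ (PowerSeries.C (X 0)) (PowerSeries.C (Y 0)) = 0 := by
    have h3 := congrArg (· * Ψ) (plane_serre_deriv hu n (half_plane (β := u ^ 2) hXX)
      (half_relation (β := u ^ 2) (γ := (u ^ n)⁻¹) hXY))
    simp only [zero_mul, Finset.sum_mul] at h3
    rw [diagSerreDeriv, ← h3]
    refine Finset.sum_congr rfl fun k _ => ?_
    rw [sandwich_of_mul_eq h1, sandwich_of_mul_eq h1, smul_mul_assoc, add_mul, ← C_eq_half,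
      ← C_eq_half]
    simp only [mul_assoc]
    rw [← mul_assoc Ψ, h2, mul_assoc, mul_pow_eq_of_mul_eq h1]
  have := congrArg (PowerSeries.coeff t) key
  rwa [coeff_diagSerreDeriv, PowerSeries.coeff_mk, map_zero] at this

theorem diagSerreDeriv_eq_zero {u : Scalar} (hu : Generic u) (n : ℕ) {ψ X Y : ℤ → S}
    (hXX : Quad (u ^ 2) X X) (hXY : Quad (u ^ n)⁻¹ X Y) (hψX : Quad (u ^ 2) ψ X)
    (hψY : Quad (u ^ n)⁻¹ ψ Y) (hψ : OneSided ψ) (m : ℤ) :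
    diagSerreDeriv u (n + 1) (ψ m) (X 0) (Y 0) = 0 := by
  rcases hψ with ⟨N, hN⟩ | ⟨N, hN⟩
  · exact diagSerreDeriv_eq_zero_of_bounded hu n hXX hXY hψX hψY hN m
  · have h1 := diagSerreDeriv_eq_zero_of_bounded hu n hXX.op_neg hXY.op_neg hψX.op_neg
      hψY.op_neg (N := -N) (fun m hm => by rw [hN _ (by omega), MulOpposite.op_zero]) (-m)
    rw [neg_neg, neg_zero] at h1
    apply MulOpposite.op_injective
    rw [op_diagSerreDeriv, h1, smul_zero, MulOpposite.op_zero]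

/-- The same mechanism with the one-sided current as the last letter; the plane identity is now
`plane_serre`. -/
theorem diagSerre_eq_zero_of_bounded {u : Scalar} (hu : Generic u) (n : ℕ) {ψ X : ℤ → S}
    (hXX : Quad (u ^ 2) X X) (hψX : Quad (u ^ n)⁻¹ ψ X) {N : ℤ} (hN : ∀ m, N < m → ψ m = 0)
    (m : ℤ) : diagSerre u (n + 1) (X 0) (ψ m) = 0 := by
  rcases lt_or_ge N m with hm | hm
  · simp [hN m hm, diagSerre]
  obtain ⟨t, rfl⟩ : ∃ t : ℕ, m = N - t := ⟨(N - m).toNat, by omega⟩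
  set Ψ : PowerSeries S := PowerSeries.mk fun t => ψ (N - t) with hΨ
  have h1 := mk_mul_C_eq hψX hN
  rw [← hΨ] at h1
  have key : diagSerre u (n + 1) (PowerSeries.C (X 0)) Ψ = 0 := by
    have h3 := congrArg (· * Ψ) (plane_serre hu n _ _ (half_plane (β := (u ^ n)⁻¹) hXX))
    simp only [zero_mul, Finset.sum_mul] at h3
    rw [diagSerre, ← h3]
    refine Finset.sum_congr rfl fun k _ => ?_
    rw [mul_assoc, mul_pow_eq_of_mul_eq h1, ← C_eq_half, smul_mul_assoc, mul_assoc]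
  have := congrArg (PowerSeries.coeff t) key
  rwa [coeff_diagSerre, PowerSeries.coeff_mk, map_zero] at this

theorem diagSerre_eq_zero {u : Scalar} (hu : Generic u) (n : ℕ) {ψ X : ℤ → S}
    (hXX : Quad (u ^ 2) X X) (hψX : Quad (u ^ n)⁻¹ ψ X) (hψ : OneSided ψ) (m : ℤ) :
    diagSerre u (n + 1) (X 0) (ψ m) = 0 := by
  rcases hψ with ⟨N, hN⟩ | ⟨N, hN⟩
  · exact diagSerre_eq_zero_of_bounded hu n hXX hψX hN m
  · have h1 := diagSerre_eq_zero_of_bounded hu n hXX.op_neg hψX.op_neg (N := -N)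
      (fun m hm => by rw [hN _ (by omega), MulOpposite.op_zero]) (-m)
    rw [neg_neg, neg_zero] at h1
    apply MulOpposite.op_injective
    rw [op_diagSerre, h1, smul_zero, MulOpposite.op_zero]

theorem serreForm_eq_zero_of_oneSided {u : Scalar} (hu : Generic u) (n : ℕ) {ψ X : ℤ → S}
    (hXX : Quad (u ^ 2) X X) (hψX : Quad (u ^ n)⁻¹ ψ X) (hψ : OneSided ψ) (l : Fin (n + 1) → ℤ)
    (m : ℤ) : serreForm u (n + 1) (fun a => X (l a)) (ψ m) = 0 := by
  refine serreForm_eq_zero_of_diag u _ _ _ fun t => ?_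
  have h1 : ∀ {c : Scalar} {Z : ℤ → S}, Quad c X Z →
      Quad c (fun j => ∑ a ∈ t, X (j + l a)) Z := fun h => Quad.sum t fun a _ => h.shift (l a)
  have := diagSerre_eq_zero hu n (h1 (h1 hXX).symm) (h1 hψX.symm).symm hψ m
  simpa only [zero_add] using this

end OneSided

/-! ### Dual numbers -/

section Dual

variable {S : Type*} [Ring S] [Algebra Scalar S]

/-- The element `x + ε w`. -/
def dual (x w : S) : DualNumber S := TrivSqZeroExt.inl x + TrivSqZeroExt.inr w

omit [Algebra Scalar S] in
@[simp] theorem fst_dual (x w : S) : (dual x w).fst = x := by simp [dual]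

omit [Algebra Scalar S] in
@[simp] theorem snd_dual (x w : S) : (dual x w).snd = w := by simp [dual]

omit [Algebra Scalar S] in
theorem dual_mul (x w y z : S) : dual x w * dual y z = dual (x * y) (x * z + w * y) := by
  ext <;> simp

omit [Algebra Scalar S] in
theorem dual_add (x w y z : S) : dual x w + dual y z = dual (x + y) (w + z) := by
  ext <;> simp

omit [Algebra Scalar S] in
theorem dual_sub (x w y z : S) : dual x w - dual y z = dual (x - y) (w - z) := by
  ext <;> simp

theorem smul_dual (c : Scalar) (x w : S) : c • dual x w = dual (c • x) (c • w) := by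
  ext <;> simp

omit [Algebra Scalar S] in
theorem dual_pow (x w : S) (k : ℕ) : dual x w ^ k = dual (x ^ k) (sandwich x w x k) := by
  induction k with
  | zero => ext <;> simp [sandwich]
  | succ k ih => rw [pow_succ', ih, dual_mul, ← pow_succ', sandwich_succ]

omit [Algebra Scalar S] in
theorem dual_sum {κ : Type*} (s : Finset κ) (x w : κ → S) :
    ∑ a ∈ s, dual (x a) (w a) = dual (∑ a ∈ s, x a) (∑ a ∈ s, w a) := by
  classical
  induction s using Finset.induction_on with
  | empty => ext <;> simp
  | insert a s ha ih => rw [Finset.sum_insert ha, ih, dual_add, Finset.sum_insert ha,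
      Finset.sum_insert ha]

theorem diagSerre_dual (u : Scalar) (r : ℕ) (x w y : S) :
    diagSerre u r (dual x w) (dual y 0) = dual (diagSerre u r x y) (diagSerreDeriv u r w x y) := by
  simp only [diagSerre, diagSerreDeriv, ← dual_sum, dual_pow, dual_mul, smul_dual]
  refine Finset.sum_congr rfl fun k _ => ?_
  congr 2
  simp only [mul_zero, zero_add]
  rw [add_comm]

theorem Quad.dual {c : Scalar} {X Y ψ χ : ℤ → S} (h : Quad c X Y) (hψ : Quad c ψ Y)
    (hχ : Quad c X χ) : Quad c (fun l => dual (X l) (ψ l)) (fun l => dual (Y l) (χ l)) :=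
  fun l m => by
    have h1 := h l m
    have h2 := hψ l m
    have h3 := hχ l m
    simp only [dual_mul, smul_dual, dual_sub]
    congr 1
    simp only [smul_add]
    linear_combination (norm := module) h2 + h3

theorem fst_serreForm_dual (u : Scalar) (r : ℕ) (x w : Fin r → S) (y z : S) :
    (serreForm u r (fun a => dual (x a) (w a)) (dual y z)).fst = serreForm u r x y := by
  have := map_serreForm (TrivSqZeroExt.fstHom Scalar S S) u r (fun a => dual (x a) (w a)) (dual y z)
  simpa using this

theorem serreForm_dual_right {u : Scalar} {r : ℕ} {x : Fin r → S} {y z : S}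
    (hy : serreForm u r x y = 0) (hz : serreForm u r x z = 0) :
    serreForm u r (fun a => dual (x a) 0) (dual y z) = 0 := by
  have h1 : ∀ y, serreForm u r (fun a => dual (x a) 0) (dual y 0) = dual (serreForm u r x y) 0 := by
    intro y
    have := map_serreForm (TrivSqZeroExt.inlAlgHom Scalar S S) u r x y
    simpa [dual] using this.symm
  have h2 : dual y z = dual y 0 + DualNumber.eps * dual z 0 := by
    ext <;> simp
  have h3 := serreForm_central_mul u r (fun _ => 1) (fun a => dual (x a) 0) (DualNumber.eps)
    (dual z 0) (fun _ b => Commute.one_left b) DualNumber.commute_eps_left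
  simp only [one_mul] at h3
  rw [h2, serreForm_add_right, h3, h1, h1, hy, hz]
  ext <;> simp

/-- Polarization replaces `X` and `ψ` by sums of their shifts by the `l a`, so that the relevant
modes all sit in degree zero, where `diagSerreDeriv_eq_zero` applies. -/
theorem snd_serreForm_dual {u : Scalar} (hu : Generic u) (n : ℕ) {ψ X Y : ℤ → S}
    (hXX : Quad (u ^ 2) X X) (hXY : Quad (u ^ n)⁻¹ X Y) (hψX : Quad (u ^ 2) ψ X)
    (hψY : Quad (u ^ n)⁻¹ ψ Y) (hψ : OneSided ψ) (l : Fin (n + 1) → ℤ) (m : ℤ) :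
    (serreForm u (n + 1) (fun a => dual (X (l a)) (ψ (l a))) (dual (Y m) 0)).snd = 0 := by
  rw [serreForm_polarization, TrivSqZeroExt.snd_sum]
  refine Finset.sum_eq_zero fun t _ => ?_
  rw [TrivSqZeroExt.snd_smul, dual_sum, diagSerre_dual, snd_dual]
  have h1 : ∀ {c : Scalar} {W Z : ℤ → S}, Quad c W Z →
      Quad c (fun j => ∑ a ∈ tᶜ, W (j + l a)) Z := fun h => Quad.sum _ fun a _ => h.shift (l a)
  have := diagSerreDeriv_eq_zero hu n (h1 (h1 hXX).symm) (h1 (hXY.symm.shift m).symm)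
    (h1 (h1 hψX.symm).symm) (h1 (hψY.symm.shift m).symm) (hψ.sum_shift _ l) 0
  simp only [zero_add] at this
  rw [this, smul_zero]

/-- Multilinearity of the Serre expression. -/
def serreMultilinear (u : Scalar) (r : ℕ) (y : S) : MultilinearMap Scalar (fun _ : Fin r => S) S :=
  ∑ k : Fin (r + 1), ((-1) ^ (k : ℕ) * qbinom u r k) •
    ∑ σ : Equiv.Perm (Fin r), (wordForm r k y).domDomCongr σ.symm

theorem serreMultilinear_apply (u : Scalar) (r : ℕ) (y : S) (x : Fin r → S) :
    serreMultilinear u r y x = serreForm u r x y := by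
  rw [serreForm_eq_wordForm]
  simp only [serreMultilinear, sum_apply, smul_apply,
    MultilinearMap.domDomCongr_apply]
  refine Finset.sum_congr rfl fun k _ => ?_
  congr 1
  exact Fintype.sum_equiv (Equiv.inv _) _ _ fun σ => rfl

end Dual

/-! ### Exponentials of power series with commuting coefficients -/

section Exp

variable {S : Type*} [Ring S] [Algebra Scalar S]

/-- The Euler operator `z d/dz`. -/
def eul (f : PowerSeries S) : PowerSeries S := PowerSeries.mk fun n => (n : S) * PowerSeries.coeff n f

omit [Algebra Scalar S] in
@[simp] theorem coeff_eul (f : PowerSeries S) (n : ℕ) :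
    PowerSeries.coeff n (eul f) = (n : S) * PowerSeries.coeff n f := by simp [eul]

omit [Algebra Scalar S] in
theorem eul_mul (f g : PowerSeries S) : eul (f * g) = eul f * g + f * eul g := by
  ext n
  simp only [coeff_eul, map_add, PowerSeries.coeff_mul, Finset.mul_sum, ← Finset.sum_add_distrib]
  refine Finset.sum_congr rfl fun p hp => ?_
  rw [← Finset.HasAntidiagonal.mem_antidiagonal.1 hp, Nat.cast_add, add_mul, mul_assoc, ← mul_assoc _ (p.2 : S),
    (Nat.cast_commute p.2 _).eq]
  simp only [mul_assoc]
  rw [(Nat.cast_commute p.2 (PowerSeries.coeff p.2 g)).eq]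

omit [Algebra Scalar S] in
theorem eul_sub (f g : PowerSeries S) : eul (f - g) = eul f - eul g := by
  ext n; simp [mul_sub]

omit [Algebra Scalar S] in
theorem eul_C (x : S) : eul (PowerSeries.C x) = 0 := by
  ext n
  rcases n with - | n
  · simp
  · simp

theorem natCast_mul_cancel {n : ℕ} {x y : S} (h : ((n + 1 : ℕ) : S) * x = ((n + 1 : ℕ) : S) * y) :
    x = y := by
  have h1 := congrArg (((n + 1 : ℕ) : Scalar)⁻¹ • ·) h
  have h2 : ∀ z : S, ((n + 1 : ℕ) : S) * z = ((n + 1 : ℕ) : Scalar) • z := fun z => by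
    rw [Algebra.smul_def, map_natCast]
  simp only [h2, smul_smul] at h1
  rwa [inv_mul_cancel₀ (by exact_mod_cast Nat.succ_ne_zero n), one_smul, one_smul] at h1

/-- The coefficients of `Q` are determined recursively, because `a` has no constant term and
positive integers are invertible. Identities between exponentials are proved below by checking that
both sides solve the same Euler equation. -/
theorem eq_zero_of_eul {a Q : PowerSeries S} (h : eul Q = a * Q) (ha : PowerSeries.coeff 0 a = 0)
    (hQ : PowerSeries.coeff 0 Q = 0) : Q = 0 := by
  ext n
  induction n using Nat.strong_induction_on with
  | _ n ih =>
    rcases n with - | n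
    · simpa using hQ
    · refine natCast_mul_cancel (n := n) ?_
      rw [← coeff_eul, h, PowerSeries.coeff_mul]
      simp only [map_zero, mul_zero]
      refine Finset.sum_eq_zero fun p hp => ?_
      have hp' := Finset.HasAntidiagonal.mem_antidiagonal.1 hp
      rcases Nat.eq_zero_or_pos p.1 with h0 | h0
      · rw [h0, ha, zero_mul]
      · rw [ih p.2 (by omega)]; simp

theorem eq_of_eul {a Q Q' : PowerSeries S} (h : eul Q = a * Q) (h' : eul Q' = a * Q')
    (ha : PowerSeries.coeff 0 a = 0) (hQ : PowerSeries.coeff 0 Q = PowerSeries.coeff 0 Q') :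
    Q = Q' := by
  rw [← sub_eq_zero]
  refine eq_zero_of_eul (a := a) ?_ ha ?_
  · rw [eul_sub, h, h', mul_sub]
  · rw [map_sub, hQ, sub_self]

/-- `∑_{s ≥ 1} x_s z ^ s`. -/
def tailSeries (x : ℕ → S) : PowerSeries S := PowerSeries.mk fun m => if m = 0 then 0 else x m

/-- `exp (∑_{s ≥ 1} x_s z ^ s)`. -/
def expSeries (x : ℕ → S) : PowerSeries S := PowerSeries.mk (expCoeff x)

@[simp] theorem coeff_expSeries (x : ℕ → S) (n : ℕ) :
    PowerSeries.coeff n (expSeries x) = expCoeff x n := by simp [expSeries]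

omit [Algebra Scalar S] in
theorem coeff_eul_tailSeries (x : ℕ → S) (n : ℕ) :
    PowerSeries.coeff n (eul (tailSeries x)) = (n : S) * x n := by
  rcases n with - | n <;> simp [tailSeries]

omit [Algebra Scalar S] in
theorem coeff_tailSeries_pow (x : ℕ → S) {k n : ℕ} (h : n < k) :
    PowerSeries.coeff n (tailSeries x ^ k) = 0 := by
  induction k generalizing n with
  | zero => omega
  | succ k ih =>
    rw [pow_succ', PowerSeries.coeff_mul]
    refine Finset.sum_eq_zero fun p hp => ?_
    have hp' := Finset.HasAntidiagonal.mem_antidiagonal.1 hp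
    rcases Nat.eq_zero_or_pos p.1 with h0 | h0
    · simp [h0, tailSeries]
    · rw [ih (by omega), mul_zero]

theorem expCoeff_eq (x : ℕ → S) {n m : ℕ} (h : n ≤ m) : expCoeff x n =
    ∑ k ∈ Finset.range (m + 1), ((k.factorial : Scalar)⁻¹) •
      PowerSeries.coeff n (tailSeries x ^ k) := by
  refine Finset.sum_subset (by intro k; simp; omega) fun k _ hk => ?_
  rw [show (PowerSeries.mk fun m => if m = 0 then 0 else x m) = tailSeries x from rfl,
    coeff_tailSeries_pow x (by simpa using hk), smul_zero]

theorem expCoeff_zero (x : ℕ → S) : expCoeff x 0 = 1 := by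
  simp [expCoeff]

@[simp] theorem constantCoeff_expSeries (x : ℕ → S) :
    PowerSeries.constantCoeff (expSeries x) = 1 := by
  rw [← PowerSeries.coeff_zero_eq_constantCoeff_apply, coeff_expSeries, expCoeff_zero]

omit [Algebra Scalar S] in
theorem commute_of_coeff {f g : PowerSeries S}
    (h : ∀ m n, Commute (PowerSeries.coeff m f) (PowerSeries.coeff n g)) : Commute f g := by
  ext n
  rw [PowerSeries.coeff_mul, PowerSeries.coeff_mul, ← Finset.Nat.sum_antidiagonal_swap]
  exact Finset.sum_congr rfl fun p _ => (h _ _).eq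

omit [Algebra Scalar S] in
theorem eul_pow {f : PowerSeries S} (h : Commute (eul f) f) (k : ℕ) :
    eul (f ^ (k + 1)) = ((k + 1 : ℕ) : PowerSeries S) * (eul f * f ^ k) := by
  induction k with
  | zero => simp
  | succ k ih =>
    rw [pow_succ' f (k + 1), eul_mul, ih, ← mul_assoc f, ← (Nat.cast_commute (k + 1) f).eq, mul_assoc,
      ← mul_assoc f (eul f), ← h.eq, mul_assoc, ← pow_succ']
    push_cast
    simp only [add_mul, one_mul]
    abel

theorem eul_expSeries {x : ℕ → S} (hx : ∀ s t, Commute (x s) (x t)) :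
    eul (expSeries x) = eul (tailSeries x) * expSeries x := by
  have hc : ∀ m n, Commute (PowerSeries.coeff m (tailSeries x))
      (PowerSeries.coeff n (tailSeries x)) := by
    intro m n
    simp only [tailSeries, PowerSeries.coeff_mk]
    split_ifs
    · exact Commute.zero_left _
    · exact Commute.zero_left _
    · exact Commute.zero_right _
    · exact hx _ _
  have hcomm : Commute (eul (tailSeries x)) (tailSeries x) := by
    refine commute_of_coeff fun m n => ?_
    rw [coeff_eul]
    exact (Nat.cast_commute m _).mul_left (hc m n)
  ext n
  -- One superfluous term of the exponential is kept, so that after removing `k = 0` and shifting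
  -- `k` both sides run over the same range.
  rw [coeff_eul, coeff_expSeries, expCoeff_eq x (Nat.le_succ n), Finset.sum_range_succ',
    PowerSeries.coeff_mul]
  have h1 : ∀ p ∈ Finset.HasAntidiagonal.antidiagonal n, PowerSeries.coeff p.1 (eul (tailSeries x)) *
      PowerSeries.coeff p.2 (expSeries x) = ∑ k ∈ Finset.range (n + 1),
        ((k.factorial : Scalar)⁻¹) • (PowerSeries.coeff p.1 (eul (tailSeries x)) *
          PowerSeries.coeff p.2 (tailSeries x ^ k)) := by
    intro p hp
    have hp' := Finset.HasAntidiagonal.mem_antidiagonal.1 hp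
    rw [coeff_expSeries, expCoeff_eq x (show p.2 ≤ n by omega), Finset.mul_sum]
    simp only [mul_smul_comm]
  rw [Finset.sum_congr rfl h1, Finset.sum_comm, mul_add, Finset.mul_sum]
  have h2 : (n : S) * ((Nat.factorial 0 : Scalar)⁻¹ • PowerSeries.coeff n (tailSeries x ^ 0)) = 0 := by
    rcases n with - | n
    · simp
    · simp [PowerSeries.coeff_one]
  rw [h2, add_zero]
  refine Finset.sum_congr rfl fun k _ => ?_
  rw [← Finset.smul_sum, ← PowerSeries.coeff_mul, mul_smul_comm, ← coeff_eul, eul_pow hcomm]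
  have h3 : ((k + 1 : ℕ) : PowerSeries S) = PowerSeries.C ((k + 1 : ℕ) : S) := by simp
  have hk : ((k + 1 : ℕ) : Scalar) ≠ 0 := by exact_mod_cast Nat.succ_ne_zero k
  have hk2 : ((k.factorial : ℕ) : Scalar) ≠ 0 := by exact_mod_cast Nat.factorial_ne_zero k
  rw [h3, PowerSeries.coeff_C_mul, ← map_natCast (algebraMap Scalar S) (k + 1), ← Algebra.smul_def,
    smul_smul, Nat.factorial_succ, Nat.cast_mul]
  congr 1
  field_simp

omit [Algebra Scalar S] in
theorem coeff_zero_eul (f : PowerSeries S) : PowerSeries.coeff 0 (eul f) = 0 := by simp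

theorem expCoeff_commute_right {x : ℕ → S} (hx : ∀ s t, Commute (x s) (x t)) {y : S}
    (h : ∀ s, Commute y (x s)) (n : ℕ) : Commute y (expCoeff x n) := by
  have hc : Commute (PowerSeries.C y) (eul (tailSeries x)) := by
    refine commute_of_coeff fun m n => ?_
    rw [coeff_eul_tailSeries, PowerSeries.coeff_C]
    split_ifs
    · exact (Nat.cast_commute n y).symm.mul_right (h n)
    · exact Commute.zero_left _
  have h1 : PowerSeries.C y * expSeries x = expSeries x * PowerSeries.C y := by
    refine eq_of_eul (a := eul (tailSeries x)) ?_ ?_ (coeff_zero_eul _) ?_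
    · rw [eul_mul, eul_C, zero_mul, zero_add, eul_expSeries hx, ← mul_assoc, hc.eq, mul_assoc]
    · rw [eul_mul, eul_C, mul_zero, add_zero, eul_expSeries hx, mul_assoc]
    · simp [expCoeff_zero]
  have := congrArg (PowerSeries.coeff n) h1
  rwa [PowerSeries.coeff_C_mul, PowerSeries.coeff_mul_C, coeff_expSeries] at this

theorem expSeries_add {x y : ℕ → S} (hx : ∀ s t, Commute (x s) (x t))
    (hy : ∀ s t, Commute (y s) (y t)) (h : ∀ s t, Commute (x s) (y t)) :
    expSeries (x + y) = expSeries x * expSeries y := by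
  have hxy : ∀ s t, Commute ((x + y) s) ((x + y) t) := fun s t =>
    ((hx s t).add_right (h s t)).add_left (((h t s).symm).add_right (hy s t))
  have e : eul (tailSeries (x + y)) = eul (tailSeries x) + eul (tailSeries y) := by
    ext n
    simp [coeff_eul_tailSeries, mul_add, -coeff_eul]
  have hc : Commute (expSeries x) (eul (tailSeries y)) := by
    refine commute_of_coeff fun m n => ?_
    rw [coeff_eul_tailSeries, coeff_expSeries]
    exact (Nat.cast_commute n _).symm.mul_right
      (expCoeff_commute_right hx (fun s => (h s n).symm) m).symm
  refine eq_of_eul (a := eul (tailSeries (x + y))) (eul_expSeries hxy) ?_ (coeff_zero_eul _) ?_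
  · rw [eul_mul, eul_expSeries hx, eul_expSeries hy, e, ← mul_assoc, hc.eq]
    simp only [add_mul, mul_assoc]
  · simp [expCoeff_zero]

theorem expCoeff_add {x y : ℕ → S} (hx : ∀ s t, Commute (x s) (x t))
    (hy : ∀ s t, Commute (y s) (y t)) (h : ∀ s t, Commute (x s) (y t)) (n : ℕ) :
    expCoeff (x + y) n = ∑ p ∈ Finset.HasAntidiagonal.antidiagonal n, expCoeff x p.1 * expCoeff y p.2 := by
  have := congrArg (PowerSeries.coeff n) (expSeries_add hx hy h)
  simpa only [PowerSeries.coeff_mul, coeff_expSeries] using this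
  
theorem expSeries_zero : expSeries (0 : ℕ → S) = 1 := by
  refine eq_of_eul (a := 0) ?_ ?_ (by simp) (by simp [expCoeff_zero])
  · have : eul (tailSeries (0 : ℕ → S)) = 0 := by ext n; simp [tailSeries]
    rw [eul_expSeries (fun _ _ => Commute.refl _), this]
  · ext n
    rcases n with - | n <;> simp [PowerSeries.coeff_one]

theorem expSeries_mul_neg {x : ℕ → S} (hx : ∀ s t, Commute (x s) (x t)) :
    expSeries x * expSeries (-x) = 1 := by
  have h := expSeries_add (y := -x) hx (fun s t => (hx s t).neg_left.neg_right)
    fun s t => (hx s t).neg_right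
  rw [← h, add_neg_cancel, expSeries_zero]

/-- Moving an exponential past a current on which its exponent acts by shifts. -/
theorem expCoeff_mul_current {h κ : ℕ → S} {X : ℤ → S} (hh : ∀ s t, Commute (h s) (h t))
    (hκ : ∀ s t, Commute (κ s) (κ t)) (hhκ : ∀ s t, Commute (h s) (κ t))
    (hX : ∀ s, 0 < s → ∀ l, h s * X l - X l * h s = κ s * X (l + s)) (n : ℕ) (l : ℤ) :
    expCoeff h n * X l = ∑ p ∈ Finset.HasAntidiagonal.antidiagonal n,
      expCoeff κ p.1 * X (l + p.1) * expCoeff h p.2 := by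
  set W : PowerSeries S := PowerSeries.mk fun i => expCoeff κ i * X (l + i) with hW
  -- `W` is the expected conjugate of `X l` under the exponential. The Euler derivative of `W` is
  -- its commutator with that of the exponent, which gives `W exp(h)` the Euler equation of `exp(h)
  -- X_l`.
  have h1 : eul (tailSeries h) * W = W * eul (tailSeries h) + eul W := by
    ext n
    rw [map_add, PowerSeries.coeff_mul, PowerSeries.coeff_mul, coeff_eul, hW, PowerSeries.coeff_mk,
      ← mul_assoc, ← coeff_expSeries κ, ← coeff_eul, eul_expSeries hκ, PowerSeries.coeff_mul,
      Finset.sum_mul, ← Finset.Nat.sum_antidiagonal_swap (n := n) (f := fun p => 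
        PowerSeries.coeff p.1 (PowerSeries.mk fun i => expCoeff κ i * X (l + i)) *
          PowerSeries.coeff p.2 (eul (tailSeries h))), ← Finset.sum_add_distrib]
    refine Finset.sum_congr rfl fun p hp => ?_
    have hp' := Finset.HasAntidiagonal.mem_antidiagonal.1 hp
    rcases Nat.eq_zero_or_pos p.1 with h0 | h0
    · rw [Prod.fst_swap, Prod.snd_swap, h0, coeff_zero_eul, coeff_zero_eul]
      simp
    · have hc : Commute (h p.1) (expCoeff κ p.2) := expCoeff_commute_right hκ (fun s => hhκ _ s) _
      have hc2 : Commute (κ p.1) (expCoeff κ p.2) := expCoeff_commute_right hκ (fun s => hκ _ s) _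
      have e : l + (p.2 : ℤ) + p.1 = l + n := by rw [← hp']; push_cast; ring
      have h2 := hX p.1 h0 (l + p.2)
      rw [e] at h2
      simp only [Prod.fst_swap, Prod.snd_swap, coeff_eul_tailSeries, coeff_expSeries,
        PowerSeries.coeff_mk]
      have hn := Nat.cast_commute (α := S) p.1
      rw [mul_assoc, mul_assoc (p.1 : S), mul_assoc (p.1 : S), ← mul_assoc _ (p.1 : S), ← (hn _).eq,
        mul_assoc (p.1 : S), ← mul_add, ← mul_assoc (h p.1), hc.eq, mul_assoc, hc2.eq, mul_assoc,
        mul_assoc, ← mul_add, ← h2]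
      congr 2
      abel
  have h3 : expSeries h * PowerSeries.C (X l) = W * expSeries h := by
    refine eq_of_eul (a := eul (tailSeries h)) ?_ ?_ (coeff_zero_eul _) ?_
    · rw [eul_mul, eul_C, mul_zero, add_zero, eul_expSeries hh, mul_assoc]
    · rw [eul_mul, eul_expSeries hh, ← mul_assoc, ← mul_assoc, h1, add_mul, add_comm]
    · simp [expCoeff_zero, hW]
  have := congrArg (PowerSeries.coeff n) h3
  rw [PowerSeries.coeff_mul_C, coeff_expSeries, PowerSeries.coeff_mul] at this
  rw [this]
  simp [hW]

/-- The exponents `(c ^ {-s} - c ^ s) / s`. -/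
def kappa (c : Scalar) (s : ℕ) : Scalar := (c⁻¹ ^ s - c ^ s) / s

theorem kappa_inv (c : Scalar) (s : ℕ) : kappa c⁻¹ s = -kappa c s := by
  rw [kappa, kappa, inv_inv, ← neg_div, neg_sub]

theorem geom_mul (c : Scalar) :
    (PowerSeries.mk fun t => c ^ t) * (1 - PowerSeries.C c * PowerSeries.X) = 1 := by
  ext t
  rw [mul_sub, mul_one, ← mul_assoc, map_sub]
  rcases t with - | t
  · simp
  · simp [PowerSeries.coeff_one, PowerSeries.coeff_succ_mul_X, pow_succ]

theorem eul_one_sub (c : Scalar) : eul (1 - PowerSeries.C c * PowerSeries.X) =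
    (1 - PowerSeries.C c * PowerSeries.X) - 1 := by
  ext t
  rcases t with - | - | t
  · simp
  · simp
  · simp [PowerSeries.coeff_one]

/-- Both sides have logarithmic Euler derivative `1 / (1 - c⁻¹ z) - 1 / (1 - c z)`. This rational
function with one linear factor above and one below is the reason why the quadratic relations have
only two terms on each side. -/
theorem expSeries_kappa (c : Scalar) : expSeries (kappa c) =
    (1 - PowerSeries.C c * PowerSeries.X) * PowerSeries.mk fun t => c⁻¹ ^ t := by
  set D1 : PowerSeries Scalar := 1 - PowerSeries.C c⁻¹ * PowerSeries.X with hD1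
  set D2 : PowerSeries Scalar := 1 - PowerSeries.C c * PowerSeries.X with hD2
  set G1 : PowerSeries Scalar := PowerSeries.mk fun t => c⁻¹ ^ t with hG1
  set G2 : PowerSeries Scalar := PowerSeries.mk fun t => c ^ t with hG2
  have h1 : G1 * D1 = 1 := geom_mul c⁻¹
  have h2 : G2 * D2 = 1 := geom_mul c
  have ha : eul (tailSeries (kappa c)) = G1 - G2 := by
    ext t
    rw [coeff_eul_tailSeries, map_sub, hG1, hG2, PowerSeries.coeff_mk, PowerSeries.coeff_mk]
    rcases t with - | t
    · simp
    · have : ((t + 1 : ℕ) : Scalar) ≠ 0 := by exact_mod_cast Nat.succ_ne_zero t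
      rw [kappa, mul_div_cancel₀ _ this]
  have e1 : eul G1 = G1 * G1 - G1 := by
    have h3 := eul_mul G1 D1
    have h4 : eul (1 : PowerSeries Scalar) = 0 := by simpa using eul_C (1 : Scalar)
    rw [h1, h4, eul_one_sub, ← hD1] at h3
    linear_combination (-G1) * h3 - (G1 + eul G1) * h1
  refine eq_of_eul (a := G1 - G2) ?_ ?_ ?_ ?_
  · rw [← ha]; exact eul_expSeries fun _ _ => mul_comm _ _
  · rw [eul_mul, e1, eul_one_sub, ← hD2]
    linear_combination G1 * h2
  · simp [hG1, hG2]
  · simp [hG1, hD2, expCoeff_zero]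

theorem expCoeff_kappa_succ (c : Scalar) (t : ℕ) :
    expCoeff (kappa c) (t + 1) = c⁻¹ * expCoeff (kappa c) t - if t = 0 then c else 0 := by
  have h : expSeries (kappa c) * (1 - PowerSeries.C c⁻¹ * PowerSeries.X) =
      1 - PowerSeries.C c * PowerSeries.X := by
    rw [expSeries_kappa, mul_assoc, geom_mul, mul_one]
  have h1 := congrArg (PowerSeries.coeff (t + 1)) h
  rw [mul_sub, mul_one, ← mul_assoc, map_sub, map_sub, PowerSeries.coeff_succ_mul_X,
    PowerSeries.coeff_succ_mul_X, PowerSeries.coeff_mul_C, PowerSeries.coeff_C, coeff_expSeries,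
    coeff_expSeries, PowerSeries.coeff_one, if_neg (Nat.succ_ne_zero t)] at h1
  linear_combination h1

/-- The current `K exp (∑_{s ≥ 1} h_s z ^ s)`. -/
def plusCurrent (K : S) (h : ℕ → S) (l : ℤ) : S := if 0 ≤ l then K * expCoeff h l.toNat else 0

/-- The current `K exp (∑_{s ≥ 1} h_s z ^ {-s})`. -/
def minusCurrent (K : S) (h : ℕ → S) (l : ℤ) : S := plusCurrent K h (-l)

theorem plusCurrent_natCast (K : S) (h : ℕ → S) (n : ℕ) :
    plusCurrent K h n = K * expCoeff h n := by simp [plusCurrent]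

theorem plusCurrent_neg (K : S) (h : ℕ → S) {l : ℤ} (hl : l < 0) : plusCurrent K h l = 0 := by
  rw [plusCurrent, if_neg (by omega)]

theorem oneSided_plusCurrent (K : S) (h : ℕ → S) : OneSided (plusCurrent K h) :=
  Or.inr ⟨0, fun _ hm => plusCurrent_neg K h hm⟩

theorem oneSided_minusCurrent (K : S) (h : ℕ → S) : OneSided (minusCurrent K h) :=
  Or.inl ⟨0, fun _ hm => plusCurrent_neg K h (by omega)⟩

theorem expCoeff_algebraMap (κ : ℕ → Scalar) (n : ℕ) :
    expCoeff (fun s => algebraMap Scalar S (κ s)) n = algebraMap Scalar S (expCoeff κ n) :=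
  (map_expCoeff (Algebra.ofId Scalar S) κ n).symm

theorem expCoeff_mul_current_scalar {h : ℕ → S} {κ : ℕ → Scalar} {X : ℤ → S}
    (hh : ∀ s t, Commute (h s) (h t))
    (hX : ∀ s, 0 < s → ∀ l, h s * X l - X l * h s = κ s • X (l + s)) (n : ℕ) (l : ℤ) :
    expCoeff h n * X l = ∑ p ∈ Finset.HasAntidiagonal.antidiagonal n,
      expCoeff κ p.1 • (X (l + p.1) * expCoeff h p.2) := by
  have := expCoeff_mul_current (κ := fun s => algebraMap Scalar S (κ s)) hh
    (fun s t => Algebra.commutes _ _) (fun s t => (Algebra.commutes (κ t) (h s)).symm)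
    (fun s hs l => by rw [hX s hs l, Algebra.smul_def]) n l
  rw [this]
  refine Finset.sum_congr rfl fun p _ => ?_
  rw [expCoeff_algebraMap, mul_assoc, ← Algebra.smul_def]

/-- Passing the current through `X` produces the series of `kappa c`; its recursion
`expCoeff_kappa_succ` clears the denominator and leaves the quadratic relation. The index `l = -1`
is the boundary at which only the constant coefficient enters. -/
theorem quad_plusCurrent {c : Scalar} (hc : c ≠ 0) {K : S} {h : ℕ → S} {X : ℤ → S}
    (hK : ∀ l, K * X l = c⁻¹ • (X l * K)) (hh : ∀ s t, Commute (h s) (h t))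
    (hX : ∀ s, 0 < s → ∀ l, h s * X l - X l * h s = kappa c s • X (l + s)) :
    Quad c (plusCurrent K h) X := by
  have key : ∀ (n : ℕ) m, c • (plusCurrent K h n * X m) =
      ∑ i ∈ Finset.range (n + 1),
        expCoeff (kappa c) i • (X (m + i) * plusCurrent K h ((n - i : ℕ) : ℤ)) := by
    intro n m
    rw [plusCurrent_natCast, mul_assoc, expCoeff_mul_current_scalar hh hX, Finset.mul_sum,
      Finset.smul_sum, Finset.Nat.sum_antidiagonal_eq_sum_range_succ_mk]
    refine Finset.sum_congr rfl fun i _ => ?_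
    rw [plusCurrent_natCast, mul_smul_comm, ← mul_assoc, hK, smul_mul_assoc, smul_smul, smul_smul,
      mul_assoc]
    congr 1
    · field_simp
    · exact mul_assoc _ _ _
  intro l m
  rcases lt_trichotomy l (-1) with hl | rfl | hl
  · rw [plusCurrent_neg K h (show l < 0 by omega), plusCurrent_neg K h (show l + 1 < 0 by omega)]
    simp
  · rw [plusCurrent_neg K h (show (-1 : ℤ) < 0 by omega)]
    have := key 0 m
    simp only [zero_add, Finset.sum_range_one, expCoeff_zero, one_smul, Nat.cast_zero, add_zero,
      Nat.sub_self] at this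
    simp [this]
  · obtain ⟨n, rfl⟩ : ∃ n : ℕ, l = n := ⟨l.toNat, by omega⟩
    have h1 := key (n + 1) m
    have h2 := congrArg (c⁻¹ • ·) (key n (m + 1))
    simp only [smul_smul, inv_mul_cancel₀ hc, one_smul, Finset.smul_sum] at h2
    rw [Finset.sum_range_succ'] at h1
    have e : ((n : ℤ) + 1) = ((n + 1 : ℕ) : ℤ) := by push_cast; ring
    rw [e, h1, h2]
    have h3 : ∀ i ∈ Finset.range (n + 1), expCoeff (kappa c) (i + 1) •
        (X (m + ((i + 1 : ℕ) : ℤ)) * plusCurrent K h ((n + 1 - (i + 1) : ℕ) : ℤ)) =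
        (c⁻¹ * expCoeff (kappa c) i) • (X (m + 1 + i) * plusCurrent K h ((n - i : ℕ) : ℤ)) -
          if i = 0 then c • (X (m + 1) * plusCurrent K h n) else 0 := by
      intro i _
      have e2 : m + ((i + 1 : ℕ) : ℤ) = m + 1 + i := by push_cast; ring
      rw [expCoeff_kappa_succ, e2, Nat.add_sub_add_right, sub_smul]
      congr 1
      split_ifs with hi
      · subst hi; simp
      · simp
    rw [Finset.sum_congr rfl h3, Finset.sum_sub_distrib, Finset.sum_ite_eq' (Finset.range (n + 1)),
      if_pos (by simp), expCoeff_zero]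
    simp only [Nat.cast_zero, add_zero, Nat.sub_zero, one_smul]
    abel

theorem quad_minusCurrent {c : Scalar} (hc : c ≠ 0) {K : S} {h : ℕ → S} {X : ℤ → S}
    (hK : ∀ l, K * X l = c • (X l * K)) (hh : ∀ s t, Commute (h s) (h t))
    (hX : ∀ s, 0 < s → ∀ l, h s * X l - X l * h s = -kappa c s • X (l - s)) :
    Quad c (minusCurrent K h) X := by
  have h1 := quad_plusCurrent (c := c⁻¹) (inv_ne_zero hc) (K := K) (h := h)
    (X := fun l => X (-l)) (fun l => by rw [inv_inv]; exact hK _) hh (fun s hs l => by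
      rw [hX s hs, kappa_inv, neg_add, ← sub_eq_add_neg])
  have h2 := h1.neg_index (inv_ne_zero hc)
  simp only [inv_inv, neg_neg] at h2
  exact h2

end Exp

/-! ### Families of currents satisfying the quadratic and the Serre relations -/

section Currents

variable {ι : Type*} {A : Matrix ι ι ℤ} {d : ι → ℕ}
variable {S : Type*} [Ring S] [Algebra Scalar S] {T : Type*} [Ring T] [Algebra Scalar T]

namespace IsSymmetrizableGCM

variable (hA : IsSymmetrizableGCM A d)
include hA

theorem bMat_symm (i j : ι) : bMat A d i j = bMat A d j i := hA.symm i j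

theorem v_pow_bMat_self (i : ι) : v ^ bMat A d i i = (v ^ d i) ^ 2 := by
  rw [bMat, hA.diag, ← pow_mul, ← zpow_natCast]
  push_cast
  rfl

omit hA in
theorem _root_.QuantumLoop.v_pow_bMat {i j : ι} {n : ℕ} (h : A i j = -n) :
    v ^ bMat A d i j = ((v ^ d i) ^ n)⁻¹ := by
  rw [bMat, h, ← pow_mul, ← zpow_natCast, ← zpow_neg]
  congr 1
  push_cast
  ring

theorem exists_neg {i j : ι} (hij : i ≠ j) {r : ℕ} (hr : (r : ℤ) = 1 - A i j) :
    ∃ n : ℕ, r = n + 1 ∧ A i j = -n := by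
  have := hA.off_diag i j hij
  exact ⟨r - 1, by omega, by omega⟩

theorem generic (i : ι) : Generic (v ^ d i) := generic_v.pow (hA.pos i)

end IsSymmetrizableGCM

theorem v_zpow_ne_zero (m : ℤ) : v ^ m ≠ 0 := zpow_ne_zero _ generic_v.ne_zero

/-- The family `X` satisfies the relations between the `E_{i,l}`. -/
structure IsCurrents (A : Matrix ι ι ℤ) (d : ι → ℕ) (X : ι → ℤ → S) : Prop where
  quad : ∀ i j, Quad (v ^ bMat A d i j) (X i) (X j)
  serre : ∀ i j, i ≠ j → ∀ r : ℕ, (r : ℤ) = 1 - A i j → ∀ (l : Fin r → ℤ) (l' : ℤ),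
    serreSum (v ^ d i) (X i) (X j l') r l = 0

theorem IsCurrents.map {X : ι → ℤ → S} (h : IsCurrents A d X) (f : S →ₐ[Scalar] T) :
    IsCurrents A d (fun i l => f (X i l)) where
  quad i j := (h.quad i j).map f
  serre i j hij r hr l l' := by
    rw [← map_serreSum f, h.serre i j hij r hr, map_zero]

/-- The condition on `c` says that products depend only on the total degree, as for constants or for
the powers `z ^ l` of a central element; such factors come out of every relation as a whole. -/
theorem IsCurrents.central_mul {X : ι → ℤ → S} (h : IsCurrents A d X) (c : ι → ℤ → S)
    (hc : ∀ i l b, Commute (c i l) b) (hcc : ∀ i j l m, c i (l + 1) * c j m = c i l * c j (m + 1)) :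
    IsCurrents A d (fun i l => c i l * X i l) where
  quad i j l m := by
    have e : ∀ i j l m, c i l * X i l * (c j m * X j m) = c i l * c j m * (X i l * X j m) := by
      intro i j l m
      rw [mul_assoc, ← mul_assoc (X i l), ← (hc j m (X i l)).eq]
      simp only [mul_assoc]
    simp only [e]
    rw [(hc j m (c i (l + 1))).eq, (hc j (m + 1) (c i l)).eq, hcc]
    have := congrArg (c i l * c j (m + 1) * ·) (h.quad i j l m)
    simpa only [mul_sub, mul_smul_comm] using this
  serre i j hij r hr l l' := by
    have h1 := h.serre i j hij r hr l l'
    rw [serreSum_eq] at h1 ⊢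
    rw [serreForm_central_mul _ _ (fun a => c i (l a)) _ _ _ (fun a b => hc _ _ b) (hc _ _), h1,
      mul_zero]

theorem IsCurrents.smul {X : ι → ℤ → S} (h : IsCurrents A d X) (g : ι → Scalar) :
    IsCurrents A d (fun i l => g i • X i l) := by
  have := h.central_mul (fun i _ => algebraMap Scalar S (g i)) (fun i _ b => Algebra.commutes _ _)
    fun _ _ _ _ => rfl
  simpa only [Algebra.smul_def] using this

/-- The Serre expression is unchanged to first order along a one-sided current. -/
theorem snd_serreForm_deform (hA : IsSymmetrizableGCM A d) {i j : ι} (hij : i ≠ j) {r : ℕ}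
    (hr : (r : ℤ) = 1 - A i j) {X Y ψ : ℤ → S} (hXX : Quad (v ^ bMat A d i i) X X)
    (hXY : Quad (v ^ bMat A d i j) X Y) (hψX : Quad (v ^ bMat A d i i) ψ X)
    (hψY : Quad (v ^ bMat A d i j) ψ Y) (hψ : OneSided ψ) (l : Fin r → ℤ) (m : ℤ) :
    (serreForm (v ^ d i) r (fun a => dual (X (l a)) (ψ (l a))) (dual (Y m) 0)).snd = 0 := by
  obtain ⟨n, rfl, hn⟩ := hA.exists_neg hij hr
  rw [hA.v_pow_bMat_self] at hXX hψX
  rw [v_pow_bMat hn] at hXY hψY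
  exact snd_serreForm_dual (hA.generic i) n hXX hXY hψX hψY hψ l m

theorem serreForm_oneSided (hA : IsSymmetrizableGCM A d) {i j : ι} (hij : i ≠ j) {r : ℕ}
    (hr : (r : ℤ) = 1 - A i j) {X ψ : ℤ → S} (hXX : Quad (v ^ bMat A d i i) X X)
    (hψX : Quad (v ^ bMat A d i j) ψ X) (hψ : OneSided ψ) (l : Fin r → ℤ) (m : ℤ) :
    serreForm (v ^ d i) r (fun a => X (l a)) (ψ m) = 0 := by
  obtain ⟨n, rfl, hn⟩ := hA.exists_neg hij hr
  rw [hA.v_pow_bMat_self] at hXX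
  rw [v_pow_bMat hn] at hψX
  exact serreForm_eq_zero_of_oneSided (hA.generic i) n hXX hψX hψ l m

theorem Quad.zero_right {c : Scalar} {X : ℤ → S} : Quad c X (fun _ => 0) := fun l m => by simp

theorem Quad.zero_left {c : Scalar} {X : ℤ → S} : Quad c (fun _ => 0) X := fun l m => by simp

/-- Deforming the `i`-th current to first order along a one-sided `ψ` costs nothing: the Serre
relation is `snd_serreForm_deform` if `i` is the repeated index and `serreForm_oneSided` if `i` is
the index of the last letter. Algebra maps to the dual numbers obtained in this way are the source
of all annihilation operators below. -/
theorem IsCurrents.deform [DecidableEq ι] (hA : IsSymmetrizableGCM A d) {X : ι → ℤ → S}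
    (hX : IsCurrents A d X) (i : ι) {ψ : ℤ → S} (hψ : OneSided ψ)
    (hq : ∀ j, Quad (v ^ bMat A d i j) ψ (X j)) :
    IsCurrents A d (fun j l => dual (X j l) (if j = i then ψ l else 0)) where
  quad j k := by
    refine Quad.dual (hX.quad j k) ?_ ?_
    · split_ifs with h
      · subst h; exact hq k
      · exact Quad.zero_left
    · split_ifs with h
      · subst h; rw [hA.bMat_symm]; exact (hq j).symm
      · exact Quad.zero_right
  serre j k hjk r hr l l' := by
    have h0 := hX.serre j k hjk r hr l l'
    rw [serreSum_eq] at h0 ⊢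
    by_cases h : j = i
    · subst h
      have e : ¬ k = j := fun h => hjk h.symm
      simp only [if_true, if_neg e]
      ext
      · rw [fst_serreForm_dual, h0, TrivSqZeroExt.fst_zero]
      · rw [snd_serreForm_deform hA hjk hr (hX.quad j j) (hX.quad j k) (hq j) (hq k) hψ,
          TrivSqZeroExt.snd_zero]
    · simp only [if_neg h]
      refine serreForm_dual_right h0 ?_
      split_ifs with h'
      · subst h'
        have := (hq j)
        rw [hA.bMat_symm] at this
        exact serreForm_oneSided hA hjk hr (hX.quad j j) this hψ l l'
      · exact serreForm_zero_right _ _ _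

omit [Algebra Scalar S] in
theorem dual_eq_add_eps (x w : S) : dual x w = dual x 0 + DualNumber.eps * dual w 0 := by
  ext <;> simp

/-- The infinitesimal shift of currents. -/
theorem IsCurrents.deform_shift {X : ι → ℤ → S} (hX : IsCurrents A d X) (a : ι → Scalar) (s : ℤ) :
    IsCurrents A d (fun j l => dual (X j l) (a j • X j (l + s))) where
  quad j k := Quad.dual (hX.quad j k) (((hX.quad j k).shift s).smul (a j))
    ((((hX.quad j k).symm.shift s).smul (a k)).symm)
  serre j k hjk r hr l l' := by
    have h0 : ∀ (l : Fin r → ℤ) (l' : ℤ),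
        serreForm (v ^ d j) r (fun b => dual (X j (l b)) 0) (dual (X k l') 0) = 0 := by
      intro l l'
      have := (hX.map (TrivSqZeroExt.inlAlgHom Scalar S S)).serre j k hjk r hr l l'
      simpa [dual, serreSum_eq] using this
    have e : ∀ (x w : S) (b : Scalar), dual x (b • w) =
        dual x 0 + (b • DualNumber.eps) * dual w 0 := by
      intro x w b
      ext <;> simp
    have hceps : ∀ (b : Scalar) (z : DualNumber S), Commute (b • DualNumber.eps) z := fun b z =>
      (DualNumber.commute_eps_left z).smul_left b
    have h1 : ∀ (c e : DualNumber S) (hc : ∀ z, Commute c z) (he : ∀ z, Commute e z) (p : ℤ),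
        serreForm (v ^ d j) r (fun b => dual (X j (l b)) 0 + c * dual (X j (l b + s)) 0)
          (e * dual (X k p) 0) = 0 := by
      intro c e hc he p
      rw [← serreMultilinear_apply]
      have := (serreMultilinear (v ^ d j) r (e * dual (X k p) 0)).map_add_univ
        (fun b => dual (X j (l b)) 0) (fun b => c * dual (X j (l b + s)) 0)
      -- In each term of the multilinear expansion the first-order factors are central and can be
      -- pulled out; a Serre expression with some indices shifted by `s` remains, and this is zero
      -- already.
      refine this.trans (Finset.sum_eq_zero fun t _ => ?_)
      rw [serreMultilinear_apply]
      have h2 := serreForm_central_mul (v ^ d j) r (fun b => if b ∈ t then 1 else c)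
        (fun b => dual (X j (if b ∈ t then l b else l b + s)) 0) e (dual (X k p) 0)
        (fun b z => by split_ifs; exacts [Commute.one_left z, hc z]) he
      rw [h0 (fun b => if b ∈ t then l b else l b + s), mul_zero] at h2
      rw [← h2]
      congr 1
      funext b
      by_cases hb : b ∈ t <;> simp [hb]
    rw [serreSum_eq]
    simp only [e]
    rw [serreForm_add_right]
    have h2 := h1 (a j • DualNumber.eps) 1 (hceps _) (fun z => Commute.one_left z) l'
    rw [one_mul] at h2
    rw [h2, h1 _ _ (hceps _) (hceps _), add_zero]

/-- The inner derivation `x ↦ x + ε (R x - x R)` as an algebra map. -/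
def adHom (R : S) : S →ₐ[Scalar] DualNumber S where
  toFun x := dual x (R * x - x * R)
  map_one' := by ext <;> simp
  map_mul' x y := by
    rw [dual_mul]
    congr 1
    simp only [mul_sub, sub_mul, mul_assoc]
    abel
  map_zero' := by ext <;> simp
  map_add' x y := by
    rw [dual_add]
    congr 1
    simp only [mul_add, add_mul]
    abel
  commutes' c := by
    ext
    · simp [TrivSqZeroExt.algebraMap_eq_inl']
    · simp [TrivSqZeroExt.algebraMap_eq_inl', Algebra.commutes]

theorem adHom_apply (R x : S) : adHom R x = dual x (R * x - x * R) := rfl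

/-- A commutator is a derivation, that is, an algebra map to the dual numbers, and algebra maps pass
through the Serre expression. -/
theorem bracket_serreForm (R : S) (u : Scalar) (r : ℕ) (x : Fin r → S) (y : S) :
    R * serreForm u r x y - serreForm u r x y * R =
      (serreForm u r (fun a => dual (x a) (R * x a - x a * R)) (dual y (R * y - y * R))).snd := by
  have := congrArg TrivSqZeroExt.snd (map_serreForm (adHom R) u r x y)
  simpa only [adHom_apply, snd_dual] using this

theorem diagSerreDeriv_sub (u : Scalar) (r : ℕ) (w w' x y : S) :
    diagSerreDeriv u r (w - w') x y = diagSerreDeriv u r w x y - diagSerreDeriv u r w' x y := by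
  simp only [diagSerreDeriv]
  rw [← Finset.sum_sub_distrib]
  refine Finset.sum_congr rfl fun k _ => ?_
  rw [← smul_sub]
  congr 1
  simp only [sandwich, mul_sub, sub_mul, Finset.sum_sub_distrib]
  abel

theorem snd_serreForm_dual_sub (u : Scalar) (r : ℕ) (x w w' : Fin r → S) (y : S) :
    (serreForm u r (fun a => dual (x a) (w a - w' a)) (dual y 0)).snd =
      (serreForm u r (fun a => dual (x a) (w a)) (dual y 0)).snd -
        (serreForm u r (fun a => dual (x a) (w' a)) (dual y 0)).snd := by
  simp only [serreForm_polarization, TrivSqZeroExt.snd_sum, dual_sum, diagSerre_dual,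
    TrivSqZeroExt.snd_smul, snd_dual, ← Finset.sum_sub_distrib, ← smul_sub]
  refine Finset.sum_congr rfl fun t _ => ?_
  congr 1
  rw [Finset.sum_sub_distrib, diagSerreDeriv_sub]

theorem snd_serreForm_dual_smul (u : Scalar) (r : ℕ) (x w : Fin r → S) (y : S) (c : Scalar) :
    (serreForm u r (fun a => dual (x a) (c • w a)) (dual y 0)).snd =
      c • (serreForm u r (fun a => dual (x a) (w a)) (dual y 0)).snd := by
  simp only [serreForm_polarization, TrivSqZeroExt.snd_sum, dual_sum, diagSerre_dual,
    TrivSqZeroExt.snd_smul, snd_dual, Finset.smul_sum (r := c), smul_comm c]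
  refine Finset.sum_congr rfl fun t _ => ?_
  congr 1
  simp only [← Finset.smul_sum, diagSerreDeriv, sandwich, mul_smul_comm, smul_mul_assoc, ← smul_add]
  rw [Finset.smul_sum]
  exact Finset.sum_congr rfl fun k _ => smul_comm _ _ _

theorem op_serreForm (u : Scalar) (r : ℕ) (x : Fin r → S) (y : S) :
    MulOpposite.op (serreForm u r x y) = (-1 : Scalar) ^ r •
      serreForm u r (fun a => MulOpposite.op (x a)) (MulOpposite.op y) := by
  simp only [serreForm_polarization, Finset.op_sum, MulOpposite.op_smul, op_diagSerre,
    Finset.smul_sum]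
  exact Finset.sum_congr rfl fun t _ => smul_comm _ _ _

/-- The relation between a Cartan current and the currents `X`, summed over all parts. -/
theorem kappa_eq (b : ℤ) (s : ℕ) :
    kappa (v ^ b) s = (v⁻¹ - v) * (qint v ((s : ℤ) * b) / ((s : ℤ) : Scalar)) := by
  have h := generic_v.qint_den_ne
  rw [kappa, qint, Int.cast_natCast, mul_div_assoc', mul_div_cancel₀ _ h]
  congr 2
  · rw [← zpow_natCast, inv_zpow', ← zpow_mul]
    congr 1
    ring
  · rw [← zpow_natCast, ← zpow_mul]
    congr 1
    ring

theorem adjoin_left_induction {s : Set S} {p : S → Prop} (one : p 1)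
    (add : ∀ x y, p x → p y → p (x + y)) (smul : ∀ (c : Scalar) x, p x → p (c • x))
    (mul : ∀ g ∈ s, ∀ x, p x → p (g * x)) {x : S} (hx : x ∈ Algebra.adjoin Scalar s) : p x := by
  suffices h : ∀ y, p y → p (x * y) by simpa using h 1 one
  induction hx using Algebra.adjoin_induction with
  | mem g hg => exact mul g hg
  | algebraMap c => intro y hy; rw [← Algebra.smul_def]; exact smul c y hy
  | add a b _ _ ha hb => intro y hy; rw [add_mul]; exact add _ _ (ha y hy) (hb y hy)
  | mul a b _ _ ha hb => intro y hy; rw [mul_assoc]; exact ha _ (hb y hy)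

end Currents

/-! ### The algebra presented by the `E_{i,l}` -/

section Presented

variable {ι : Type*} (A : Matrix ι ι ℤ) (d : ι → ℕ)

/-- The relations between the `E_{i,l}`. -/
inductive NRel : FreeAlgebra Scalar (ι × ℤ) → FreeAlgebra Scalar (ι × ℤ) → Prop
  | quad (i j : ι) (l m : ℤ) : NRel
      (v ^ bMat A d i j • (FreeAlgebra.ι Scalar (i, l + 1) * FreeAlgebra.ι Scalar (j, m)) -
        FreeAlgebra.ι Scalar (j, m) * FreeAlgebra.ι Scalar (i, l + 1))
      (FreeAlgebra.ι Scalar (i, l) * FreeAlgebra.ι Scalar (j, m + 1) -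
        v ^ bMat A d i j • (FreeAlgebra.ι Scalar (j, m + 1) * FreeAlgebra.ι Scalar (i, l)))
  | serre (i j : ι) (hij : i ≠ j) (r : ℕ) (hr : (r : ℤ) = 1 - A i j) (l : Fin r → ℤ) (l' : ℤ) :
      NRel (serreSum (v ^ d i) (fun n => FreeAlgebra.ι Scalar (i, n))
        (FreeAlgebra.ι Scalar (j, l')) r l) 0

/-- The algebra with generators `E_{i,l}` and the quadratic and Serre relations. -/
def NAlg : Type _ := RingQuot (NRel A d)

instance : Ring (NAlg A d) := inferInstanceAs (Ring (RingQuot (NRel A d)))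

instance : Algebra Scalar (NAlg A d) := inferInstanceAs (Algebra Scalar (RingQuot (NRel A d)))

namespace NAlg

/-- The quotient map. -/
def mk : FreeAlgebra Scalar (ι × ℤ) →ₐ[Scalar] NAlg A d := RingQuot.mkAlgHom Scalar (NRel A d)

/-- The generator `E_{i,l}`. -/
def E (i : ι) (l : ℤ) : NAlg A d := mk A d (FreeAlgebra.ι Scalar (i, l))

theorem isCurrents : IsCurrents A d (E A d) where
  quad i j l m := by
    have : mk A d _ = mk A d _ := RingQuot.mkAlgHom_rel Scalar (NRel.quad i j l m)
    simp only [map_sub, map_smul, map_mul] at this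
    exact this
  serre i j hij r hr l l' := by
    have : mk A d _ = mk A d _ := RingQuot.mkAlgHom_rel Scalar (NRel.serre i j hij r hr l l')
    rw [map_serreSum, map_zero] at this
    exact this

theorem adjoin_eq_top : Algebra.adjoin Scalar {x | ∃ i l, x = E A d i l} = ⊤ := by
  have h1 : (⊤ : Subalgebra Scalar (NAlg A d)) = (⊤ : Subalgebra Scalar _).map (mk A d) := by
    rw [Algebra.map_top, eq_comm, AlgHom.range_eq_top]
    exact RingQuot.mkAlgHom_surjective Scalar _
  rw [h1, ← FreeAlgebra.adjoin_range_ι, AlgHom.map_adjoin]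
  congr 1
  ext x
  constructor
  · rintro ⟨i, l, rfl⟩; exact ⟨_, ⟨(i, l), rfl⟩, rfl⟩
  · rintro ⟨_, ⟨⟨i, l⟩, rfl⟩, rfl⟩; exact ⟨i, l, rfl⟩

variable {A d}

theorem induction {p : NAlg A d → Prop} (one : p 1) (add : ∀ x y, p x → p y → p (x + y))
    (smul : ∀ (c : Scalar) x, p x → p (c • x)) (mul : ∀ i l x, p x → p (E A d i l * x))
    (x : NAlg A d) : p x :=
  adjoin_left_induction (s := {x | ∃ i l, x = E A d i l}) one add smul (by rintro _ ⟨i, l, rfl⟩; exact mul i l)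
    (by rw [adjoin_eq_top]; exact Algebra.mem_top)

variable {S : Type*} [Ring S] [Algebra Scalar S]

/-- The universal property. -/
def lift {X : ι → ℤ → S} (h : IsCurrents A d X) : NAlg A d →ₐ[Scalar] S :=
  RingQuot.liftAlgHom Scalar ⟨FreeAlgebra.lift Scalar fun p => X p.1 p.2, by
    intro x y hxy
    cases hxy with
    | quad i j l m => simpa using h.quad i j l m
    | serre i j hij r hr l l' =>
      rw [map_serreSum, map_zero]
      simpa using h.serre i j hij r hr l l'⟩

theorem lift_E {X : ι → ℤ → S} (h : IsCurrents A d X) (i : ι) (l : ℤ) :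
    lift h (E A d i l) = X i l := by
  refine (RingQuot.liftAlgHom_mkAlgHom_apply (S := Scalar) _ _ _).trans ?_
  simp

end NAlg

end Presented

theorem expCoeff_congr {S : Type*} [Ring S] [Algebra Scalar S] {x y : ℕ → S}
    (h : ∀ s, 0 < s → x s = y s) (n : ℕ) : expCoeff x n = expCoeff y n := by
  have : tailSeries x = tailSeries y := by
    ext m
    rcases m with - | m
    · simp [tailSeries]
    · simp [tailSeries, h (m + 1) (Nat.succ_pos m)]
  have e : ∀ z : ℕ → S, (PowerSeries.mk fun m => if m = 0 then 0 else z m) = tailSeries z :=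
    fun z => rfl
  simp only [expCoeff, e, this]

/-! ### Derivations, weight automorphisms and the Fock space of the presented algebra. -/

section NOperators

variable {ι : Type*} {A : Matrix ι ι ℤ} {d : ι → ℕ}

/-- The coefficient `[s b_{i,j}] / s`. -/
def hcoef (A : Matrix ι ι ℤ) (d : ι → ℕ) (i j : ι) (s : ℤ) : Scalar :=
  qint v (s * bMat A d i j) / (s : Scalar)

theorem hcoef_zero (i j : ι) : hcoef A d i j 0 = 0 := by simp [hcoef]

theorem hcoef_neg (i j : ι) (s : ℤ) : hcoef A d i j (-s) = hcoef A d i j s := by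
  have h : ∀ {F : Type} [Field F] (a b c e : F), (a - b) / c / (-e) = (b - a) / c / e := by
    intro F _ a b c e
    rw [← neg_sub b a, neg_div, neg_div_neg_eq]
  rw [hcoef, hcoef, qint, qint, neg_mul, neg_neg, Int.cast_neg]
  exact h _ _ _ _

theorem hcoef_symm (hA : IsSymmetrizableGCM A d) (i j : ι) (s : ℤ) :
    hcoef A d i j s = hcoef A d j i s := by
  rw [hcoef, hcoef, hA.bMat_symm]

theorem kappa_eq_hcoef (i j : ι) (s : ℕ) :
    kappa (v ^ bMat A d i j) s = (v⁻¹ - v) * hcoef A d i j s := kappa_eq _ _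

namespace NAlg

theorem algHom_ext {S : Type*} [Ring S] [Algebra Scalar S] {f g : NAlg A d →ₐ[Scalar] S}
    (h : ∀ i l, f (E A d i l) = g (E A d i l)) : f = g := by
  ext x
  induction x using NAlg.induction with
  | one => simp
  | add x y hx hy => simp [hx, hy]
  | smul c x hx => simp [hx]
  | mul i l x hx => simp [hx, h]

/-- The derivation `E_{j,l} ↦ a_j E_{j,l+s}`. -/
def der (a : ι → Scalar) (s : ℤ) : Module.End Scalar (NAlg A d) where
  toFun x := (lift ((isCurrents A d).deform_shift a s) x).snd
  map_add' x y := by simp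
  map_smul' c x := by simp

theorem fst_lift_deform_shift (a : ι → Scalar) (s : ℤ) (x : NAlg A d) :
    (lift ((isCurrents A d).deform_shift a s) x).fst = x := by
  have : (TrivSqZeroExt.fstHom Scalar (NAlg A d) (NAlg A d)).comp
      (lift ((isCurrents A d).deform_shift a s)) = AlgHom.id _ _ := by
    refine algHom_ext fun i l => ?_
    simp [lift_E]
  simpa using DFunLike.congr_fun this x

theorem der_mul (a : ι → Scalar) (s : ℤ) (x y : NAlg A d) :
    der a s (x * y) = x * der a s y + der a s x * y := by
  simp only [der, LinearMap.coe_mk, AddHom.coe_mk, map_mul, DualNumber.snd_mul,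
    fst_lift_deform_shift]

@[simp] theorem der_E (a : ι → Scalar) (s : ℤ) (j : ι) (l : ℤ) :
    der a s (E A d j l) = a j • E A d j (l + s) := by
  simp [der, lift_E]

@[simp] theorem der_one (a : ι → Scalar) (s : ℤ) : der a s (1 : NAlg A d) = 0 := by
  simp [der]

/-- The automorphism `E_{j,l} ↦ g_j E_{j,l}`. -/
def wt (g : ι → Scalar) : NAlg A d →ₐ[Scalar] NAlg A d := lift ((isCurrents A d).smul g)

@[simp] theorem wt_E (g : ι → Scalar) (j : ι) (l : ℤ) :
    wt g (E A d j l) = g j • E A d j l := lift_E _ _ _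

end NAlg

/-! ### The Fock space -/

/-- The polynomial ring in which the `H_{i,s}` with `s > 0` act on the vacuum. -/
def FockVars (ι : Type*) : Type _ := MvPolynomial (ι × ℕ) Scalar

instance (ι : Type*) : CommRing (FockVars ι) := inferInstanceAs (CommRing (MvPolynomial (ι × ℕ) Scalar))

instance (ι : Type*) : Algebra Scalar (FockVars ι) :=
  inferInstanceAs (Algebra Scalar (MvPolynomial (ι × ℕ) Scalar))

/-- The variables. -/
def FockVars.X (a : ι × ℕ) : FockVars ι := (MvPolynomial.X a : MvPolynomial (ι × ℕ) Scalar)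

variable (A d)

/-- The space on which the quantum loop algebra acts. -/
abbrev Fock : Type _ := NAlg A d ⊗[Scalar] FockVars ι

/-- Operators on the first factor of the Fock space. -/
def fockOp : Module.End Scalar (NAlg A d) →ₐ[Scalar] Module.End Scalar (Fock A d) :=
  Module.End.rTensorAlgHom Scalar (NAlg A d) (FockVars ι)

variable {A d} in
@[simp] theorem fockOp_tmul (f : Module.End Scalar (NAlg A d)) (n : NAlg A d)
    (p : FockVars ι) : fockOp A d f (n ⊗ₜ p) = f n ⊗ₜ p := rfl

namespace Fock

/-- The action of `E_{i,l}`. -/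
def E (i : ι) (l : ℤ) : Module.End Scalar (Fock A d) := fockOp A d (Algebra.lmul Scalar _ (NAlg.E A d i l))

/-- The action of a Cartan element with eigenvalues `g_j` on the simple roots. -/
def K (g : ι → Scalar) : Module.End Scalar (Fock A d) := fockOp A d (NAlg.wt g).toLinearMap

/-- The action of `H_{i,s}`. -/
def H (i : ι) (s : ℤ) : Module.End Scalar (Fock A d) :=
  fockOp A d (NAlg.der (fun j => hcoef A d i j s) s) +
    if 0 < s then LinearMap.lTensor (NAlg A d)
      (LinearMap.mulLeft Scalar (FockVars.X (i, s.toNat))) else 0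

variable {A d}

@[simp] theorem E_tmul (i : ι) (l : ℤ) (n : NAlg A d) (p : FockVars ι) :
    E A d i l (n ⊗ₜ p) = (NAlg.E A d i l * n) ⊗ₜ p := by simp [E]

@[simp] theorem K_tmul (g : ι → Scalar) (n : NAlg A d) (p : FockVars ι) :
    K A d g (n ⊗ₜ p) = NAlg.wt g n ⊗ₜ p := by simp [K]

theorem H_one_tmul (i : ι) (s : ℤ) (p : FockVars ι) :
    H A d i s (1 ⊗ₜ p) = (1 : NAlg A d) ⊗ₜ (if 0 < s then FockVars.X (i, s.toNat) * p else 0) := by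
  split_ifs with h <;> simp [H, h]

theorem isCurrents : IsCurrents A d (E A d) :=
  (NAlg.isCurrents A d).map (T := Module.End Scalar (Fock A d))
    ((fockOp A d).comp (Algebra.lmul Scalar (NAlg A d)))

theorem K_mul_E (g : ι → Scalar) (j : ι) (l : ℤ) :
    K A d g * E A d j l = g j • (E A d j l * K A d g) := by
  rw [K, E, ← map_mul, ← map_mul, ← map_smul]
  congr 1
  ext x
  simp

theorem H_mul_E (i j : ι) (s l : ℤ) :
    H A d i s * E A d j l = E A d j l * H A d i s + hcoef A d i j s • E A d j (l + s) := by
  have h1 : ∀ f : Module.End Scalar (FockVars ι),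
      LinearMap.lTensor (NAlg A d) f * E A d j l = E A d j l * LinearMap.lTensor (NAlg A d) f := by
    intro f
    refine TensorProduct.ext' fun n p => ?_
    simp
  have h2 : fockOp A d (NAlg.der (fun j => hcoef A d i j s) s) * E A d j l =
      E A d j l * fockOp A d (NAlg.der (fun j => hcoef A d i j s) s) +
        hcoef A d i j s • E A d j (l + s) := by
    rw [E, E, ← map_mul, ← map_mul, ← map_smul, ← map_add]
    congr 1
    ext x
    simp [NAlg.der_mul]
  rw [H, add_mul, mul_add, h2]
  split_ifs
  · rw [h1]; abel
  · simp

/-- The Fock space is generated from the vectors `1 ⊗ p` by the `E_{j,l}`. -/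
theorem ext_of_bracket {T T' : Module.End Scalar (Fock A d)}
    (h1 : ∀ p, T ((1 : NAlg A d) ⊗ₜ p) = T' (1 ⊗ₜ p))
    (h2 : ∀ j l, T * E A d j l - E A d j l * T = T' * E A d j l - E A d j l * T') : T = T' := by
  refine TensorProduct.ext' fun n p => ?_
  induction n using NAlg.induction with
  | one => exact h1 p
  | add x y hx hy => simp only [TensorProduct.add_tmul, map_add, hx, hy]
  | smul c x hx => rw [← TensorProduct.smul_tmul', map_smul, map_smul, hx]
  | mul j l x hx =>
    have := DFunLike.congr_fun (h2 j l) (x ⊗ₜ[Scalar] p)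
    simp only [LinearMap.sub_apply, Module.End.mul_apply, hx, E_tmul] at this
    exact sub_left_injective this

theorem H_mul_H (i j : ι) (s t : ℤ) : H A d i s * H A d j t = H A d j t * H A d i s := by
  refine ext_of_bracket (fun p => ?_) fun k l => ?_
  · simp only [Module.End.mul_apply, H_one_tmul]
    congr 1
    split_ifs
    · exact mul_left_comm _ _ _
    · exact mul_zero _
    · exact (mul_zero _).symm
    · rfl
  · have e : l + t + s = l + s + t := by ring
    rw [mul_assoc, H_mul_E, mul_add, ← mul_assoc, H_mul_E, mul_smul_comm, H_mul_E,
      mul_assoc (H A d j t), H_mul_E i k s, mul_add (H A d j t), ← mul_assoc (H A d j t), H_mul_E j,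
      mul_smul_comm _ (H A d j t), H_mul_E j k t (l + s), e]
    simp only [add_mul, smul_add, smul_mul_assoc, mul_assoc]
    rw [smul_comm (hcoef A d j k t)]
    abel

theorem K_mul_H (g : ι → Scalar) (i : ι) (s : ℤ) : K A d g * H A d i s = H A d i s * K A d g := by
  have h : ∀ n, NAlg.wt g (NAlg.der (fun j => hcoef A d i j s) s n) =
      NAlg.der (fun j => hcoef A d i j s) s (NAlg.wt g n : NAlg A d) := by
    intro n
    induction n using NAlg.induction with
    | one => simp
    | add x y hx hy => simp only [map_add, hx, hy]
    | smul c x hx => simp only [map_smul, hx]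
    | mul j l x hx =>
      simp only [map_mul, NAlg.der_mul, map_add, hx, NAlg.wt_E, NAlg.der_E, map_smul]
      rw [smul_comm (g j)]
  refine TensorProduct.ext' fun n p => ?_
  simp only [Module.End.mul_apply, H, LinearMap.add_apply, fockOp_tmul, map_add, K_tmul, h]
  congr 1
  split_ifs <;> simp

theorem K_mul_K (g g' : ι → Scalar) : K A d g * K A d g' = K A d (g * g') := by
  have h : (NAlg.wt g).comp (NAlg.wt g') = (NAlg.wt (g * g') : NAlg A d →ₐ[Scalar] NAlg A d) :=
    NAlg.algHom_ext fun i l => by simp [smul_smul, mul_comm]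
  refine TensorProduct.ext' fun n p => ?_
  simp [← h]

theorem K_one : K A d 1 = 1 := by
  have h : NAlg.wt 1 = AlgHom.id Scalar (NAlg A d) := NAlg.algHom_ext fun i l => by simp
  refine TensorProduct.ext' fun n p => ?_
  simp [h]

/-- The annihilation operator with prescribed commutators with the `E_{i,l}`. -/
theorem exists_annihilation [DecidableEq ι] (hA : IsSymmetrizableGCM A d) (i : ι)
    {ψ : ℤ → Module.End Scalar (Fock A d)} (hψ : OneSided ψ)
    (hq : ∀ j, Quad (v ^ bMat A d i j) ψ (E A d j)) :
    ∃ r : Module.End Scalar (Fock A d), (∀ p, r ((1 : NAlg A d) ⊗ₜ p) = 0) ∧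
      ∀ j l, r * E A d j l = E A d j l * r + if j = i then ψ l else 0 := by
  set Φ := NAlg.lift (isCurrents.deform hA i hψ hq) with hΦ
  have h1 : ∀ n, (Φ n).fst = fockOp A d (Algebra.lmul Scalar _ n) := by
    let f : NAlg A d →ₐ[Scalar] Module.End Scalar (Fock A d) :=
      (fockOp A d).comp (Algebra.lmul Scalar (NAlg A d))
    have : (TrivSqZeroExt.fstHom Scalar (Module.End Scalar (Fock A d))
        (Module.End Scalar (Fock A d))).comp Φ = f := by
      refine NAlg.algHom_ext fun j l => ?_
      simp [hΦ, NAlg.lift_E, E, f]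
    intro n
    exact DFunLike.congr_fun this n
  -- The operator sends `n ⊗ p` to the `ε`-part of `Φ n` applied to `1 ⊗ p`. It therefore kills the
  -- vacuum vectors, and the product rule in the dual numbers yields the commutators.
  refine ⟨TensorProduct.lift
    { toFun := fun n => (Φ n).snd ∘ₗ TensorProduct.mk Scalar (NAlg A d) _ 1
      map_add' := fun x y => by ext; simp
      map_smul' := fun c x => by ext; simp }, fun p => by simp, fun j l => ?_⟩
  refine TensorProduct.ext' fun n p => ?_
  have h2 : (Φ (NAlg.E A d j l * n)).snd =
      E A d j l * (Φ n).snd + (if j = i then ψ l else 0) * (Φ n).fst := by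
    rw [map_mul, DualNumber.snd_mul, hΦ, NAlg.lift_E, fst_dual, snd_dual]
  simp only [Module.End.mul_apply, E_tmul, LinearMap.add_apply, TensorProduct.lift.tmul,
    LinearMap.coe_mk, AddHom.coe_mk, LinearMap.comp_apply, TensorProduct.mk_apply, h2, h1,
    fockOp_tmul, Algebra.coe_lmul_eq_mul, LinearMap.mul_apply', mul_one]

end Fock

end NOperators

/-! ### The Serre expression in its last letter, and pairs of Cartan currents. -/

section SerreRight

variable {S : Type*} [Ring S] [Algebra Scalar S]

theorem serreForm_smul_right (u : Scalar) (r : ℕ) (x : Fin r → S) (c : Scalar) (y : S) :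
    serreForm u r x (c • y) = c • serreForm u r x y := by
  simp only [serreForm, mul_smul_comm, smul_mul_assoc, Finset.smul_sum, smul_comm c]

theorem serreForm_sub_right (u : Scalar) (r : ℕ) (x : Fin r → S) (y z : S) :
    serreForm u r x (y - z) = serreForm u r x y - serreForm u r x z := by
  rw [sub_eq_add_neg, serreForm_add_right, ← neg_one_smul Scalar z, serreForm_smul_right,
    neg_one_smul, sub_eq_add_neg]

theorem snd_serreForm_dual_right (u : Scalar) (r : ℕ) (x : Fin r → S) (y z : S) :
    (serreForm u r (fun a => dual (x a) 0) (dual y z)).snd = serreForm u r x z := by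
  have h1 : ∀ y, serreForm u r (fun a => dual (x a) 0) (dual y 0) = dual (serreForm u r x y) 0 := by
    intro y
    have := map_serreForm (TrivSqZeroExt.inlAlgHom Scalar S S) u r x y
    simpa [dual] using this.symm
  have h3 := serreForm_central_mul u r (fun _ => 1) (fun a => dual (x a) 0) (DualNumber.eps)
    (dual z 0) (fun _ b => Commute.one_left b) DualNumber.commute_eps_left
  simp only [one_mul] at h3
  rw [dual_eq_add_eps, serreForm_add_right, h3, h1, h1]
  simp

omit [Algebra Scalar S] in
theorem OneSided.shift {ψ : ℤ → S} (h : OneSided ψ) (m : ℤ) : OneSided fun l => ψ (l + m) := by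
  rcases h with ⟨N, hN⟩ | ⟨N, hN⟩
  · exact Or.inl ⟨N - m, fun l hl => hN _ (by omega)⟩
  · exact Or.inr ⟨N - m, fun l hl => hN _ (by omega)⟩

omit [Algebra Scalar S] in
theorem OneSided.op {ψ : ℤ → S} (h : OneSided ψ) : OneSided fun l => MulOpposite.op (ψ l) := by
  rcases h with ⟨N, hN⟩ | ⟨N, hN⟩
  · exact Or.inl ⟨N, fun l hl => congrArg MulOpposite.op (hN l hl)⟩
  · exact Or.inr ⟨N, fun l hl => congrArg MulOpposite.op (hN l hl)⟩

/-- Both Cartan currents satisfy the quadratic relation with a current of given weight. -/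
theorem quad_cartan {c : Scalar} (hc : c ≠ 0) {K K' : S} {H : ℤ → S} {η : ℤ → Scalar} {X : ℤ → S}
    (hK : ∀ l, K * X l = c⁻¹ • (X l * K)) (hK' : ∀ l, K' * X l = c • (X l * K'))
    (hH : ∀ s t, H s * H t = H t * H s)
    (hHX : ∀ s l, H s * X l = X l * H s + η s • X (l + s))
    (hη : ∀ s : ℕ, (v⁻¹ - v) * η s = kappa c s) (hη' : ∀ s : ℕ, (v⁻¹ - v) * η (-s) = kappa c s) :
    Quad c (plusCurrent K fun s => (v⁻¹ - v) • H s) X ∧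
      Quad c (minusCurrent K' fun s => (-(v⁻¹ - v)) • H (-s)) X := by
  constructor
  · refine quad_plusCurrent hc hK (fun s t => ?_) fun s _ l => ?_
    · exact ((show Commute (H s) (H t) from hH s t).smul_left _).smul_right _
    · rw [smul_mul_assoc, mul_smul_comm, hHX, smul_add, add_sub_cancel_left, smul_smul, hη]
  · refine quad_minusCurrent hc hK' (fun s t => ?_) fun s _ l => ?_
    · exact ((show Commute (H (-s)) (H (-t)) from hH _ _).smul_left _).smul_right _
    · rw [smul_mul_assoc, mul_smul_comm, hHX, smul_add, add_sub_cancel_left, smul_smul, neg_mul, hη',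
        sub_eq_add_neg]

end SerreRight

namespace Fock

variable {ι : Type*} {A : Matrix ι ι ℤ} {d : ι → ℕ}

theorem ext_of_twisted {T T' : Module.End Scalar (Fock A d)}
    (h1 : ∀ p, T ((1 : NAlg A d) ⊗ₜ p) = T' (1 ⊗ₜ p))
    (h2 : ∀ j l, ∃ (g : Scalar) (Y : Module.End Scalar (Fock A d)),
      T * E A d j l = g • (E A d j l * T) + Y ∧ T' * E A d j l = g • (E A d j l * T') + Y) :
    T = T' := by
  refine TensorProduct.ext' fun n p => ?_
  induction n using NAlg.induction with
  | one => exact h1 p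
  | add x y hx hy => simp only [TensorProduct.add_tmul, map_add, hx, hy]
  | smul c x hx => rw [← TensorProduct.smul_tmul', map_smul, map_smul, hx]
  | mul j l x hx =>
    obtain ⟨g, Y, e1, e2⟩ := h2 j l
    have e3 := DFunLike.congr_fun e1 (x ⊗ₜ[Scalar] p)
    have e4 := DFunLike.congr_fun e2 (x ⊗ₜ[Scalar] p)
    simp only [LinearMap.add_apply, LinearMap.smul_apply, Module.End.mul_apply, E_tmul] at e3 e4
    rw [e3, e4, hx]

/-! ### The representation of the quantum loop algebra on the Fock space. -/

section Representation

variable [Fintype ι] [DecidableEq ι] {V : Type*} [AddCommGroup V] [Module ℂ V] (R : Realization A V)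

/-- The integer `α_j(h)`. -/
def latticeWeight (h : R.lattice) (j : ι) : ℤ := (h.2 j).choose

variable {R}

theorem latticeWeight_eq {h : R.lattice} {j : ι} {m : ℤ} (hm : R.root j (h : V) = (m : ℂ)) :
    latticeWeight R h j = m := by
  have := (h.2 j).choose_spec
  exact Int.cast_injective (α := ℂ) (this.symm.trans hm)

theorem root_eq (h : R.lattice) (j : ι) : R.root j (h : V) = (latticeWeight R h j : ℂ) :=
  (h.2 j).choose_spec

variable (d) in
/-- The action of `K_h`. -/
def Kh (h : R.lattice) : Module.End Scalar (Fock A d) := K A d fun j => v ^ (-latticeWeight R h j)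

theorem Kh_mul_Kh (h h' : R.lattice) : Kh d h * Kh d h' = Kh d (h + h') := by
  rw [Kh, Kh, K_mul_K, Kh]
  congr 1
  funext j
  have : latticeWeight R (h + h') j = latticeWeight R h j + latticeWeight R h' j :=
    latticeWeight_eq (by simp [root_eq])
  rw [Pi.mul_apply, ← zpow_add₀ generic_v.ne_zero, this]
  congr 1
  ring

theorem Kh_zero : Kh d (0 : R.lattice) = 1 := by
  rw [Kh, ← K_one]
  congr 1
  funext j
  have : latticeWeight R 0 j = 0 := latticeWeight_eq (by simp)
  simp [this]

theorem Kh_mul_neg (h : R.lattice) : Kh d h * Kh d (-h) = 1 := by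
  rw [Kh_mul_Kh, add_neg_cancel, Kh_zero]

theorem Kh_comm (h h' : R.lattice) : Kh d h * Kh d h' = Kh d h' * Kh d h := by
  rw [Kh_mul_Kh, Kh_mul_Kh, add_comm]

theorem Kh_mul_E (h : R.lattice) (j : ι) (l : ℤ) :
    Kh d h * E A d j l = v ^ (-latticeWeight R h j) • (E A d j l * Kh d h) := K_mul_E _ j l

theorem latticeWeight_scaledCoroot (i j : ι) :
    latticeWeight R (R.scaledCoroot d i) j = bMat A d i j :=
  latticeWeight_eq (by simp [Realization.scaledCoroot, R.root_coroot, bMat])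

theorem latticeWeight_neg_scaledCoroot (i j : ι) :
    latticeWeight R (-R.scaledCoroot d i) j = -bMat A d i j :=
  latticeWeight_eq (by simp [Realization.scaledCoroot, R.root_coroot, bMat])

variable (R d) in
/-- The action of `φ⁺_{i,l}`. -/
def phiP (i : ι) : ℤ → Module.End Scalar (Fock A d) :=
  plusCurrent (Kh d (R.scaledCoroot d i)) fun s => (v⁻¹ - v) • H A d i s

variable (R d) in
/-- The action of `φ⁻_{i,l}`. -/
def phiM (i : ι) : ℤ → Module.End Scalar (Fock A d) :=
  minusCurrent (Kh d (-R.scaledCoroot d i)) fun s => (-(v⁻¹ - v)) • H A d i (-s)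

variable (R d) in
/-- The value of `[E_{i,l}, F_{i,m}]` in terms of `l + m`, up to sign. -/
def comm (i : ι) (l : ℤ) : Module.End Scalar (Fock A d) :=
  (-((v ^ d i)⁻¹ - v ^ d i)⁻¹) • (phiP d R i l - phiM d R i l)

theorem comm_commute {T : Module.End Scalar (Fock A d)} (hK : ∀ h : R.lattice, Commute T (Kh d h))
    (hH : ∀ i s, Commute T (H A d i s)) (i : ι) (l : ℤ) : Commute T (comm d R i l) := by
  have h1 : ∀ (c : Scalar) (f : ℕ → ℤ) n, Commute T (expCoeff (fun s => c • H A d i (f s)) n) :=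
    fun c f n => expCoeff_commute_right
      (fun s t => ((show Commute (H A d i (f s)) (H A d i (f t)) from H_mul_H _ _ _ _).smul_left
        _).smul_right _) (fun s => (hH i _).smul_right _) n
  refine Commute.smul_right (Commute.sub_right ?_ ?_) _
  · rw [phiP, plusCurrent]
    split_ifs
    · exact (hK _).mul_right (h1 _ (fun s => s) _)
    · exact Commute.zero_right _
  · rw [phiM, minusCurrent, plusCurrent]
    split_ifs
    · exact (hK _).mul_right (h1 _ (fun s => -s) _)
    · exact Commute.zero_right _

theorem Kh_commute_comm (h : R.lattice) (i : ι) (l : ℤ) : Commute (Kh d h) (comm d R i l) :=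
  comm_commute (fun _ => Kh_comm h _) (fun i s => K_mul_H _ i s) i l

theorem H_commute_comm (j : ι) (s : ℤ) (i : ι) (l : ℤ) : Commute (H A d j s) (comm d R i l) :=
  comm_commute (fun _ => (K_mul_H _ j s).symm) (fun i t => H_mul_H j i s t) i l

variable (R) in
theorem quad_phi_E (i j : ι) : Quad (v ^ bMat A d i j) (phiP d R i) (E A d j) ∧
    Quad (v ^ bMat A d i j) (phiM d R i) (E A d j) := by
  refine quad_cartan (η := fun s => hcoef A d i j s) (v_zpow_ne_zero _) (fun l => ?_) (fun l => ?_)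
    (H_mul_H i i) (fun s l => H_mul_E i j s l) (fun s => (kappa_eq_hcoef i j s).symm) fun s => ?_
  · rw [Kh_mul_E, latticeWeight_scaledCoroot, zpow_neg]
  · rw [Kh_mul_E, latticeWeight_neg_scaledCoroot, neg_neg]
  · rw [hcoef_neg, kappa_eq_hcoef]

variable (R) in
/-- The operators `F_{i,m}` on the Fock space. -/
theorem exists_F (hA : IsSymmetrizableGCM A d) : ∃ F : ι → ℤ → Module.End Scalar (Fock A d),
    (∀ i m p, F i m ((1 : NAlg A d) ⊗ₜ p) = 0) ∧ ∀ i m j l,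
      F i m * E A d j l = E A d j l * F i m + if j = i then comm d R i (l + m) else 0 := by
  -- `φ⁺` and `φ⁻` are each one-sided while their difference in general is not, so `F` is obtained
  -- as a difference of two annihilation operators.
  have h1 : ∀ (i : ι) (m : ℤ), ∃ r : Module.End Scalar (Fock A d),
      (∀ p, r ((1 : NAlg A d) ⊗ₜ p) = 0) ∧
      ∀ j l, r * E A d j l = E A d j l * r + if j = i then phiP d R i (l + m) else 0 := fun i m =>
    exists_annihilation hA i ((oneSided_plusCurrent _ _).shift m)
      fun j => (quad_phi_E R i j).1.shift m
  have h2 : ∀ (i : ι) (m : ℤ), ∃ r : Module.End Scalar (Fock A d),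
      (∀ p, r ((1 : NAlg A d) ⊗ₜ p) = 0) ∧
      ∀ j l, r * E A d j l = E A d j l * r + if j = i then phiM d R i (l + m) else 0 := fun i m =>
    exists_annihilation hA i ((oneSided_minusCurrent _ _).shift m)
      fun j => (quad_phi_E R i j).2.shift m
  choose r hr hr' using h1
  choose r' hs hs' using h2
  refine ⟨fun i m => (-((v ^ d i)⁻¹ - v ^ d i)⁻¹) • (r i m - r' i m), fun i m p => ?_,
    fun i m j l => ?_⟩
  · rw [LinearMap.smul_apply, LinearMap.sub_apply, hr, hs, sub_zero, smul_zero]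
  · rw [smul_mul_assoc, sub_mul, hr', hs', mul_smul_comm, mul_sub]
    split_ifs
    · rw [comm, ← smul_add]
      congr 1
      abel
    · simp only [add_zero]

variable {F : ι → ℤ → Module.End Scalar (Fock A d)}

section

variable (hF : ∀ i m p, F i m ((1 : NAlg A d) ⊗ₜ p) = 0) (hFE : ∀ i m j l,
  F i m * E A d j l = E A d j l * F i m + if j = i then comm d R i (l + m) else 0)
include hF hFE

/-- The relations that involve an `F_{j,l}` on the left and the vacuum on the right are all verified
by `ext_of_twisted`: both sides kill the vacuum vectors and obey the same exchange rule with every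
`E_{k,m}`. -/
theorem Kh_mul_F (h : R.lattice) (j : ι) (l : ℤ) :
    Kh d h * F j l = v ^ latticeWeight R h j • (F j l * Kh d h) := by
  refine ext_of_twisted (fun p => ?_) fun k m => ?_
  · simp [hF, Kh]
  · refine ⟨v ^ (-latticeWeight R h k), Kh d h * if k = j then comm d R j (m + l) else 0, ?_, ?_⟩
    · rw [mul_assoc, hFE, mul_add, ← mul_assoc, Kh_mul_E, smul_mul_assoc, mul_assoc]
    · rw [smul_mul_assoc, mul_assoc, Kh_mul_E, mul_smul_comm, ← mul_assoc, hFE, add_mul, smul_add,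
        smul_add, mul_smul_comm, mul_assoc, smul_comm]
      congr 1
      split_ifs with hk
      · subst hk
        rw [smul_smul, ← zpow_add₀ generic_v.ne_zero, add_neg_cancel, zpow_zero, one_smul,
          (Kh_commute_comm h k _).eq]
      · simp

theorem H_mul_F (i j : ι) (s l : ℤ) :
    H A d i s * F j l = F j l * H A d i s - hcoef A d i j s • F j (l + s) := by
  refine ext_of_twisted (fun p => ?_) fun k m => ?_
  · simp [hF, H_one_tmul]
  · refine ⟨1, hcoef A d i k s • (E A d k (m + s) * F j l) +
      H A d i s * if k = j then comm d R j (m + l) else 0, ?_, ?_⟩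
    · rw [mul_assoc, hFE, mul_add, ← mul_assoc, H_mul_E, add_mul, smul_mul_assoc, one_smul,
        mul_assoc, add_assoc]
    · have e1 : m + s + l = m + l + s := by ring
      have e2 : m + (l + s) = m + l + s := by ring
      rw [sub_mul, mul_assoc, H_mul_E, mul_add, ← mul_assoc, hFE, mul_smul_comm, hFE, smul_mul_assoc,
        hFE, e1, e2, one_smul, mul_sub, mul_smul_comm, smul_add, smul_add, add_mul, mul_assoc]
      split_ifs with hk
      · subst hk
        rw [(H_commute_comm i s k _).eq]
        abel
      · simp only [smul_zero, zero_mul, mul_zero, add_zero]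
        abel

theorem quad_phi_F (i j : ι) : Quad (v ^ (-bMat A d i j)) (phiP d R i) (F j) ∧
    Quad (v ^ (-bMat A d i j)) (phiM d R i) (F j) := by
  have e : ∀ s, kappa (v ^ (-bMat A d i j)) s = -((v⁻¹ - v) * hcoef A d i j s) := fun s => by
    rw [zpow_neg, kappa_inv, kappa_eq_hcoef]
  refine quad_cartan (η := fun s => -hcoef A d i j s) (v_zpow_ne_zero _) (fun l => ?_) (fun l => ?_)
    (H_mul_H i i) (fun s l => ?_) (fun s => ?_) fun s => ?_
  · rw [Kh_mul_F hF hFE, latticeWeight_scaledCoroot, zpow_neg, inv_inv]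
  · rw [Kh_mul_F hF hFE, latticeWeight_neg_scaledCoroot]
  · rw [H_mul_F hF hFE, neg_smul, sub_eq_add_neg]
  · rw [e, mul_neg]
  · rw [e, hcoef_neg, mul_neg]

theorem quad_comm_F (i j : ι) (n : ℤ) :
    Quad (v ^ (-bMat A d i j)) (fun l => comm d R i (n + l)) (F j) := by
  have h := (((quad_phi_F hF hFE i j).1.sub (quad_phi_F hF hFE i j).2).smul
    (-((v ^ d i)⁻¹ - v ^ d i)⁻¹)).shift n
  simp only [add_comm n]
  exact h

theorem quad_F (hA : IsSymmetrizableGCM A d) (i j : ι) :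
    Quad (v ^ (-bMat A d i j)) (F i) (F j) := by
  intro l m
  refine ext_of_twisted (fun p => ?_) fun k n => ?_
  · simp [hF]
  have h1 : Quad (v ^ (-bMat A d i j)) (fun l => if k = i then comm d R i (n + l) else 0) (F j) := by
    split_ifs
    · exact quad_comm_F hF hFE i j n
    · exact Quad.zero_left
  have h2 : Quad (v ^ (-bMat A d i j)) (F i) (fun l => if k = j then comm d R j (n + l) else 0) := by
    split_ifs
    · rw [hA.bMat_symm]; exact (quad_comm_F hF hFE j i n).symm
    · exact Quad.zero_right
  have h3 := h1 l m
  have h4 := h2 l m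
  have e1 := fun l => hFE i l k n
  have e2 := fun m => hFE j m k n
  set W := fun l => if k = i then comm d R i (n + l) else 0 with hW
  set W' := fun m => if k = j then comm d R j (n + m) else 0 with hW'
  have e1' : ∀ l, F i l * E A d k n = E A d k n * F i l + W l := e1
  have e2' : ∀ l, F j l * E A d k n = E A d k n * F j l + W' l := e2
  have f1 : ∀ l m, F i l * F j m * E A d k n =
      E A d k n * (F i l * F j m) + (W l * F j m + F i l * W' m) := by
    intro l m
    rw [mul_assoc, e2', mul_add, ← mul_assoc, e1', add_mul]
    simp only [mul_assoc]; abel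
  have f2 : ∀ l m, F j m * F i l * E A d k n =
      E A d k n * (F j m * F i l) + (W' m * F i l + F j m * W l) := by
    intro l m
    rw [mul_assoc, e1', mul_add, ← mul_assoc, e2', add_mul]
    simp only [mul_assoc]; abel
  refine ⟨1, v ^ (-bMat A d i j) • (W (l + 1) * F j m + F i (l + 1) * W' m) -
    (W' m * F i (l + 1) + F j m * W (l + 1)), ?_, ?_⟩
  · rw [sub_mul, smul_mul_assoc, f1, f2, one_smul, mul_sub, mul_smul_comm, smul_add]
    abel
  · have e3 : v ^ (-bMat A d i j) • (W (l + 1) * F j m + F i (l + 1) * W' m) -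
        (W' m * F i (l + 1) + F j m * W (l + 1)) =
        (W l * F j (m + 1) - v ^ (-bMat A d i j) • (F j (m + 1) * W l)) +
          (F i l * W' (m + 1) - v ^ (-bMat A d i j) • (W' (m + 1) * F i l)) := by
      rw [← h3, ← h4, smul_add]; abel
    rw [e3, sub_mul, smul_mul_assoc, f1, f2, one_smul, mul_sub, mul_smul_comm, smul_add, smul_add]
    abel

omit [Fintype ι] [DecidableEq ι] hFE in
theorem list_prod_vacuum (L : List (Module.End Scalar (Fock A d))) (hL : ∀ T ∈ L, ∃ i m, T = F i m)
    (p : FockVars ι) : L = [] ∨ L.prod ((1 : NAlg A d) ⊗ₜ p) = 0 := by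
  induction L with
  | nil => exact Or.inl rfl
  | cons T L ih =>
    right
    rw [List.prod_cons, Module.End.mul_apply]
    rcases ih fun T hT => hL T (List.mem_cons_of_mem _ hT) with rfl | h
    · obtain ⟨i, m, rfl⟩ := hL T (by simp)
      simpa using hF i m p
    · rw [h, map_zero]

omit [Fintype ι] [DecidableEq ι] hFE in
theorem serre_vacuum (u : Scalar) (r : ℕ) (i j : ι) (l : Fin r → ℤ) (l' : ℤ) (p : FockVars ι) :
    serreForm u r (fun a => F i (l a)) (F j l') ((1 : NAlg A d) ⊗ₜ p) = 0 := by
  simp only [serreForm, LinearMap.sum_apply, LinearMap.smul_apply, Module.End.mul_apply]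
  refine Finset.sum_eq_zero fun σ _ => Finset.sum_eq_zero fun k _ => ?_
  rcases list_prod_vacuum hF ((List.ofFn fun a => F i (l (σ a))).drop k) (fun T hT => by
    obtain ⟨a, rfl⟩ := (List.mem_ofFn' _ _).1 (List.mem_of_mem_drop hT)
    exact ⟨_, _, rfl⟩) p with h | h
  · rw [h, List.prod_nil, Module.End.one_apply, hF, map_zero, smul_zero]
  · rw [h, map_zero, map_zero, smul_zero]

/-- Every word kills the vacuum, so it suffices that the Serre expression commutes with each
`E_{k,n}`. The bracket is computed in the opposite algebra, where the parameter of the `F` is that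
of the `E`. It is a first-order variation along `φ⁺` and `φ⁻` for `k = i`, and a Serre expression
with last letter `φ⁺` or `φ⁻` for `k = j`; both vanish by one-sidedness. -/
theorem serre_F (hA : IsSymmetrizableGCM A d) (i j : ι) (hij : i ≠ j) (r : ℕ)
    (hr : (r : ℤ) = 1 - A i j) (l : Fin r → ℤ) (l' : ℤ) :
    serreSum (v ^ d i) (F i) (F j l') r l = 0 := by
  rw [serreSum_eq]
  refine ext_of_twisted (fun p => ?_) fun k n => ⟨1, 0, ?_, by simp⟩
  · rw [serre_vacuum hF]; rfl
  rw [one_smul, add_zero]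
  have hop : ∀ {i j : ι} {X Y : ℤ → Module.End Scalar (Fock A d)}, Quad (v ^ (-bMat A d i j)) X Y →
      Quad (v ^ bMat A d i j) (fun l => MulOpposite.op (X l)) (fun l => MulOpposite.op (Y l)) := by
    intro i j X Y h
    have := h.op (v_zpow_ne_zero _)
    rwa [zpow_neg, inv_inv] at this
  have hb := bracket_serreForm (MulOpposite.op (E A d k n)) (v ^ d i) r
    (fun a => MulOpposite.op (F i (l a))) (MulOpposite.op (F j l'))
  have e1 : ∀ i m, MulOpposite.op (E A d k n) * MulOpposite.op (F i m) -
      MulOpposite.op (F i m) * MulOpposite.op (E A d k n) =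
        MulOpposite.op (if k = i then comm d R i (n + m) else 0) := by
    intro i m
    rw [← MulOpposite.op_mul, ← MulOpposite.op_mul, ← MulOpposite.op_sub, hFE, add_sub_cancel_left]
  simp only [e1] at hb
  have hc : ∀ i m, MulOpposite.op (comm d R i m) = (-((v ^ d i)⁻¹ - v ^ d i)⁻¹) •
      (MulOpposite.op (phiP d R i m) - MulOpposite.op (phiM d R i m)) := fun i m => rfl
  have hXX := hop (quad_F hF hFE hA i i)
  have hz : MulOpposite.op (E A d k n) *
      serreForm (v ^ d i) r (fun a => MulOpposite.op (F i (l a))) (MulOpposite.op (F j l')) -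
      serreForm (v ^ d i) r (fun a => MulOpposite.op (F i (l a))) (MulOpposite.op (F j l')) *
      MulOpposite.op (E A d k n) = 0 := by
    rw [hb]
    by_cases hki : k = i
    · subst hki
      simp only [if_true, if_neg hij, MulOpposite.op_zero, hc]
      rw [snd_serreForm_dual_smul, snd_serreForm_dual_sub]
      have h1 := snd_serreForm_deform hA hij hr hXX (hop (quad_F hF hFE hA k j))
        (ψ := fun m => MulOpposite.op (phiP d R k (m + n)))
        ((hop (quad_phi_F hF hFE k k).1).shift n) ((hop (quad_phi_F hF hFE k j).1).shift n)
        ((oneSided_plusCurrent _ _).op.shift n) l l'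
      have h2 := snd_serreForm_deform hA hij hr hXX (hop (quad_F hF hFE hA k j))
        (ψ := fun m => MulOpposite.op (phiM d R k (m + n)))
        ((hop (quad_phi_F hF hFE k k).2).shift n) ((hop (quad_phi_F hF hFE k j).2).shift n)
        ((oneSided_minusCurrent _ _).op.shift n) l l'
      simp only [add_comm _ n] at h1 h2
      rw [h1, h2, sub_zero, smul_zero]
    · simp only [if_neg hki, MulOpposite.op_zero]
      rw [snd_serreForm_dual_right]
      split_ifs with hkj
      · subst hkj
        have h1 := serreForm_oneSided hA hij hr hXX
          (ψ := fun m => MulOpposite.op (phiP d R k (m + n))) (by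
            have := hop (quad_phi_F hF hFE k i).1
            rw [hA.bMat_symm] at this
            exact this.shift n) ((oneSided_plusCurrent _ _).op.shift n) l l'
        have h2 := serreForm_oneSided hA hij hr hXX
          (ψ := fun m => MulOpposite.op (phiM d R k (m + n))) (by
            have := hop (quad_phi_F hF hFE k i).2
            rw [hA.bMat_symm] at this
            exact this.shift n) ((oneSided_minusCurrent _ _).op.shift n) l l'
        simp only [add_comm _ n] at h1 h2
        rw [hc, serreForm_smul_right, serreForm_sub_right, h1, h2, sub_zero, smul_zero]
      · rw [MulOpposite.op_zero, serreForm_zero_right]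
  have hs : (-1 : Scalar) ^ r ≠ 0 := pow_ne_zero _ (by norm_num)
  have h5 := op_serreForm (v ^ d i) r (fun a => F i (l a)) (F j l')
  apply MulOpposite.op_injective
  rw [MulOpposite.op_mul, MulOpposite.op_mul, h5, mul_smul_comm, smul_mul_assoc, sub_eq_zero.1 hz]

end

variable (R) in
/-- The action of the quantum loop algebra on the Fock space. -/
theorem exists_representation (hA : IsSymmetrizableGCM A d) :
    ∃ ρ : LoopAlg d R →ₐ[Scalar] Module.End Scalar (Fock A d),
      (∀ i l, ρ (proj d R (Free.E R i l)) = E A d i l) ∧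
      ∀ i s, ρ (proj d R (Free.H R i s)) = H A d i s := by
  obtain ⟨F, hF, hFE⟩ := exists_F R hA
  let f : Free R →ₐ[Scalar] Module.End Scalar (Fock A d) := FreeAlgebra.lift Scalar fun
    | Gen.E i l => E A d i l
    | Gen.F i l => F i l
    | Gen.K h => Kh d h
    | Gen.H i s => H A d i s
  have fE : ∀ i l, f (Free.E R i l) = E A d i l := fun i l => FreeAlgebra.lift_ι_apply _ _
  have fF : ∀ i l, f (Free.F R i l) = F i l := fun i l => FreeAlgebra.lift_ι_apply _ _
  have fK : ∀ h, f (Free.K R h) = Kh d h := fun h => FreeAlgebra.lift_ι_apply _ _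
  have fH : ∀ i s, f (Free.H R i s) = H A d i s := fun i s => FreeAlgebra.lift_ι_apply _ _
  have fP : ∀ i m, f (Free.phiPlus R d i m) = phiP d R i m := by
    intro i m
    rw [Free.phiPlus, phiP, plusCurrent]
    split_ifs
    · rw [map_mul, map_expCoeff, fK]
      congr 1
      refine expCoeff_congr (fun s hs => ?_) _
      rw [dif_pos (by omega), map_smul, fH]
    · rw [map_zero]
  have fM : ∀ i m, f (Free.phiMinus R d i m) = phiM d R i m := by
    intro i m
    rw [Free.phiMinus, phiM, minusCurrent, plusCurrent]
    by_cases hm : m ≤ 0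
    · rw [if_pos hm, if_pos (by omega), map_mul, map_expCoeff, fK]
      congr 1
      refine expCoeff_congr (fun s hs => ?_) _
      rw [dif_pos (by omega), map_smul, fH]
    · rw [if_neg hm, if_neg (by omega), map_zero]
  refine ⟨RingQuot.liftAlgHom Scalar ⟨f, ?_⟩, fun i l =>
    (RingQuot.liftAlgHom_mkAlgHom_apply (S := Scalar) _ _ _).trans (fE i l), fun i s =>
    (RingQuot.liftAlgHom_mkAlgHom_apply (S := Scalar) _ _ _).trans (fH i s)⟩
  intro x y hxy
  cases hxy with
  | K_add h h' => rw [map_mul, fK, fK, fK, Kh_mul_Kh]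
  | K_zero => rw [fK, map_one, Kh_zero]
  | K_H h j s => rw [map_mul, map_mul, fK, fH]; exact K_mul_H _ _ _
  | H_H i j s t => rw [map_mul, map_mul, fH, fH]; exact H_mul_H _ _ _ _
  | K_E h j l m hm =>
    rw [map_mul, map_mul, map_smul, fK, fK, fE, Kh_mul_E, smul_mul_assoc, mul_assoc, Kh_mul_neg,
      mul_one, latticeWeight_eq hm]
  | K_F h j l m hm =>
    rw [map_mul, map_mul, map_smul, fK, fK, fF, Kh_mul_F hF hFE, smul_mul_assoc, mul_assoc,
      Kh_mul_neg, mul_one, latticeWeight_eq hm]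
  | H_E i j s l =>
    rw [map_sub, map_mul, map_mul, map_smul, fH, fE, fE, H_mul_E, add_sub_cancel_left, add_comm]
    rfl
  | H_F i j s l =>
    rw [map_sub, map_mul, map_mul, map_smul, fH, fF, fF, H_mul_F hF hFE, sub_sub_cancel_left,
      add_comm]
    exact (neg_smul (hcoef A d i j s) _).symm
  | E_F_same i l m =>
    rw [map_sub, map_mul, map_mul, map_smul, map_sub, fE, fF, fP, fM, hFE, if_pos rfl, comm,
      sub_add_cancel_left]
    have h := neg_smul (((v ^ d i)⁻¹ - v ^ d i)⁻¹) (phiP d R i (l + m) - phiM d R i (l + m))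
    exact neg_eq_iff_eq_neg.2 h
  | E_F_ne i j hij l m =>
    rw [map_sub, map_mul, map_mul, map_zero, fE, fF, hFE, if_neg hij, add_zero, sub_self]
  | E_E i j l m =>
    simp only [map_sub, map_mul, map_smul, fE]
    exact isCurrents.quad i j l m
  | F_F i j l m =>
    simp only [map_sub, map_mul, map_smul, fF]
    exact quad_F hF hFE hA i j l m
  | serre_E i j hij r hr l l' =>
    rw [map_serreSum, map_zero, fE]
    simp only [fE]
    exact isCurrents.serre i j hij r hr l l'
  | serre_F i j hij r hr l l' =>
    rw [map_serreSum, map_zero, fF]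
    simp only [fF]
    exact serre_F hF hFE hA i j hij r hr l l'

end Representation

end Fock

/-! ### A presentation of the upper half of the quantum loop algebra -/

section Plus

variable {ι : Type*} {A : Matrix ι ι ℤ} {d : ι → ℕ}
variable {S : Type*} [Ring S] [Algebra Scalar S]

/-- The relations among the `E_{i,l}` and the `H_{i,s}` with `s > 0`; for convenience `H_{i,0} = 0`. -/
structure IsPlus (A : Matrix ι ι ℤ) (d : ι → ℕ) (X : ι → ℤ → S) (H : ι → ℕ → S) : Prop where
  currents : IsCurrents A d X
  H_zero : ∀ i, H i 0 = 0
  H_H : ∀ i j s t, H i s * H j t = H j t * H i s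
  H_X : ∀ i j (s : ℕ) l, H i s * X j l = X j l * H i s + hcoef A d i j s • X j (l + s)

theorem IsPlus.of_jointly_injective {S₁ S₂ : Type*} [Ring S₁] [Algebra Scalar S₁] [Ring S₂]
    [Algebra Scalar S₂] (f : S →ₐ[Scalar] S₁) (g : S →ₐ[Scalar] S₂)
    (hfg : ∀ x y, f x = f y → g x = g y → x = y) {X : ι → ℤ → S} {H : ι → ℕ → S}
    (hf : IsPlus A d (fun i l => f (X i l)) fun i s => f (H i s))
    (hg : IsPlus A d (fun i l => g (X i l)) fun i s => g (H i s)) : IsPlus A d X H where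
  currents :=
    { quad := fun i j l m => by
        apply hfg
        · simpa only [map_sub, map_smul, map_mul] using hf.currents.quad i j l m
        · simpa only [map_sub, map_smul, map_mul] using hg.currents.quad i j l m
      serre := fun i j hij r hr l l' => by
        apply hfg
        · rw [map_serreSum, map_zero, hf.currents.serre i j hij r hr l l']
        · rw [map_serreSum, map_zero, hg.currents.serre i j hij r hr l l'] }
  H_zero i := hfg _ _ (by rw [map_zero]; exact hf.H_zero i) (by rw [map_zero]; exact hg.H_zero i)
  H_H i j s t := by
    apply hfg
    · simpa only [map_mul] using hf.H_H i j s t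
    · simpa only [map_mul] using hg.H_H i j s t
  H_X i j s l := by
    apply hfg
    · simpa only [map_add, map_smul, map_mul] using hf.H_X i j s l
    · simpa only [map_add, map_smul, map_mul] using hg.H_X i j s l

theorem exists_fockVars_hom (H : ι → ℕ → S) (hH : ∀ i j s t, H i s * H j t = H j t * H i s) :
    ∃ k : FockVars ι →ₐ[Scalar] S, ∀ i s, k (FockVars.X (i, s)) = H i s := by
  let T : Set S := Set.range fun a : ι × ℕ => H a.1 a.2
  have hT : ∀ a ∈ T, ∀ b ∈ T, a * b = b * a := by
    rintro _ ⟨a, rfl⟩ _ ⟨b, rfl⟩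
    exact hH _ _ _ _
  have hc : IsMulCommutative (Algebra.adjoin Scalar T) := Algebra.isMulCommutative_adjoin Scalar hT
  let : CommRing (Algebra.adjoin Scalar T) :=
    { (inferInstance : Ring (Algebra.adjoin Scalar T)) with mul_comm := hc.1.1 }
  let k : MvPolynomial (ι × ℕ) Scalar →ₐ[Scalar] Algebra.adjoin Scalar T :=
    MvPolynomial.aeval fun a => ⟨H a.1 a.2, Algebra.subset_adjoin ⟨a, rfl⟩⟩
  refine ⟨(Algebra.adjoin Scalar T).val.comp k, fun i s => ?_⟩
  have : k (MvPolynomial.X (i, s)) = ⟨H i s, Algebra.subset_adjoin ⟨(i, s), rfl⟩⟩ :=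
    MvPolynomial.aeval_X _ _
  exact congrArg Subtype.val this

variable [Fintype ι] [DecidableEq ι] {V : Type*} [AddCommGroup V] [Module ℂ V]
  {R : Realization A V}

/-- The map `μ : n ⊗ p ↦ j(n) k(p)` from the Fock space to `S` turns the action of `f x` into left
multiplication by `x`. Hence `x` is recovered from `f x` by acting on `1 ⊗ 1`. Thus no relations
hold among the `E_{i,l}` and positive `H_{i,s}` in the loop algebra beyond those of `IsPlus`. -/
theorem IsPlus.injective (hA : IsSymmetrizableGCM A d) {X : ι → ℤ → S} {H : ι → ℕ → S}
    (h : IsPlus A d X H)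
    (htop : Algebra.adjoin Scalar ({x | ∃ i l, x = X i l} ∪ {x | ∃ i s, x = H i s}) = ⊤)
    (f : S →ₐ[Scalar] LoopAlg d R) (fX : ∀ i l, f (X i l) = proj d R (Free.E R i l))
    (fH : ∀ i (s : ℕ) (hs : (s : ℤ) ≠ 0), f (H i s) = proj d R (Free.H R i ⟨s, hs⟩)) :
    Function.Injective f := by
  obtain ⟨ρ, ρE, ρH⟩ := Fock.exists_representation R hA
  obtain ⟨k, hk⟩ := exists_fockVars_hom H h.H_H
  let j : NAlg A d →ₐ[Scalar] S := NAlg.lift h.currents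
  let μ : Fock A d →ₗ[Scalar] S := LinearMap.mul' Scalar S ∘ₗ
    TensorProduct.map j.toLinearMap k.toLinearMap
  have hμ : ∀ n p, μ (n ⊗ₜ p) = j n * k p := fun n p => rfl
  have hder : ∀ i (s : ℕ) n, H i s * j n = j n * H i s + j (NAlg.der (fun a => hcoef A d i a s) s n) := by
    intro i s n
    induction n using NAlg.induction with
    | one => simp
    | add x y hx hy => simp only [map_add, mul_add, add_mul, hx, hy]; abel
    | smul c x hx => simp only [map_smul, mul_smul_comm, smul_mul_assoc, hx, smul_add]
    | mul b l x hx =>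
      have hb : ∀ l, j (NAlg.E A d b l) = X b l := fun l => NAlg.lift_E _ _ _
      rw [map_mul, hb, ← mul_assoc, h.H_X, add_mul, mul_assoc, hx, NAlg.der_mul, NAlg.der_E,
        map_add, map_mul, map_mul, map_smul, hb, hb, mul_add, mul_assoc]
      abel
  have hmain : ∀ x, ∀ w, μ (ρ (f x) w) = x * μ w := by
    intro x
    have hx : x ∈ Algebra.adjoin Scalar ({x | ∃ i l, x = X i l} ∪ {x | ∃ i s, x = H i s}) := by
      rw [htop]; trivial
    induction hx using Algebra.adjoin_induction with
    | algebraMap c =>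
      intro w
      rw [Algebra.algebraMap_eq_smul_one, map_smul, map_smul, map_one, map_one, smul_mul_assoc,
        one_mul, LinearMap.smul_apply, map_smul, Module.End.one_apply]
    | add x y _ _ hx hy => intro w; rw [map_add, map_add, LinearMap.add_apply, map_add, hx, hy, add_mul]
    | mul x y _ _ hx hy => intro w; rw [map_mul, map_mul, Module.End.mul_apply, hx, hy, mul_assoc]
    | mem x hx =>
      rcases hx with ⟨i, l, rfl⟩ | ⟨i, s, rfl⟩
      · intro w
        rw [fX, ρE]
        induction w using TensorProduct.induction_on with
        | zero => simp
        | add x y hx hy => simp only [map_add, mul_add, hx, hy]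
        | tmul n p =>
          rw [Fock.E_tmul, hμ, hμ, map_mul, mul_assoc]
          congr 1
          exact NAlg.lift_E _ _ _
      · intro w
        rcases Nat.eq_zero_or_pos s with rfl | hs
        · rw [h.H_zero, map_zero, map_zero, zero_mul, LinearMap.zero_apply, map_zero]
        rw [fH i s (by omega), ρH]
        induction w using TensorProduct.induction_on with
        | zero => simp
        | add x y hx hy => simp only [map_add, mul_add, hx, hy]
        | tmul n p =>
          rw [Fock.H, if_pos (by simpa using hs), LinearMap.add_apply, map_add, fockOp_tmul, hμ, hμ,
            LinearMap.lTensor_tmul, hμ, ← mul_assoc, hder, LinearMap.mulLeft_apply, map_mul,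
            Int.toNat_natCast, hk, add_mul, mul_assoc, add_comm]
  intro x y hxy
  have h1 := hmain x (1 ⊗ₜ 1)
  have h2 := hmain y (1 ⊗ₜ 1)
  rw [hxy, hμ, map_one, map_one, one_mul, mul_one] at *
  exact h1.symm.trans h2

/-! ### The universal property of `Uplus` -/

namespace Uplus

variable (d R) in
/-- `H_{i,s}` for `s > 0`, and zero for `s = 0`. -/
def H (i : ι) (s : ℕ) : Uplus d R := if h : 0 < s then Hplus d R i s h else 0

theorem H_pos (i : ι) (s : ℕ) (h : 0 < s) : H d R i s = Hplus d R i s h := dif_pos h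

theorem coe_H (i : ι) (s : ℕ) (h : (s : ℤ) ≠ 0) :
    (H d R i s : LoopAlg d R) = proj d R (Free.H R i ⟨s, h⟩) := by
  rw [H_pos i s (by omega)]
  rfl

theorem proj_rel {x y : Free R} (h : Rel d R x y) : proj d R x = proj d R y :=
  RingQuot.mkAlgHom_rel Scalar h

variable (d R) in
theorem isPlus : IsPlus A d (Eplus d R) (H d R) where
  currents :=
    { quad := fun i j l m => by
        apply Subtype.ext
        have := proj_rel (Rel.E_E (d := d) (R := R) i j l m)
        simp only [map_sub, map_smul, map_mul] at this
        exact this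
      serre := fun i j hij r hr l l' => by
        have hv : Function.Injective (Uplus d R).val := Subtype.val_injective
        apply hv
        rw [map_serreSum]
        have := proj_rel (Rel.serre_E (d := d) (R := R) i j hij r hr l l')
        rw [map_serreSum, map_zero] at this
        rw [map_zero]
        exact this }
  H_zero i := dif_neg (lt_irrefl _)
  H_H i j s t := by
    apply Subtype.ext
    rcases Nat.eq_zero_or_pos s with rfl | hs
    · simp [H]
    rcases Nat.eq_zero_or_pos t with rfl | ht
    · simp [H]
    have := proj_rel (Rel.H_H (d := d) (R := R) i j ⟨s, by omega⟩ ⟨t, by omega⟩)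
    rw [map_mul, map_mul, ← coe_H, ← coe_H] at this
    exact this
  H_X i j s l := by
    apply Subtype.ext
    rcases Nat.eq_zero_or_pos s with rfl | hs
    · simp [H, hcoef]
    have := proj_rel (Rel.H_E (d := d) (R := R) i j ⟨s, by omega⟩ l)
    rw [map_sub, map_mul, map_mul, ← coe_H, map_smul, sub_eq_iff_eq_add'] at this
    rw [add_comm l]
    exact this

theorem adjoin_eq_top :
    Algebra.adjoin Scalar ({x | ∃ i l, x = Eplus d R i l} ∪ {x | ∃ i s, x = H d R i s}) = ⊤ := by
  refine eq_top_iff.2 ((Algebra.adjoin_adjoin_coe_preimage (R := Scalar)).ge.trans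
    (Algebra.adjoin_mono ?_))
  rintro ⟨x, hx⟩ (⟨i, l, h⟩ | ⟨i, ⟨s, h0⟩, hs, h⟩)
  · exact Or.inl ⟨i, l, Subtype.ext h⟩
  · refine Or.inr ⟨i, s.toNat, Subtype.ext ?_⟩
    have hs' : 0 < s := hs
    lift s to ℕ using hs'.le
    rw [Int.toNat_natCast, coe_H i s h0]
    exact h

/-- The desired homomorphism is given by its graph, the subalgebra `Q` of `Uplus d R × S` generated
by the pairs of generators. `Q` satisfies the same relations, so its first projection is injective
by `IsPlus.injective`, and it is visibly surjective. -/
theorem exists_lift (hA : IsSymmetrizableGCM A d) {X : ι → ℤ → S} {Y : ι → ℕ → S}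
    (h : IsPlus A d X Y) :
    ∃ Φ : Uplus d R →ₐ[Scalar] S, (∀ i l, Φ (Eplus d R i l) = X i l) ∧
      ∀ i s, Φ (H d R i s) = Y i s := by
  let T : Set (Uplus d R × S) := {x | ∃ i l, x = (Eplus d R i l, X i l)} ∪
    {x | ∃ i s, x = (H d R i s, Y i s)}
  let Q := Algebra.adjoin Scalar T
  let x : ι → ℤ → Q := fun i l => ⟨(Eplus d R i l, X i l), Algebra.subset_adjoin (Or.inl ⟨i, l, rfl⟩)⟩
  let y : ι → ℕ → Q := fun i s => ⟨(H d R i s, Y i s), Algebra.subset_adjoin (Or.inr ⟨i, s, rfl⟩)⟩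
  let f : Q →ₐ[Scalar] Uplus d R := (AlgHom.fst Scalar _ _).comp Q.val
  let g : Q →ₐ[Scalar] S := (AlgHom.snd Scalar _ _).comp Q.val
  have hQ : IsPlus A d x y := IsPlus.of_jointly_injective f g
    (fun a b h1 h2 => Subtype.ext (Prod.ext h1 h2)) (isPlus d R) h
  have htop : Algebra.adjoin Scalar ({a | ∃ i l, a = x i l} ∪ {a | ∃ i s, a = y i s}) = ⊤ := by
    refine eq_top_iff.2 ((Algebra.adjoin_adjoin_coe_preimage (R := Scalar)).ge.trans
      (Algebra.adjoin_mono ?_))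
    rintro ⟨x, hx⟩ (⟨i, l, h⟩ | ⟨i, s, h⟩)
    · exact Or.inl ⟨i, l, Subtype.ext h⟩
    · exact Or.inr ⟨i, s, Subtype.ext h⟩
  have hinj : Function.Injective f := by
    have := hQ.injective hA htop ((Uplus d R).val.comp f) (fun i l => rfl)
      fun i s hs => coe_H i s hs
    exact Function.Injective.of_comp (f := (Uplus d R).val) this
  have hsurj : Function.Surjective f := by
    rw [← AlgHom.range_eq_top, eq_top_iff, ← adjoin_eq_top]
    refine Algebra.adjoin_le ?_
    rintro _ (⟨i, l, rfl⟩ | ⟨i, s, rfl⟩)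
    · exact ⟨x i l, rfl⟩
    · exact ⟨y i s, rfl⟩
  let e := AlgEquiv.ofBijective f ⟨hinj, hsurj⟩
  refine ⟨g.comp e.symm.toAlgHom, fun i l => ?_, fun i s => ?_⟩
  · have : e.symm (Eplus d R i l) = x i l := e.symm_apply_eq.2 rfl
    exact congrArg g this
  · have : e.symm (H d R i s) = y i s := e.symm_apply_eq.2 rfl
    exact congrArg g this

/-- The homomorphism out of `Uplus` with prescribed values on the generators. -/
def lift (hA : IsSymmetrizableGCM A d) {X : ι → ℤ → S} {Y : ι → ℕ → S} (h : IsPlus A d X Y) :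
    Uplus d R →ₐ[Scalar] S := (exists_lift hA h).choose

@[simp] theorem lift_E (hA : IsSymmetrizableGCM A d) {X : ι → ℤ → S} {Y : ι → ℕ → S}
    (h : IsPlus A d X Y) (i : ι) (l : ℤ) : lift (R := R) hA h (Eplus d R i l) = X i l :=
  (exists_lift hA h).choose_spec.1 i l

@[simp] theorem lift_H (hA : IsSymmetrizableGCM A d) {X : ι → ℤ → S} {Y : ι → ℕ → S}
    (h : IsPlus A d X Y) (i : ι) (s : ℕ) : lift (R := R) hA h (H d R i s) = Y i s :=
  (exists_lift hA h).choose_spec.2 i s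

theorem induction {p : Uplus d R → Prop} (one : p 1) (add : ∀ x y, p x → p y → p (x + y))
    (smul : ∀ (c : Scalar) x, p x → p (c • x)) (mul_E : ∀ i l x, p x → p (Eplus d R i l * x))
    (mul_H : ∀ i s x, p x → p (H d R i s * x)) (x : Uplus d R) : p x := by
  refine adjoin_left_induction (s := {x | ∃ i l, x = Eplus d R i l} ∪ {x | ∃ i s, x = H d R i s}) one add
    smul ?_ (by rw [adjoin_eq_top]; trivial)
  rintro _ (⟨i, l, rfl⟩ | ⟨i, s, rfl⟩) y hy
  · exact mul_E i l y hy
  · exact mul_H i s y hy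

theorem algHom_ext {f g : Uplus d R →ₐ[Scalar] S}
    (hE : ∀ i l, f (Eplus d R i l) = g (Eplus d R i l))
    (hH : ∀ i s, f (H d R i s) = g (H d R i s)) : f = g := by
  ext x
  induction x using induction with
  | one => simp
  | add x y hx hy => rw [map_add, map_add, hx, hy]
  | smul c x hx => rw [map_smul, map_smul, hx]
  | mul_E i l x hx => rw [map_mul, map_mul, hx, hE]
  | mul_H i s x hx => rw [map_mul, map_mul, hx, hH]

end Uplus

end Plus

/-! ### Detecting elements by annihilation operators -/

section Detection

variable {M : Type*} [AddCommGroup M] [Module Scalar M]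

/-- The span of the words in the operators `e_l`, `l ∈ I`, applied to elements of `C`. -/
def wordSpan (C : Submodule Scalar M) (e : ℤ → Module.End Scalar M) (I : Set ℤ) :
    Submodule Scalar M :=
  sInf {P | C ≤ P ∧ ∀ l ∈ I, ∀ w ∈ P, e l w ∈ P}

variable {C : Submodule Scalar M} {e : ℤ → Module.End Scalar M} {I J : Set ℤ}

theorem le_wordSpan : C ≤ wordSpan C e I := le_sInf fun _ hP => hP.1

theorem map_mem_wordSpan {l : ℤ} (hl : l ∈ I) {w : M} (hw : w ∈ wordSpan C e I) :
    e l w ∈ wordSpan C e I :=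
  Submodule.mem_sInf.2 fun P hP => hP.2 l hl w (Submodule.mem_sInf.1 hw P hP)

theorem wordSpan_le {P : Submodule Scalar M} (h1 : C ≤ P) (h2 : ∀ l ∈ I, ∀ w ∈ P, e l w ∈ P) :
    wordSpan C e I ≤ P := sInf_le ⟨h1, h2⟩

theorem wordSpan_mono (h : I ⊆ J) : wordSpan C e I ≤ wordSpan C e J :=
  wordSpan_le le_wordSpan fun _ hl _ hw => map_mem_wordSpan (h hl) hw

theorem wordSpan_empty : wordSpan C e ∅ = C :=
  le_antisymm (wordSpan_le le_rfl fun _ hl => hl.elim) le_wordSpan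

theorem exists_mem_wordSpan_interval {w : M} (hw : w ∈ wordSpan C e Set.univ) :
    ∃ n : ℕ, w ∈ wordSpan C e (Set.Ico (-n : ℤ) n) := by
  have hmono : ∀ {m n : ℕ}, m ≤ n →
      wordSpan C e (Set.Ico (-m : ℤ) m) ≤ wordSpan C e (Set.Ico (-n : ℤ) n) := fun h =>
    wordSpan_mono (Set.Ico_subset_Ico (by omega) (by omega))
  let P : Submodule Scalar M :=
    { carrier := {w | ∃ n : ℕ, w ∈ wordSpan C e (Set.Ico (-n : ℤ) n)}
      zero_mem' := ⟨0, Submodule.zero_mem _⟩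
      add_mem' := by
        rintro a b ⟨m, hm⟩ ⟨n, hn⟩
        exact ⟨max m n, Submodule.add_mem _ (hmono (le_max_left _ _) hm)
          (hmono (le_max_right _ _) hn)⟩
      smul_mem' := by
        rintro c a ⟨m, hm⟩
        exact ⟨m, Submodule.smul_mem _ _ hm⟩ }
  refine wordSpan_le (P := P) (fun w hw => ⟨0, le_wordSpan hw⟩) ?_ hw
  rintro l - w ⟨n, hn⟩
  refine ⟨max n (l.natAbs + 1), map_mem_wordSpan ?_ (hmono (le_max_left _ _) hn)⟩
  constructor <;> omega

/-- Words can be rewritten with the lowest letter in front. -/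
theorem wordSpan_le_iSup {c : Scalar} (hc : c ≠ 0) (hq : Quad c e e) (a b : ℤ) :
    wordSpan C e (Set.Ico a b) ≤
      ⨆ k : ℕ, (wordSpan C e (Set.Ico (a + 1) b)).map (e a ^ k) := by
  set W := wordSpan C e (Set.Ico (a + 1) b) with hW
  let Q : ℕ → Submodule Scalar M := fun k => ⨆ j : ℕ, ⨆ _ : j ≤ k, W.map (e a ^ j)
  have hmem : ∀ {j k : ℕ}, j ≤ k → ∀ {u}, u ∈ W → (e a ^ j) u ∈ Q k := fun {j k} hjk u hu =>
    Submodule.mem_iSup_of_mem j (Submodule.mem_iSup_of_mem hjk ⟨u, hu, rfl⟩)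
  have hind : ∀ {k : ℕ} {P : Submodule Scalar M}, (∀ j ≤ k, ∀ u ∈ W, (e a ^ j) u ∈ P) → Q k ≤ P := by
    intro k P h
    refine iSup_le fun j => iSup_le fun hj => ?_
    rintro _ ⟨u, hu, rfl⟩
    exact h j hj u hu
  have hmono : ∀ {j k : ℕ}, j ≤ k → Q j ≤ Q k := fun hjk =>
    hind fun i hi u hu => hmem (hi.trans hjk) hu
  have hA : ∀ k, ∀ z ∈ Q k, e a z ∈ Q (k + 1) := fun k z hz =>
    hind (P := (Q (k + 1)).comap (e a)) (fun j hj u hu => by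
      have := hmem (Nat.succ_le_succ hj) hu
      rwa [Nat.succ_eq_add_one, pow_succ'] at this) hz
  have hL : ∀ k, ∀ l ∈ Set.Ico (a + 1) b, ∀ z ∈ Q k, e l z ∈ Q k := by
    intro k
    induction k with
    | zero =>
      intro l hl z hz
      refine hind (P := (Q 0).comap (e l)) (fun j hj u hu => ?_) hz
      obtain rfl : j = 0 := by omega
      exact hmem (j := 0) le_rfl (map_mem_wordSpan hl hu)
    | succ k ih =>
      intro l hl z hz
      refine hind (P := (Q (k + 1)).comap (e l)) (fun j hj u hu => ?_) hz
      change e l ((e a ^ j) u) ∈ Q (k + 1)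
      rcases Nat.lt_or_eq_of_le hj with hj' | rfl
      · exact hmono (Nat.le_succ k) (ih l hl _ (hmem (by omega) hu))
      rw [pow_succ', Module.End.mul_apply]
      set y := (e a ^ k) u with hy
      have hyQ : y ∈ Q k := hmem le_rfl hu
      have ha1 : a + 1 ∈ Set.Ico (a + 1) b := ⟨le_rfl, hl.1.trans_lt hl.2⟩
      -- The quadratic relation at `l - 1` and `a` exchanges `e l` and `e a` at the cost of words in
      -- `l - 1` and `a + 1`, which are allowed letters unless `l = a + 1`. In that case it reads `2
      -- c e_{a+1} e_a = 2 e_a e_{a+1}`.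
      have hq' := DFunLike.congr_fun (hq (l - 1) a) y
      simp only [sub_add_cancel, LinearMap.sub_apply, LinearMap.smul_apply,
        Module.End.mul_apply] at hq'
      have key : c • e l (e a y) ∈ Q (k + 1) := by
        rcases hl.1.eq_or_lt with rfl | hlt
        · rw [add_sub_cancel_right] at hq'
          have h2 : c • e (a + 1) (e a y) = e a (e (a + 1) y) := by
            have h3 : (2 : Scalar) • (c • e (a + 1) (e a y)) = (2 : Scalar) • e a (e (a + 1) y) := by
              rw [two_smul, two_smul, ← sub_eq_sub_iff_add_eq_add]
              exact hq'
            exact smul_right_injective M (two_ne_zero' Scalar) h3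
          rw [h2]
          exact hA k _ (ih _ ha1 _ hyQ)
        · have hl1 : l - 1 ∈ Set.Ico (a + 1) b := ⟨by omega, by have := hl.2; omega⟩
          rw [sub_eq_iff_eq_add.1 hq']
          refine Submodule.add_mem _ (hmono (Nat.le_succ k) (Submodule.sub_mem _ ?_
            (Submodule.smul_mem _ _ ?_))) (hA k _ (ih l hl _ hyQ))
          · exact ih _ hl1 _ (ih _ ha1 _ hyQ)
          · exact ih _ ha1 _ (ih _ hl1 _ hyQ)
      exact (Submodule.smul_mem_iff _ hc).1 key
  have hQ : ∀ k, Q k ≤ ⨆ k : ℕ, W.map (e a ^ k) := fun k =>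
    hind fun j _ u hu => Submodule.mem_iSup_of_mem j ⟨u, hu, rfl⟩
  refine wordSpan_le (fun w hw => hQ 0 (hmem (j := 0) le_rfl (le_wordSpan hw))) ?_
  intro l hl w hw
  induction hw using Submodule.iSup_induction' with
  | zero => rw [map_zero]; exact Submodule.zero_mem _
  | add x y _ _ hx hy => rw [map_add]; exact Submodule.add_mem _ hx hy
  | mem k x hx =>
    obtain ⟨u, hu, rfl⟩ := hx
    rcases hl.1.eq_or_lt with rfl | hlt
    · exact hQ _ (hA k _ (hmem le_rfl hu))
    · exact hQ _ (hL k l ⟨hlt, hl.2⟩ _ (hmem le_rfl hu))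

/-- Each of the `k + 1` places at which `ρ` can meet `e` leaves a `p`; bringing `p` to the front
costs a power of `g`, and the powers add up to a geometric sum. -/
theorem annihilation_pow {e ρ p : Module.End Scalar M} {g : Scalar} (h : ρ * e = e * ρ + p)
    (he : e * p = g • (p * e)) {u : M} (hu : ρ u = 0) (k : ℕ) :
    ρ ((e ^ (k + 1)) u) = (∑ j ∈ Finset.range (k + 1), g ^ j) • p ((e ^ k) u) := by
  have hT : ∀ w, ρ (e w) = e (ρ w) + p w := fun w => DFunLike.congr_fun h w
  have hp : ∀ w, e (p w) = g • p (e w) := fun w => DFunLike.congr_fun he w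
  induction k with
  | zero => simp [hT, hu]
  | succ k ih =>
    have hk : e ((e ^ k) u) = (e ^ (k + 1)) u := by rw [pow_succ', Module.End.mul_apply]
    rw [pow_succ' e (k + 1), Module.End.mul_apply, hT, ih, map_smul, hp, hk,
      smul_smul, Finset.sum_range_succ' _ (k + 1), pow_zero, add_smul, one_smul, Finset.sum_mul]
    simp only [pow_succ]

/-- Applying `ρ` and cancelling the injective `p` lowers every exponent by one, so the number of
terms can be reduced by induction. -/
theorem eq_zero_of_sum_pow {e ρ p : Module.End Scalar M} {g : Scalar} (h : ρ * e = e * ρ + p)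
    (he : e * p = g • (p * e)) (hp : Function.Injective p)
    (hg : ∀ k, ∑ j ∈ Finset.range (k + 1), g ^ j ≠ 0) (n : ℕ) (u : ℕ → M) (hu : ∀ k, ρ (u k) = 0)
    (h0 : ∑ k ∈ Finset.range n, (e ^ k) (u k) = 0) : ∀ k < n, u k = 0 := by
  induction n generalizing u with
  | zero => intro k hk; omega
  | succ n ih =>
    have h1 := congrArg ρ h0
    rw [Finset.sum_range_succ', map_add, map_sum, map_zero] at h1
    simp only [annihilation_pow h he (hu _), pow_zero, Module.End.one_apply, hu, add_zero] at h1
    have h2 : p (∑ k ∈ Finset.range n, (e ^ k) ((∑ j ∈ Finset.range (k + 1), g ^ j) • u (k + 1))) =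
        p 0 := by
      simp only [map_zero, map_sum, map_smul, h1]
    have h3 := ih _ (fun k => by rw [map_smul, hu, smul_zero]) (hp h2)
    have h4 : ∀ k < n, u (k + 1) = 0 := fun k hk => (smul_eq_zero.1 (h3 k hk)).resolve_left (hg k)
    have h5 : u 0 = 0 := by
      rw [Finset.sum_range_succ', Finset.sum_eq_zero, zero_add] at h0
      · exact h0
      · intro k hk
        rw [h4 k (Finset.mem_range.1 hk), map_zero]
    rintro (- | k) hk
    · exact h5
    · exact h4 k (by omega)

/-- An element of the span of words that is killed by all annihilation operators lies in `C`. -/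
theorem mem_of_annihilated {c g : Scalar} (hc : c ≠ 0) (hq : Quad c e e)
    {ρ ψ : ℤ → Module.End Scalar M} (hρ : ∀ m l, ρ m * e l = e l * ρ m + ψ (m - l))
    (hψ : ∀ t < 0, ψ t = 0) (hψe : ∀ l, e l * ψ 0 = g • (ψ 0 * e l))
    (hinj : Function.Injective (ψ 0)) (hg : ∀ k, ∑ j ∈ Finset.range (k + 1), g ^ j ≠ 0)
    (hC : ∀ m, ∀ w ∈ C, ρ m w = 0) {w : M} (hw : w ∈ wordSpan C e Set.univ)
    (h0 : ∀ m, ρ m w = 0) : w ∈ C := by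
  obtain ⟨N, hN⟩ := exists_mem_wordSpan_interval hw
  -- Induction on the length of the interval of letters. The lowest letter `a` is removed by means
  -- of `ρ a`, which kills all words in the higher letters.
  suffices h : ∀ n : ℕ, ∀ a b : ℤ, b ≤ a + n → w ∈ wordSpan C e (Set.Ico a b) → w ∈ C from
    h (N + N) _ _ (by push_cast; omega) hN
  intro n
  induction n with
  | zero =>
    intro a b hab hw
    rwa [Set.Ico_eq_empty (by simpa using hab), wordSpan_empty] at hw
  | succ n ih =>
    intro a b hab hw
    refine ih (a + 1) b (by push_cast at hab; omega) ?_
    set W := wordSpan C e (Set.Ico (a + 1) b) with hW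
    have hker : ∀ u ∈ W, ρ a u = 0 := fun u hu =>
      wordSpan_le (P := LinearMap.ker (ρ a)) (fun w hw => hC a w hw) (fun l hl w hw => by
        have := DFunLike.congr_fun (hρ a l) w
        have hl1 := hl.1
        rw [hψ _ (by omega), add_zero, Module.End.mul_apply, Module.End.mul_apply,
          LinearMap.mem_ker.1 hw, map_zero] at this
        exact this) hu
    obtain ⟨f, hf, hsum⟩ := (Submodule.mem_iSup_iff_exists_finsupp _ _).1 (wordSpan_le_iSup hc hq a b hw)
    choose u hu huf using hf
    obtain ⟨m, hm⟩ : ∃ m : ℕ, f.support ⊆ Finset.range (m + 1) := by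
      refine ⟨f.support.sup id, fun k hk => Finset.mem_range.2 (Nat.lt_succ_of_le ?_)⟩
      exact Finset.le_sup (f := id) hk
    have hw2 : w = ∑ k ∈ Finset.range (m + 1), (e a ^ k) (u k) := by
      rw [← hsum, Finsupp.sum, Finset.sum_subset hm fun k _ hk => Finsupp.notMem_support_iff.1 hk]
      exact Finset.sum_congr rfl fun k _ => (huf k).symm
    have hTe := hρ a a
    rw [sub_self] at hTe
    -- Applying `ρ a` leaves `ψ 0` of a sum with one power of `e a` fewer. By injectivity and
    -- `eq_zero_of_sum_pow` all terms with a positive power vanish, so `w = u 0` uses only letters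
    -- above `a`.
    have h1 := h0 a
    rw [hw2, Finset.sum_range_succ', map_add, map_sum] at h1
    simp only [annihilation_pow hTe (hψe a) (hker _ (hu _)), pow_zero, Module.End.one_apply,
      hker _ (hu _), add_zero] at h1
    have h2 : ψ 0 (∑ k ∈ Finset.range m, (e a ^ k) ((∑ j ∈ Finset.range (k + 1), g ^ j) • u (k + 1))) =
        ψ 0 0 := by
      simp only [map_zero, map_sum, map_smul, h1]
    have h3 := hinj h2
    simp only [map_smul] at h3
    have h4 := eq_zero_of_sum_pow hTe (hψe a) hinj hg m
      (fun k => (∑ j ∈ Finset.range (k + 1), g ^ j) • u (k + 1))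
      (fun k => by rw [map_smul, hker _ (hu _), smul_zero]) (by simpa only [map_smul] using h3)
    rw [hw2, Finset.sum_range_succ', Finset.sum_eq_zero, zero_add, pow_zero]
    · exact hu 0
    · intro k hk
      rw [(smul_eq_zero.1 (h4 k (Finset.mem_range.1 hk))).resolve_left (hg k), map_zero]

end Detection

namespace Shortcut

scoped instance : CommRing Scalar := inferInstance
scoped instance : CommSemiring Scalar := inferInstance
scoped instance : Semiring Scalar := inferInstance
scoped instance : Monoid Scalar := inferInstance

variable {ι : Type*} [Fintype ι] [DecidableEq ι] {A : Matrix ι ι ℤ} {d : ι → ℕ}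
  {V : Type*} [AddCommGroup V] [Module ℂ V] {R : Realization A V}

scoped instance : Ring (Uplus d R) := inferInstance
scoped instance : AddCommGroup (Uplus d R) := Ring.toAddCommGroup
scoped instance : Algebra Scalar (Uplus d R) := inferInstance
scoped instance : Module Scalar (Uplus d R) := Algebra.toModule
scoped instance : AddCommMonoid (Uplus d R) := AddCommGroup.toAddCommMonoid
scoped instance : DistribMulAction Scalar (Uplus d R) := Module.toDistribMulAction
scoped instance : SMul Scalar (Uplus d R) := Algebra.toSMul
scoped instance : Ring (Module.End Scalar (Uplus d R)) := inferInstance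
scoped instance : Algebra Scalar (Module.End Scalar (Uplus d R)) := inferInstance
scoped instance : SMul Scalar (Module.End Scalar (Uplus d R)) := Algebra.toSMul
scoped instance : DistribMulAction Scalar (Module.End Scalar (Uplus d R)) := Module.toDistribMulAction

end Shortcut

/-! ### Exponentials with central commutators, and operators from first-order deformations. -/

section ExpCentral

variable {S : Type*} [Ring S] [Algebra Scalar S]

/-- An element with central commutators with the exponent. -/
theorem mul_expCoeff_central {h : ℕ → S} (hh : ∀ s t, Commute (h s) (h t)) {Y : S} {c : Scalar}
    {s : ℕ} (hs : 0 < s) (hY : ∀ t, Y * h t = h t * Y + if t = s then c • (1 : S) else 0) (n : ℕ) :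
    Y * expCoeff h n = expCoeff h n * Y + if s ≤ n then c • expCoeff h (n - s) else 0 := by
  set Z : PowerSeries S := PowerSeries.C (c • (1 : S)) * PowerSeries.X ^ s with hZ
  set a := eul (tailSeries h) with ha
  set E := expSeries h with hE
  have hcY : ∀ x : S, Commute (c • (1 : S)) x := fun x => (Commute.one_left x).smul_left c
  have hZc : ∀ f : PowerSeries S, Commute Z f := by
    intro f
    refine Commute.mul_left (commute_of_coeff fun m n => ?_) (PowerSeries.commute_X_pow f s).symm
    rw [PowerSeries.coeff_C]
    split_ifs
    · exact hcY _
    · exact Commute.zero_left _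
  have hcoefZ : ∀ (f : PowerSeries S) n, PowerSeries.coeff n (Z * f) =
      if s ≤ n then c • PowerSeries.coeff (n - s) f else 0 := by
    intro f n
    rw [hZ, mul_assoc, PowerSeries.coeff_C_mul, PowerSeries.coeff_X_pow_mul', mul_ite, mul_zero,
      smul_mul_assoc, one_mul]
  have heulZ : eul Z = (s : PowerSeries S) * Z := by
    ext n
    have h1 := hcoefZ 1 n
    rw [mul_one] at h1
    rw [coeff_eul, h1, ← nsmul_eq_mul, ← nsmul_eq_mul, map_nsmul, h1]
    split_ifs with h2
    · rcases eq_or_ne n s with rfl | h3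
      · rfl
      · rw [PowerSeries.coeff_one, if_neg (by omega), smul_zero, smul_zero, smul_zero]
    · rw [smul_zero, smul_zero]
  have hYa : PowerSeries.C Y * a = a * PowerSeries.C Y + (s : PowerSeries S) * Z := by
    ext n
    have h1 := hcoefZ 1 n
    rw [mul_one] at h1
    rw [map_add, PowerSeries.coeff_C_mul, PowerSeries.coeff_mul_C, ha, coeff_eul_tailSeries,
      ← nsmul_eq_mul s, map_nsmul, h1, ← mul_assoc, ← (Nat.cast_commute n Y).eq, mul_assoc, hY,
      mul_add, mul_assoc]
    congr 1
    rcases eq_or_ne n s with rfl | h3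
    · simp
    · rw [if_neg h3, mul_zero]
      split_ifs
      · rw [PowerSeries.coeff_one, if_neg (by omega), smul_zero, smul_zero]
      · rw [smul_zero]
  have hEe : eul E = a * E := eul_expSeries hh
  -- The difference solves the Euler equation of `E` and has no constant term, since `s > 0`.
  have key : PowerSeries.C Y * E - E * PowerSeries.C Y - Z * E = 0 := by
    refine eq_zero_of_eul (a := a) ?_ (coeff_zero_eul _) ?_
    · rw [eul_sub, eul_sub, eul_mul, eul_mul, eul_mul, eul_C, heulZ, hEe, zero_mul, zero_add,
        mul_zero, add_zero, ← mul_assoc, hYa, ← mul_assoc Z, (hZc a).eq]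
      noncomm_ring
    · rw [map_sub, map_sub, hcoefZ, if_neg (by omega), PowerSeries.coeff_C_mul,
        PowerSeries.coeff_mul_C, hE, coeff_expSeries, expCoeff_zero, mul_one, one_mul, sub_self,
        sub_zero]
  have h1 := congrArg (PowerSeries.coeff n) key
  rw [map_sub, map_sub, hcoefZ, PowerSeries.coeff_C_mul, PowerSeries.coeff_mul_C, hE,
    coeff_expSeries, coeff_expSeries, map_zero, sub_sub, sub_eq_zero] at h1
  exact h1

theorem commute_plusCurrent {K Y : S} {h : ℕ → S} (hh : ∀ s t, Commute (h s) (h t))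
    (hK : Commute Y K) (hY : ∀ s, Commute Y (h s)) (l : ℤ) : Commute Y (plusCurrent K h l) := by
  unfold plusCurrent
  split_ifs
  · exact hK.mul_right (expCoeff_commute_right hh hY _)
  · exact Commute.zero_right _

/-- A first-order deformation of the regular representation gives an operator. -/
theorem exists_op_of_dual (Φ : S →ₐ[Scalar] DualNumber (Module.End Scalar S))
    (h : ∀ x, (Φ x).fst = Algebra.lmul Scalar S x) :
    ∃ r : Module.End Scalar S, r 1 = 0 ∧
      ∀ x, r * Algebra.lmul Scalar S x = Algebra.lmul Scalar S x * r + (Φ x).snd := by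
  refine ⟨{ toFun := fun x => (Φ x).snd 1
            map_add' := fun x y => by rw [map_add, TrivSqZeroExt.snd_add, LinearMap.add_apply]
            map_smul' := fun c x => by
              rw [map_smul, TrivSqZeroExt.snd_smul, LinearMap.smul_apply]; rfl }, ?_, fun x => ?_⟩
  · change (Φ 1).snd 1 = 0
    rw [map_one Φ, TrivSqZeroExt.snd_one, LinearMap.zero_apply]
  · ext y : 1
    change (Φ (x * y)).snd 1 = x * (Φ y).snd 1 + (Φ x).snd y
    rw [map_mul, DualNumber.snd_mul, h, h, LinearMap.add_apply, Module.End.mul_apply,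
      Module.End.mul_apply, Algebra.coe_lmul_eq_mul, LinearMap.mul_apply', LinearMap.mul_apply',
      mul_one]

theorem smul_bracket (c : Scalar) (x y : S) : c • x * y - y * (c • x) = c • (x * y - y * x) := by
  rw [smul_mul_assoc, mul_smul_comm, smul_sub]

end ExpCentral

/-! ### Derivations, weight operators and annihilation operators on `Uplus`. -/

section PlusOperators

variable {ι : Type*} [Fintype ι] [DecidableEq ι] {A : Matrix ι ι ℤ} {d : ι → ℕ}
  {V : Type*} [AddCommGroup V] [Module ℂ V] {R : Realization A V}

namespace Uplus

theorem ext_of_bracket {T T' : Module.End Scalar (Uplus d R)} (h1 : T 1 = T' 1)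
    (hE : ∀ j l x, T x = T' x → T (Eplus d R j l * x) = T' (Eplus d R j l * x))
    (hH : ∀ j s x, T x = T' x → T (H d R j s * x) = T' (H d R j s * x)) : T = T' := by
  ext x : 1
  induction x using induction with
  | one => exact h1
  | add x y hx hy => rw [map_add, map_add, hx, hy]
  | smul c x hx => rw [map_smul, map_smul, hx]
  | mul_E i l x hx => exact hE i l x hx
  | mul_H i s x hx => exact hH i s x hx

/-! ### The derivations -/

-- These values are dictated by the pairing to be constructed: `der` is going to be the adjoint of
-- left multiplication by `H_{i,s}`, and its constant value on `H_{j,s}` is the prescribed pairing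
-- of `H_{i,s}` with `H_{j,s}`.
variable (d R) in
theorem isPlus_deform (i : ι) (s : ℕ) :
    IsPlus A d (fun j l => dual (Eplus d R j l) (hcoef A d i j s • Eplus d R j (l + -(s : ℤ))))
      (fun j t => dual (H d R j t)
        (if t = s then (hcoef A d i j s / (v⁻¹ - v)) • (1 : Uplus d R) else 0)) where
  currents := (isPlus d R).currents.deform_shift _ _
  H_zero j := by
    rw [(isPlus d R).H_zero]
    split_ifs with h
    · subst h
      simp [hcoef, dual]
    · simp [dual]
  H_H j k t t' := by
    rw [dual_mul, dual_mul, (isPlus d R).H_H]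
    congr 1
    split_ifs <;> simp [add_comm]
  H_X j k t l := by
    rw [dual_mul, dual_mul, smul_dual, dual_add, (isPlus d R).H_X]
    congr 1
    rw [mul_smul_comm, (isPlus d R).H_X, smul_add, smul_mul_assoc, smul_comm (hcoef A d i k s),
      add_right_comm l]
    split_ifs <;> simp
    abel

variable (R) in
/-- The derivation `E_{j,l} ↦ ([s b_{i,j}] / s) E_{j,l-s}` with constant values on the `H_{j,t}`. -/
def der (hA : IsSymmetrizableGCM A d) (i : ι) (s : ℕ) : Module.End Scalar (Uplus d R) where
  toFun x := (lift hA (isPlus_deform d R i s) x).snd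
  map_add' x y := by simp
  map_smul' c x := by simp

variable (hA : IsSymmetrizableGCM A d)

theorem fst_lift_deform (i : ι) (s : ℕ) (x : Uplus d R) :
    (lift hA (isPlus_deform d R i s) x).fst = x := by
  have : (TrivSqZeroExt.fstHom Scalar (Uplus d R) (Uplus d R)).comp
      (lift hA (isPlus_deform d R i s)) = AlgHom.id _ _ :=
    algHom_ext (fun i l => by simp) fun i s => by simp
  simpa using DFunLike.congr_fun this x

theorem der_mul (i : ι) (s : ℕ) (x y : Uplus d R) :
    der R hA i s (x * y) = x * der R hA i s y + der R hA i s x * y := by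
  simp only [der, LinearMap.coe_mk, AddHom.coe_mk, map_mul, DualNumber.snd_mul, fst_lift_deform]

@[simp] theorem der_E (i : ι) (s : ℕ) (j : ι) (l : ℤ) :
    der R hA i s (Eplus d R j l) = hcoef A d i j s • Eplus d R j (l - s) := by
  simp [der, sub_eq_add_neg]

@[simp] theorem der_H (i : ι) (s : ℕ) (j : ι) (t : ℕ) :
    der R hA i s (H d R j t) =
      if t = s then (hcoef A d i j s / (v⁻¹ - v)) • (1 : Uplus d R) else 0 := by
  simp [der]

@[simp] theorem der_one (i : ι) (s : ℕ) : der R hA i s (1 : Uplus d R) = 0 := by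
  simp [der]

theorem der_comm (i j : ι) (s t : ℕ) : Commute (der R hA i s) (der R hA j t) := by
  refine ext_of_bracket (by simp) (fun k l x hx => ?_) fun k u x hx => ?_
  · simp only [Module.End.mul_apply] at hx ⊢
    simp only [der_mul, der_E, map_add, smul_mul_assoc, map_smul, hx]
    rw [show l - t - s = l - s - t by ring]
    module
  · simp only [Module.End.mul_apply] at hx ⊢
    simp only [der_mul, der_H, map_add, hx]
    split_ifs <;> simp
    abel

omit [Fintype ι] [DecidableEq ι] in
theorem _root_.QuantumLoop.IsPlus.smul {S : Type*} [Ring S] [Algebra Scalar S] {X : ι → ℤ → S}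
    {Y : ι → ℕ → S} (h : IsPlus A d X Y) (g : ι → Scalar) :
    IsPlus A d (fun i l => g i • X i l) Y where
  currents := h.currents.smul g
  H_zero := h.H_zero
  H_H := h.H_H
  H_X i j s l := by
    rw [mul_smul_comm, h.H_X, smul_add, smul_mul_assoc, smul_comm (g j)]

variable (R) in
/-- The automorphism `E_{j,l} ↦ g_j E_{j,l}`. -/
def wt (g : ι → Scalar) : Uplus d R →ₐ[Scalar] Uplus d R := lift hA ((isPlus d R).smul g)

@[simp] theorem wt_E (g : ι → Scalar) (j : ι) (l : ℤ) :
    wt R hA g (Eplus d R j l) = g j • Eplus d R j l := lift_E _ _ _ _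

@[simp] theorem wt_H (g : ι → Scalar) (j : ι) (s : ℕ) :
    wt R hA g (H d R j s) = H d R j s := lift_H _ _ _ _

variable (R) in
/-- `wt` as a linear operator. -/
def wtOp (g : ι → Scalar) : Module.End Scalar (Uplus d R) := (wt R hA g).toLinearMap

@[simp] theorem wtOp_apply (g : ι → Scalar) (x : Uplus d R) : wtOp R hA g x = wt R hA g x := rfl

theorem wtOp_der (g : ι → Scalar) (i : ι) (s : ℕ) : Commute (wtOp R hA g) (der R hA i s) := by
  refine ext_of_bracket (by simp) (fun k l x hx => ?_) fun k u x hx => ?_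
  · simp only [Module.End.mul_apply, wtOp_apply] at hx ⊢
    simp only [der_mul, der_E, map_add, map_mul, wt_E, map_smul, hx]
    rw [smul_comm (g k)]
  · simp only [Module.End.mul_apply, wtOp_apply] at hx ⊢
    simp only [der_mul, der_H, map_add, map_mul, wt_H, hx]
    split_ifs <;> simp

theorem wtOp_comm (g g' : ι → Scalar) : Commute (wtOp R hA g) (wtOp R hA g') := by
  refine ext_of_bracket (by simp) (fun k l x hx => ?_) fun k u x hx => ?_
  · simp only [Module.End.mul_apply, wtOp_apply] at hx ⊢
    simp only [map_mul, wt_E, map_smul, hx]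
    rw [smul_comm (g k)]
  · simp only [Module.End.mul_apply, wtOp_apply] at hx ⊢
    simp only [map_mul, wt_H, hx]

theorem wtOp_mul_wtOp (g g' : ι → Scalar) : wtOp R hA g * wtOp R hA g' = wtOp R hA (g * g') := by
  refine ext_of_bracket (by simp) (fun k l x hx => ?_) fun k u x hx => ?_
  · simp only [Module.End.mul_apply, wtOp_apply] at hx ⊢
    simp only [map_mul, wt_E, map_smul, hx, smul_mul_assoc, smul_smul, Pi.mul_apply, mul_comm]
  · simp only [Module.End.mul_apply, wtOp_apply] at hx ⊢
    simp only [map_mul, wt_H, hx]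

theorem wtOp_one : wtOp R hA (1 : ι → Scalar) = 1 := by
  refine ext_of_bracket (by simp) (fun k l x hx => ?_) fun k u x hx => ?_
  · simp only [Module.End.one_apply, wtOp_apply] at hx ⊢
    simp only [map_mul, wt_E, hx, Pi.one_apply, one_smul]
  · simp only [Module.End.one_apply, wtOp_apply] at hx ⊢
    simp only [map_mul, wt_H, hx]

/-! ### Left multiplications -/

variable (d R) in
/-- Left multiplication. -/
abbrev mulOp : Uplus d R →ₐ[Scalar] Module.End Scalar (Uplus d R) := Algebra.lmul Scalar _

@[simp] theorem mulOp_apply (x y : Uplus d R) : mulOp d R x y = x * y := rfl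

theorem wtOp_mul_mulOp_E (g : ι → Scalar) (j : ι) (l : ℤ) :
    wtOp R hA g * mulOp d R (Eplus d R j l) = g j • (mulOp d R (Eplus d R j l) * wtOp R hA g) := by
  ext x : 1
  simp

theorem wtOp_mulOp_H (g : ι → Scalar) (j : ι) (s : ℕ) :
    Commute (wtOp R hA g) (mulOp d R (H d R j s)) := by
  ext x : 1
  simp

theorem mulOp_isPlus : IsPlus A d (fun i l => mulOp d R (Eplus d R i l))
    fun i s => mulOp d R (H d R i s) where
  currents := (isPlus d R).currents.map (T := Module.End Scalar (Uplus d R)) (mulOp d R)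
  H_zero i := by rw [(isPlus d R).H_zero, map_zero]
  H_H i j s t := by rw [← map_mul, (isPlus d R).H_H, map_mul]
  H_X i j s l := by rw [← map_mul, (isPlus d R).H_X, map_add, map_mul, map_smul]

theorem der_mul_mulOp_E (i : ι) (s : ℕ) (j : ι) (l : ℤ) :
    der R hA i s * mulOp d R (Eplus d R j l) - mulOp d R (Eplus d R j l) * der R hA i s =
      hcoef A d i j s • mulOp d R (Eplus d R j (l - s)) := by
  ext x : 1
  simp [der_mul]

theorem mulOp_H_mul_der (i : ι) (s : ℕ) (j : ι) (t : ℕ) :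
    mulOp d R (H d R j t) * der R hA i s = der R hA i s * mulOp d R (H d R j t) +
      if s = t then (-(hcoef A d i j t / (v⁻¹ - v))) • 1 else 0 := by
  ext x : 1
  by_cases h : s = t
  · subst h
    simp [der_mul]
  · simp [der_mul, h, Ne.symm h]

/-! ### The annihilation operators -/

variable (R) in
/-- The current `K exp (-(v⁻¹ - v) ∑_{s ≥ 1} der_{i,s} z ^ s)`. -/
def psi (i : ι) (l : ℤ) : Module.End Scalar (Uplus d R) :=
  minusCurrent (wtOp R hA fun j => v ^ bMat A d i j) (fun s => (-(v⁻¹ - v)) • der R hA i s) l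

theorem quad_psi (i j : ι) :
    Quad (v ^ bMat A d i j) (psi R hA i) (fun l => mulOp d R (Eplus d R j l)) := by
  refine quad_minusCurrent (v_zpow_ne_zero _) (fun l => wtOp_mul_mulOp_E hA _ _ _)
    (fun s t => ((der_comm hA i i s t).smul_left _).smul_right _) fun s _ l => ?_
  rw [smul_bracket, der_mul_mulOp_E, smul_smul, kappa_eq_hcoef, neg_mul]

theorem wtOp_psi (g : ι → Scalar) (i : ι) (l : ℤ) : Commute (wtOp R hA g) (psi R hA i l) := by
  refine commute_plusCurrent (fun s t => ?_) (wtOp_comm hA _ _) (fun s => ?_) _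
  · exact ((der_comm hA i i s t).smul_left _).smul_right _
  · exact (wtOp_der hA g i s).smul_right _

/-- This is the first-order part of the relation between `H_{j,s}` and the `i`-th current, needed
for deforming along `psi`. -/
theorem mulOp_H_mul_psi (i j : ι) (s : ℕ) (l : ℤ) :
    mulOp d R (H d R j s) * psi R hA i l = psi R hA i l * mulOp d R (H d R j s) +
      hcoef A d i j s • psi R hA i (l + s) := by
  rcases Nat.eq_zero_or_pos s with rfl | hs
  · simp [(isPlus d R).H_zero, hcoef]
  by_cases hl : l ≤ 0
  · obtain ⟨n, rfl⟩ : ∃ n : ℕ, l = -n := ⟨l.natAbs, by omega⟩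
    have h1 := mul_expCoeff_central (h := fun s => (-(v⁻¹ - v)) • der R hA i s)
      (fun s t => ((der_comm hA i i s t).smul_left _).smul_right _)
      (Y := mulOp d R (H d R j s)) (c := hcoef A d i j s) hs (fun t => by
        rw [mul_smul_comm, mulOp_H_mul_der, smul_add, smul_mul_assoc]
        congr 1
        split_ifs
        · rw [smul_smul, neg_mul_neg, mul_div_cancel₀]
          exact generic_v.qint_den_ne
        · exact smul_zero _) n
    have e1 : psi R hA i (-n) = wtOp R hA (fun j => v ^ bMat A d i j) *
        expCoeff (fun s => (-(v⁻¹ - v)) • der R hA i s) n := by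
      rw [psi, minusCurrent, neg_neg, plusCurrent_natCast]
    rw [e1, ← mul_assoc, ← (wtOp_mulOp_H hA _ j s).eq, mul_assoc, h1, mul_add, mul_assoc]
    congr 1
    split_ifs with h
    · rw [mul_smul_comm, psi, minusCurrent, show -(-(n : ℤ) + s) = ((n - s : ℕ) : ℤ) by omega,
        plusCurrent_natCast]
    · rw [mul_zero, psi, minusCurrent, plusCurrent_neg _ _ (by omega), smul_zero]
  · rw [psi, minusCurrent, plusCurrent_neg _ _ (by omega), psi, minusCurrent,
      plusCurrent_neg _ _ (by omega), mul_zero, zero_mul, smul_zero, add_zero]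

-- On `Uplus`, unlike on the algebra of the `E_{j,l}` alone, the deformation must also respect the
-- relations with the `H_{j,s}`, which are kept undeformed; this is what `hH` provides.
include hA in
theorem exists_annihilation_of_quad (i : ι) {ψ : ℤ → Module.End Scalar (Uplus d R)}
    (hψ : OneSided ψ) (hq : ∀ j, Quad (v ^ bMat A d i j) ψ fun l => mulOp d R (Eplus d R j l))
    (hH : ∀ j (s : ℕ) l, mulOp d R (H d R j s) * ψ l = ψ l * mulOp d R (H d R j s) +
      hcoef A d i j s • ψ (l + s)) :
    ∃ r : Module.End Scalar (Uplus d R), r 1 = 0 ∧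
      (∀ j l, r * mulOp d R (Eplus d R j l) = mulOp d R (Eplus d R j l) * r +
        if j = i then ψ l else 0) ∧
      ∀ j s, r * mulOp d R (H d R j s) = mulOp d R (H d R j s) * r := by
  have hP : IsPlus A d (fun j l => dual (mulOp d R (Eplus d R j l)) (if j = i then ψ l else 0))
      (fun j s => dual (mulOp d R (H d R j s)) 0) := by
    refine ⟨mulOp_isPlus.currents.deform hA i hψ hq, fun j => ?_, fun j k s t => ?_,
      fun j k s l => ?_⟩
    · rw [mulOp_isPlus.H_zero]; simp [dual]
    · rw [dual_mul, dual_mul, mulOp_isPlus.H_H]; simp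
    · rw [dual_mul, dual_mul, smul_dual, dual_add, mulOp_isPlus.H_X]
      congr 1
      split_ifs with h
      · subst h
        rw [hH, hcoef_symm hA]
        simp [add_comm]
      · simp
  set Φ := lift (R := R) hA hP with hΦ
  have h1 : ∀ n, (Φ n).fst = mulOp d R n := by
    have : (TrivSqZeroExt.fstHom Scalar (Module.End Scalar (Uplus d R))
        (Module.End Scalar (Uplus d R))).comp Φ = mulOp d R :=
      algHom_ext (fun i l => by simp [hΦ]) fun i s => by simp [hΦ]
    exact fun n => DFunLike.congr_fun this n
  obtain ⟨r, h2, h3⟩ := exists_op_of_dual Φ h1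
  refine ⟨r, h2, fun j l => ?_, fun j s => ?_⟩
  · rw [h3, hΦ, lift_E, snd_dual]
  · rw [h3, hΦ, lift_H, snd_dual, add_zero]

variable (R) in
theorem exists_annihilation (i : ι) (m : ℤ) :
    ∃ r : Module.End Scalar (Uplus d R), r 1 = 0 ∧
      (∀ j l, r * mulOp d R (Eplus d R j l) = mulOp d R (Eplus d R j l) * r +
        if j = i then psi R hA i (l - m) else 0) ∧
      (∀ j s, r * mulOp d R (H d R j s) = mulOp d R (H d R j s) * r) ∧
      ∀ g : ι → Scalar, r * wtOp R hA g = g i • (wtOp R hA g * r) := by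
  obtain ⟨r, h1, h2, h3⟩ := exists_annihilation_of_quad hA i
    (ψ := fun l => psi R hA i (l - m)) ((oneSided_minusCurrent _ _).shift (-m))
    (fun j => (quad_psi hA i j).shift (-m)) fun j s l => by
      rw [mulOp_H_mul_psi, sub_add_eq_add_sub]
  refine ⟨r, h1, h2, h3, fun g => ?_⟩
  have h2' := fun j l x => DFunLike.congr_fun (h2 j l) x
  have h3' := fun j s x => DFunLike.congr_fun (h3 j s) x
  simp only [LinearMap.add_apply, Module.End.mul_apply, mulOp_apply] at h2' h3'
  refine ext_of_bracket (by simp [h1]) (fun k l x hx => ?_) fun k u x hx => ?_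
  · simp only [Module.End.mul_apply, wtOp_apply, LinearMap.smul_apply] at hx ⊢
    rw [map_mul, wt_E, smul_mul_assoc, map_smul, h2', h2', hx, map_add, map_mul, wt_E, smul_add,
      smul_add, mul_smul_comm, smul_mul_assoc, smul_comm (g k)]
    congr 1
    split_ifs with h
    · subst h
      congr 1
      exact (DFunLike.congr_fun (wtOp_psi hA g k (l - m)).eq x).symm
    · simp
  · simp only [Module.End.mul_apply, wtOp_apply, LinearMap.smul_apply] at hx ⊢
    rw [map_mul, wt_H, h3', h3', hx, map_mul, wt_H, mul_smul_comm]

end Uplus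

end PlusOperators

/-! ### Annihilation operators on the algebra of the `E_{i,l}` -/

namespace NAlg

section

variable {ι : Type*} {A : Matrix ι ι ℤ} {d : ι → ℕ}

instance : AddCommGroup (NAlg A d) := Ring.toAddCommGroup
instance : Module Scalar (NAlg A d) := Algebra.toModule
instance : Ring (Module.End Scalar (NAlg A d)) := inferInstance
instance : Algebra Scalar (Module.End Scalar (NAlg A d)) := inferInstance

variable (A d) in
/-- Left multiplication. -/
abbrev mulOp : NAlg A d →ₐ[Scalar] Module.End Scalar (NAlg A d) := Algebra.lmul Scalar _

@[simp] theorem mulOp_apply (x y : NAlg A d) : mulOp A d x y = x * y := rfl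

variable (A d) in
/-- `wt` as a linear operator. -/
def wtOp (g : ι → Scalar) : Module.End Scalar (NAlg A d) := (wt g).toLinearMap

@[simp] theorem wtOp_apply (g : ι → Scalar) (x : NAlg A d) : wtOp A d g x = wt g x := rfl

theorem wtOp_mul_mulOp_E (g : ι → Scalar) (j : ι) (l : ℤ) :
    wtOp A d g * mulOp A d (E A d j l) = g j • (mulOp A d (E A d j l) * wtOp A d g) := by
  ext x : 1
  simp

theorem ext_of_bracket {T T' : Module.End Scalar (NAlg A d)} (h1 : T 1 = T' 1)
    (hE : ∀ j l x, T x = T' x → T (E A d j l * x) = T' (E A d j l * x)) : T = T' := by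
  ext x : 1
  induction x using induction with
  | one => exact h1
  | add x y hx hy => rw [map_add, map_add, hx, hy]
  | smul c x hx => rw [map_smul, map_smul, hx]
  | mul i l x hx => exact hE i l x hx

theorem der_comm (a b : ι → Scalar) (s t : ℤ) :
    Commute (der a s : Module.End Scalar (NAlg A d)) (der b t) := by
  refine ext_of_bracket (by simp) fun k l x hx => ?_
  simp only [Module.End.mul_apply] at hx ⊢
  simp only [der_mul, der_E, map_add, smul_mul_assoc, map_smul, hx]
  rw [show l + t + s = l + s + t by ring]
  module

theorem der_mul_mulOp_E (a : ι → Scalar) (s : ℤ) (j : ι) (l : ℤ) :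
    der a s * mulOp A d (E A d j l) - mulOp A d (E A d j l) * der a s =
      a j • mulOp A d (E A d j (l + s)) := by
  ext x : 1
  simp [der_mul]

theorem wtOp_mul_wtOp (g g' : ι → Scalar) : wtOp A d g * wtOp A d g' = wtOp A d (g * g') := by
  refine ext_of_bracket (by simp) fun k l x hx => ?_
  simp only [Module.End.mul_apply, wtOp_apply] at hx ⊢
  simp only [map_mul, wt_E, map_smul, hx, smul_mul_assoc, smul_smul, Pi.mul_apply, mul_comm]

theorem wtOp_one : wtOp A d (1 : ι → Scalar) = 1 := by
  refine ext_of_bracket (by simp) fun k l x hx => ?_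
  simp only [Module.End.one_apply, wtOp_apply] at hx ⊢
  simp only [map_mul, wt_E, hx, Pi.one_apply, one_smul]

variable (A d) in
/-- The current `K exp ((v⁻¹ - v) ∑_{s ≥ 1} der_{i,s} z ^ s)`. -/
def phi (i : ι) (l : ℤ) : Module.End Scalar (NAlg A d) :=
  plusCurrent (wtOp A d fun j => v ^ (-bMat A d i j))
    (fun s => (v⁻¹ - v) • der (fun j => hcoef A d i j s) s) l

theorem quad_phi (i j : ι) :
    Quad (v ^ bMat A d i j) (phi A d i) (fun l => mulOp A d (E A d j l)) := by
  refine quad_plusCurrent (v_zpow_ne_zero _) (fun l => ?_)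
    (fun s t => ((der_comm _ _ _ _).smul_left _).smul_right _) fun s _ l => ?_
  · rw [wtOp_mul_mulOp_E, zpow_neg]
  · rw [smul_bracket, der_mul_mulOp_E, smul_smul, kappa_eq_hcoef]

theorem exists_annihilation [DecidableEq ι] (hA : IsSymmetrizableGCM A d) (i : ι) (m : ℤ) :
    ∃ r : Module.End Scalar (NAlg A d), r 1 = 0 ∧
      ∀ j l, r * mulOp A d (E A d j l) = mulOp A d (E A d j l) * r +
        if j = i then phi A d i (l + m) else 0 := by
  set Φ := lift (((isCurrents A d).map (T := Module.End Scalar (NAlg A d)) (mulOp A d)).deform hA i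
    (ψ := fun l => phi A d i (l + m)) ((oneSided_plusCurrent _ _).shift m)
    fun j => (quad_phi i j).shift m) with hΦ
  have h1 : ∀ n, (Φ n).fst = mulOp A d n := by
    have : (TrivSqZeroExt.fstHom Scalar (Module.End Scalar (NAlg A d))
        (Module.End Scalar (NAlg A d))).comp Φ = mulOp A d :=
      algHom_ext fun i l => by simp [hΦ, lift_E]
    exact fun n => DFunLike.congr_fun this n
  obtain ⟨r, h2, h3⟩ := exists_op_of_dual Φ h1
  exact ⟨r, h2, fun j l => by rw [h3, hΦ, lift_E, snd_dual]⟩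

end

end NAlg

/-! ### Hahn series over the integers -/

section Hahn

/-- A summation range independent of the supports allows products over different coefficient rings
to be compared term by term, as in `intertwiner`. -/
theorem hahn_coeff_mul {S : Type*} [NonUnitalNonAssocSemiring S] {x y : HahnSeries ℤ S} {m n : ℤ}
    (hx : ∀ p < m, x.coeff p = 0) (hy : ∀ p < n, y.coeff p = 0) (p : ℤ) :
    (x * y).coeff p = ∑ i ∈ Finset.Icc m (p - n), x.coeff i * y.coeff (p - i) := by
  rw [HahnSeries.coeff_mul]
  refine Finset.sum_of_injOn Prod.fst ?_ ?_ ?_ ?_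
  · intro a ha b hb h
    have h1 := (Finset.mem_antidiagonal.1 ha).2.2
    have h2 := (Finset.mem_antidiagonal.1 hb).2.2
    exact Prod.ext h (by omega)
  · intro a ha
    obtain ⟨h1, h2, h3⟩ := Finset.mem_antidiagonal.1 ha
    have h4 : m ≤ a.1 := not_lt.1 fun h => h1 (hx _ h)
    have h5 : n ≤ a.2 := not_lt.1 fun h => h2 (hy _ h)
    exact Finset.mem_coe.2 (Finset.mem_Icc.2 ⟨h4, by omega⟩)
  · intro i _ h
    by_contra h0
    refine h ⟨(i, p - i), Finset.mem_coe.2 (Finset.mem_antidiagonal.2 ⟨?_, ?_, ?_⟩), rfl⟩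
    · exact fun h => h0 (by rw [h, zero_mul])
    · exact fun h => h0 (by rw [h, mul_zero])
    · simp
  · intro a ha
    rw [← (Finset.mem_antidiagonal.1 ha).2.2, add_sub_cancel_left]

variable {S : Type*} [Ring S] [Algebra Scalar S]

omit [Algebra Scalar S] in
theorem hahn_coeff_mul_order (x y : HahnSeries ℤ S) {m n : ℤ} (hm : m ≤ x.order) (hn : n ≤ y.order)
    (p : ℤ) : (x * y).coeff p = ∑ i ∈ Finset.Icc m (p - n), x.coeff i * y.coeff (p - i) :=
  hahn_coeff_mul (fun _ h => HahnSeries.coeff_eq_zero_of_lt_order (h.trans_le hm))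
    (fun _ h => HahnSeries.coeff_eq_zero_of_lt_order (h.trans_le hn)) p

/-- The Hahn series with coefficients in a subalgebra. -/
def hahnSubalgebra (Q : Subalgebra Scalar S) : Subalgebra Scalar (HahnSeries ℤ S) where
  carrier := {f | ∀ p, f.coeff p ∈ Q}
  mul_mem' := fun {f g} hf hg p => by
    rw [hahn_coeff_mul_order f g le_rfl le_rfl]
    exact Q.sum_mem fun i _ => Q.mul_mem (hf _) (hg _)
  add_mem' := fun hf hg p => Q.add_mem (hf p) (hg p)
  algebraMap_mem' := fun c p => by
    rw [Algebra.algebraMap_eq_smul_one, HahnSeries.coeff_smul, HahnSeries.coeff_one]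
    split_ifs
    · exact Q.smul_mem Q.one_mem c
    · rw [smul_zero]; exact Q.zero_mem

/-- Pairs of families of operators that are intertwined by `T`. -/
def intertwiner {M M' S' : Type*} [AddCommGroup M] [Module Scalar M] [AddCommGroup M']
    [Module Scalar M'] [Ring S'] [Algebra Scalar S'] (T : M →ₗ[Scalar] M')
    (f : S' →ₐ[Scalar] Module.End Scalar M') :
    Subalgebra Scalar (HahnSeries ℤ (Module.End Scalar M) × HahnSeries ℤ S') where
  carrier := {Z | ∀ p w, T (Z.1.coeff p w) = f (Z.2.coeff p) (T w)}
  mul_mem' := fun {Z Y} hZ hY p w => by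
    rw [Prod.fst_mul, Prod.snd_mul,
      hahn_coeff_mul_order Z.1 Y.1 (min_le_left _ Z.2.order) (min_le_left _ Y.2.order),
      hahn_coeff_mul_order Z.2 Y.2 (min_le_right Z.1.order _) (min_le_right Y.1.order _),
      LinearMap.sum_apply, map_sum, map_sum, LinearMap.sum_apply]
    refine Finset.sum_congr rfl fun i _ => ?_
    rw [Module.End.mul_apply, hZ, hY, map_mul, Module.End.mul_apply]
  add_mem' := fun {Z Y} hZ hY p w => by
    rw [Prod.fst_add, Prod.snd_add, HahnSeries.coeff_add, HahnSeries.coeff_add, LinearMap.add_apply,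
      map_add, map_add, LinearMap.add_apply, hZ, hY]
  algebraMap_mem' := fun c p w => by
    rw [Algebra.algebraMap_eq_smul_one, Prod.smul_fst, Prod.smul_snd, Prod.fst_one, Prod.snd_one,
      HahnSeries.coeff_smul, HahnSeries.coeff_smul, HahnSeries.coeff_one, HahnSeries.coeff_one]
    split_ifs <;> simp

theorem mem_intertwiner {M M' S' : Type*} [AddCommGroup M] [Module Scalar M] [AddCommGroup M']
    [Module Scalar M'] [Ring S'] [Algebra Scalar S'] {T : M →ₗ[Scalar] M'}
    {f : S' →ₐ[Scalar] Module.End Scalar M'}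
    {Z : HahnSeries ℤ (Module.End Scalar M) × HahnSeries ℤ S'} :
    Z ∈ intertwiner T f ↔ ∀ p w, T (Z.1.coeff p w) = f (Z.2.coeff p) (T w) := Iff.rfl

theorem serreForm_mem (Q : Subalgebra Scalar S) (u : Scalar) {r : ℕ} {x : Fin r → S} {y : S}
    (hx : ∀ a, x a ∈ Q) (hy : y ∈ Q) : serreForm u r x y ∈ Q := by
  have := map_serreForm Q.val u r (fun a => ⟨x a, hx a⟩) ⟨y, hy⟩
  rw [show serreForm u r x y = serreForm u r (fun a => Q.val ⟨x a, hx a⟩) (Q.val ⟨y, hy⟩) from rfl,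
    ← this]
  exact Subtype.property _

theorem serreForm_prod {S' : Type*} [Ring S'] [Algebra Scalar S'] (u : Scalar) {r : ℕ}
    (x : Fin r → S) (y : S) (x' : Fin r → S') (y' : S') :
    serreForm u r (fun a => (x a, x' a)) (y, y') = (serreForm u r x y, serreForm u r x' y') :=
  Prod.ext (map_serreForm (AlgHom.fst Scalar S S') u r _ _)
    (map_serreForm (AlgHom.snd Scalar S S') u r _ _)

theorem expCoeff_mem (Q : Subalgebra Scalar S) {x : ℕ → S} (hx : ∀ s, x s ∈ Q) (n : ℕ) :
    expCoeff x n ∈ Q := by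
  have := map_expCoeff Q.val (fun s => ⟨x s, hx s⟩) n
  rw [show expCoeff x n = expCoeff (fun s => Q.val ⟨x s, hx s⟩) n from rfl, ← this]
  exact Subtype.property _

/-- The operators that preserve a submodule. -/
def stabilizer {M : Type*} [AddCommGroup M] [Module Scalar M] (W : Submodule Scalar M) :
    Subalgebra Scalar (Module.End Scalar M) where
  carrier := {T | ∀ w ∈ W, T w ∈ W}
  mul_mem' := fun hS hT w hw => hS _ (hT w hw)
  add_mem' := fun hS hT w hw => W.add_mem (hS w hw) (hT w hw)
  algebraMap_mem' := fun c w hw => by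
    rw [Module.algebraMap_end_apply]
    exact W.smul_mem c hw

/-! ### Convolution of currents -/

/-- The series `∑_{p ≥ 0} Θ_p w_{l-p} z ^ p`. -/
def conv (Θ w : ℤ → S) (l : ℤ) : HahnSeries ℤ S :=
  HahnSeries.ofSuppBddBelow (fun p => if 0 ≤ p then Θ p * w (l - p) else 0)
    ⟨0, fun _ hp => not_lt.1 fun h => hp (if_neg (not_le.2 h))⟩

variable {Θ Θ' w w' x : ℤ → S}

omit [Algebra Scalar S] in
theorem coeff_conv (hΘ : ∀ t < 0, Θ t = 0) (w : ℤ → S) (l p : ℤ) :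
    (conv Θ w l).coeff p = Θ p * w (l - p) := by
  have : (conv Θ w l).coeff p = if 0 ≤ p then Θ p * w (l - p) else 0 := rfl
  rw [this]
  split_ifs with h
  · rfl
  · rw [hΘ p (not_le.1 h), zero_mul]

theorem quad_single {c : Scalar} {X Y : ℤ → S} (h : Quad c X Y) :
    Quad c (fun l => HahnSeries.single l (X l)) (fun l => HahnSeries.single l (Y l)) := by
  intro l m
  simp only [HahnSeries.single_mul_single]
  rw [show m + (l + 1) = l + 1 + m by ring, show l + (m + 1) = l + 1 + m by ring,
    show m + 1 + l = l + 1 + m by ring]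
  ext p
  simp only [HahnSeries.coeff_sub, HahnSeries.coeff_smul, HahnSeries.coeff_single]
  split_ifs
  · exact h l m
  · simp

theorem quad_conv_single {c : Scalar} (hΘ : ∀ t < 0, Θ t = 0) (h : Quad c Θ x)
    (hw : ∀ l m, Commute (x l) (w m)) :
    Quad c (conv Θ w) (fun l => HahnSeries.single l (x l)) := by
  intro l m
  ext p
  simp only [HahnSeries.coeff_sub, HahnSeries.coeff_smul, HahnSeries.coeff_mul_single,
    HahnSeries.coeff_single_mul, coeff_conv hΘ]
  have e : l - (p - (m + 1)) = l + 1 - (p - m) := by ring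
  have h1 := h (p - (m + 1)) m
  rw [show p - (m + 1) + 1 = p - m by ring] at h1
  have h2 := congrArg (· * w (l + 1 - (p - m))) h1
  simp only [sub_mul, smul_mul_assoc] at h2
  rw [e, mul_assoc, mul_assoc, ← (hw _ _).eq, ← (hw _ _).eq, ← mul_assoc, ← mul_assoc, ← mul_assoc,
    ← mul_assoc, h2]

theorem quad_single_conv {c : Scalar} {ψ : ℤ → S} (hΘ : ∀ t < 0, Θ t = 0)
    (h : ∀ n, Quad c ψ fun l => Θ l * w n) :
    Quad c (fun l => HahnSeries.single l (ψ l)) (conv Θ w) := by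
  intro l m
  ext p
  simp only [HahnSeries.coeff_sub, HahnSeries.coeff_smul, HahnSeries.coeff_mul_single,
    HahnSeries.coeff_single_mul, coeff_conv hΘ]
  have h1 := h (m - (p - (l + 1))) l (p - (l + 1))
  rw [show p - (l + 1) + 1 = p - l by ring] at h1
  rw [show m + 1 - (p - l) = m - (p - (l + 1)) by ring]
  exact h1

omit [Algebra Scalar S] in
theorem coeff_conv_mul_conv (hΘ : ∀ t < 0, Θ t = 0) (hΘ' : ∀ t < 0, Θ' t = 0)
    (hc : ∀ s m, Commute (Θ' s) (w m)) (l m p : ℤ) :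
    (conv Θ w l * conv Θ' w' m).coeff p =
      ∑ i ∈ Finset.Icc 0 p, Θ i * Θ' (p - i) * (w (l - i) * w' (m - (p - i))) := by
  rw [hahn_coeff_mul (m := 0) (n := 0) (fun p hp => by rw [coeff_conv hΘ, hΘ p hp, zero_mul])
    (fun p hp => by rw [coeff_conv hΘ', hΘ' p hp, zero_mul]), sub_zero]
  refine Finset.sum_congr rfl fun i _ => ?_
  rw [coeff_conv hΘ, coeff_conv hΘ', mul_assoc, ← mul_assoc (w _), ← (hc _ _).eq]
  simp only [mul_assoc]

theorem quad_conv_conv {c : Scalar} (hΘ : ∀ t < 0, Θ t = 0) (hΘ' : ∀ t < 0, Θ' t = 0)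
    (hΘΘ : ∀ s t, Commute (Θ s) (Θ' t)) (h1 : ∀ s m, Commute (Θ s) (w' m))
    (h2 : ∀ s m, Commute (Θ' s) (w m)) (h : Quad c w w') : Quad c (conv Θ w) (conv Θ' w') := by
  have e : ∀ l m p, (conv Θ' w' m * conv Θ w l).coeff p =
      ∑ i ∈ Finset.Icc 0 p, Θ i * Θ' (p - i) * (w' (m - (p - i)) * w (l - i)) := by
    intro l m p
    rw [coeff_conv_mul_conv hΘ' hΘ h1]
    refine Finset.sum_nbij' (fun i => p - i) (fun i => p - i) (fun i hi => ?_) (fun i hi => ?_)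
      (fun i _ => sub_sub_cancel _ _) (fun i _ => sub_sub_cancel _ _) fun i _ => ?_
    · rw [Finset.mem_Icc] at hi ⊢; omega
    · rw [Finset.mem_Icc] at hi ⊢; omega
    · rw [sub_sub_cancel, (hΘΘ _ _).eq]
  intro l m
  ext p
  simp only [HahnSeries.coeff_sub, HahnSeries.coeff_smul, e, coeff_conv_mul_conv hΘ hΘ' h2,
    Finset.smul_sum, ← Finset.sum_sub_distrib]
  refine Finset.sum_congr rfl fun i _ => ?_
  have h3 := congrArg (Θ i * Θ' (p - i) * ·) (h (l - i) (m - (p - i)))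
  simp only [mul_sub, mul_smul_comm] at h3
  rw [show l + 1 - i = l - i + 1 by ring, show m + 1 - (p - i) = m - (p - i) + 1 by ring]
  exact h3

end Hahn

/-! ### The sum of two families of currents -/

section Single

variable {S : Type*} [Ring S] [Algebra Scalar S]

variable (S) in
/-- The constant series. -/
def hahnC : S →ₐ[Scalar] HahnSeries ℤ S :=
  { (HahnSeries.C : S →+* HahnSeries ℤ S) with commutes' := fun _ => rfl }

omit [Algebra Scalar S] in
theorem commute_single_one (l : ℤ) (f : HahnSeries ℤ S) : Commute (HahnSeries.single l 1) f := by
  ext p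
  rw [HahnSeries.coeff_single_mul, HahnSeries.coeff_mul_single, one_mul, mul_one]

/-- Marking the mode `l` by `z ^ l` is multiplication by a central factor of the kind treated in
`IsCurrents.central_mul`. -/
theorem IsCurrents.single {ι : Type*} {A : Matrix ι ι ℤ} {d : ι → ℕ} {x : ι → ℤ → S}
    (h : IsCurrents A d x) : IsCurrents A d fun i l => HahnSeries.single l (x i l) := by
  have h1 := (h.map (hahnC S)).central_mul (fun _ l => HahnSeries.single l 1)
    (fun _ l f => commute_single_one l f) fun i j l m => by
      rw [HahnSeries.single_mul_single, HahnSeries.single_mul_single, add_right_comm, add_assoc]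
  have h2 : ∀ i l, HahnSeries.single l 1 * hahnC S (x i l) = HahnSeries.single l (x i l) := by
    intro i l
    change HahnSeries.single l 1 * HahnSeries.single 0 (x i l) = _
    rw [HahnSeries.single_mul_single, add_zero, one_mul]
  simpa only [h2] using h1

end Single

section Combined

variable {ι : Type*} {A : Matrix ι ι ℤ} {d : ι → ℕ}
  {M : Type*} [AddCommGroup M] [Module Scalar M]

/-- Operators on a tensor product: `x_{i,l}` on the first factor, `y_{i,l}` on the second one, and
Cartan currents `Θ_i` on the first factor. -/
structure IsTensorCurrents (A : Matrix ι ι ℤ) (d : ι → ℕ) (x Θ y : ι → ℤ → Module.End Scalar M) :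
    Prop where
  left : IsCurrents A d x
  right : IsCurrents A d fun i => conv (Θ i) (y i)
  quad : ∀ i j, Quad (v ^ bMat A d i j) (Θ i) (x j)
  vanish : ∀ i, ∀ t < 0, Θ i t = 0
  comm : ∀ i j s t, Commute (Θ i s) (Θ j t)
  comm_right : ∀ i j s l, Commute (Θ i s) (y j l)
  left_right : ∀ i j l m, Commute (x i l) (y j m)

/-- The current `x_{i,l} + ∑_{p ≥ 0} Θ_{i,p} y_{i,l-p}`. -/
def combined (x Θ y : ι → ℤ → Module.End Scalar M) (i : ι) (l : ℤ) :
    HahnSeries ℤ (Module.End Scalar M) :=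
  HahnSeries.single l (x i l) + conv (Θ i) (y i) l

namespace IsTensorCurrents

variable {x Θ y : ι → ℤ → Module.End Scalar M} (D : IsTensorCurrents A d x Θ y)
include D

theorem quad_left (i j : ι) : Quad (v ^ bMat A d i j) (fun l => HahnSeries.single l (x i l))
    (fun l => HahnSeries.single l (x j l)) := quad_single (D.left.quad i j)

theorem quad_right_left (i j : ι) : Quad (v ^ bMat A d i j) (conv (Θ i) (y i))
    (fun l => HahnSeries.single l (x j l)) :=
  quad_conv_single (D.vanish i) (D.quad i j) fun _ _ => D.left_right _ _ _ _

theorem quad_combined_left (i j : ι) : Quad (v ^ bMat A d i j) (combined x Θ y i)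
    (fun l => HahnSeries.single l (x j l)) :=
  (D.quad_left i j).add (D.quad_right_left i j)

theorem quad_combined_right (hA : IsSymmetrizableGCM A d) (i j : ι) :
    Quad (v ^ bMat A d i j) (combined x Θ y i) (conv (Θ j) (y j)) :=
  Quad.add (by rw [hA.bMat_symm]; exact (D.quad_right_left j i).symm) (D.right.quad i j)

/-- Both summands satisfy the relation among themselves, and the mixed relation comes from the one
between the Cartan current and `x`; since `Quad` is bilinear, nothing else is needed. The Serre
relation has no such additivity and takes the two arguments that follow. -/
theorem quad_combined (hA : IsSymmetrizableGCM A d) (i j : ι) :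
    Quad (v ^ bMat A d i j) (combined x Θ y i) (combined x Θ y j) :=
  ((D.quad_combined_left i j).symm.add (D.quad_combined_right hA i j).symm).symm

theorem coeff_combined (i : ι) (l p : ℤ) :
    (combined x Θ y i l).coeff p = (if p = l then x i l else 0) + Θ i p * y i (l - p) := by
  rw [combined, HahnSeries.coeff_add, coeff_conv (D.vanish i), HahnSeries.coeff_single]
  congr

omit [AddCommGroup M] [Module Scalar M] D in
theorem _root_.QuantumLoop.geom_sum_ne_zero (hA : IsSymmetrizableGCM A d) (i : ι) (k : ℕ) :
    ∑ j ∈ Finset.range (k + 1), (v ^ bMat A d i i) ^ j ≠ 0 ∧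
      ∑ j ∈ Finset.range (k + 1), (v ^ (-bMat A d i i)) ^ j ≠ 0 := by
  have h : Generic (v ^ bMat A d i i) := by
    rw [hA.v_pow_bMat_self]
    exact (hA.generic i).pow two_pos
  refine ⟨h.geom_sum_ne_zero (Nat.succ_pos k), ?_⟩
  rw [zpow_neg]
  exact h.inv.geom_sum_ne_zero (Nat.succ_pos k)

/-- The Serre relations with the last factor in the first component. -/
theorem serre_left (hA : IsSymmetrizableGCM A d) [DecidableEq ι] {i j : ι} (hij : i ≠ j) {r : ℕ}
    (hr : (r : ℤ) = 1 - A i j) (hy : IsCurrents A d y) {ρ φ : ℤ → Module.End Scalar M}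
    (hρx : ∀ m j l, Commute (ρ m) (x j l)) (hρΘ : ∀ m j t, Commute (ρ m) (Θ j t))
    (hρy : ∀ m j l, ρ m * y j l = y j l * ρ m + if j = i then φ (l + m) else 0)
    (hφ : ∀ t < 0, φ t = 0) (hφy : ∀ j, Quad (v ^ bMat A d i j) φ (y j))
    (hφx : ∀ t j l, Commute (x j l) (φ t)) (hφΘ : ∀ t j s, Commute (Θ j s) (φ t))
    (hφ0 : ∀ l, y i l * φ 0 = v ^ bMat A d i i • (φ 0 * y i l)) (hinj : Function.Injective (φ 0))
    {C : Submodule Scalar M} (hCx : ∀ j l, ∀ w ∈ C, x j l w ∈ C) (hCΘ : ∀ j t, ∀ w ∈ C, Θ j t w ∈ C)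
    (hCρ : ∀ m, ∀ w ∈ C, ρ m w = 0) {ε : Module.End Scalar M} (hεx : ∀ j l, Commute ε (x j l))
    (hεΘ : ∀ j t, Commute ε (Θ j t)) (hεy : ∀ l, ε * y i l = 0) (hεC : ∀ w ∈ C, ε w = w)
    (l : Fin r → ℤ) (m p : ℤ) {w : M} (hw : w ∈ C) :
    (serreForm (v ^ d i) r (fun a => combined x Θ y i (l a))
      (HahnSeries.single m (x j m))).coeff p w = 0 := by
  set Z := serreForm (v ^ d i) r (fun a => combined x Θ y i (l a)) (HahnSeries.single m (x j m)) with hZ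
  -- The index is reversed so that `φ (l + m)` acquires the form `ψ (m - l)` asked for by
  -- `mem_of_annihilated`.
  set W := wordSpan C (fun l => y i (-l)) Set.univ with hW
  have hWcomm : ∀ T : Module.End Scalar M, (∀ w ∈ C, T w ∈ C) → (∀ l, Commute T (y i l)) →
      T ∈ stabilizer W := by
    intro T h1 h2 w hw
    refine wordSpan_le (P := W.comap T) (fun w hw => le_wordSpan (h1 w hw)) (fun l _ w hw => ?_) hw
    have := DFunLike.congr_fun (h2 (-l)).eq w
    change T (y i (-l) w) ∈ W
    rw [← Module.End.mul_apply, this]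
    exact map_mem_wordSpan (Set.mem_univ l) hw
  have hyW : ∀ l, y i l ∈ stabilizer W := fun l w hw => by
    have := map_mem_wordSpan (e := fun l => y i (-l)) (Set.mem_univ (-l)) hw
    rwa [neg_neg] at this
  have hZW : Z ∈ hahnSubalgebra (stabilizer W) := by
    refine serreForm_mem _ _ (fun a p => ?_) fun p => ?_
    · rw [D.coeff_combined]
      refine Subalgebra.add_mem _ ?_ (Subalgebra.mul_mem _ (hWcomm _ (hCΘ i p) fun _ =>
        D.comm_right _ _ _ _) (hyW _))
      split_ifs
      · exact hWcomm _ (hCx _ _) fun _ => D.left_right _ _ _ _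
      · exact Subalgebra.zero_mem _
    · rw [HahnSeries.coeff_single]
      split_ifs
      · exact hWcomm _ (hCx _ _) fun _ => D.left_right _ _ _ _
      · exact Subalgebra.zero_mem _
  -- Bracketing with `ρ k` sends the repeated current to the one-sided current `conv (Θ i) φ` and
  -- kills the last letter, so the bracket of `Z` vanishes by `snd_serreForm_deform`.
  have hbr : ∀ k, HahnSeries.single 0 (ρ k) * Z - Z * HahnSeries.single 0 (ρ k) = 0 := by
    intro k
    rw [hZ, bracket_serreForm]
    have e1 : ∀ l, HahnSeries.single 0 (ρ k) * combined x Θ y i l -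
        combined x Θ y i l * HahnSeries.single 0 (ρ k) = conv (Θ i) φ (l + k) := by
      intro l
      ext p : 2
      rw [HahnSeries.coeff_sub, HahnSeries.coeff_single_zero_mul, HahnSeries.coeff_mul_single_zero,
        D.coeff_combined, mul_add, add_mul, ← mul_assoc, (hρΘ k i p).eq, mul_assoc, hρy, if_pos rfl,
        coeff_conv (D.vanish i), mul_add, mul_assoc, sub_add_eq_add_sub]
      split_ifs
      · rw [(hρx k i l).eq]; abel
      · rw [mul_zero, zero_mul]; abel
    have e2 : HahnSeries.single 0 (ρ k) * HahnSeries.single m (x j m) -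
        HahnSeries.single m (x j m) * HahnSeries.single 0 (ρ k) = 0 := by
      rw [HahnSeries.single_mul_single, HahnSeries.single_mul_single, (hρx k j m).eq, add_comm,
        sub_self]
    simp only [e1, e2]
    refine snd_serreForm_deform hA hij hr (ψ := fun l => conv (Θ i) φ (l + k))
      (D.quad_combined hA i i) (D.quad_combined_left i j) ?_ ?_ (Or.inr ⟨-k, fun l hl => ?_⟩) l m
    · refine Quad.shift (Quad.symm (Quad.add ?_ ?_)) k
      · exact (quad_conv_single (D.vanish i) (D.quad i i) fun _ _ => hφx _ _ _).symm
      · exact (quad_conv_conv (D.vanish i) (D.vanish i) (D.comm i i) (D.comm_right i i)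
          (fun s t => hφΘ t i s) (hφy i)).symm
    · exact Quad.shift (quad_conv_single (D.vanish i) (D.quad i j) fun _ _ => hφx _ _ _) k
    · ext p : 2
      rw [coeff_conv (D.vanish i), HahnSeries.coeff_zero]
      rcases lt_or_ge p 0 with hp | hp
      · rw [D.vanish i p hp, zero_mul]
      · rw [hφ _ (by omega), mul_zero]
  have hρZ : ∀ k, ρ k (Z.coeff p w) = 0 := by
    intro k
    have h1 := DFunLike.congr_fun (congrArg (fun f => HahnSeries.coeff f p) (hbr k)) w
    simp only [HahnSeries.coeff_sub, HahnSeries.coeff_single_zero_mul,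
      HahnSeries.coeff_mul_single_zero, HahnSeries.coeff_zero, LinearMap.sub_apply,
      Module.End.mul_apply, hCρ k w hw, map_zero, sub_zero, LinearMap.zero_apply] at h1
    exact h1
  have hZC : Z.coeff p w ∈ C := by
    refine mem_of_annihilated (c := (v ^ bMat A d i i)⁻¹) (g := v ^ bMat A d i i)
      (inv_ne_zero (v_zpow_ne_zero _)) ((hy.quad i i).neg_index (v_zpow_ne_zero _)) (ρ := ρ) (ψ := φ)
      (fun m l => ?_) hφ (fun l => hφ0 _) hinj (fun k => (geom_sum_ne_zero hA i k).1) hCρ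
      (hZW p w (le_wordSpan hw)) hρZ
    rw [hρy, if_pos rfl, neg_add_eq_sub]
  -- `ε` kills `y i` and commutes with the other operators, so it intertwines `Z` with the Serre
  -- expression in the `x` alone, which is zero. As `ε` fixes `C`, where `Z.coeff p w` lies, that
  -- vector is zero.
  have hpair : ((Z, 0) : HahnSeries ℤ (Module.End Scalar M) × HahnSeries ℤ (Module.End Scalar M)) ∈
      intertwiner ε (AlgHom.id Scalar _) := by
    have h0 : serreForm (v ^ d i) r (fun a => HahnSeries.single (l a) (x i (l a)))
        (HahnSeries.single m (x j m)) = 0 :=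
      D.left.single.serre i j hij r hr l m
    rw [hZ, ← h0, ← serreForm_prod]
    refine serreForm_mem _ _ (fun a q u => ?_) fun q u => ?_
    · rw [D.coeff_combined, HahnSeries.coeff_single, LinearMap.add_apply, map_add,
        Module.End.mul_apply]
      have h1 := DFunLike.congr_fun (hεΘ i q).eq (y i (l a - q) u)
      have h2 := DFunLike.congr_fun (hεy (l a - q)) u
      have h3 := DFunLike.congr_fun (hεx i (l a)).eq u
      simp only [Module.End.mul_apply, LinearMap.zero_apply] at h1 h2 h3
      rw [h1, h2, map_zero, add_zero]
      split_ifs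
      · exact h3
      · simp
    · have h3 := DFunLike.congr_fun (hεx j m).eq u
      simp only [HahnSeries.coeff_single]
      split_ifs
      · exact h3
      · simp
  have h5 := (mem_intertwiner.1 hpair) p w
  simp only [HahnSeries.coeff_zero, map_zero, LinearMap.zero_apply] at h5
  rw [← hεC _ hZC, h5]

/-- The Serre relations with the last factor in the second component. -/
theorem serre_right (hA : IsSymmetrizableGCM A d) [DecidableEq ι] {i j : ι} (hij : i ≠ j) {r : ℕ}
    (hr : (r : ℤ) = 1 - A i j) {ρ ψ : ℤ → Module.End Scalar M}
    (hρx : ∀ m j l, ρ m * x j l = x j l * ρ m + if j = i then ψ (l - m) else 0)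
    (hρy : ∀ m j t n, Commute (ρ m) (Θ j t * y j n)) (hψ : ∀ t, 0 < t → ψ t = 0)
    (hψx : ∀ j, Quad (v ^ bMat A d i j) ψ (x j))
    (hψy : ∀ j n, Quad (v ^ bMat A d i j) ψ fun l => Θ j l * y j n)
    (hψ0 : ∀ l, x i l * ψ 0 = v ^ (-bMat A d i i) • (ψ 0 * x i l)) (hinj : Function.Injective (ψ 0))
    {C : Submodule Scalar M} (hWΘ : ∀ j t, Θ j t ∈ stabilizer (wordSpan C (x i) Set.univ))
    (hWy : ∀ j l, y j l ∈ stabilizer (wordSpan C (x i) Set.univ))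
    (hCρ : ∀ m, ∀ w ∈ C, ρ m w = 0) {ε : Module.End Scalar M} (hεx : ∀ l, ε * x i l = 0)
    (hεΘ : ∀ j t, Commute ε (Θ j t)) (hεy : ∀ j l, Commute ε (y j l)) (hεC : ∀ w ∈ C, ε w = w)
    (l : Fin r → ℤ) (m p : ℤ) {w : M} (hw : w ∈ C) :
    (serreForm (v ^ d i) r (fun a => combined x Θ y i (l a)) (conv (Θ j) (y j) m)).coeff p w = 0 := by
  set Z := serreForm (v ^ d i) r (fun a => combined x Θ y i (l a)) (conv (Θ j) (y j) m) with hZ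
  set W := wordSpan C (x i) Set.univ with hW
  have hZW : Z ∈ hahnSubalgebra (stabilizer W) := by
    refine serreForm_mem _ _ (fun a p => ?_) fun p => ?_
    · rw [D.coeff_combined]
      refine Subalgebra.add_mem _ ?_ (Subalgebra.mul_mem _ (hWΘ _ _) (hWy _ _))
      split_ifs
      · exact fun w hw => map_mem_wordSpan (Set.mem_univ _) hw
      · exact Subalgebra.zero_mem _
    · rw [coeff_conv (D.vanish j)]
      exact Subalgebra.mul_mem _ (hWΘ _ _) (hWy _ _)
  have hbr : ∀ k, HahnSeries.single 0 (ρ k) * Z - Z * HahnSeries.single 0 (ρ k) = 0 := by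
    intro k
    rw [hZ, bracket_serreForm]
    -- Here `ρ k` commutes with the products `Θ y`, so only the first-factor current contributes;
    -- the result vanishes for `l > k`, on the side opposite to that in `serre_left`.
    have e1 : ∀ l, HahnSeries.single 0 (ρ k) * combined x Θ y i l -
        combined x Θ y i l * HahnSeries.single 0 (ρ k) = HahnSeries.single l (ψ (l - k)) := by
      intro l
      ext p : 2
      rw [HahnSeries.coeff_sub, HahnSeries.coeff_single_zero_mul, HahnSeries.coeff_mul_single_zero,
        D.coeff_combined, mul_add, add_mul, (hρy k i p (l - p)).eq, HahnSeries.coeff_single]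
      split_ifs
      · rw [hρx, if_pos rfl]; abel
      · rw [mul_zero, zero_mul]; abel
    have e2 : HahnSeries.single 0 (ρ k) * conv (Θ j) (y j) m -
        conv (Θ j) (y j) m * HahnSeries.single 0 (ρ k) = 0 := by
      ext p : 2
      rw [HahnSeries.coeff_sub, HahnSeries.coeff_single_zero_mul, HahnSeries.coeff_mul_single_zero,
        coeff_conv (D.vanish j), (hρy k j p (m - p)).eq, sub_self, HahnSeries.coeff_zero]
    simp only [e1, e2]
    have hψk : ∀ j, Quad (v ^ bMat A d i j) (fun l => ψ (l - k)) (x j) := fun j =>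
      (hψx j).shift (-k)
    have hψk' : ∀ j n, Quad (v ^ bMat A d i j) (fun l => ψ (l - k)) fun l => Θ j l * y j n :=
      fun j n => (hψy j n).shift (-k)
    refine snd_serreForm_deform hA hij hr (ψ := fun l => HahnSeries.single l (ψ (l - k)))
      (D.quad_combined hA i i) (D.quad_combined_right hA i j) ?_ ?_ (Or.inl ⟨k, fun l hl => ?_⟩) l m
    · exact (Quad.add (quad_single (hψk i)).symm
        (quad_single_conv (D.vanish i) (hψk' i)).symm).symm
    · exact quad_single_conv (D.vanish j) (hψk' j)
    · change HahnSeries.single l (ψ (l - k)) = 0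
      rw [hψ _ (by omega), HahnSeries.single_eq_zero]
  have hρZ : ∀ k, ρ k (Z.coeff p w) = 0 := by
    intro k
    have h1 := DFunLike.congr_fun (congrArg (fun f => HahnSeries.coeff f p) (hbr k)) w
    simp only [HahnSeries.coeff_sub, HahnSeries.coeff_single_zero_mul,
      HahnSeries.coeff_mul_single_zero, HahnSeries.coeff_zero, LinearMap.sub_apply,
      Module.End.mul_apply, hCρ k w hw, map_zero, sub_zero, LinearMap.zero_apply] at h1
    exact h1
  have hZC : Z.coeff p w ∈ C := by
    refine mem_of_annihilated (c := v ^ bMat A d i i) (g := v ^ (-bMat A d i i))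
      (v_zpow_ne_zero _) (D.left.quad i i) (ρ := ρ) (ψ := fun t => ψ (-t))
      (fun m l => ?_) (fun t ht => hψ _ (by omega)) (fun l => hψ0 _) hinj
      (fun k => (geom_sum_ne_zero hA i k).2) hCρ (hZW p w (le_wordSpan hw)) hρZ
    rw [hρx, if_pos rfl, neg_sub]
  -- Now `ε` kills `x i`, and what it leaves of `Z` is the Serre expression of the dressed currents,
  -- zero by assumption.
  have hpair : ((Z, 0) : HahnSeries ℤ (Module.End Scalar M) × HahnSeries ℤ (Module.End Scalar M)) ∈
      intertwiner ε (AlgHom.id Scalar _) := by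
    have h0 : serreForm (v ^ d i) r (fun a => conv (Θ i) (y i) (l a)) (conv (Θ j) (y j) m) = 0 :=
      D.right.serre i j hij r hr l m
    have h6 : ∀ j q n u, ε (Θ j q (y j n u)) = Θ j q (y j n (ε u)) := by
      intro j q n u
      have h1 := DFunLike.congr_fun (hεΘ j q).eq (y j n u)
      have h2 := DFunLike.congr_fun (hεy j n).eq u
      simp only [Module.End.mul_apply] at h1 h2
      rw [h1, h2]
    rw [hZ, ← h0, ← serreForm_prod]
    refine serreForm_mem _ _ (fun a q u => ?_) fun q u => ?_
    · rw [D.coeff_combined, coeff_conv (D.vanish i), LinearMap.add_apply, map_add,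
        Module.End.mul_apply, h6]
      have h2 := DFunLike.congr_fun (hεx (l a)) u
      split_ifs
      · exact add_eq_right.2 h2
      · simp
    · simp only [coeff_conv (D.vanish j)]
      exact h6 _ _ _ _
  have h5 := (mem_intertwiner.1 hpair) p w
  simp only [HahnSeries.coeff_zero, map_zero, LinearMap.zero_apply] at h5
  rw [← hεC _ hZC, h5]

end IsTensorCurrents

end Combined

/-! ### Dressing a family of currents by Cartan currents. -/

section Dressing

variable {S : Type*} [Ring S] [Algebra Scalar S] {ι : Type*} {A : Matrix ι ι ℤ} {d : ι → ℕ}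

theorem IsCurrents.of_injective {T : Type*} [Ring T] [Algebra Scalar T] {X : ι → ℤ → S}
    {f : S →ₐ[Scalar] T} (hf : Function.Injective f) (h : IsCurrents A d fun i l => f (X i l)) :
    IsCurrents A d X where
  quad i j l m := hf (by
    have := h.quad i j l m
    simpa only [map_sub, map_mul, map_smul] using this)
  serre i j hij r hr l l' := hf (by
    rw [map_serreSum, map_zero]
    exact h.serre i j hij r hr l l')

/-- Inside the centralizer of the `k i` these elements are central, so `IsCurrents.central_mul`
applies there. -/
theorem IsCurrents.commute_mul {X : ι → ℤ → S} (h : IsCurrents A d X) (k : ι → S)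
    (hk : ∀ i j, Commute (k i) (k j)) (hX : ∀ i j l, Commute (k i) (X j l)) :
    IsCurrents A d (fun i l => k i * X i l) := by
  set Q := Subalgebra.centralizer Scalar (Set.range k) with hQ
  have hmem : ∀ {x : S}, (∀ i, Commute (k i) x) → x ∈ Q := fun {x} hx =>
    (Subalgebra.mem_centralizer_iff Scalar).2 (by rintro _ ⟨i, rfl⟩; exact hx i)
  have h1 : IsCurrents A d fun i l => (⟨X i l, hmem fun j => hX j i l⟩ : Q) :=
    IsCurrents.of_injective (f := Q.val) Subtype.val_injective h
  exact (h1.central_mul (fun i _ => ⟨k i, hmem fun j => hk j i⟩) (fun i _ b => Subtype.ext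
    ((Subalgebra.mem_centralizer_iff Scalar).1 b.2 _ ⟨i, rfl⟩)) fun _ _ _ _ => rfl).map Q.val

/-- Conjugation by the exponential of commuting elements. -/
def conjExp (h : ℕ → S) (hh : ∀ s t, Commute (h s) (h t)) : S →ₐ[Scalar] PowerSeries S where
  toFun x := expSeries h * PowerSeries.C x * expSeries (-h)
  map_one' := by rw [map_one, mul_one, expSeries_mul_neg hh]
  map_zero' := by rw [map_zero, mul_zero, zero_mul]
  map_add' x y := by rw [map_add, mul_add, add_mul]
  map_mul' x y := by
    have h1 : expSeries (-h) * expSeries h = 1 := by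
      have := expSeries_mul_neg (x := -h) fun s t => (hh s t).neg_left.neg_right
      rwa [neg_neg] at this
    rw [map_mul, mul_assoc _ (expSeries (-h)), ← mul_assoc (expSeries (-h)),
      ← mul_assoc (expSeries (-h)), h1]
    noncomm_ring
  commutes' c := by
    have h1 : PowerSeries.C (algebraMap Scalar S c) = algebraMap Scalar (PowerSeries S) c := by
      rw [Algebra.algebraMap_eq_smul_one, Algebra.algebraMap_eq_smul_one]
      ext n
      rcases n with - | n <;> simp [PowerSeries.coeff_C, PowerSeries.coeff_one]
    rw [h1, ← Algebra.commutes, mul_assoc, expSeries_mul_neg hh, mul_one]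

/-- With `h_s = ∑_j η_{j,s} D_{j,s}` one has `[h_s, y_{i,l}] = η_{i,s} y_{i,l-s}`, so conjugation by
the exponential of `h` multiplies the current `y_i` by the exponential of `η_i`. The dressed family
is thus the image of `y` under an algebra map and inherits all relations. -/
theorem isCurrents_conv_exp [Fintype ι] [DecidableEq ι] {y : ι → ℤ → S} (hy : IsCurrents A d y)
    {η D : ι → ℕ → S} (hη : ∀ i j s t, Commute (η i s) (η j t))
    (hD : ∀ i j s t, Commute (D i s) (D j t)) (hηD : ∀ i j s t, Commute (η i s) (D j t))
    (hηy : ∀ i j s l, Commute (η i s) (y j l))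
    (hDy : ∀ j s i l, D j s * y i l - y i l * D j s = if i = j then y i (l - s) else 0) :
    IsCurrents A d fun i => conv (plusCurrent 1 (η i)) (y i) := by
  set h : ℕ → S := fun s => ∑ j, η j s * D j s with hh
  have hc : ∀ s t, Commute (h s) (h t) := fun s t =>
    Commute.sum_left _ _ _ fun i _ => Commute.sum_right _ _ _ fun j _ =>
      ((hη i j s t).mul_right (hηD i j s t)).mul_left
        ((hηD j i t s).symm.mul_right (hD i j s t))
  have hηh : ∀ i s t, Commute (h s) (η i t) := fun i s t =>
    Commute.sum_left _ _ _ fun j _ => (hη j i s t).mul_left (hηD i j t s).symm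
  have hX : ∀ i s l, h s * y i l - y i l * h s = η i s * y i (l - s) := by
    intro i s l
    rw [hh, Finset.sum_mul, Finset.mul_sum, ← Finset.sum_sub_distrib, Finset.sum_eq_single i]
    · rw [← mul_assoc, ← (hηy i i s l).eq, mul_assoc, mul_assoc, ← mul_sub, hDy, if_pos rfl]
    · intro j _ hj
      rw [← mul_assoc, ← (hηy j i s l).eq, mul_assoc, mul_assoc, ← mul_sub, hDy,
        if_neg (Ne.symm hj), mul_zero]
    · simp
  have hconj : ∀ i l, conjExp h hc (y i l) =
      PowerSeries.mk fun p => expCoeff (η i) p * y i (l - p) := by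
    intro i l
    set W : PowerSeries S := PowerSeries.mk fun p => expCoeff (η i) p * y i (l - p) with hW
    have h1 : expSeries h * PowerSeries.C (y i l) = W * expSeries h := by
      ext n
      have h2 := expCoeff_mul_current (X := fun l => y i (-l)) hc (hη i i) (fun s t => hηh i s t)
        (fun s _ l => by
          rw [hX, show -l - (s : ℤ) = -(l + s) by ring]) n (-l)
      rw [neg_neg] at h2
      rw [PowerSeries.coeff_mul_C, coeff_expSeries, h2, PowerSeries.coeff_mul]
      refine Finset.sum_congr rfl fun p _ => ?_
      rw [hW, PowerSeries.coeff_mk, coeff_expSeries, show -(-l + (p.1 : ℤ)) = l - p.1 by ring]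
    change expSeries h * PowerSeries.C (y i l) * expSeries (-h) = W
    rw [h1, mul_assoc, expSeries_mul_neg hc, mul_one]
  have h3 := (hy.map (conjExp h hc)).map (HahnSeries.ofPowerSeriesAlg ℤ Scalar (A := S))
  have h4 : (fun i => conv (plusCurrent 1 (η i)) (y i)) =
      fun i l => HahnSeries.ofPowerSeriesAlg ℤ Scalar (conjExp h hc (y i l)) := by
    funext i l
    rw [hconj]
    ext p
    rw [coeff_conv fun t ht => plusCurrent_neg _ _ ht]
    change _ = (HahnSeries.ofPowerSeries ℤ S _).coeff p
    rcases lt_or_ge p 0 with hp | hp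
    · rw [plusCurrent_neg _ _ hp, zero_mul, HahnSeries.ofPowerSeries_apply,
        HahnSeries.embDomain_of_notMem_range]
      rintro ⟨n, rfl⟩
      simp at hp
      omega
    · lift p to ℕ using hp
      rw [HahnSeries.ofPowerSeries_apply_coeff, plusCurrent_natCast, one_mul, PowerSeries.coeff_mk]
  rw [h4]
  exact h3

theorem isCurrents_conv_plusCurrent [Fintype ι] [DecidableEq ι] {y : ι → ℤ → S}
    (hy : IsCurrents A d y) {k : ι → S} {η D : ι → ℕ → S}
    (hη : ∀ i j s t, Commute (η i s) (η j t))
    (hD : ∀ i j s t, Commute (D i s) (D j t)) (hηD : ∀ i j s t, Commute (η i s) (D j t))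
    (hηy : ∀ i j s l, Commute (η i s) (y j l))
    (hDy : ∀ j s i l, D j s * y i l - y i l * D j s = if i = j then y i (l - s) else 0)
    (hk : ∀ i j, Commute (k i) (k j)) (hkη : ∀ i j s, Commute (k i) (η j s))
    (hky : ∀ i j l, Commute (k i) (y j l)) :
    IsCurrents A d fun i => conv (plusCurrent (k i) (η i)) (y i) := by
  have h1 : ∀ i t, t < 0 → plusCurrent (1 : S) (η i) t = 0 := fun i t ht => plusCurrent_neg _ _ ht
  have h2 : ∀ i t, plusCurrent (k i) (η i) t = k i * plusCurrent 1 (η i) t := fun i t => by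
    unfold plusCurrent; split_ifs <;> simp
  have h4 : ∀ i l, conv (plusCurrent (k i) (η i)) (y i) l =
      HahnSeries.single 0 (k i) * conv (plusCurrent 1 (η i)) (y i) l := fun i l => by
    ext p
    rw [HahnSeries.coeff_single_zero_mul, coeff_conv (h1 i),
      coeff_conv (fun t ht => plusCurrent_neg _ _ ht), h2, mul_assoc]
  have h5 := (isCurrents_conv_exp hy hη hD hηD hηy hDy).commute_mul
    (fun i => HahnSeries.single 0 (k i)) (fun i j => by
      rw [Commute, SemiconjBy, HahnSeries.single_mul_single, HahnSeries.single_mul_single,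
        (hk i j).eq])
    fun i j l => by
      ext p
      rw [HahnSeries.coeff_single_zero_mul, HahnSeries.coeff_mul_single_zero, coeff_conv (h1 j)]
      exact (commute_plusCurrent (hη j j) (Commute.one_right _) (hkη i j) p).mul_right (hky i j _)
  simpa only [← h4] using h5

end Dressing

/-! ### Exchange rules between single elements and Cartan currents. -/

section General

variable {S T : Type*} [Ring S] [Algebra Scalar S] [Ring T] [Algebra Scalar T]

theorem map_plusCurrent (f : S →ₐ[Scalar] T) (K : S) (h : ℕ → S) (l : ℤ) :
    f (plusCurrent K h l) = plusCurrent (f K) (fun s => f (h s)) l := by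
  unfold plusCurrent
  split_ifs
  · rw [map_mul, map_expCoeff]
  · exact map_zero f

theorem Quad.mul_commute {c : Scalar} {X Y : ℤ → S} (h : Quad c X Y) {k : S}
    (hk : ∀ m, Commute k (Y m)) : Quad c (fun l => X l * k) Y := by
  intro l m
  have := congrArg (· * k) (h l m)
  simp only [sub_mul, smul_mul_assoc] at this
  rw [mul_assoc, mul_assoc (X l), (hk m).eq, (hk (m + 1)).eq]
  simpa only [mul_assoc] using this

theorem mul_plusCurrent_semi {Y K : S} {h : ℕ → S} (hh : ∀ s t, Commute (h s) (h t)) {g : Scalar}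
    (hK : Y * K = g • (K * Y)) (hY : ∀ s, Commute Y (h s)) (l : ℤ) :
    Y * plusCurrent K h l = g • (plusCurrent K h l * Y) := by
  unfold plusCurrent
  split_ifs
  · rw [← mul_assoc, hK, smul_mul_assoc, mul_assoc, (expCoeff_commute_right hh hY _).eq, mul_assoc]
  · simp

theorem mul_plusCurrent_central {K Y : S} {h : ℕ → S} (hh : ∀ s t, Commute (h s) (h t))
    (hK : Commute Y K) {c : Scalar} {s : ℕ} (hs : 0 < s)
    (hY : ∀ t, Y * h t = h t * Y + if t = s then c • (1 : S) else 0) (l : ℤ) :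
    Y * plusCurrent K h l = plusCurrent K h l * Y + c • plusCurrent K h (l - s) := by
  rcases lt_or_ge l 0 with hl | hl
  · rw [plusCurrent_neg _ _ hl, plusCurrent_neg _ _ (by omega)]; simp
  · lift l to ℕ using hl with n
    rw [plusCurrent_natCast, ← mul_assoc, hK.eq, mul_assoc, mul_expCoeff_central hh hs hY, mul_add,
      mul_assoc]
    congr 1
    split_ifs with h
    · rw [mul_smul_comm, show (n : ℤ) - s = ((n - s : ℕ) : ℤ) by omega, plusCurrent_natCast]
    · rw [mul_zero, plusCurrent_neg _ _ (by omega), smul_zero]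

end General

/-! ### The currents `θ` on `Uplus`, and the Serre relations on the vacuum of a tensor product. -/

section PlusTheta

variable {ι : Type*} [Fintype ι] [DecidableEq ι] {A : Matrix ι ι ℤ} {d : ι → ℕ}
  {V : Type*} [AddCommGroup V] [Module ℂ V] {R : Realization A V}

namespace Uplus

variable (hA : IsSymmetrizableGCM A d)

variable (R) in
/-- The current `K exp ((v⁻¹ - v) ∑_{s ≥ 1} H_{i,s} z ^ s)`, acting by left multiplication. -/
def theta (i : ι) (t : ℤ) : Module.End Scalar (Uplus d R) :=
  plusCurrent (wtOp R hA fun j => v ^ (-bMat A d i j)) (fun s => (v⁻¹ - v) • mulOp d R (H d R i s)) t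

theorem mulOp_H_comm (i j : ι) (s t : ℕ) :
    Commute (mulOp d R (H d R i s)) (mulOp d R (H d R j t)) := mulOp_isPlus.H_H i j s t

theorem smul_H_comm (c : Scalar) (i j : ι) (s t : ℕ) :
    Commute (c • mulOp d R (H d R i s)) (c • mulOp d R (H d R j t)) :=
  ((mulOp_H_comm i j s t).smul_left c).smul_right c

theorem theta_neg (i : ι) {t : ℤ} (ht : t < 0) : theta R hA i t = 0 := plusCurrent_neg _ _ ht

theorem wtOp_theta (g : ι → Scalar) (i : ι) (t : ℤ) : Commute (wtOp R hA g) (theta R hA i t) :=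
  commute_plusCurrent (fun s t => smul_H_comm _ i i s t) (wtOp_comm hA _ _)
    (fun s => (wtOp_mulOp_H hA g i s).smul_right _) t

theorem mulOp_H_theta (i j : ι) (s : ℕ) (t : ℤ) : Commute (mulOp d R (H d R i s)) (theta R hA j t) :=
  commute_plusCurrent (fun s t => smul_H_comm _ j j s t) (wtOp_mulOp_H hA _ i s).symm
    (fun u => (mulOp_H_comm i j s u).smul_right _) t

theorem theta_comm (i j : ι) (s t : ℤ) : Commute (theta R hA i s) (theta R hA j t) :=
  (commute_plusCurrent (fun s t => smul_H_comm _ i i s t) (wtOp_theta hA _ j t).symm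
    (fun u => (mulOp_H_theta hA i j u t).symm.smul_right _) s).symm

theorem quad_theta (i j : ι) :
    Quad (v ^ bMat A d i j) (theta R hA i) (fun l => mulOp d R (Eplus d R j l)) := by
  refine quad_plusCurrent (v_zpow_ne_zero _) (fun l => ?_)
    (fun s t => smul_H_comm _ i i s t) fun s _ l => ?_
  · rw [wtOp_mul_mulOp_E, zpow_neg]
  · rw [smul_bracket, mulOp_isPlus.H_X, add_sub_cancel_left, smul_smul, kappa_eq_hcoef]

theorem der_mul_theta (i j : ι) {s : ℕ} (hs : 0 < s) (t : ℤ) :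
    der R hA i s * theta R hA j t =
      theta R hA j t * der R hA i s + hcoef A d i j s • theta R hA j (t - s) := by
  refine mul_plusCurrent_central (fun s t => smul_H_comm _ j j s t) (wtOp_der hA _ i s).symm hs
    (fun t => ?_) t
  have h1 := mulOp_H_mul_der (R := R) hA i s j t
  rw [mul_smul_comm, eq_sub_of_add_eq h1.symm, smul_sub, smul_mul_assoc, sub_eq_add_neg]
  congr 1
  by_cases h : s = t
  · subst h
    rw [if_pos rfl, if_pos rfl, neg_smul, smul_neg, neg_neg, smul_smul,
      mul_div_cancel₀ _ generic_v.qint_den_ne]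
  · rw [if_neg h, if_neg (Ne.symm h), smul_zero, neg_zero]

end Uplus

/-! ### The tensor product on which the coproduct acts -/

variable (d R) in
/-- The tensor product of `Uplus` with the algebra of the `E_{i,l}`. -/
def Ten : Type _ := Uplus d R ⊗[Scalar] NAlg A d

namespace Ten

instance : AddCommGroup (Ten d R) := inferInstanceAs (AddCommGroup (Uplus d R ⊗[Scalar] NAlg A d))
instance : Module Scalar (Ten d R) := inferInstanceAs (Module Scalar (Uplus d R ⊗[Scalar] NAlg A d))
instance : Ring (Module.End Scalar (Ten d R)) := inferInstance
instance : Algebra Scalar (Module.End Scalar (Ten d R)) := inferInstance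

variable (d R) in
/-- Operators on the first factor. -/
def left : Module.End Scalar (Uplus d R) →ₐ[Scalar] Module.End Scalar (Ten d R) :=
  Module.End.rTensorAlgHom Scalar (Uplus d R) (NAlg A d)

variable (d R) in
/-- Operators on the second factor. -/
def right : Module.End Scalar (NAlg A d) →ₐ[Scalar] Module.End Scalar (Ten d R) :=
  Module.End.lTensorAlgHom Scalar (NAlg A d) (Uplus d R)

/-- The pure tensors. -/
def mk (x : Uplus d R) (y : NAlg A d) : Ten d R := x ⊗ₜ[Scalar] y

@[simp] theorem left_mk (f : Module.End Scalar (Uplus d R)) (x : Uplus d R) (y : NAlg A d) :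
    left d R f (mk x y) = mk (f x) y := rfl

@[simp] theorem right_mk (f : Module.End Scalar (NAlg A d)) (x : Uplus d R) (y : NAlg A d) :
    right d R f (mk x y) = mk x (f y) := rfl

theorem left_right (f : Module.End Scalar (Uplus d R)) (g : Module.End Scalar (NAlg A d)) :
    Commute (left d R f) (right d R g) :=
  TensorProduct.ext' fun _ _ => rfl

variable (hA : IsSymmetrizableGCM A d)

variable (d R) in
/-- The action of `E_{i,l}` on the first factor. -/
def x (i : ι) (l : ℤ) : Module.End Scalar (Ten d R) := left d R (Uplus.mulOp d R (Eplus d R i l))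

variable (d R) in
/-- The action of `E_{i,l}` on the second factor. -/
def y (i : ι) (l : ℤ) : Module.End Scalar (Ten d R) := right d R (NAlg.mulOp A d (NAlg.E A d i l))

variable (R) in
/-- The Cartan currents on the first factor. -/
def Θ (i : ι) (t : ℤ) : Module.End Scalar (Ten d R) := left d R (Uplus.theta R hA i t)

theorem y_currents : IsCurrents A d (y d R) :=
  ((NAlg.isCurrents A d).map (T := Module.End Scalar (NAlg A d)) (NAlg.mulOp A d)).map
    (T := Module.End Scalar (Ten d R)) (right d R)

theorem Θ_eq (i : ι) : Θ R hA i = plusCurrent (left d R (Uplus.wtOp R hA fun j => v ^ (-bMat A d i j)))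
    fun s => left d R ((v⁻¹ - v) • Uplus.mulOp d R (Uplus.H d R i s)) :=
  funext fun _ => map_plusCurrent (left d R) _ _ _

/-- The required `D_{j,s}` are the derivations shifting the modes of the `j`-th current alone; the
algebra presented by the `E_{i,l}` has them for each `j` separately. -/
theorem right_currents : IsCurrents A d fun i => conv (Θ R hA i) (y d R i) := by
  simp only [Θ_eq]
  refine isCurrents_conv_plusCurrent (y_currents (R := R))
    (D := fun j s => right d R (NAlg.der (Pi.single j 1) (-(s : ℤ))))
    (fun i j s t => (Uplus.smul_H_comm _ i j s t).map (left d R))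
    (fun i j s t => (NAlg.der_comm _ _ _ _).map (right d R)) (fun _ _ _ _ => left_right _ _)
    (fun _ _ _ _ => left_right _ _) (fun j s i l => ?_)
    (fun i j => (Uplus.wtOp_comm hA _ _).map (left d R))
    (fun i j s => ((Uplus.wtOp_mulOp_H hA _ j s).smul_right _).map (left d R))
    fun _ _ _ => left_right _ _
  rw [y, ← map_mul, ← map_mul, ← map_sub, NAlg.der_mul_mulOp_E, ← sub_eq_add_neg]
  by_cases h : i = j
  · subst h
    rw [if_pos rfl, Pi.single_eq_same]
    exact congrArg (right d R) (one_smul Scalar _)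
  · rw [if_neg h, Pi.single_eq_of_ne h]
    exact (congrArg (right d R) (zero_smul Scalar _)).trans (map_zero _)

theorem isTensorCurrents : IsTensorCurrents A d (x d R) (Θ R hA) (y d R) where
  left := Uplus.mulOp_isPlus.currents.map (T := Module.End Scalar (Ten d R)) (left d R)
  right := right_currents hA
  quad i j := (Uplus.quad_theta hA i j).map (left d R)
  vanish i _ ht := (congrArg (left d R) (Uplus.theta_neg hA i ht)).trans (map_zero _)
  comm i j s t := (Uplus.theta_comm hA i j s t).map (left d R)
  comm_right _ _ _ _ := left_right _ _
  left_right _ _ _ _ := left_right _ _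

theorem map_semi {S T : Type*} [Ring S] [Algebra Scalar S] [Ring T] [Algebra Scalar T]
    (f : S →ₐ[Scalar] T) {a b : S} {g : Scalar} (h : a * b = g • (b * a)) :
    f a * f b = g • (f b * f a) := by
  rw [← map_mul, h, map_smul, map_mul]

omit [Fintype ι] [DecidableEq ι] in
theorem zpow_cancel (b : ι → ℤ) : (fun j => v ^ (-b j)) * (fun j => v ^ b j) = 1 := by
  funext j
  rw [Pi.mul_apply, zpow_neg, inv_mul_cancel₀ (v_zpow_ne_zero _), Pi.one_apply]

omit [Fintype ι] [DecidableEq ι] in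
theorem zpow_cancel' (b : ι → ℤ) : (fun j => v ^ b j) * (fun j => v ^ (-b j)) = 1 := by
  rw [mul_comm]; exact zpow_cancel b

theorem injective_of_mul_eq_one {M : Type*} [AddCommGroup M] [Module Scalar M]
    {f g : Module.End Scalar M} (h : g * f = 1) : Function.Injective f :=
  Function.LeftInverse.injective (g := g) fun w => DFunLike.congr_fun h w

omit [Fintype ι] [DecidableEq ι] in
theorem phi_zero (i : ι) : NAlg.phi A d i 0 = NAlg.wtOp A d fun j => v ^ (-bMat A d i j) := by
  rw [NAlg.phi]
  have := plusCurrent_natCast (NAlg.wtOp A d fun j => v ^ (-bMat A d i j))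
    (fun s => (v⁻¹ - v) • NAlg.der (fun j => hcoef A d i j s) s) 0
  rwa [expCoeff_zero, mul_one] at this

theorem psi_zero (i : ι) : Uplus.psi R hA i 0 = Uplus.wtOp R hA fun j => v ^ bMat A d i j := by
  rw [Uplus.psi, minusCurrent, neg_zero]
  have := plusCurrent_natCast (Uplus.wtOp R hA fun j => v ^ bMat A d i j)
    (fun s => (-(v⁻¹ - v)) • Uplus.der R hA i s) 0
  rwa [expCoeff_zero, mul_one] at this

theorem semi_of_eq {S : Type*} [Ring S] [Algebra Scalar S] {a b : S} {g : Scalar} (hg : g ≠ 0)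
    (h : a * b = g⁻¹ • (b * a)) : b * a = g • (a * b) := by
  rw [h, smul_inv_smul₀ hg]

/-- Here `C` consists of the vectors `u ⊗ 1`, the annihilation operators act on the second factor,
and `ε` is the weight operator with all scalars zero there, which keeps the constants and kills
every word in the `E_{j,l}`. -/
theorem serre_vacuum_left {i j : ι} (hij : i ≠ j) {r : ℕ} (hr : (r : ℤ) = 1 - A i j)
    (l : Fin r → ℤ) (m p : ℤ) :
    (serreForm (v ^ d i) r (fun a => combined (x d R) (Θ R hA) (y d R) i (l a))
      (HahnSeries.single m (x d R j m))).coeff p (mk 1 1) = 0 := by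
  choose ρ hρ1 hρ using NAlg.exists_annihilation (A := A) (d := d) hA i
  refine (isTensorCurrents (R := R) hA).serre_left hA hij hr y_currents
    (ρ := fun m => right d R (ρ m)) (φ := fun t => right d R (NAlg.phi A d i t))
    (fun _ _ _ => (left_right _ _).symm) (fun _ _ _ => (left_right _ _).symm) (fun m j l => ?_)
    (fun t ht => ?_) (fun j => (NAlg.quad_phi i j).map (right d R)) (fun _ _ _ => left_right _ _)
    (fun _ _ _ => left_right _ _) (fun l => ?_) ?_
    (C := LinearMap.range ((TensorProduct.mk Scalar (Uplus d R) (NAlg A d)).flip 1))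
    (fun j l w hw => ?_) (fun j l w hw => ?_) (fun m w hw => ?_)
    (ε := right d R (NAlg.wtOp A d 0)) (fun _ _ => (left_right _ _).symm)
    (fun _ _ => (left_right _ _).symm) (fun l => ?_) (fun w hw => ?_) l m p ⟨1, rfl⟩
  · simp only [y, ← map_mul, hρ, map_add]
    split_ifs <;> simp
  · exact (congrArg (right d R) (plusCurrent_neg _ _ ht)).trans (map_zero _)
  · refine map_semi (right d R) ?_
    rw [phi_zero]
    refine semi_of_eq (v_zpow_ne_zero _) ?_
    rw [NAlg.wtOp_mul_mulOp_E, zpow_neg]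
  · refine injective_of_mul_eq_one (g := right d R (NAlg.wtOp A d fun j => v ^ bMat A d i j)) ?_
    rw [← map_mul, phi_zero, NAlg.wtOp_mul_wtOp, zpow_cancel', NAlg.wtOp_one, map_one]
  · obtain ⟨u, rfl⟩ := hw
    exact ⟨Eplus d R j l * u, rfl⟩
  · obtain ⟨u, rfl⟩ := hw
    exact ⟨Uplus.theta R hA j l u, rfl⟩
  · obtain ⟨u, rfl⟩ := hw
    change mk u (ρ m 1) = 0
    rw [hρ1]
    exact TensorProduct.tmul_zero _ _
  · rw [y, ← map_mul, NAlg.wtOp_mul_mulOp_E]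
    exact (congrArg (right d R) (zero_smul Scalar _)).trans (map_zero _)
  · obtain ⟨u, rfl⟩ := hw
    change mk u (NAlg.wt 0 1) = mk u 1
    rw [map_one]

/-- The annihilation operators act on the first factor and are multiplied by a weight operator `κ`
on the second: the scalar `v ^ (-b)` arising from `ρ` and `Θ` cancels the scalar `v ^ b` arising
from `κ` and `y`. The space `C` is the part without letters `E` in the first factor, cut out by the
weight operator with all scalars zero. -/
theorem serre_vacuum_right {i j : ι} (hij : i ≠ j) {r : ℕ} (hr : (r : ℤ) = 1 - A i j)
    (l : Fin r → ℤ) (m p : ℤ) :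
    (serreForm (v ^ d i) r (fun a => combined (x d R) (Θ R hA) (y d R) i (l a))
      (conv (Θ R hA j) (y d R j) m)).coeff p (mk 1 1) = 0 := by
  choose ρ hρ1 hρ hρH hρw using Uplus.exists_annihilation R hA i
  set κ := NAlg.wtOp A d fun j => v ^ bMat A d i j with hκ
  set ε := Uplus.wtOp R hA 0 with hε
  have hdd : ∀ s t, Commute ((-(v⁻¹ - v)) • Uplus.der R hA i s) ((-(v⁻¹ - v)) • Uplus.der R hA i t) :=
    fun s t => ((Uplus.der_comm hA i i s t).smul_left _).smul_right _
  have hκy : ∀ j l, right d R κ * y d R j l = v ^ bMat A d i j • (y d R j l * right d R κ) :=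
    fun j l => map_semi (right d R) (NAlg.wtOp_mul_mulOp_E _ _ _)
  have hρθ : ∀ m j t, ρ m * Uplus.theta R hA j t =
      v ^ (-bMat A d i j) • (Uplus.theta R hA j t * ρ m) := by
    intro m j t
    refine mul_plusCurrent_semi (fun s t => Uplus.smul_H_comm _ j j s t) ?_
      (fun s => Commute.smul_right (hρH m j s) _) t
    rw [hρw, hA.bMat_symm]
  have hswap : ∀ {a b c e : Module.End Scalar (Ten d R)}, Commute b c →
      a * b * (c * e) = a * c * (b * e) := fun {a b c e} h => by
    rw [mul_assoc, ← mul_assoc b, h.eq, mul_assoc, mul_assoc]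
  set C := LinearMap.range (left d R ε) with hC
  have hεε : ε * ε = ε := by rw [hε, Uplus.wtOp_mul_wtOp, mul_zero]
  have hCmem : ∀ {T : Module.End Scalar (Ten d R)}, Commute (left d R ε) T → ∀ w ∈ C, T w ∈ C := by
    rintro T hT _ ⟨u, rfl⟩
    exact ⟨T u, DFunLike.congr_fun hT.eq u⟩
  have hκΘ : ∀ j t, Commute (right d R κ) (Θ R hA j t) := fun _ _ => (left_right _ _).symm
  have hyl : ∀ j l f, Commute (y d R j l) (left d R f) := fun _ _ _ => (left_right _ _).symm
  have hstab : ∀ {T : Module.End Scalar (Ten d R)}, Commute (left d R ε) T →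
      (∀ l w, w ∈ wordSpan C (x d R i) Set.univ → T w ∈ wordSpan C (x d R i) Set.univ →
        T (x d R i l w) ∈ wordSpan C (x d R i) Set.univ) →
      T ∈ stabilizer (wordSpan C (x d R i) Set.univ) := by
    intro T hT h w hw
    -- Membership of `w` itself is carried along, because moving an `H` past `x i l` produces an
    -- additional term to which the operator is not applied.
    refine (wordSpan_le (P := wordSpan C (x d R i) Set.univ ⊓ (wordSpan C (x d R i) Set.univ).comap T)
      (fun w hw => ⟨le_wordSpan hw, le_wordSpan (hCmem hT w hw)⟩) (fun l hl w hw => ?_) hw).2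
    exact ⟨map_mem_wordSpan hl hw.1, h l w hw.1 hw.2⟩
  refine (isTensorCurrents (R := R) hA).serre_right hA hij hr
    (ρ := fun m => left d R (ρ m) * right d R κ)
    (ψ := fun t => left d R (Uplus.psi R hA i t) * right d R κ)
    (fun m j l => ?_) (fun m j t n => ?_) (fun t ht => ?_)
    (fun j => ((Uplus.quad_psi hA i j).map (left d R)).mul_commute fun m => (left_right _ _).symm)
    (fun j n => ?_) (fun l => ?_) ?_ (C := C) (fun j t => ?_) (fun j l => ?_) (fun m w hw => ?_)
    (ε := left d R ε) (fun l => ?_) (fun j t => (Uplus.wtOp_theta hA 0 j t).map (left d R))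
    (fun _ _ => left_right _ _) (fun w hw => ?_) l m p ⟨mk 1 1, ?_⟩
  · rw [x, mul_assoc, ← (left_right _ _).eq, ← mul_assoc, ← map_mul, hρ, map_add, add_mul, map_mul,
      mul_assoc]
    congr 1
    split_ifs <;> simp
  · rw [Commute, SemiconjBy, hswap (hκΘ j t), hswap (hyl j n _), hκy, Θ,
      map_semi (left d R) (hρθ m j t), smul_mul_smul_comm, zpow_neg,
      inv_mul_cancel₀ (v_zpow_ne_zero _)]
    exact one_smul Scalar _
  · rw [Uplus.psi, minusCurrent, plusCurrent_neg _ _ (by omega), map_zero, zero_mul]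
  · have h1 : (fun t => left d R (Uplus.psi R hA i t) * right d R κ) =
        minusCurrent (left d R (Uplus.wtOp R hA fun j => v ^ bMat A d i j) * right d R κ)
          fun s => left d R ((-(v⁻¹ - v)) • Uplus.der R hA i s) := by
      funext t
      rw [Uplus.psi, minusCurrent, map_plusCurrent, minusCurrent]
      unfold plusCurrent
      split_ifs
      · rw [mul_assoc, mul_assoc, ← map_expCoeff, (left_right _ _).eq]
      · exact zero_mul _
    rw [h1]
    refine quad_minusCurrent (v_zpow_ne_zero _) (fun l => ?_) (fun s t => (hdd s t).map (left d R))
      fun s hs l => ?_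
    · rw [hswap (hκΘ j l), hκy, Θ, ← map_mul, (Uplus.wtOp_theta hA _ j l).eq, map_mul,
        mul_smul_comm, hswap (hyl j n _).symm]
    · rw [← mul_assoc, mul_assoc (Θ R hA j l), (hyl j n _).eq, ← mul_assoc, ← sub_mul, Θ,
        ← map_mul, ← map_mul, ← map_sub, smul_bracket, Uplus.der_mul_theta hA i j hs,
        add_sub_cancel_left, smul_smul, kappa_eq_hcoef, map_smul, smul_mul_assoc, neg_mul]
      rfl
  · rw [← mul_assoc, psi_zero, x, ← map_mul]
    rw [mul_assoc (left d R _), ← (left_right _ _).eq, ← mul_assoc, ← map_mul,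
      Uplus.wtOp_mul_mulOp_E, map_smul, smul_mul_assoc, smul_smul, zpow_neg,
      inv_mul_cancel₀ (v_zpow_ne_zero _)]
    exact (one_smul Scalar _).symm
  · refine injective_of_mul_eq_one (g := left d R (Uplus.wtOp R hA fun j => v ^ (-bMat A d i j)) *
      right d R (NAlg.wtOp A d fun j => v ^ (-bMat A d i j))) ?_
    rw [hswap (left_right _ _).symm, ← map_mul, ← map_mul, psi_zero, Uplus.wtOp_mul_wtOp,
      NAlg.wtOp_mul_wtOp, zpow_cancel, Uplus.wtOp_one, NAlg.wtOp_one, map_one, map_one, mul_one]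
  · have hK : ∀ g, left d R (Uplus.wtOp R hA g) ∈ stabilizer (wordSpan C (x d R i) Set.univ) := by
      refine fun g => hstab ((Uplus.wtOp_comm hA _ _).map (left d R)) fun l w _ hw => ?_
      have h1 := DFunLike.congr_fun (map_semi (left d R) (Uplus.wtOp_mul_mulOp_E hA g i l)) w
      exact h1 ▸ Submodule.smul_mem _ _ (map_mem_wordSpan (Set.mem_univ l) hw)
    have hH : ∀ j s, left d R (Uplus.mulOp d R (Uplus.H d R j s)) ∈
        stabilizer (wordSpan C (x d R i) Set.univ) := by
      refine fun j s => hstab ((Uplus.wtOp_mulOp_H hA _ j s).map (left d R)) fun l w hw hw' => ?_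
      have h1 := congrArg (left d R) (Uplus.mulOp_isPlus.H_X j i s l)
      rw [map_add, map_mul, map_mul, map_smul] at h1
      have h2 := DFunLike.congr_fun h1 w
      refine h2 ▸ Submodule.add_mem _ (map_mem_wordSpan (Set.mem_univ l) hw') ?_
      exact Submodule.smul_mem _ _ (map_mem_wordSpan (Set.mem_univ _) hw)
    rw [Θ_eq]
    unfold plusCurrent
    split_ifs
    · refine Subalgebra.mul_mem _ (hK _) (expCoeff_mem _ (fun s => ?_) _)
      rw [map_smul]
      exact Subalgebra.smul_mem _ (hH j s) _
    · exact Subalgebra.zero_mem _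
  · refine hstab (left_right _ _) fun n w _ hw => ?_
    have h1 := DFunLike.congr_fun (hyl j l (Uplus.mulOp d R (Eplus d R i n))).eq w
    exact h1 ▸ map_mem_wordSpan (Set.mem_univ n) hw
  · obtain ⟨u, rfl⟩ := hw
    rw [← Module.End.mul_apply, mul_assoc, ← (left_right _ _).eq, ← mul_assoc, ← map_mul, hρw]
    have h1 : ((0 : ι → Scalar) i) • (Uplus.wtOp R hA 0 * ρ m) = 0 := zero_smul Scalar _
    rw [h1, map_zero, zero_mul, LinearMap.zero_apply]
  · rw [x, ← map_mul, Uplus.wtOp_mul_mulOp_E]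
    exact (congrArg (left d R) (zero_smul Scalar _)).trans (map_zero _)
  · obtain ⟨u, rfl⟩ := hw
    rw [← Module.End.mul_apply, ← map_mul, hεε]
  · change mk (Uplus.wt R hA 0 1) 1 = mk 1 1
    rw [map_one]

end Ten

end PlusTheta

section Twisted

variable {ι : Type*} [Fintype ι] [DecidableEq ι] {A : Matrix ι ι ℤ} {d : ι → ℕ}
  {V : Type*} [AddCommGroup V] [Module ℂ V] {R : Realization A V}

/-! ### Homogeneous elements -/

/-- `x` is homogeneous of weight `α`. -/
def IsWeight (α : ι → ℤ) (x : Uplus d R) : Prop :=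
  weightHom d R (x : LoopAlg d R) = AddMonoidAlgebra.single α (x : LoopAlg d R)

namespace IsWeight

theorem weightComponents {α : ι → ℤ} {x : Uplus d R} (h : IsWeight α x) :
    weightComponents d R x = Finsupp.single α x := by
  ext β
  change (weightHom d R (x : LoopAlg d R)).coeff β = _
  rw [h, AddMonoidAlgebra.coeff_single]
  by_cases hβ : α = β
  · subst hβ; simp
  · rw [Finsupp.single_eq_of_ne (Ne.symm hβ), Finsupp.single_eq_of_ne (Ne.symm hβ)]; rfl

theorem one : IsWeight 0 (1 : Uplus d R) := by
  rw [IsWeight, OneMemClass.coe_one, map_one, AddMonoidAlgebra.one_def]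

theorem E (i : ι) (l : ℤ) : IsWeight (Pi.single i 1) (Eplus d R i l) :=
  weightHom_gen d R (Gen.E i l)

theorem H (i : ι) (s : ℕ) : IsWeight 0 (Uplus.H d R i s) := by
  by_cases h : 0 < s
  · rw [Uplus.H_pos i s h]
    exact weightHom_gen d R (Gen.H i ⟨(s : ℤ), by omega⟩)
  · rw [Uplus.H, dif_neg h, IsWeight, ZeroMemClass.coe_zero, map_zero, AddMonoidAlgebra.single_zero]

theorem mul {α β : ι → ℤ} {x y : Uplus d R} (hx : IsWeight α x) (hy : IsWeight β y) :
    IsWeight (α + β) (x * y) := by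
  rw [IsWeight, MulMemClass.coe_mul, map_mul, hx, hy, AddMonoidAlgebra.single_mul_single]

theorem smul {α : ι → ℤ} {x : Uplus d R} (c : Scalar) (hx : IsWeight α x) :
    IsWeight α (c • x) := by
  rw [IsWeight]
  change weightHom d R (c • (x : LoopAlg d R)) = AddMonoidAlgebra.single α (c • (x : LoopAlg d R))
  rw [map_smul, hx, AddMonoidAlgebra.smul_single]

/-- Every element is a sum of homogeneous elements. -/
theorem induction {p : Uplus d R → Prop} (add : ∀ x y, p x → p y → p (x + y))
    (weight : ∀ α x, IsWeight α x → p x) (x : Uplus d R) : p x := by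
  let P : Submodule Scalar (Uplus d R) := Submodule.span Scalar {x | ∃ α, IsWeight α x}
  have hmul : ∀ g : Uplus d R, (∃ α, IsWeight α g) → ∀ x ∈ P, g * x ∈ P := by
    rintro g ⟨α, hg⟩ x hx
    induction hx using Submodule.span_induction with
    | mem x hx => obtain ⟨β, hx⟩ := hx; exact Submodule.subset_span ⟨_, hg.mul hx⟩
    | zero => rw [mul_zero]; exact Submodule.zero_mem _
    | add x y _ _ hx hy => rw [mul_add]; exact Submodule.add_mem _ hx hy
    | smul c x _ hx => rw [mul_smul_comm]; exact Submodule.smul_mem _ c hx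
  have hx : x ∈ P := by
    induction x using Uplus.induction with
    | one => exact Submodule.subset_span ⟨0, one⟩
    | add x y hx hy => exact Submodule.add_mem _ hx hy
    | smul c x hx => exact Submodule.smul_mem _ c hx
    | mul_E i l x hx => exact hmul _ ⟨_, E i l⟩ x hx
    | mul_H i s x hx => exact hmul _ ⟨_, H i s⟩ x hx
  have h0 : p 0 := weight 0 0 (by
    rw [IsWeight, ZeroMemClass.coe_zero, map_zero, AddMonoidAlgebra.single_zero])
  have key : ∀ c : Scalar, p (c • x) := by
    induction hx using Submodule.span_induction with
    | mem x hx => obtain ⟨α, hx⟩ := hx; exact fun c => weight α _ (hx.smul c)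
    | zero => intro c; rw [smul_zero]; exact h0
    | add x y _ _ hx hy => intro c; rw [smul_add]; exact add _ _ (hx c) (hy c)
    | smul a x _ hx => intro c; rw [smul_smul]; exact hx _
  have := key 1
  rwa [one_smul] at this

end IsWeight

omit [DecidableEq ι] in
theorem rootForm_add_left (α β γ : ι → ℤ) :
    rootForm A d (α + β) γ = rootForm A d α γ + rootForm A d β γ := by
  simp only [rootForm, Pi.add_apply, add_mul, Finset.sum_add_distrib]

omit [DecidableEq ι] in
theorem rootForm_add_right (α β γ : ι → ℤ) :
    rootForm A d α (β + γ) = rootForm A d α β + rootForm A d α γ := by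
  simp only [rootForm, Pi.add_apply, mul_add, Finset.sum_add_distrib]

omit [DecidableEq ι] in
theorem rootForm_zero_left (α : ι → ℤ) : rootForm A d 0 α = 0 := by simp [rootForm]

omit [DecidableEq ι] in
theorem rootForm_zero_right (α : ι → ℤ) : rootForm A d α 0 = 0 := by simp [rootForm]

theorem rootForm_single (i j : ι) :
    rootForm A d (Pi.single i 1) (Pi.single j 1) = bMat A d i j := by
  rw [rootForm, Finset.sum_eq_single i, Finset.sum_eq_single j]
  · simp
  · intro k _ hk; simp [hk]
  · simp
  · intro k _ hk; simp [hk]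
  · simp

/-! ### The algebra structure of the twisted square -/

namespace TwistedSquare

theorem braiding_tmul {α β : ι → ℤ} {x y : Uplus d R} (hx : IsWeight β x) (hy : IsWeight α y) :
    braiding d R (x ⊗ₜ y) = v ^ (-rootForm A d β α) • (y ⊗ₜ[Scalar] x) := by
  rw [braiding, TensorProduct.lift.tmul, LinearMap.compl₁₂_apply, hx.weightComponents,
    hy.weightComponents, Finsupp.lsum_single, LinearMap.flip_apply, Finsupp.lsum_single]
  rfl

omit [Fintype ι] [DecidableEq ι] in
theorem map_mul_tmul {S : Type*} [Ring S] [Algebra Scalar S] (c : Scalar) (x x' y y' : S) :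
    TensorProduct.map (LinearMap.mul' Scalar S) (LinearMap.mul' Scalar S)
      ((TensorProduct.tensorTensorTensorAssoc Scalar S S S S).symm
        ((x ⊗ₜ (c • (y ⊗ₜ[Scalar] x'))) ⊗ₜ[Scalar] y')) = c • ((x * y) ⊗ₜ (x' * y')) := by
  rw [TensorProduct.tmul_smul, ← TensorProduct.smul_tmul', map_smul, map_smul]
  simp

theorem tens_mul_tens {α β : ι → ℤ} {x x' y y' : Uplus d R} (hx : IsWeight β x')
    (hy : IsWeight α y) : tens d R x x' * tens d R y y' =
      v ^ (-rootForm A d β α) • tens d R (x * y) (x' * y') := by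
  change twistedMul d R ((x ⊗ₜ x') ⊗ₜ (y ⊗ₜ y')) = _
  rw [twistedMul]
  simp only [LinearMap.comp_apply, LinearEquiv.coe_coe,
    TensorProduct.tensorTensorTensorAssoc_tmul, TensorProduct.map_tmul, braiding_tmul hx hy]
  exact map_mul_tmul _ x x' y y'

theorem induction {p : TwistedSquare d R → Prop} (add : ∀ x y, p x → p y → p (x + y))
    (weight : ∀ α β x y, IsWeight α x → IsWeight β y → p (tens d R x y)) (z : TwistedSquare d R) :
    p z := by
  have h0 : p 0 := by
    have := weight 0 0 0 0 (by
      rw [IsWeight, ZeroMemClass.coe_zero, map_zero, AddMonoidAlgebra.single_zero]) (by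
      rw [IsWeight, ZeroMemClass.coe_zero, map_zero, AddMonoidAlgebra.single_zero])
    rwa [tens, TensorProduct.zero_tmul] at this
  refine TensorProduct.induction_on z h0 (fun x y => ?_) add
  induction x using IsWeight.induction with
  | add x x' hx hx' => rw [TensorProduct.add_tmul]; exact add _ _ hx hx'
  | weight α x hx =>
    induction y using IsWeight.induction with
    | add y y' hy hy' => rw [TensorProduct.tmul_add]; exact add _ _ hy hy'
    | weight β y hy => exact weight α β x y hx hy

theorem smul_mul (c : Scalar) (x y : TwistedSquare d R) : (c • x) * y = c • (x * y) :=
  (congrArg (twistedMul d R) (TensorProduct.smul_tmul' (R := Scalar)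
    (M := Uplus d R ⊗[Scalar] Uplus d R) (N := Uplus d R ⊗[Scalar] Uplus d R) c x y).symm).trans
    (LinearMap.map_smul (twistedMul d R) c _)

theorem mul_smul (c : Scalar) (x y : TwistedSquare d R) : x * (c • y) = c • (x * y) :=
  (congrArg (twistedMul d R) (TensorProduct.tmul_smul (R := Scalar)
    (M := Uplus d R ⊗[Scalar] Uplus d R) (N := Uplus d R ⊗[Scalar] Uplus d R) c x y)).trans
    (LinearMap.map_smul (twistedMul d R) c _)

instance : One (TwistedSquare d R) := ⟨tens d R 1 1⟩

theorem one_def : (1 : TwistedSquare d R) = tens d R 1 1 := rfl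

/-- On homogeneous tensors this is the biadditivity of `rootForm` in the exponent of `v`. -/
protected theorem mul_assoc (x y z : TwistedSquare d R) : x * y * z = x * (y * z) := by
  induction x using induction with
  | add x x' hx hx' => rw [add_mul, add_mul, add_mul, hx, hx']
  | weight α α' x x' hx hx' =>
    induction y using induction with
    | add y y' hy hy' => rw [mul_add, add_mul, add_mul, mul_add, hy, hy']
    | weight β β' y y' hy hy' =>
      induction z using induction with
      | add z z' hz hz' => rw [mul_add, mul_add, mul_add, hz, hz']
      | weight γ γ' z z' hz hz' =>
        rw [tens_mul_tens hx' hy, tens_mul_tens hy' hz, smul_mul, mul_smul,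
          tens_mul_tens (hx'.mul hy') hz, tens_mul_tens hx' (hy.mul hz), smul_smul, smul_smul,
          ← zpow_add₀ generic_v.ne_zero, ← zpow_add₀ generic_v.ne_zero, rootForm_add_left,
          rootForm_add_right, mul_assoc, mul_assoc]
        congr 2
        ring

protected theorem one_mul (x : TwistedSquare d R) : 1 * x = x := by
  induction x using induction with
  | add x x' hx hx' => rw [mul_add, hx, hx']
  | weight α α' x x' hx hx' =>
    rw [one_def, tens_mul_tens IsWeight.one hx, rootForm_zero_left, neg_zero, zpow_zero, one_smul,
      one_mul, one_mul]

protected theorem mul_one (x : TwistedSquare d R) : x * 1 = x := by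
  induction x using induction with
  | add x x' hx hx' => rw [add_mul, hx, hx']
  | weight α α' x x' hx hx' =>
    rw [one_def, tens_mul_tens hx' IsWeight.one, rootForm_zero_right, neg_zero, zpow_zero, one_smul,
      mul_one, mul_one]

scoped instance : Ring (TwistedSquare d R) :=
  { (inferInstance : NonUnitalNonAssocRing (TwistedSquare d R)) with
    mul_assoc := TwistedSquare.mul_assoc
    one_mul := TwistedSquare.one_mul
    mul_one := TwistedSquare.mul_one }

scoped instance : Algebra Scalar (TwistedSquare d R) := Algebra.ofModule smul_mul mul_smul

/-- The first factor. -/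
def inl : Uplus d R →ₐ[Scalar] TwistedSquare d R :=
  AlgHom.ofLinearMap ((TensorProduct.mk Scalar (Uplus d R) (Uplus d R)).flip 1) rfl fun x y => by
    change tens d R (x * y) 1 = tens d R x 1 * tens d R y 1
    induction y using IsWeight.induction with
    | add y y' hy hy' =>
      rw [mul_add]
      have e : ∀ a b : Uplus d R, tens d R (a + b) 1 = tens d R a 1 + tens d R b 1 :=
        fun a b => TensorProduct.add_tmul _ _ _
      rw [e, e, mul_add, hy, hy']
    | weight α y hy =>
      rw [tens_mul_tens IsWeight.one hy, rootForm_zero_left, neg_zero, zpow_zero, one_smul, one_mul]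

/-- The second factor. -/
def inr : Uplus d R →ₐ[Scalar] TwistedSquare d R :=
  AlgHom.ofLinearMap (TensorProduct.mk Scalar (Uplus d R) (Uplus d R) 1) rfl fun x y => by
    change tens d R 1 (x * y) = tens d R 1 x * tens d R 1 y
    induction x using IsWeight.induction with
    | add x x' hx hx' =>
      rw [add_mul]
      have e : ∀ a b : Uplus d R, tens d R 1 (a + b) = tens d R 1 a + tens d R 1 b :=
        fun a b => TensorProduct.tmul_add _ _ _
      rw [e, e, add_mul, hx, hx']
    | weight α x hx =>
      rw [tens_mul_tens hx IsWeight.one, rootForm_zero_right, neg_zero, zpow_zero, one_smul, one_mul]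

theorem inl_apply (x : Uplus d R) : inl x = tens d R x 1 := rfl

theorem inr_apply (x : Uplus d R) : inr x = tens d R 1 x := rfl

theorem inl_mul_inr (x y : Uplus d R) : inl x * inr y = tens d R x y := by
  rw [inl_apply, inr_apply, tens_mul_tens IsWeight.one IsWeight.one, rootForm_zero_right, neg_zero,
    zpow_zero, one_smul, one_mul, mul_one]

theorem inr_mul_inl {α β : ι → ℤ} {x y : Uplus d R} (hx : IsWeight β x) (hy : IsWeight α y) :
    inr x * inl y = v ^ (-rootForm A d β α) • (inl y * inr x) := by
  rw [inl_mul_inr, inl_apply, inr_apply, tens_mul_tens hx hy, one_mul, mul_one]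

theorem inr_mul_inl_of_zero {x : Uplus d R} (hx : IsWeight 0 x) (y : Uplus d R) :
    Commute (inr x) (inl y) := by
  induction y using IsWeight.induction with
  | add y y' hy hy' => rw [map_add]; exact hy.add_right hy'
  | weight α y hy =>
    rw [Commute, SemiconjBy, inr_mul_inl hx hy, rootForm_zero_left, neg_zero, zpow_zero]
    exact one_smul Scalar _

/-- The twist amounts to a weight automorphism of the first factor. For this reason the operators
`theta` include that automorphism: on an untwisted tensor product they then reproduce multiplication
by `θ_{i,t} ⊗ E_{i,l}` in the twisted one. -/
theorem inr_E_mul_inl (hA : IsSymmetrizableGCM A d) (i : ι) (l : ℤ) (y : Uplus d R) :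
    inr (Eplus d R i l) * inl y =
      inl (Uplus.wt R hA (fun j => v ^ (-bMat A d i j)) y) * inr (Eplus d R i l) := by
  induction y using Uplus.induction with
  | one => rw [map_one, map_one, map_one, one_mul, mul_one]
  | add x y hx hy => rw [map_add, map_add, map_add, mul_add, add_mul, hx, hy]
  | smul c x hx => rw [map_smul, map_smul, map_smul, mul_smul_comm, hx, smul_mul_assoc]
  | mul_E j m x hx =>
    rw [map_mul, ← mul_assoc, inr_mul_inl (IsWeight.E i l) (IsWeight.E j m), smul_mul_assoc,
      mul_assoc, hx, map_mul, Uplus.wt_E, smul_mul_assoc, map_smul, map_mul, smul_mul_assoc,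
      mul_assoc, rootForm_single]
  | mul_H j s x hx =>
    have h0 : Commute (inr (Eplus d R i l)) (inl (Uplus.H d R j s)) := by
      rw [Commute, SemiconjBy, inr_mul_inl (IsWeight.E i l) (IsWeight.H j s), rootForm_zero_right,
        neg_zero, zpow_zero]
      exact one_smul Scalar _
    rw [map_mul, ← mul_assoc, h0.eq, mul_assoc, hx, map_mul, Uplus.wt_H, map_mul, mul_assoc]

end TwistedSquare

end Twisted

open scoped TwistedSquare

/-! ### Exponentials of Hahn series concentrated in one degree. -/

section SingleExp

variable {S : Type*} [Ring S] [Algebra Scalar S]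

omit [Algebra Scalar S] in
theorem coeff_pow_single (h : ℕ → S) (k n : ℕ) :
    PowerSeries.coeff n ((PowerSeries.mk fun m => if m = 0 then 0 else
      HahnSeries.single (m : ℤ) (h m)) ^ k) =
    HahnSeries.single (n : ℤ) (PowerSeries.coeff n ((PowerSeries.mk fun m =>
      if m = 0 then 0 else h m) ^ k)) := by
  induction k generalizing n with
  | zero =>
    rw [pow_zero, pow_zero, PowerSeries.coeff_one, PowerSeries.coeff_one]
    split_ifs with h
    · subst h; rfl
    · simp
  | succ k ih =>
    rw [pow_succ, pow_succ, PowerSeries.coeff_mul, PowerSeries.coeff_mul]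
    have : ∀ s : Finset (ℕ × ℕ), ∀ f : ℕ × ℕ → S, HahnSeries.single (n : ℤ) (∑ p ∈ s, f p) =
        ∑ p ∈ s, HahnSeries.single (n : ℤ) (f p) := fun s f =>
      map_sum (HahnSeries.single.addMonoidHom (n : ℤ) : S →+ _) f s
    rw [this]
    refine Finset.sum_congr rfl fun p hp => ?_
    rw [ih, PowerSeries.coeff_mk, PowerSeries.coeff_mk]
    split_ifs
    · simp
    · rw [HahnSeries.single_mul_single, ← Finset.HasAntidiagonal.mem_antidiagonal.1 hp]
      push_cast
      rfl

theorem smul_hahnSingle (c : Scalar) (n : ℤ) (x : S) :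
    c • HahnSeries.single n x = HahnSeries.single n (c • x) := by
  ext p
  simp only [HahnSeries.coeff_smul, HahnSeries.coeff_single]
  split_ifs <;> simp

theorem expCoeff_single (h : ℕ → S) (n : ℕ) :
    expCoeff (fun s => HahnSeries.single (s : ℤ) (h s)) n = HahnSeries.single (n : ℤ) (expCoeff h n) := by
  have : ∀ s : Finset ℕ, ∀ f : ℕ → S, HahnSeries.single (n : ℤ) (∑ p ∈ s, f p) =
      ∑ p ∈ s, HahnSeries.single (n : ℤ) (f p) := fun s f =>
    map_sum (HahnSeries.single.addMonoidHom (n : ℤ) : S →+ _) f s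
  rw [expCoeff, expCoeff, this]
  refine Finset.sum_congr rfl fun k _ => ?_
  rw [coeff_pow_single, smul_hahnSingle]

theorem expCoeff_C (h : ℕ → S) (n : ℕ) :
    expCoeff (fun s => HahnSeries.single (0 : ℤ) (h s)) n = HahnSeries.single (0 : ℤ) (expCoeff h n) :=
  (map_expCoeff (hahnC S) h n).symm

end SingleExp

/-! ### Construction of the coproduct. -/

section Coproduct

variable {ι : Type*} [Fintype ι] [DecidableEq ι] {A : Matrix ι ι ℤ} {d : ι → ℕ}
  {V : Type*} [AddCommGroup V] [Module ℂ V] {R : Realization A V}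

theorem thetaPlus_eq (i : ι) (s : ℕ) :
    thetaPlus d R i s = expCoeff (fun m => (v⁻¹ - v) • Uplus.H d R i m) s := by
  refine congrArg (fun x => expCoeff x s) (funext fun m => ?_)
  rw [Uplus.H]
  split_ifs
  · rfl
  · exact (smul_zero _).symm

theorem theta_natCast (hA : IsSymmetrizableGCM A d) (i : ι) (n : ℕ) (x : Uplus d R) :
    Uplus.theta R hA i n x = thetaPlus d R i n * Uplus.wt R hA (fun j => v ^ (-bMat A d i j)) x := by
  have h1 : Commute (Uplus.wtOp R hA fun j => v ^ (-bMat A d i j))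
      (Uplus.mulOp d R (thetaPlus d R i n)) := by
    rw [thetaPlus_eq, map_expCoeff]
    refine expCoeff_commute_right (fun s t => ?_) (fun s => ?_) n
    · rw [map_smul, map_smul]; exact Uplus.smul_H_comm _ i i s t
    · rw [map_smul]; exact (Uplus.wtOp_mulOp_H hA _ i s).smul_right _
  rw [Uplus.theta, plusCurrent_natCast]
  have h2 : expCoeff (fun s => (v⁻¹ - v) • Uplus.mulOp d R (Uplus.H d R i s)) n =
      Uplus.mulOp d R (thetaPlus d R i n) := by
    rw [thetaPlus_eq, map_expCoeff]
    simp only [map_smul]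
  rw [h2, h1.eq]
  rfl

/-- `θ⁺_{i,t}`, extended by zero to negative `t`. -/
def thetaZ (d : ι → ℕ) (R : Realization A V) (i : ι) (t : ℤ) : Uplus d R :=
  if 0 ≤ t then thetaPlus d R i t.toNat else 0

theorem thetaZ_neg (i : ι) {t : ℤ} (ht : t < 0) : thetaZ d R i t = 0 := if_neg (not_le.2 ht)

theorem thetaZ_natCast (i : ι) (n : ℕ) : thetaZ d R i n = thetaPlus d R i n := by simp [thetaZ]

theorem theta_apply (hA : IsSymmetrizableGCM A d) (i : ι) (t : ℤ) (x : Uplus d R) :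
    Uplus.theta R hA i t x = thetaZ d R i t * Uplus.wt R hA (fun j => v ^ (-bMat A d i j)) x := by
  rcases lt_or_ge t 0 with ht | ht
  · rw [Uplus.theta_neg hA i ht, thetaZ_neg i ht, zero_mul, LinearMap.zero_apply]
  · lift t to ℕ using ht
    rw [theta_natCast, thetaZ_natCast]

namespace Coproduct

open TwistedSquare

variable (d R) in
/-- The image of `E_{i,l}` under the coproduct. -/
def E (i : ι) (l : ℤ) : CompletedSquare d R :=
  HahnSeries.single l (inl (Eplus d R i l)) +
    conv (fun t => inl (thetaZ d R i t)) (fun l => inr (Eplus d R i l)) l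

variable (d R) in
/-- The image of `H_{i,s}` under the coproduct. -/
def H (i : ι) (s : ℕ) : CompletedSquare d R :=
  HahnSeries.single (s : ℤ) (inl (Uplus.H d R i s)) + HahnSeries.single 0 (inr (Uplus.H d R i s))

theorem inl_thetaZ_neg (i : ι) (t : ℤ) (ht : t < 0) : inl (thetaZ d R i t) = 0 := by
  rw [thetaZ_neg i ht, map_zero]

theorem coeff_E (i : ι) (l p : ℤ) : (E d R i l).coeff p =
    (if p = l then inl (Eplus d R i l) else 0) + inl (thetaZ d R i p) * inr (Eplus d R i (l - p)) := by
  rw [E, HahnSeries.coeff_add, coeff_conv (inl_thetaZ_neg i), HahnSeries.coeff_single]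
  congr

variable (d R) in
/-- The map from the tensor product on which the coproduct acts. -/
def fromTen : Ten d R →ₗ[Scalar] TwistedSquare d R :=
  TensorProduct.lift ((LinearMap.mul Scalar (TwistedSquare d R)).compl₁₂ inl.toLinearMap
    (inr.comp (NAlg.lift (Uplus.isPlus d R).currents)).toLinearMap)

theorem fromTen_mk (x : Uplus d R) (y : NAlg A d) :
    fromTen d R (Ten.mk x y) = inl x * inr (NAlg.lift (Uplus.isPlus d R).currents y) := rfl

variable (hA : IsSymmetrizableGCM A d)

theorem ten_induction {p : Ten d R → Prop} (h0 : p 0) (add : ∀ x y, p x → p y → p (x + y))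
    (mk : ∀ x y, p (Ten.mk x y)) (z : Ten d R) : p z :=
  TensorProduct.induction_on z h0 mk add

theorem fromTen_x (i : ι) (l : ℤ) (w : Ten d R) :
    fromTen d R (Ten.x d R i l w) = inl (Eplus d R i l) * fromTen d R w := by
  induction w using ten_induction with
  | h0 => rw [map_zero, map_zero, mul_zero]
  | add x y hx hy => rw [map_add, map_add, map_add, mul_add, hx, hy]
  | mk x y =>
    rw [Ten.x, Ten.left_mk, fromTen_mk, fromTen_mk, Uplus.mulOp_apply, map_mul, mul_assoc]

theorem fromTen_Θ_y (i : ι) (t l : ℤ) (w : Ten d R) :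
    fromTen d R (Ten.Θ R hA i t (Ten.y d R i l w)) =
      inl (thetaZ d R i t) * inr (Eplus d R i l) * fromTen d R w := by
  induction w using ten_induction with
  | h0 => rw [map_zero, map_zero, map_zero, mul_zero]
  | add x y hx hy => rw [map_add, map_add, map_add, map_add, mul_add, hx, hy]
  | mk x y =>
    rw [Ten.y, Ten.right_mk, Ten.Θ, Ten.left_mk, fromTen_mk, fromTen_mk, NAlg.mulOp_apply, map_mul,
      NAlg.lift_E, theta_apply, map_mul, map_mul, mul_assoc, mul_assoc, ← mul_assoc (inl _),
      ← mul_assoc (inr (Eplus d R i l)), inr_E_mul_inl hA]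
    simp only [mul_assoc]

theorem combined_mem_intertwiner (i : ι) (l : ℤ) :
    (combined (Ten.x d R) (Ten.Θ R hA) (Ten.y d R) i l, E d R i l) ∈
      intertwiner (fromTen d R) (Algebra.lmul Scalar (TwistedSquare d R)) := by
  intro p w
  rw [(Ten.isTensorCurrents hA).coeff_combined, coeff_E, LinearMap.add_apply, map_add, map_add,
    LinearMap.add_apply, Module.End.mul_apply, fromTen_Θ_y]
  congr 1
  split_ifs
  · exact fromTen_x i l w
  · rw [LinearMap.zero_apply, map_zero, map_zero, LinearMap.zero_apply]

/-- `fromTen` sends the vacuum to `1`, on which a multiplication operator is faithful. A relation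
among the images of the generators may therefore be tested on the vacuum of the tensor product. -/
theorem eq_zero_of_intertwiner {Z : HahnSeries ℤ (Module.End Scalar (Ten d R))}
    {Z' : CompletedSquare d R}
    (h : (Z, Z') ∈ intertwiner (fromTen d R) (Algebra.lmul Scalar (TwistedSquare d R)))
    (h0 : ∀ p, Z.coeff p (Ten.mk 1 1) = 0) : Z' = 0 := by
  ext p
  have h1 := h p (Ten.mk 1 1)
  rw [h0, map_zero, fromTen_mk, map_one, map_one, map_one, mul_one] at h1
  exact ((mul_one _).symm.trans h1.symm).trans HahnSeries.coeff_zero.symm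

include hA in
theorem isCurrents : IsCurrents A d (E d R) where
  quad i j l m := by
    have hm := combined_mem_intertwiner (R := R) hA
    have h1 := Subalgebra.sub_mem _ (Subalgebra.sub_mem _
      (Subalgebra.smul_mem _ (Subalgebra.mul_mem _ (hm i (l + 1)) (hm j m)) (v ^ bMat A d i j))
      (Subalgebra.mul_mem _ (hm j m) (hm i (l + 1)))) (Subalgebra.sub_mem _
      (Subalgebra.mul_mem _ (hm i l) (hm j (m + 1)))
      (Subalgebra.smul_mem _ (Subalgebra.mul_mem _ (hm j (m + 1)) (hm i l)) (v ^ bMat A d i j)))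
    refine sub_eq_zero.1 (eq_zero_of_intertwiner h1 fun p => ?_)
    have h2 := sub_eq_zero.2 ((Ten.isTensorCurrents (R := R) hA).quad_combined hA i j l m)
    exact DFunLike.congr_fun (congrArg (fun f => HahnSeries.coeff f p) h2) _
  serre i j hij r hr l m := by
    rw [serreSum_eq]
    have h1 := serreForm_mem (intertwiner (fromTen d R) (Algebra.lmul Scalar (TwistedSquare d R)))
      (v ^ d i) (fun a => combined_mem_intertwiner hA i (l a)) (combined_mem_intertwiner hA j m)
    rw [serreForm_prod] at h1
    refine eq_zero_of_intertwiner h1 fun p => ?_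
    -- Only the last letter is split into its two summands; these are the two cases of the vacuum
    -- computation.
    rw [combined, serreForm_add_right, HahnSeries.coeff_add, LinearMap.add_apply,
      Ten.serre_vacuum_left hA hij hr, Ten.serre_vacuum_right hA hij hr, add_zero]

theorem H_comm (i j : ι) (s t : ℕ) :
    Commute (Uplus.H d R i s) (Uplus.H d R j t) := (Uplus.isPlus d R).H_H i j s t

theorem H_thetaZ (i j : ι) (s : ℕ) (t : ℤ) : Commute (Uplus.H d R i s) (thetaZ d R j t) := by
  unfold thetaZ
  split_ifs
  · rw [thetaPlus_eq]
    exact expCoeff_commute_right (fun s t => ((H_comm j j s t).smul_left _).smul_right _)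
      (fun t => (H_comm i j s t).smul_right _) _
  · exact Commute.zero_right _

include hA in
theorem isPlus : IsPlus A d (E d R) (H d R) where
  currents := isCurrents hA
  H_zero i := by
    simp only [H, (Uplus.isPlus d R).H_zero, map_zero, add_zero]
  H_H i j s t := by
    have h1 : ∀ (a b : ℤ) {x y : TwistedSquare d R}, Commute x y →
        Commute (HahnSeries.single a x) (HahnSeries.single b y) := fun a b {x y} h => by
      rw [Commute, SemiconjBy, HahnSeries.single_mul_single, HahnSeries.single_mul_single, h.eq,
        add_comm]
    exact ((h1 _ _ ((H_comm i j s t).map inl)).add_right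
      (h1 _ _ (inr_mul_inl_of_zero (IsWeight.H j t) _).symm)).add_left
      ((h1 _ _ (inr_mul_inl_of_zero (IsWeight.H i s) _)).add_right
        (h1 _ _ ((H_comm i j s t).map inr)))
  H_X i j s l := by
    have hX := (Uplus.isPlus d R).H_X i j s
    ext p
    have e1 : (H d R i s * E d R j l).coeff p = inl (Uplus.H d R i s) * (E d R j l).coeff (p - s) +
        inr (Uplus.H d R i s) * (E d R j l).coeff p := by
      rw [H, add_mul, HahnSeries.coeff_add, HahnSeries.coeff_single_mul,
        HahnSeries.coeff_single_zero_mul]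
    have e2 : (E d R j l * H d R i s).coeff p = (E d R j l).coeff (p - s) * inl (Uplus.H d R i s) +
        (E d R j l).coeff p * inr (Uplus.H d R i s) := by
      rw [H, mul_add, HahnSeries.coeff_add, HahnSeries.coeff_mul_single,
        HahnSeries.coeff_mul_single_zero]
    have hc0 : ∀ l, Commute (inl (Uplus.H d R i s)) (inr (Eplus d R j l)) := by
      intro l
      have := inr_E_mul_inl hA j l (Uplus.H d R i s)
      rw [Uplus.wt_H] at this
      exact this.symm
    have hc1 : ∀ t l, Commute (inl (Uplus.H d R i s)) (inl (thetaZ d R j t) * inr (Eplus d R j l)) :=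
      fun t l => ((H_thetaZ i j s t).map inl).mul_right (hc0 l)
    have hc2 : ∀ x : Uplus d R, Commute (inr (Uplus.H d R i s)) (inl x) :=
      inr_mul_inl_of_zero (IsWeight.H i s)
    have hi := congrArg (inl (R := R) (d := d)) (hX l)
    have hr := fun l => congrArg (inr (R := R) (d := d)) (hX l)
    simp only [map_add, map_mul, map_smul] at hi hr
    rw [HahnSeries.coeff_add, HahnSeries.coeff_smul, e1, e2, coeff_E, coeff_E, coeff_E, mul_add,
      mul_add, add_mul, add_mul, (hc1 _ _).eq, ← mul_assoc (inr _), (hc2 _).eq,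
      mul_assoc (inl (thetaZ d R j p)), hr, mul_add, smul_add, mul_smul_comm,
      show l + (s : ℤ) - p = l - p + s by ring]
    have f1 : inl (Uplus.H d R i s) * (if p - (s : ℤ) = l then inl (Eplus d R j l) else 0) =
        (if p - (s : ℤ) = l then inl (Eplus d R j l) else 0) * inl (Uplus.H d R i s) +
          hcoef A d i j s • (if p = l + s then inl (Eplus d R j (l + s)) else 0) := by
      by_cases h : p = l + s
      · rw [if_pos h, if_pos (by omega), hi]
      · rw [if_neg h, if_neg (by omega), mul_zero, zero_mul, zero_add]
        exact (smul_zero _).symm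
    have f2 : inr (Uplus.H d R i s) * (if p = l then inl (Eplus d R j l) else 0) =
        (if p = l then inl (Eplus d R j l) else 0) * inr (Uplus.H d R i s) := by
      split_ifs
      · exact (hc2 _).eq
      · rw [mul_zero, zero_mul]
    rw [f1, f2]
    simp only [mul_assoc]
    abel

variable (R) in
/-- The twisted coproduct. -/
def Δ : Uplus d R →ₐ[Scalar] CompletedSquare d R := Uplus.lift hA (isPlus hA)

@[simp] theorem Δ_E (i : ι) (l : ℤ) : Δ R hA (Eplus d R i l) = E d R i l := Uplus.lift_E _ _ _ _

@[simp] theorem Δ_H (i : ι) (s : ℕ) : Δ R hA (Uplus.H d R i s) = H d R i s := Uplus.lift_H _ _ _ _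

/-- The two summands of the coproduct of `H_{i,s}` commute, so the exponential of their sum is the
product of the exponentials in the two factors. -/
theorem Δ_theta (i : ι) (m : ℕ) : Δ R hA (thetaPlus d R i m) =
    ∑ p ∈ Finset.HasAntidiagonal.antidiagonal m,
      HahnSeries.single (p.1 : ℤ) (tens d R (thetaPlus d R i p.1) (thetaPlus d R i p.2)) := by
  have h1 : (fun s => Δ R hA ((v⁻¹ - v) • Uplus.H d R i s)) =
      (fun s : ℕ => HahnSeries.single (s : ℤ) (inl ((v⁻¹ - v) • Uplus.H d R i s))) +
        fun s : ℕ => HahnSeries.single (0 : ℤ) (inr ((v⁻¹ - v) • Uplus.H d R i s)) := by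
    funext s
    rw [map_smul, Δ_H, H, smul_add, smul_hahnSingle, smul_hahnSingle, Pi.add_apply,
      map_smul inl, map_smul inr]
  have hcc : ∀ s t, Commute ((v⁻¹ - v) • Uplus.H d R i s) ((v⁻¹ - v) • Uplus.H d R i t) :=
    fun s t => ((H_comm i i s t).smul_left _).smul_right _
  have h2 : ∀ (a b : ℤ) {x y : TwistedSquare d R}, Commute x y →
      Commute (HahnSeries.single a x) (HahnSeries.single b y) := fun a b {x y} h => by
    rw [Commute, SemiconjBy, HahnSeries.single_mul_single, HahnSeries.single_mul_single, h.eq,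
      add_comm]
  rw [thetaPlus_eq, map_expCoeff, h1, expCoeff_add]
  · refine Finset.sum_congr rfl fun p _ => ?_
    rw [expCoeff_single, expCoeff_C, HahnSeries.single_mul_single, add_zero, thetaPlus_eq,
      thetaPlus_eq, ← inl_mul_inr, map_expCoeff, map_expCoeff]
  · exact fun s t => h2 _ _ ((hcc s t).map inl)
  · exact fun s t => h2 _ _ ((hcc s t).map inr)
  · exact fun s t => h2 _ _ (inr_mul_inl_of_zero ((IsWeight.H i t).smul _) _).symm

theorem isTwistedCoproduct : IsTwistedCoproduct (Δ R hA).toLinearMap where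
  map_one := map_one (Δ R hA)
  map_mul x y := map_mul (Δ R hA) x y
  map_E i n p := by
    change (Δ R hA (Eplus d R i n)).coeff p = _
    rw [Δ_E, coeff_E]
    congr 1
    unfold thetaZ
    split_ifs
    · rw [inl_mul_inr]
    · rw [map_zero, zero_mul]
  map_theta i m p := by
    change (Δ R hA (thetaPlus d R i m)).coeff p = _
    rw [Δ_theta, HahnSeries.coeff_sum]
    split_ifs with h
    · rw [Finset.sum_eq_single (p.toNat, m - p.toNat)]
      · rw [HahnSeries.coeff_single, if_pos (by simp [h.1])]
      · rintro ⟨a, b⟩ hab hne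
        have h1 := Finset.HasAntidiagonal.mem_antidiagonal.1 hab
        rw [HahnSeries.coeff_single_of_ne]
        rintro rfl
        exact hne (Prod.ext (by simp) (by simp at h1 ⊢; omega))
      · intro h1
        exact (h1 (Finset.HasAntidiagonal.mem_antidiagonal.2 (by simp; omega))).elim
    · refine Finset.sum_eq_zero fun ab hab => ?_
      have h1 := Finset.HasAntidiagonal.mem_antidiagonal.1 hab
      rw [HahnSeries.coeff_single_of_ne]
      rintro rfl
      exact h ⟨by omega, by omega⟩

end Coproduct

end Coproduct

/-! ### Right multiplications, and detection of currents by brackets. -/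

section RightOperators

variable {S : Type*} [Ring S] [Algebra Scalar S]

variable (S) in
/-- Right multiplication. -/
def rmul : S →ₐ[Scalar] (Module.End Scalar S)ᵐᵒᵖ :=
  AlgHom.ofLinearMap
    { toFun := fun x => MulOpposite.op (LinearMap.mulRight Scalar x)
      map_add' := fun x y => MulOpposite.unop_injective (LinearMap.ext fun z => mul_add z x y)
      map_smul' := fun c x => MulOpposite.unop_injective
        (LinearMap.ext fun z => mul_smul_comm c z x) }
    (MulOpposite.unop_injective (LinearMap.ext fun z => mul_one z))
    fun x y => MulOpposite.unop_injective (LinearMap.ext fun z => (mul_assoc z x y).symm)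

@[simp] theorem unop_rmul_apply (x z : S) : (rmul S x).unop z = z * x := rfl

theorem adHom_serreForm_snd (R : S) (u : Scalar) {r : ℕ} (x : Fin r → S) (y : S) {x' : Fin r → S}
    {y' : S} (hx : ∀ a, R * x a - x a * R = x' a) (hy : R * y - y * R = y') :
    R * serreForm u r x y - serreForm u r x y * R =
      (serreForm u r (fun a => dual (x a) (x' a)) (dual y y')).snd := by
  rw [bracket_serreForm]
  simp only [hx, hy]

theorem snd_serreForm_dual_zero (u : Scalar) {r : ℕ} (x : Fin r → S) (y z : S) :
    (serreForm u r (fun a => dual (x a) 0) (dual y z)).snd = serreForm u r x z := by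
  have h1 : ∀ y, serreForm u r (fun a => dual (x a) 0) (dual y 0) = dual (serreForm u r x y) 0 := by
    intro y
    have := map_serreForm (TrivSqZeroExt.inlAlgHom Scalar S S) u r x y
    simpa [dual] using this.symm
  have h3 := serreForm_central_mul u r (fun _ => 1) (fun a => dual (x a) 0) (DualNumber.eps)
    (dual z 0) (fun _ b => Commute.one_left b) DualNumber.commute_eps_left
  simp only [one_mul] at h3
  rw [dual_eq_add_eps, serreForm_add_right, h3, h1, h1]
  simp

/-- Currents are detected by their brackets with test operators. -/
theorem IsCurrents.of_bracket {ι : Type*} [DecidableEq ι] {A : Matrix ι ι ℤ} {d : ι → ℕ}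
    (hA : IsSymmetrizableGCM A d) {X ψ ρ : ι → ℤ → S}
    (hb : ∀ i n j m, ρ j m * X i n - X i n * ρ j m = if j = i then ψ i (n - m) else 0)
    (hψ : ∀ i, OneSided (ψ i)) (hq : ∀ i j, Quad (v ^ bMat A d i j) (ψ i) (X j))
    (Q : Subalgebra Scalar (S × Scalar)) (hX : ∀ i n, (X i n, 0) ∈ Q)
    (hdet : ∀ Z, (Z, 0) ∈ Q → (∀ j m, ρ j m * Z - Z * ρ j m = 0) → Z = 0) : IsCurrents A d X := by
  have hquad : ∀ i j, Quad (v ^ bMat A d i j) (X i) (X j) := by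
    intro i j l m
    rw [← sub_eq_zero]
    refine hdet _ ?_ fun k n => ?_
    · have h0 := Subalgebra.sub_mem _ (Subalgebra.sub_mem _
        (Subalgebra.smul_mem _ (Subalgebra.mul_mem _ (hX i (l + 1)) (hX j m)) (v ^ bMat A d i j))
        (Subalgebra.mul_mem _ (hX j m) (hX i (l + 1)))) (Subalgebra.sub_mem _
        (Subalgebra.mul_mem _ (hX i l) (hX j (m + 1)))
        (Subalgebra.smul_mem _ (Subalgebra.mul_mem _ (hX j (m + 1)) (hX i l)) (v ^ bMat A d i j)))
      simpa using h0
    · have hl : Quad (v ^ bMat A d i j) (fun l => if k = i then ψ i (l - n) else 0) (X j) := by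
        split_ifs
        · exact (hq i j).shift (-n)
        · exact Quad.zero_left
      have hr : Quad (v ^ bMat A d i j) (X i) (fun m => if k = j then ψ j (m - n) else 0) := by
        split_ifs
        · rw [hA.bMat_symm]
          exact ((hq j i).shift (-n)).symm
        · exact Quad.zero_right
      have h1 : ∀ i m, ρ k n * X i m = X i m * ρ k n + if k = i then ψ i (m - n) else 0 :=
        fun i m => by rw [← hb, add_sub_cancel]
      have h2 : ∀ i j l m, ρ k n * (X i l * X j m) - X i l * X j m * ρ k n =
          X i l * (if k = j then ψ j (m - n) else 0) +
            (if k = i then ψ i (l - n) else 0) * X j m := by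
        intro i j l m
        rw [← mul_assoc, h1, add_mul, mul_assoc, h1, mul_add]
        noncomm_ring
      have h3 := hl l m
      have h4 := hr l m
      have e := fun i j l m => eq_add_of_sub_eq (h2 i j l m)
      simp only [mul_sub, sub_mul, mul_smul_comm, smul_mul_assoc, e, smul_add]
      linear_combination (norm := module) h3 + h4
  refine ⟨hquad, fun i j hij r hr l m => ?_⟩
  rw [serreSum_eq]
  refine hdet _ ?_ fun k n => ?_
  · have := serreForm_mem Q (v ^ d i) (fun a => hX i (l a)) (hX j m)
    rwa [serreForm_prod, serreForm_zero_right] at this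
  · rw [adHom_serreForm_snd _ _ _ _ (fun a => hb i (l a) k n) (hb j m k n)]
    by_cases hki : k = i
    · subst hki
      simp only [if_true, if_neg hij]
      exact snd_serreForm_deform hA hij hr (hquad k k) (hquad k j) ((hq k k).shift (-n))
        ((hq k j).shift (-n)) ((hψ k).shift (-n)) l m
    · simp only [if_neg hki]
      rw [snd_serreForm_dual_zero]
      split_ifs
      · have hq' := hq j i
        rw [hA.bMat_symm] at hq'
        exact serreForm_oneSided hA hij hr (ψ := fun m => ψ j (m - n)) (hquad i i) (hq'.shift (-n))
          ((hψ j).shift (-n)) l m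
      · exact serreForm_zero_right _ _ _

end RightOperators

/-! ### The currents `coTheta`, the operators `F'` and their left Leibniz rules. -/

section FPrime

variable {ι : Type*} [Fintype ι] [DecidableEq ι] {A : Matrix ι ι ℤ} {d : ι → ℕ}
  {V : Type*} [AddCommGroup V] [Module ℂ V] {R : Realization A V}

/-- The coefficients of `v ^ {-b_{i,j}} exp ((v⁻¹ - v) ∑_{s ≥ 1} ([s b_{i,j}] / s) z ^ s)`. -/
def gcoef (A : Matrix ι ι ℤ) (d : ι → ℕ) (i j : ι) (t : ℕ) : Scalar :=
  v ^ (-bMat A d i j) * expCoeff (fun s : ℕ => (v⁻¹ - v) * hcoef A d i j s) t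

omit [Fintype ι] [DecidableEq ι] in
theorem gcoef_symm (hA : IsSymmetrizableGCM A d) (i j : ι) (t : ℕ) :
    gcoef A d i j t = gcoef A d j i t := by
  simp only [gcoef, hA.bMat_symm i j, hcoef_symm hA i j]

namespace Uplus

instance : Ring (Module.End Scalar (Uplus d R))ᵐᵒᵖ := inferInstance
instance : Algebra Scalar (Module.End Scalar (Uplus d R))ᵐᵒᵖ := inferInstance

theorem right_induction {p : Uplus d R → Prop} (one : p 1) (add : ∀ x y, p x → p y → p (x + y))
    (smul : ∀ (c : Scalar) x, p x → p (c • x)) (mul_E : ∀ i l x, p x → p (x * Eplus d R i l))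
    (mul_H : ∀ i s x, p x → p (x * H d R i s)) (x : Uplus d R) : p x := by
  have hx : x ∈ Algebra.adjoin Scalar
      ({x | ∃ i l, x = Eplus d R i l} ∪ {x | ∃ i s, x = H d R i s}) := by
    rw [adjoin_eq_top]; trivial
  suffices h : ∀ y, p y → p (y * x) by simpa using h 1 one
  induction hx using Algebra.adjoin_induction with
  | mem g hg =>
    obtain ⟨i, l, rfl⟩ | ⟨i, s, rfl⟩ := hg
    · exact mul_E i l
    · exact mul_H i s
  | algebraMap c =>
    intro y hy
    rw [← Algebra.commutes, ← Algebra.smul_def]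
    exact smul c y hy
  | add a b _ _ ha hb => intro y hy; rw [mul_add]; exact add _ _ (ha y hy) (hb y hy)
  | mul a b _ _ ha hb => intro y hy; rw [← mul_assoc]; exact hb _ (ha y hy)

variable (hA : IsSymmetrizableGCM A d)

theorem smul_der_comm (i : ι) (s t : ℕ) :
    Commute ((v⁻¹ - v) • der R hA i s) ((v⁻¹ - v) • der R hA i t) :=
  ((der_comm hA i i s t).smul_left _).smul_right _

variable (R) in
/-- The current `K exp ((v⁻¹ - v) ∑_{s ≥ 1} der_{i,s} z ^ s)`. -/
def coTheta (i : ι) (u : ℤ) : Module.End Scalar (Uplus d R) :=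
  plusCurrent (wtOp R hA fun j => v ^ (-bMat A d i j)) (fun s => (v⁻¹ - v) • der R hA i s) u

theorem coTheta_neg (i : ι) {u : ℤ} (hu : u < 0) : coTheta R hA i u = 0 := plusCurrent_neg _ _ hu

theorem coTheta_one (i : ι) (u : ℤ) : coTheta R hA i u 1 = if u = 0 then 1 else 0 := by
  rcases lt_or_ge u 0 with hu | hu
  · rw [coTheta_neg hA i hu, if_neg hu.ne]; rfl
  lift u to ℕ using hu
  have h : ∀ u : ℕ, expCoeff (fun s => (v⁻¹ - v) • der R hA i s) u 1 = if u = 0 then 1 else 0 := by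
    intro u
    rw [expCoeff, LinearMap.sum_apply, Finset.sum_eq_single 0]
    · simp [PowerSeries.coeff_one]
      split_ifs <;> simp
    · intro k _ hk
      obtain ⟨k, rfl⟩ := Nat.exists_eq_succ_of_ne_zero hk
      rw [LinearMap.smul_apply, pow_succ, PowerSeries.coeff_mul, LinearMap.sum_apply,
        Finset.sum_eq_zero, smul_zero]
      intro p _
      rw [PowerSeries.coeff_mk, Module.End.mul_apply]
      split_ifs
      · exact map_zero _
      · rw [LinearMap.smul_apply, der_one, smul_zero, map_zero]
    · simp
  rw [coTheta, plusCurrent_natCast, Module.End.mul_apply, h]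
  split_ifs <;> simp_all

theorem wtOp_coTheta (g : ι → Scalar) (i : ι) (u : ℤ) :
    Commute (wtOp R hA g) (coTheta R hA i u) :=
  commute_plusCurrent (smul_der_comm hA i) (wtOp_comm hA _ _)
    (fun s => (wtOp_der hA g i s).smul_right _) u

theorem der_coTheta (i j : ι) (s : ℕ) (u : ℤ) : Commute (der R hA i s) (coTheta R hA j u) :=
  commute_plusCurrent (smul_der_comm hA j) (wtOp_der hA _ i s).symm
    (fun t => (der_comm hA i j s t).smul_right _) u

/-- The operator `Y` is kept general in order to cover both left and right multiplication by
`H_{j,s}`. -/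
theorem coTheta_mul_of_bracket (i j : ι) {s : ℕ} (hs : 0 < s) (u : ℤ)
    {Y : Module.End Scalar (Uplus d R)} (hw : Commute Y (wtOp R hA fun j => v ^ (-bMat A d i j)))
    (hY : ∀ t, Y * der R hA i t = der R hA i t * Y +
      if t = s then (-(hcoef A d i j s / (v⁻¹ - v))) • 1 else 0) :
    coTheta R hA i u * Y = Y * coTheta R hA i u + hcoef A d i j s • coTheta R hA i (u - s) := by
  have h1 := mul_plusCurrent_central (S := Module.End Scalar (Uplus d R)) (smul_der_comm hA i)
    (c := -hcoef A d i j s) hw hs (fun t => by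
      rw [mul_smul_comm, hY, smul_add, smul_mul_assoc]
      congr 1
      split_ifs with h
      · rw [smul_smul, mul_neg, mul_div_cancel₀ _ generic_v.qint_den_ne]
      · exact smul_zero _) u
  rw [coTheta, coTheta, h1, add_assoc]
  have h2 : ∀ x : Module.End Scalar (Uplus d R), (-hcoef A d i j s) • x + hcoef A d i j s • x = 0 :=
    fun x => (add_smul _ _ x).symm.trans (by rw [neg_add_cancel]; exact zero_smul Scalar x)
  rw [h2, add_zero]

theorem coTheta_mul_mulOp_H (i j : ι) (s : ℕ) (u : ℤ) :
    coTheta R hA i u * mulOp d R (H d R j s) = mulOp d R (H d R j s) * coTheta R hA i u +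
      hcoef A d i j s • coTheta R hA i (u - s) := by
  rcases Nat.eq_zero_or_pos s with rfl | hs
  · rw [(isPlus d R).H_zero, map_zero, mul_zero, zero_mul, Nat.cast_zero, hcoef_zero, zero_add]
    exact (zero_smul Scalar _).symm
  exact coTheta_mul_of_bracket hA i j hs u (wtOp_mulOp_H hA _ j s).symm fun t =>
    mulOp_H_mul_der hA i t j s

/-- Any `N > u` is allowed, since the surplus terms contain `coTheta` in negative degree; a common
`N` is convenient when several such sums are combined. -/
theorem coTheta_mul_mulOp_E (i j : ι) (u l : ℤ) {N : ℕ} (hN : u < N) :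
    coTheta R hA i u * mulOp d R (Eplus d R j l) = ∑ t ∈ Finset.range N,
      gcoef A d i j t • (mulOp d R (Eplus d R j (l - t)) * coTheta R hA i (u - t)) := by
  rcases lt_or_ge u 0 with hu | hu
  · rw [coTheta_neg hA i hu, zero_mul]
    refine (Finset.sum_eq_zero fun t _ => ?_).symm
    rw [coTheta_neg hA i (by omega), mul_zero]
    exact smul_zero _
  lift u to ℕ using hu
  have h1 := expCoeff_mul_current_scalar (S := Module.End Scalar (Uplus d R)) (smul_der_comm hA i)
    (κ := fun s : ℕ => (v⁻¹ - v) * hcoef A d i j s)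
    (X := fun l => mulOp d R (Eplus d R j (-l))) (fun s _ l => by
      rw [smul_bracket, der_mul_mulOp_E, smul_smul,
        show -(l + (s : ℤ)) = -l - s by ring]) u (-l)
  rw [neg_neg] at h1
  have h2 : ∀ n : ℕ, coTheta R hA i n = (wtOp R hA fun j => v ^ (-bMat A d i j)) *
      expCoeff (fun s => (v⁻¹ - v) • der R hA i s) n := fun n => plusCurrent_natCast _ _ _
  rw [h2, mul_assoc, h1, Finset.Nat.sum_antidiagonal_eq_sum_range_succ_mk, Finset.mul_sum]
  refine Finset.sum_congr_of_eq_on_inter (fun t _ h => ?_) (fun t h h' => ?_) fun t _ h => ?_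
  · exact (h (Finset.mem_range.2 (by have := Finset.mem_range.1 ‹t ∈ _›; omega))).elim
  · rw [coTheta_neg hA i (by have := Finset.mem_range.not.1 h'; omega), mul_zero]
    exact smul_zero _
  · have ht : t ≤ u := by have := Finset.mem_range.1 ‹t ∈ Finset.range u.succ›; omega
    rw [show ((u : ℤ) - t) = ((u - t : ℕ) : ℤ) by omega, h2, mul_smul_comm, ← mul_assoc,
      wtOp_mul_mulOp_E, smul_mul_assoc, smul_smul, mul_assoc, mul_comm, gcoef]
    simp only [neg_add, neg_neg, sub_eq_add_neg]

/-! ### The operators `F'_{i,n}` -/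

theorem coTheta_mul_H (i j : ι) (s : ℕ) (u : ℤ) (x : Uplus d R) :
    coTheta R hA i u (x * H d R j s) = coTheta R hA i u x * H d R j s +
      hcoef A d i j s • coTheta R hA i (u - s) x := by
  rcases Nat.eq_zero_or_pos s with rfl | hs
  · rw [(isPlus d R).H_zero, mul_zero, map_zero, mul_zero, Nat.cast_zero, hcoef_zero, zero_add]
    exact (zero_smul Scalar _).symm
  refine DFunLike.congr_fun (coTheta_mul_of_bracket hA i j hs u
    (Y := LinearMap.mulRight Scalar (H d R j s)) ?_ fun t => ?_) x
  · ext y : 1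
    change wt R hA _ y * _ = wt R hA _ (y * _)
    rw [map_mul, wt_H]
  · ext y : 1
    change der R hA i t y * _ = der R hA i t (y * _) + _
    rw [der_mul, der_H]
    by_cases h : s = t
    · subst h
      simp
    · simp [h, Ne.symm h]

theorem quad_coTheta (i j : ι) : Quad (v ^ bMat A d i j)
    (fun l => MulOpposite.op (coTheta R hA i (-l))) (fun l => rmul _ (Eplus d R j l)) := by
  have h1 : Quad (v ^ bMat A d i j) (coTheta R hA i)
      (fun l => LinearMap.mulRight Scalar (Eplus d R j (-l))) := by
    refine quad_plusCurrent (v_zpow_ne_zero _) (fun l => ?_) (smul_der_comm hA i) fun s _ l => ?_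
    · ext x : 1
      change wt R hA _ (x * Eplus d R j (-l)) = (v ^ bMat A d i j)⁻¹ • (wt R hA _ x * Eplus d R j (-l))
      rw [map_mul, wt_E, mul_smul_comm, zpow_neg]
    · rw [smul_bracket, kappa_eq_hcoef, ← smul_smul]
      congr 1
      ext x : 1
      change der R hA i s (x * Eplus d R j (-l)) - der R hA i s x * Eplus d R j (-l) =
        hcoef A d i j s • (x * Eplus d R j (-(l + s)))
      rw [der_mul, der_E, add_sub_cancel_right, mul_smul_comm, show -(l + (s : ℤ)) = -l - s by ring]
  have h2 := h1.op_neg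
  simp only [neg_neg] at h2
  exact h2

include hA in
theorem exists_derivation {T : Type*} [Ring T] [Algebra Scalar T] (π : Uplus d R →ₐ[Scalar] T)
    {w : ι → ℤ → T} (hP : IsPlus A d (fun j l => dual (π (Eplus d R j l)) (w j l))
      (fun j s => dual (π (H d R j s)) 0)) :
    ∃ D : Uplus d R →ₗ[Scalar] T, (∀ x y, D (x * y) = π x * D y + D x * π y) ∧
      (∀ j l, D (Eplus d R j l) = w j l) ∧ ∀ j s, D (H d R j s) = 0 := by
  have h1 : ∀ x, (lift (R := R) hA hP x).fst = π x := by
    have : (TrivSqZeroExt.fstHom Scalar T T).comp (lift (R := R) hA hP) = π :=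
      algHom_ext (fun i l => by simp) fun i s => by simp
    exact fun n => DFunLike.congr_fun this n
  refine ⟨{ toFun := fun x => (lift (R := R) hA hP x).snd
            map_add' := fun x y => by rw [map_add, TrivSqZeroExt.snd_add]
            map_smul' := fun c x => by rw [map_smul, TrivSqZeroExt.snd_smul]; rfl },
    fun x y => ?_, fun j l => ?_, fun j s => ?_⟩
  · change (lift (R := R) hA hP (x * y)).snd = _
    rw [map_mul, DualNumber.snd_mul, h1, h1]
    rfl
  · change (lift (R := R) hA hP (Eplus d R j l)).snd = _
    rw [lift_E, snd_dual]
  · change (lift (R := R) hA hP (H d R j s)).snd = _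
    rw [lift_H, snd_dual]

/-- The right regular representation, valued in the opposite algebra, is deformed along `coTheta`.
As a function of `l` this current vanishes for `l > n`, so the Serre relations are automatic, and
compatibility with the undeformed `H_{j,s}` is `coTheta_mul_H`. -/
theorem exists_FPrime (i : ι) (n : ℤ) : ∃ r : Module.End Scalar (Uplus d R), r 1 = 0 ∧
    (∀ x j l, r (x * Eplus d R j l) =
      r x * Eplus d R j l + if j = i then coTheta R hA i (n - l) x else 0) ∧
    ∀ x j s, r (x * H d R j s) = r x * H d R j s := by
  have hP : IsPlus A d (fun j l => dual (rmul _ (Eplus d R j l))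
      (if j = i then MulOpposite.op (coTheta R hA i (n - l)) else 0))
      (fun j s => dual (rmul _ (H d R j s)) 0) := by
    refine ⟨((isPlus d R).currents.map (T := (Module.End Scalar (Uplus d R))ᵐᵒᵖ) (rmul _)).deform hA i
      (ψ := fun l => MulOpposite.op (coTheta R hA i (n - l))) ?_ fun j => ?_, fun j => ?_,
      fun j k s t => ?_, fun j k s l => ?_⟩
    · refine Or.inl ⟨n, fun m hm => ?_⟩
      change MulOpposite.op (coTheta R hA i (n - m)) = 0
      rw [coTheta_neg hA i (by omega), MulOpposite.op_zero]
    · have := (quad_coTheta (R := R) hA i j).shift (-n)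
      simpa only [← sub_eq_add_neg, neg_sub] using this
    · rw [(isPlus d R).H_zero, map_zero]; simp [dual]
    · rw [dual_mul, dual_mul, ← map_mul, (isPlus d R).H_H, map_mul]; simp
    · rw [dual_mul, dual_mul, smul_dual, dual_add, ← map_mul, (isPlus d R).H_X, map_add, map_mul,
        map_smul]
      congr 1
      split_ifs with h
      · subst h
        refine MulOpposite.unop_injective (LinearMap.ext fun x => ?_)
        have h1 := coTheta_mul_H hA k j s (n - l) x
        rw [hcoef_symm hA, sub_sub] at h1
        simpa using h1
      · simp
  obtain ⟨D, h1, h2, h3⟩ := exists_derivation hA (rmul (Uplus d R)) (w := fun j l => if j = i then MulOpposite.op (coTheta R hA i (n - l)) else 0) hP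
  refine ⟨{ toFun := fun x => (D x).unop 1
            map_add' := fun x y => by rw [map_add]; rfl
            map_smul' := fun c x => by rw [map_smul]; rfl }, ?_, fun x j l => ?_, fun x j s => ?_⟩
  · have h4 := h1 1 1
    rw [map_one, one_mul, one_mul, mul_one, left_eq_add] at h4
    change (D 1).unop 1 = 0
    rw [h4]; rfl
  · change (D (x * _)).unop 1 = (D x).unop 1 * _ + _
    rw [h1, h2, MulOpposite.unop_add, LinearMap.add_apply, add_comm]
    congr 1
    split_ifs
    · exact congrArg _ (one_mul x)
    · rfl
  · change (D (x * _)).unop 1 = (D x).unop 1 * _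
    rw [h1, h3, mul_zero, zero_add]
    rfl

variable (R) in
/-- The operator `F'_{i,n}`. -/
def FPrime (i : ι) (n : ℤ) : Module.End Scalar (Uplus d R) := (exists_FPrime (R := R) hA i n).choose

@[simp] theorem FPrime_one (i : ι) (n : ℤ) : FPrime R hA i n 1 = 0 :=
  (exists_FPrime hA i n).choose_spec.1

theorem FPrime_mul_E (i : ι) (n : ℤ) (x : Uplus d R) (j : ι) (l : ℤ) :
    FPrime R hA i n (x * Eplus d R j l) =
      FPrime R hA i n x * Eplus d R j l + if j = i then coTheta R hA i (n - l) x else 0 :=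
  (exists_FPrime hA i n).choose_spec.2.1 x j l

theorem FPrime_mul_H (i : ι) (n : ℤ) (x : Uplus d R) (j : ι) (s : ℕ) :
    FPrime R hA i n (x * H d R j s) = FPrime R hA i n x * H d R j s :=
  (exists_FPrime hA i n).choose_spec.2.2 x j s

/-- This is the finiteness that makes sense of the a priori infinite left Leibniz rule. -/
theorem FPrime_bounded (i : ι) (x : Uplus d R) : ∃ m, ∀ n < m, FPrime R hA i n x = 0 := by
  induction x using right_induction with
  | one => exact ⟨0, fun n _ => FPrime_one hA i n⟩
  | add x y hx hy =>
    obtain ⟨a, ha⟩ := hx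
    obtain ⟨b, hb⟩ := hy
    exact ⟨min a b, fun n hn => by rw [map_add, ha n (by omega), hb n (by omega), add_zero]⟩
  | smul c x hx =>
    obtain ⟨a, ha⟩ := hx
    exact ⟨a, fun n hn => by rw [map_smul, ha n hn, smul_zero]⟩
  | mul_E j l x hx =>
    obtain ⟨a, ha⟩ := hx
    exact ⟨min a l, fun n hn => by
      rw [FPrime_mul_E, ha n (by omega), zero_mul, coTheta_neg hA i (by omega)]; simp⟩
  | mul_H j s x hx =>
    obtain ⟨a, ha⟩ := hx
    exact ⟨a, fun n hn => by rw [FPrime_mul_H, ha n hn, zero_mul]⟩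

theorem FPrime_H_mul (i : ι) (n : ℤ) (j : ι) (s : ℕ) (x : Uplus d R) :
    FPrime R hA i n (H d R j s * x) =
      H d R j s * FPrime R hA i n x + hcoef A d i j s • FPrime R hA i (n - s) x := by
  induction x using right_induction generalizing n with
  | one =>
    have := FPrime_mul_H (R := R) hA i n 1 j s
    rw [one_mul] at this
    rw [mul_one, this, FPrime_one, FPrime_one, zero_mul, mul_zero, smul_zero, add_zero]
  | add x y hx hy => rw [mul_add, map_add, map_add, map_add, hx, hy, mul_add, smul_add]; abel
  | smul c x hx =>
    rw [mul_smul_comm, map_smul, map_smul, map_smul, hx, smul_add, mul_smul_comm,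
      smul_comm c (hcoef A d i j s)]
  | mul_E k l x hx =>
    have h1 := DFunLike.congr_fun (coTheta_mul_mulOp_H hA i j s (n - l)) x
    simp only [Module.End.mul_apply, mulOp_apply, LinearMap.add_apply, LinearMap.smul_apply] at h1
    rw [← mul_assoc, FPrime_mul_E, FPrime_mul_E, FPrime_mul_E, hx, h1, add_mul, mul_add, mul_assoc,
      smul_mul_assoc, smul_add, show n - (s : ℤ) - l = n - l - s by ring]
    split_ifs
    · abel
    · simp
  | mul_H k t x hx =>
    rw [← mul_assoc, FPrime_mul_H, FPrime_mul_H, FPrime_mul_H, hx, add_mul, mul_assoc, smul_mul_assoc]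

/-- The rule for left multiplication is extracted from the defining rule for right multiplication by
induction on right words. Validity for all large `N` is what allows the bounds of different summands
to be merged. -/
theorem exists_FPrime_E_mul (i : ι) (n : ℤ) (j : ι) (l : ℤ) (x : Uplus d R) :
    ∃ N₀ : ℕ, ∀ N ≥ N₀, FPrime R hA i n (Eplus d R j l * x) = (if i = j ∧ n = l then x else 0) +
      ∑ t ∈ Finset.range N, gcoef A d i j t • (Eplus d R j (l - t) * FPrime R hA i (n - t) x) := by
  induction x using right_induction generalizing n with
  | one =>
    refine ⟨0, fun N _ => ?_⟩
    have h1 := FPrime_mul_E (R := R) hA i n 1 j l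
    rw [one_mul, FPrime_one, zero_mul, zero_add] at h1
    rw [mul_one, h1, Finset.sum_eq_zero fun t _ => by rw [FPrime_one, mul_zero, smul_zero], add_zero]
    rw [coTheta_one]
    by_cases h : j = i <;> by_cases h' : n = l <;> simp [h, h', Ne.symm, sub_eq_zero]
  | add x y hx hy =>
    obtain ⟨a, ha⟩ := hx n
    obtain ⟨b, hb⟩ := hy n
    refine ⟨max a b, fun N hN => ?_⟩
    rw [mul_add, map_add, ha N (by omega), hb N (by omega)]
    simp only [map_add, mul_add, smul_add, Finset.sum_add_distrib]
    split_ifs <;> abel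
  | smul c x hx =>
    obtain ⟨a, ha⟩ := hx n
    refine ⟨a, fun N hN => ?_⟩
    rw [mul_smul_comm, map_smul, ha N hN, smul_add, Finset.smul_sum]
    simp only [map_smul, mul_smul_comm, smul_comm c]
    split_ifs <;> simp
  | mul_E k m x hx =>
    obtain ⟨a, ha⟩ := hx n
    refine ⟨max a ((n - m).toNat + 1), fun N hN => ?_⟩
    have h1 := DFunLike.congr_fun (coTheta_mul_mulOp_E hA i j (n - m) l (N := N) (by omega)) x
    simp only [Module.End.mul_apply, mulOp_apply, LinearMap.sum_apply, LinearMap.smul_apply] at h1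
    rw [← mul_assoc, FPrime_mul_E, ha N (by omega), h1, add_mul, ite_mul, zero_mul, add_assoc]
    congr 1
    simp only [FPrime_mul_E, mul_add, smul_add, Finset.sum_add_distrib, Finset.sum_mul,
      smul_mul_assoc, mul_assoc]
    congr 1
    split_ifs
    · exact Finset.sum_congr rfl fun t _ => by rw [show n - (t : ℤ) - m = n - m - t by ring]
    · simp
  | mul_H k s x hx =>
    obtain ⟨a, ha⟩ := hx n
    refine ⟨a, fun N hN => ?_⟩
    rw [← mul_assoc, FPrime_mul_H, ha N hN, add_mul, Finset.sum_mul]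
    simp only [FPrime_mul_H, smul_mul_assoc, mul_assoc, ite_mul, zero_mul]

theorem FPrime_E_mul (i : ι) (n : ℤ) (j : ι) (l : ℤ) (x : Uplus d R) {N : ℕ}
    (hN : ∀ t : ℕ, N ≤ t → FPrime R hA i (n - t) x = 0) :
    FPrime R hA i n (Eplus d R j l * x) = (if i = j ∧ n = l then x else 0) +
      ∑ t ∈ Finset.range N, gcoef A d i j t • (Eplus d R j (l - t) * FPrime R hA i (n - t) x) := by
  obtain ⟨a, ha⟩ := exists_FPrime_E_mul hA i n j l x
  rw [ha (max a N) (le_max_left _ _)]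
  congr 1
  refine (Finset.sum_subset (Finset.range_mono (le_max_right _ _)) fun t _ ht => ?_).symm
  rw [hN t (not_lt.1 fun h => ht (Finset.mem_range.2 h)), mul_zero, smul_zero]

theorem FPrime_eventually (i : ι) (n : ℤ) (x : Uplus d R) :
    ∃ N : ℕ, ∀ t : ℕ, N ≤ t → FPrime R hA i (n - t) x = 0 := by
  obtain ⟨m, hm⟩ := FPrime_bounded hA i x
  exact ⟨(n - m).toNat + 1, fun t ht => hm _ (by omega)⟩

end Uplus

end FPrime

/-! ### Relations between the operators `F'`. -/

section FPrimeRelations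

variable {ι : Type*} [Fintype ι] [DecidableEq ι] {A : Matrix ι ι ℤ} {d : ι → ℕ}
  {V : Type*} [AddCommGroup V] [Module ℂ V] {R : Realization A V}

namespace Uplus

variable (hA : IsSymmetrizableGCM A d)

theorem FPrime_der (i j : ι) (s : ℕ) (n : ℤ) (x : Uplus d R) :
    FPrime R hA j n (der R hA i s x) =
      der R hA i s (FPrime R hA j n x) + hcoef A d i j s • FPrime R hA j (n + s) x := by
  induction x using right_induction generalizing n with
  | one => simp
  | add x y hx hy => simp only [map_add, hx, hy, smul_add]; abel
  | smul c x hx => simp only [map_smul, hx, smul_add, smul_comm c]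
  | mul_E k l x hx =>
    have h1 := DFunLike.congr_fun (der_coTheta (R := R) hA i j s (n - l)) x
    simp only [Module.End.mul_apply] at h1
    rw [der_mul, der_E, map_add, mul_smul_comm, map_smul, FPrime_mul_E, FPrime_mul_E, FPrime_mul_E,
      FPrime_mul_E, map_add, der_mul, der_E, hx, show n - (l - s) = n - l + s by ring,
      show n + (s : ℤ) - l = n - l + s by ring]
    split_ifs with h
    · subst h
      rw [h1, add_mul, smul_mul_assoc, mul_smul_comm]
      module
    · simp only [add_zero, map_zero, add_mul, smul_mul_assoc, mul_smul_comm]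
      abel
  | mul_H k t x hx =>
    rw [der_mul, der_H, map_add, FPrime_mul_H, FPrime_mul_H, FPrime_mul_H, der_mul, der_H, hx]
    split_ifs
    · simp only [mul_smul_comm, mul_one, map_smul, add_mul, smul_mul_assoc]
      abel
    · simp only [mul_zero, map_zero, zero_add, add_mul, smul_mul_assoc]

theorem FPrime_wt (g : ι → Scalar) (j : ι) (n : ℤ) (x : Uplus d R) :
    FPrime R hA j n (wt R hA g x) = g j • wt R hA g (FPrime R hA j n x) := by
  induction x using right_induction with
  | one => simp
  | add x y hx hy => simp only [map_add, hx, hy, smul_add]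
  | smul c x hx => simp only [map_smul, hx, smul_comm c]
  | mul_E k l x hx =>
    have h1 := DFunLike.congr_fun (wtOp_coTheta (R := R) hA g j (n - l)) x
    simp only [Module.End.mul_apply, wtOp_apply] at h1
    rw [map_mul, wt_E, mul_smul_comm, map_smul, FPrime_mul_E, FPrime_mul_E, map_add, map_mul, wt_E,
      hx]
    split_ifs with h
    · subst h
      rw [h1, smul_mul_assoc, mul_smul_comm]
    · simp only [add_zero, map_zero, smul_mul_assoc, mul_smul_comm, smul_comm (g k)]
  | mul_H k t x hx =>
    rw [map_mul, wt_H, FPrime_mul_H, FPrime_mul_H, map_mul, wt_H, hx, smul_mul_assoc]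

theorem quad_op_coTheta_FPrime (i j : ι) : Quad (v ^ bMat A d i j)
    (fun l => MulOpposite.op (coTheta R hA i l)) (fun l => MulOpposite.op (FPrime R hA j l)) := by
  have h1 : Quad (v ^ bMat A d i j)⁻¹ (coTheta R hA i) (FPrime R hA j) := by
    refine quad_plusCurrent (inv_ne_zero (v_zpow_ne_zero _)) (fun l => ?_) (smul_der_comm hA i)
      fun s _ l => ?_
    · rw [inv_inv]
      ext x : 1
      change wt R hA _ (FPrime R hA j l x) = v ^ bMat A d i j • FPrime R hA j l (wt R hA _ x)
      rw [FPrime_wt, smul_smul, ← zpow_add₀ generic_v.ne_zero, add_neg_cancel, zpow_zero]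
      exact (one_smul Scalar _).symm
    · rw [smul_bracket, kappa_inv, kappa_eq_hcoef, ← mul_neg, ← smul_smul]
      congr 1
      ext x : 1
      change der R hA i s (FPrime R hA j l x) - FPrime R hA j l (der R hA i s x) =
        (-hcoef A d i j s) • FPrime R hA j (l + s) x
      rw [FPrime_der]
      module
  have h2 := h1.op (inv_ne_zero (v_zpow_ne_zero _))
  rwa [inv_inv] at h2

/-- The operators `F'_{i,n}` satisfy the relations of the opposite currents. -/
theorem isCurrents_op_FPrime : IsCurrents A d fun i n => MulOpposite.op (FPrime R hA i n) := by
  -- The scalar records the action on the vector `1`. An element `(Z, 0)` of `Q` kills `1` and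
  -- commutes with right multiplication by the `H_{j,s}`; if it also commutes with right
  -- multiplication by the `E_{j,m}`, it is zero.
  let Q : Subalgebra Scalar ((Module.End Scalar (Uplus d R))ᵐᵒᵖ × Scalar) :=
    { carrier := {z | z.1.unop 1 = z.2 • (1 : Uplus d R) ∧
        ∀ x j s, z.1.unop (x * H d R j s) = z.1.unop x * H d R j s}
      mul_mem' := fun {a b} ha hb => by
        refine ⟨?_, fun x j s => ?_⟩
        · change b.1.unop (a.1.unop 1) = (a.2 * b.2) • (1 : Uplus d R)
          rw [ha.1, map_smul, hb.1, smul_smul]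
        · change b.1.unop (a.1.unop (x * H d R j s)) = b.1.unop (a.1.unop x) * H d R j s
          rw [ha.2, hb.2]
      add_mem' := fun {a b} ha hb => by
        refine ⟨?_, fun x j s => ?_⟩
        · change a.1.unop 1 + b.1.unop 1 = (a.2 + b.2) • (1 : Uplus d R)
          rw [ha.1, hb.1, add_smul]
        · change a.1.unop (x * H d R j s) + b.1.unop (x * H d R j s) =
            (a.1.unop x + b.1.unop x) * H d R j s
          rw [ha.2, hb.2, add_mul]
      algebraMap_mem' := fun c => ⟨rfl, fun x j s => (smul_mul_assoc c x (H d R j s)).symm⟩ }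
  refine IsCurrents.of_bracket hA (ψ := fun i l => MulOpposite.op (coTheta R hA i l))
    (ρ := fun j m => rmul _ (Eplus d R j m)) (fun i n j m => ?_) (fun i => ?_)
    (quad_op_coTheta_FPrime hA) Q (fun i n => ?_) fun Z hZ h => ?_
  · refine MulOpposite.unop_injective (LinearMap.ext fun x => ?_)
    have h1 := FPrime_mul_E hA i n x j m
    have h2 : (if j = i then MulOpposite.op (coTheta R hA i (n - m)) else 0).unop x =
      if j = i then coTheta R hA i (n - m) x else 0 := by split_ifs <;> rfl
    rw [h2]
    exact sub_eq_of_eq_add' h1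
  · exact Or.inr ⟨0, fun m hm => congrArg MulOpposite.op (coTheta_neg hA i hm)⟩
  · exact ⟨(FPrime_one hA i n).trans (zero_smul Scalar _).symm, fun x j s => FPrime_mul_H hA i n x j s⟩
  · refine MulOpposite.unop_injective (LinearMap.ext fun x => ?_)
    change Z.unop x = 0
    induction x using right_induction with
    | one => exact hZ.1.trans (zero_smul Scalar _)
    | add x y hx hy => rw [map_add, hx, hy, add_zero]
    | smul c x hx => rw [map_smul, hx, smul_zero]
    | mul_E j m x hx =>
      have h1 := DFunLike.congr_fun (congrArg MulOpposite.unop (h j m)) x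
      change Z.unop (x * Eplus d R j m) - Z.unop x * Eplus d R j m = 0 at h1
      rwa [hx, zero_mul, sub_zero] at h1
    | mul_H j s x hx => 
      have h1 := hZ.2 x j s
      change Z.unop _ = Z.unop x * _ at h1
      rw [h1, hx, zero_mul]

end Uplus

end FPrimeRelations

/-! ### The symmetric bilinear form. -/

section Pairing

variable {ι : Type*} [Fintype ι] [DecidableEq ι] {A : Matrix ι ι ℤ} {d : ι → ℕ}
  {V : Type*} [AddCommGroup V] [Module ℂ V] {R : Realization A V}

namespace Uplus

variable (hA : IsSymmetrizableGCM A d)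

omit [Fintype ι] [DecidableEq ι] in
theorem _root_.QuantumLoop.isPlus_zero {S : Type*} [Ring S] [Algebra Scalar S] :
    IsPlus A d (fun _ _ => (0 : S)) fun _ _ => 0 where
  currents := ⟨fun _ _ => Quad.zero_left, fun i j _ r _ l m => by
    rw [serreSum_eq]; exact serreForm_zero_right _ _ _⟩
  H_zero _ := rfl
  H_H _ _ _ _ := rfl
  H_X _ _ _ _ := by simp

variable (R) in
/-- The counit. -/
def counit : Uplus d R →ₐ[Scalar] Scalar := lift hA isPlus_zero

@[simp] theorem counit_E (i : ι) (l : ℤ) : counit R hA (Eplus d R i l) = 0 := lift_E _ _ _ _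

@[simp] theorem counit_H (i : ι) (s : ℕ) : counit R hA (H d R i s) = 0 := lift_H _ _ _ _

theorem der_zero (i : ι) : der R hA i 0 = 0 := by
  refine ext_of_bracket (by simp) (fun k l x hx => ?_) fun k t x hx => ?_
  · simp only [LinearMap.zero_apply] at hx ⊢
    rw [der_mul, hx, mul_zero, zero_add, der_E, Nat.cast_zero, hcoef_zero, smul_mul_assoc]
    exact zero_smul Scalar _
  · simp only [LinearMap.zero_apply] at hx ⊢
    rw [der_mul, hx, mul_zero, zero_add, der_H, Nat.cast_zero, hcoef_zero, zero_div]
    split_ifs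
    · rw [smul_mul_assoc]
      exact zero_smul Scalar _
    · exact zero_mul _

/-- The rescaled `F'_{i,n}` and the `der` are the intended adjoints of left multiplication. Because
they satisfy the relations of `Uplus` in the opposite algebra, the universal property yields an
adjoint for every element, and with it the form. -/
theorem isPlus_op : IsPlus A d
    (fun i n => (v ^ (-2 : ℤ) - 1)⁻¹ • MulOpposite.op (FPrime R hA i n))
    (fun i s => MulOpposite.op (der R hA i s)) := by
  refine IsPlus.smul (g := fun _ => (v ^ (-2 : ℤ) - 1)⁻¹)
    ⟨isCurrents_op_FPrime hA, fun i => ?_, fun i j s t => ?_, fun i j s l => ?_⟩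
  · rw [der_zero, MulOpposite.op_zero]
  · rw [← MulOpposite.op_mul, (der_comm hA j i t s).eq, MulOpposite.op_mul]
  · refine MulOpposite.unop_injective (LinearMap.ext fun x => ?_)
    exact FPrime_der hA i j s l x

variable (R) in
/-- The adjoints of the left multiplications. -/
def adjOp : Uplus d R →ₐ[Scalar] (Module.End Scalar (Uplus d R))ᵐᵒᵖ := lift hA (isPlus_op hA)

variable (R) in
/-- The Hopf pairing. -/
def form : Uplus d R →ₗ[Scalar] Uplus d R →ₗ[Scalar] Scalar :=
  LinearMap.mk₂ Scalar (fun x y => counit R hA ((adjOp R hA y).unop x))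
    (fun x x' y => by rw [map_add, map_add]) (fun c x y => by rw [map_smul, map_smul])
    (fun x y y' => by rw [map_add, MulOpposite.unop_add, LinearMap.add_apply, map_add])
    fun c x y => by rw [map_smul, MulOpposite.unop_smul, LinearMap.smul_apply, map_smul]

theorem form_one_right (x : Uplus d R) : form R hA x 1 = counit R hA x :=
  congrArg (fun T : (Module.End Scalar (Uplus d R))ᵐᵒᵖ => counit R hA (MulOpposite.unop T x)) (map_one (adjOp R hA))

theorem form_E_mul_right (x : Uplus d R) (i : ι) (n : ℤ) (y : Uplus d R) :
    form R hA x (Eplus d R i n * y) = (v ^ (-2 : ℤ) - 1)⁻¹ * form R hA (FPrime R hA i n x) y := by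
  have h1 : adjOp R hA (Eplus d R i n * y) =
      ((v ^ (-2 : ℤ) - 1)⁻¹ • MulOpposite.op (FPrime R hA i n)) * adjOp R hA y := by
    rw [map_mul]
    congr 1
    exact lift_E _ _ _ _
  have h2 := congrArg (fun T : (Module.End Scalar (Uplus d R))ᵐᵒᵖ => counit R hA (MulOpposite.unop T x)) h1
  refine h2.trans ?_
  change counit R hA ((adjOp R hA y).unop ((v ^ (-2 : ℤ) - 1)⁻¹ • FPrime R hA i n x)) = _
  rw [map_smul, map_smul]
  rfl

theorem form_H_mul_right (x : Uplus d R) (i : ι) (s : ℕ) (y : Uplus d R) :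
    form R hA x (H d R i s * y) = form R hA (der R hA i s x) y := by
  have h1 : adjOp R hA (H d R i s * y) = MulOpposite.op (der R hA i s) * adjOp R hA y := by
    rw [map_mul]
    congr 1
    exact lift_H _ _ _ _
  exact congrArg (fun T : (Module.End Scalar (Uplus d R))ᵐᵒᵖ => counit R hA (MulOpposite.unop T x)) h1

theorem form_one_left (y : Uplus d R) : form R hA 1 y = counit R hA y := by
  induction y using induction with
  | one => rw [form_one_right]
  | add x y hx hy => rw [map_add, map_add, hx, hy]
  | smul c x hx => rw [map_smul, map_smul, hx]
  | mul_E i l x _ => rw [form_E_mul_right, FPrime_one]; simp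
  | mul_H i s x _ => rw [form_H_mul_right, der_one]; simp

/-- By construction the adjoints are known in the second argument only; here and in
`form_E_mul_left` the same adjoints are found in the first argument, which is what symmetry amounts
to. -/
theorem form_H_mul_left (i : ι) (s : ℕ) (z y : Uplus d R) :
    form R hA (H d R i s * z) y = form R hA z (der R hA i s y) := by
  induction y using induction generalizing z with
  | one => rw [form_one_right, der_one, map_mul, counit_H, zero_mul, map_zero]
  | add x y hx hy => simp only [map_add, hx, hy]
  | smul c x hx => simp only [map_smul, hx]
  | mul_E j n y hy =>
    rw [form_E_mul_right, FPrime_H_mul, der_mul, der_E, map_add, map_add, smul_mul_assoc, map_smul,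
      map_smul, LinearMap.add_apply, LinearMap.smul_apply, hy, form_E_mul_right, form_E_mul_right,
      hcoef_symm hA i j, smul_eq_mul, smul_eq_mul]
    ring
  | mul_H j t y hy =>
    rw [form_H_mul_right, der_mul, der_mul, der_H, der_H, map_add, map_add, LinearMap.add_apply, hy,
      form_H_mul_right, hcoef_symm hA i j]
    congr 1
    by_cases h : s = t
    · subst h
      simp only [if_true, smul_mul_assoc, one_mul, map_smul, LinearMap.smul_apply]
    · simp [h, Ne.symm h]

/-- Induction on `y`. The left Leibniz rules of `F'_{i,l}` and `F'_{j,n}` mirror each other, and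
their coefficients `gcoef` are symmetric in `i` and `j`. -/
theorem form_E_mul_left (i : ι) (l : ℤ) (z y : Uplus d R) :
    form R hA (Eplus d R i l * z) y = (v ^ (-2 : ℤ) - 1)⁻¹ * form R hA z (FPrime R hA i l y) := by
  induction y using induction generalizing z l with
  | one => rw [form_one_right, FPrime_one, map_mul, counit_E, zero_mul, map_zero, mul_zero]
  | add x y hx hy => simp only [map_add, hx, hy, mul_add]
  | smul c x hx => simp only [map_smul, hx, smul_eq_mul]; ring
  | mul_E j n y hy =>
    obtain ⟨N, hN⟩ := FPrime_eventually hA j n z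
    obtain ⟨M, hM⟩ := FPrime_eventually hA i l y
    rw [form_E_mul_right,
      FPrime_E_mul hA j n i l z (N := max N M) fun t ht => hN t (le_trans (le_max_left _ _) ht),
      FPrime_E_mul hA i l j n y (N := max N M) fun t ht => hM t (le_trans (le_max_right _ _) ht)]
    simp only [map_add, map_sum, map_smul, LinearMap.add_apply, LinearMap.sum_apply,
      LinearMap.smul_apply, hy, form_E_mul_right, gcoef_symm hA j i]
    congr 2
    · by_cases h : i = j ∧ l = n
      · rw [if_pos h, if_pos ⟨h.1.symm, h.2.symm⟩]
      · rw [if_neg h, if_neg fun h' => h ⟨h'.1.symm, h'.2.symm⟩]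
        simp
  | mul_H j s y hy =>
    rw [form_H_mul_right, FPrime_H_mul, der_mul, der_E, map_add, map_add, smul_mul_assoc, map_smul,
      map_smul, LinearMap.add_apply, LinearMap.smul_apply, hy, hy, form_H_mul_right,
      hcoef_symm hA i j, smul_eq_mul, smul_eq_mul]
    ring

theorem form_symm (x y : Uplus d R) : form R hA x y = form R hA y x := by
  induction x using induction generalizing y with
  | one => rw [form_one_left, form_one_right]
  | add x x' hx hx' => rw [map_add, map_add, LinearMap.add_apply, hx, hx']
  | smul c x hx => rw [map_smul, map_smul, LinearMap.smul_apply, hx]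
  | mul_E i l x hx => rw [form_E_mul_left, form_E_mul_right, hx]
  | mul_H i s x hx => rw [form_H_mul_left, form_H_mul_right, hx]

theorem form_E_E (i j : ι) (k l : ℤ) : form R hA (Eplus d R i k) (Eplus d R j l) =
    if i = j ∧ k = l then 1 / (v ^ (-2 : ℤ) - 1) else 0 := by
  have h1 := form_E_mul_right hA (Eplus d R i k) j l 1
  have h2 := FPrime_mul_E (R := R) hA j l 1 i k
  rw [mul_one, form_one_right] at h1
  rw [one_mul, FPrime_one, zero_mul, zero_add, coTheta_one] at h2
  rw [h1, h2]
  by_cases h : i = j <;> by_cases h' : k = l <;> simp [h, h', sub_eq_zero, Ne.symm]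

theorem form_E_H (i j : ι) (k : ℤ) (s : ℕ) : form R hA (Eplus d R i k) (H d R j s) = 0 := by
  have h1 := form_H_mul_right hA (Eplus d R i k) j s 1
  rw [mul_one, form_one_right, der_E, map_smul, counit_E, smul_zero] at h1
  exact h1

theorem form_H_H (i j : ι) (m n : ℕ) : form R hA (H d R i m) (H d R j n) =
    if m = n then hcoef A d i j m / (v⁻¹ - v) else 0 := by
  have h1 := form_H_mul_right hA (H d R i m) j n 1
  rw [mul_one, form_one_right, der_H] at h1
  rw [h1]
  split_ifs with h
  · subst h
    rw [map_smul, map_one, smul_eq_mul, mul_one, hcoef_symm hA j i]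
  · exact map_zero _

end Uplus

end Pairing

theorem op_expCoeff {S : Type*} [Ring S] [Algebra Scalar S] (x : ℕ → S) (n : ℕ) :
    MulOpposite.op (expCoeff x n) = expCoeff (fun s => MulOpposite.op (x s)) n := by
  have h : ∀ k n, MulOpposite.op (PowerSeries.coeff n
      ((PowerSeries.mk fun m => if m = 0 then 0 else x m) ^ k)) = PowerSeries.coeff n
      ((PowerSeries.mk fun m => if m = 0 then 0 else MulOpposite.op (x m)) ^ k) := by
    intro k
    induction k with
    | zero =>
      intro n
      rw [pow_zero, pow_zero, PowerSeries.coeff_one, PowerSeries.coeff_one]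
      split_ifs <;> rfl
    | succ k ih =>
      intro n
      rw [pow_succ, pow_succ', PowerSeries.coeff_mul, PowerSeries.coeff_mul, Finset.op_sum,
        ← Finset.Nat.sum_antidiagonal_swap]
      refine Finset.sum_congr rfl fun p _ => ?_
      rw [MulOpposite.op_mul, Prod.fst_swap, Prod.snd_swap, ih, PowerSeries.coeff_mk,
        PowerSeries.coeff_mk]
      split_ifs <;> rfl
  rw [expCoeff, expCoeff, Finset.op_sum]
  exact Finset.sum_congr rfl fun k _ => by rw [MulOpposite.op_smul, h]

theorem expCoeff_prod {S T : Type*} [Ring S] [Algebra Scalar S] [Ring T] [Algebra Scalar T]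
    (x : ℕ → S) (y : ℕ → T) (n : ℕ) :
    expCoeff (fun s => (x s, y s)) n = (expCoeff x n, expCoeff y n) :=
  Prod.ext (map_expCoeff (AlgHom.fst Scalar S T) _ n) (map_expCoeff (AlgHom.snd Scalar S T) _ n)

theorem sum_range_shift {M : Type*} [AddCommMonoid M] {f : ℕ → M} {N s : ℕ} (h0 : ∀ t < s, f t = 0)
    (h1 : ∀ t ≥ N, f t = 0) : ∑ t ∈ Finset.range N, f t = ∑ t ∈ Finset.range N, f (s + t) := by
  have h2 : ∑ t ∈ Finset.range N, f t = ∑ t ∈ Finset.range (s + N), f t :=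
    Finset.sum_subset (Finset.range_mono (Nat.le_add_left _ _)) fun t _ ht =>
      h1 t (not_lt.1 fun h => ht (Finset.mem_range.2 h))
  rw [h2, Finset.sum_range_add, Finset.sum_eq_zero fun t ht => h0 t (Finset.mem_range.1 ht),
    zero_add]

/-! ### Finitely supported sums over the integers. -/

section HasFinsum

/-- The family `f` has finite support and sum `a`. -/
def HasFinsum {M : Type*} [AddCommMonoid M] (f : ℤ → M) (a : M) : Prop :=
  f.support.Finite ∧ ∑ᶠ p, f p = a

namespace HasFinsum

variable {M : Type*} [AddCommMonoid M] {f g : ℤ → M} {a b : M}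

theorem zero : HasFinsum (fun _ => (0 : M)) 0 := ⟨by simp, finsum_zero⟩

theorem single (p : ℤ) (a : M) : HasFinsum (fun q => if q = p then a else 0) a := by
  refine ⟨(Set.finite_singleton p).subset fun q hq => ?_, ?_⟩
  · by_contra h
    exact hq (if_neg h)
  · rw [finsum_eq_single _ p fun q hq => if_neg hq, if_pos rfl]

theorem add (hf : HasFinsum f a) (hg : HasFinsum g b) : HasFinsum (fun p => f p + g p) (a + b) :=
  ⟨(hf.1.union hg.1).subset (Function.support_add f g),
    by rw [finsum_add_distrib hf.1 hg.1, hf.2, hg.2]⟩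

theorem map {M' : Type*} [AddCommMonoid M'] (hf : HasFinsum f a) (φ : M →+ M') :
    HasFinsum (fun p => φ (f p)) (φ a) :=
  ⟨hf.1.subset (Function.support_comp_subset (map_zero φ) f),
    by rw [← hf.2]; exact (φ.map_finsum hf.1).symm⟩

theorem const_mul {f : ℤ → Scalar} {a : Scalar} (hf : HasFinsum f a) (c : Scalar) :
    HasFinsum (fun p => c * f p) (c * a) := hf.map (AddMonoidHom.mulLeft c)

theorem shift (hf : HasFinsum f a) (s : ℤ) : HasFinsum (fun p => f (p - s)) a :=
  ⟨hf.1.preimage (sub_left_injective (b := s)).injOn,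
    by rw [← hf.2]; exact finsum_comp_equiv (f := f) (Equiv.subRight s)⟩

theorem sum {κ : Type*} (s : Finset κ) {f : κ → ℤ → M} {a : κ → M}
    (h : ∀ k, HasFinsum (f k) (a k)) : HasFinsum (fun p => ∑ k ∈ s, f k p) (∑ k ∈ s, a k) := by
  classical
  induction s using Finset.induction_on with
  | empty => simpa using zero
  | insert k s hk ih =>
    simp only [Finset.sum_insert hk]
    exact (h k).add ih

end HasFinsum

end HasFinsum

/-! ### The Hopf property of the form. -/

section Hopf

variable {ι : Type*} [Fintype ι] [DecidableEq ι] {A : Matrix ι ι ℤ} {d : ι → ℕ}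
  {V : Type*} [AddCommGroup V] [Module ℂ V] {R : Realization A V}

namespace Uplus

variable (hA : IsSymmetrizableGCM A d)

/-- The twisted Leibniz rule for `F'_{i,n}`. -/
theorem FPrime_mul (i : ι) (n : ℤ) (y z : Uplus d R) {N : ℕ}
    (hN : ∀ t : ℕ, N ≤ t → FPrime R hA i (n - t) z = 0) :
    FPrime R hA i n (y * z) = FPrime R hA i n y * z +
      ∑ t ∈ Finset.range N, coTheta R hA i t y * FPrime R hA i (n - t) z := by
  induction y using induction generalizing n N with
  | one =>
    simp only [coTheta_one, one_mul, FPrime_one, zero_mul, zero_add, ite_mul, Nat.cast_eq_zero]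
    rcases Nat.eq_zero_or_pos N with rfl | h
    · simpa using hN 0 le_rfl
    · rw [Finset.sum_ite_eq' (Finset.range N), if_pos (Finset.mem_range.2 h), Nat.cast_zero, sub_zero]
  | add x y hx hy =>
    simp only [add_mul, map_add, hx n hN, hy n hN, Finset.sum_add_distrib]
    abel
  | smul c x hx => simp only [smul_mul_assoc, map_smul, hx n hN, smul_add, Finset.smul_sum]
  | mul_E j l y hy =>
    obtain ⟨N₁, h₁⟩ := FPrime_eventually hA i n (y * z)
    obtain ⟨N₂, h₂⟩ := FPrime_eventually hA i n y
    -- A common bound makes all Leibniz sums run over one range, so that the double sum can be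
    -- interchanged and the inner index shifted by `s`.
    set M := max N (max N₁ N₂) with hM
    have hNM : N ≤ M := le_max_left _ _
    have h3 : ∑ t ∈ Finset.range N, coTheta R hA i t (Eplus d R j l * y) * FPrime R hA i (n - t) z =
        ∑ t ∈ Finset.range M, coTheta R hA i t (Eplus d R j l * y) * FPrime R hA i (n - t) z :=
      Finset.sum_subset (Finset.range_mono hNM) fun t _ ht => by
        rw [hN t (not_lt.1 fun h => ht (Finset.mem_range.2 h)), mul_zero]
    have h4 : ∀ t ∈ Finset.range M, coTheta R hA i t (Eplus d R j l * y) * FPrime R hA i (n - t) z =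
        ∑ s ∈ Finset.range M, gcoef A d i j s • (Eplus d R j (l - s) *
          (coTheta R hA i ((t : ℤ) - s) y * FPrime R hA i (n - t) z)) := by
      intro t ht
      have := DFunLike.congr_fun (coTheta_mul_mulOp_E (R := R) hA i j t l (N := M)
        (by exact_mod_cast Finset.mem_range.1 ht)) y
      simp only [Module.End.mul_apply, mulOp_apply, LinearMap.sum_apply, LinearMap.smul_apply] at this
      rw [this, Finset.sum_mul]
      simp only [smul_mul_assoc, mul_assoc]
    rw [mul_assoc, FPrime_E_mul hA i n j l (y * z) (N := M) fun t ht => h₁ t (by omega),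
      FPrime_E_mul hA i n j l y (N := M) fun t ht => h₂ t (by omega), h3, Finset.sum_congr rfl h4,
      Finset.sum_comm, add_mul, Finset.sum_mul, ite_mul, zero_mul, add_assoc,
      ← Finset.sum_add_distrib]
    congr 1
    refine Finset.sum_congr rfl fun s _ => ?_
    rw [hy (n - s) (N := M) fun t ht => by
      have := hN (s + t) (by omega)
      rwa [Nat.cast_add, ← sub_sub] at this]
    rw [← Finset.smul_sum, ← Finset.mul_sum, smul_mul_assoc, ← smul_add, mul_assoc, ← mul_add,
      sum_range_shift
        (f := fun t : ℕ => coTheta R hA i ((t : ℤ) - s) y * FPrime R hA i (n - t) z) (s := s)]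
    · simp only [Nat.cast_add, add_sub_cancel_left, sub_sub]
    · intro t ht
      rw [coTheta_neg hA i (by omega), LinearMap.zero_apply, zero_mul]
    · intro t ht
      rw [hN t (by omega), mul_zero]
  | mul_H j s y hy =>
    have h4 : ∀ t : ℕ, coTheta R hA i t (H d R j s * y) = H d R j s * coTheta R hA i t y +
        hcoef A d i j s • coTheta R hA i ((t : ℤ) - s) y := fun t =>
      DFunLike.congr_fun (coTheta_mul_mulOp_H hA i j s t) y
    rw [mul_assoc, FPrime_H_mul, FPrime_H_mul, hy n hN, hy (n - s) (N := N) fun t ht => by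
      have := hN (s + t) (by omega)
      rwa [Nat.cast_add, ← sub_sub] at this]
    simp only [h4, add_mul, Finset.sum_add_distrib, smul_mul_assoc, mul_assoc, mul_add, smul_add,
      ← Finset.mul_sum, ← Finset.smul_sum]
    rw [sum_range_shift (f := fun t : ℕ => coTheta R hA i ((t : ℤ) - s) y * FPrime R hA i (n - t) z)
      (s := s)]
    · simp only [Nat.cast_add, add_sub_cancel_left, sub_sub]
      abel
    · intro t ht
      rw [coTheta_neg hA i (by omega), LinearMap.zero_apply, zero_mul]
    · intro t ht
      rw [hN t (by omega), mul_zero]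

theorem form_wt (g : ι → Scalar) (x y : Uplus d R) :
    form R hA (wt R hA g x) y = form R hA x (wt R hA g y) := by
  induction x using induction generalizing y with
  | one =>
    rw [map_one, form_one_left, form_one_left]
    have : (counit R hA).comp (wt R hA g) = counit R hA :=
      algHom_ext (fun i l => by simp) fun i s => by simp
    exact (DFunLike.congr_fun this y).symm
  | add x x' hx hx' => simp only [map_add, LinearMap.add_apply, hx, hx']
  | smul c x hx => simp only [map_smul, LinearMap.smul_apply, hx]
  | mul_E i l x hx =>
    rw [map_mul, wt_E, smul_mul_assoc, map_smul, LinearMap.smul_apply, form_E_mul_left,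
      form_E_mul_left, hx, FPrime_wt, map_smul, smul_eq_mul, smul_eq_mul]
    ring
  | mul_H i s x hx =>
    have := DFunLike.congr_fun (wtOp_der (R := R) hA g i s) y
    rw [map_mul, wt_H, form_H_mul_left, form_H_mul_left, hx]
    exact congrArg _ this

theorem form_theta (i : ι) (t : ℤ) (x y : Uplus d R) :
    form R hA (theta R hA i t x) y = form R hA x (coTheta R hA i t y) := by
  rcases lt_or_ge t 0 with ht | ht
  · rw [theta_neg hA i ht, coTheta_neg hA i ht]
    simp
  lift t to ℕ using ht
  -- Pairs of mutually adjoint operators form a subalgebra once the second member is reversed, so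
  -- adjointness of the exponents passes to the coefficients of the exponentials.
  let Q : Subalgebra Scalar (Module.End Scalar (Uplus d R) × (Module.End Scalar (Uplus d R))ᵐᵒᵖ) :=
    { carrier := {z | ∀ x y, form R hA (z.1 x) y = form R hA x (z.2.unop y)}
      mul_mem' := fun {a b} ha hb x y => (ha _ _).trans (hb _ _)
      add_mem' := fun {a b} ha hb x y => by
        change form R hA (a.1 x + b.1 x) y = form R hA x (a.2.unop y + b.2.unop y)
        rw [map_add, map_add, LinearMap.add_apply, ha, hb]
      algebraMap_mem' := fun c x y => by
        change form R hA (c • x) y = form R hA x (c • y)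
        rw [map_smul, map_smul, LinearMap.smul_apply] }
  have h1 : ∀ s, ((v⁻¹ - v) • mulOp d R (H d R i s), MulOpposite.op ((v⁻¹ - v) • der R hA i s)) ∈ Q := by
    intro s x y
    change form R hA ((v⁻¹ - v) • (H d R i s * x)) y = form R hA x ((v⁻¹ - v) • der R hA i s y)
    rw [map_smul, map_smul, LinearMap.smul_apply, form_H_mul_left]
  have h2 := expCoeff_mem Q h1 t
  rw [expCoeff_prod, ← op_expCoeff] at h2
  have h6 : Commute (wtOp R hA fun j => v ^ (-bMat A d i j))
      (expCoeff (fun s => (v⁻¹ - v) • der R hA i s) t) :=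
    expCoeff_commute_right (smul_der_comm hA i) (fun s => (wtOp_der hA _ i s).smul_right _) t
  rw [theta, coTheta, plusCurrent_natCast, plusCurrent_natCast, h6.eq]
  change form R hA (wt R hA _ (expCoeff (fun s => (v⁻¹ - v) • mulOp d R (H d R i s)) t x)) y = _
  rw [form_wt]
  exact h2 x (wt R hA (fun j => v ^ (-bMat A d i j)) y)

end Uplus

namespace TwistedSquare

theorem inl_mul_tens (x a b : Uplus d R) : inl x * tens d R a b = tens d R (x * a) b := by
  rw [← inl_mul_inr, ← mul_assoc, ← map_mul, inl_mul_inr]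

theorem inr_E_mul_tens (hA : IsSymmetrizableGCM A d) (i : ι) (l : ℤ) (a b : Uplus d R) :
    inr (Eplus d R i l) * tens d R a b =
      tens d R (Uplus.wt R hA (fun j => v ^ (-bMat A d i j)) a) (Eplus d R i l * b) := by
  rw [← inl_mul_inr, ← mul_assoc, inr_E_mul_inl hA, mul_assoc, ← map_mul, inl_mul_inr]

theorem inr_H_mul_tens (i : ι) (s : ℕ) (a b : Uplus d R) :
    inr (Uplus.H d R i s) * tens d R a b = tens d R a (Uplus.H d R i s * b) := by
  rw [← inl_mul_inr, ← mul_assoc, (inr_mul_inl_of_zero (IsWeight.H i s) a).eq, mul_assoc, ← map_mul,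
    inl_mul_inr]

end TwistedSquare

open TwistedSquare

namespace Coproduct

variable {M : Type*} [AddCommGroup M] [Module Scalar M]

/-- The convolution is cut to a finite range only after `φ` has been applied: `θ` vanishes in
negative degree, and `hN` disposes of the terms from `N` on. -/
theorem coeff_E_mul (φ : TwistedSquare d R →ₗ[Scalar] M) (i : ι) (l : ℤ) (D : CompletedSquare d R)
    (p : ℤ) {N : ℕ} (hN : ∀ t : ℕ, N ≤ t → φ (inl (thetaZ d R i t) *
      (inr (Eplus d R i (l - t)) * D.coeff (p - t))) = 0) :
    φ ((E d R i l * D).coeff p) = φ (inl (Eplus d R i l) * D.coeff (p - l)) +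
      ∑ t ∈ Finset.range N,
        φ (inl (thetaZ d R i t) * (inr (Eplus d R i (l - t)) * D.coeff (p - t))) := by
  -- Low enough for `D` to vanish below `n` and for the convolution range, which ends at `p - n`, to
  -- contain both `l` and all `t < N`.
  set n := min D.order (min (p - l) (p - N)) with hn
  have h1 : n ≤ D.order := min_le_left _ _
  have h2 : n ≤ p - l := (min_le_right _ _).trans (min_le_left _ _)
  have h3 : n ≤ p - N := (min_le_right _ _).trans (min_le_right _ _)
  have h4 : min l 0 ≤ 0 := min_le_right _ _
  have h5 : min l 0 ≤ l := min_le_left _ _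
  rw [hahn_coeff_mul (m := min l 0) (n := n) (fun a ha => ?_) (fun a ha =>
    HahnSeries.coeff_eq_zero_of_lt_order (ha.trans_le h1)), map_sum]
  · simp only [coeff_E, add_mul, map_add, Finset.sum_add_distrib]
    congr 1
    · rw [Finset.sum_eq_single l (fun a _ ha => by rw [if_neg ha, zero_mul, map_zero]) fun h =>
        (h (Finset.mem_Icc.2 ⟨h5, by omega⟩)).elim, if_pos rfl]
    · refine (Finset.sum_of_injOn (fun t : ℕ => (t : ℤ)) Nat.cast_injective.injOn ?_ ?_ ?_).symm
      · intro t ht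
        have := Finset.mem_range.1 ht
        exact Finset.mem_coe.2 (Finset.mem_Icc.2 (by dsimp only; omega))
      · intro a _ ha
        rcases lt_or_ge a 0 with h | h
        · rw [inl_thetaZ_neg i a h, zero_mul, zero_mul, map_zero]
        · lift a to ℕ using h
          rw [mul_assoc]
          exact hN a (not_lt.1 fun h => ha ⟨a, Finset.mem_coe.2 (Finset.mem_range.2 h), rfl⟩)
      · intro t _
        rw [mul_assoc]
  · rw [coeff_E, if_neg (by omega), inl_thetaZ_neg i a (by omega), zero_mul, add_zero]

theorem coeff_H_mul (i : ι) (s : ℕ) (D : CompletedSquare d R) (p : ℤ) :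
    (H d R i s * D).coeff p =
      inl (Uplus.H d R i s) * D.coeff (p - s) + inr (Uplus.H d R i s) * D.coeff p := by
  have h : ∀ (a : ℤ) (x : TwistedSquare d R),
      (HahnSeries.single a x * D).coeff p = x * D.coeff (p - a) := fun a x => by
    conv_lhs => rw [← sub_add_cancel p a]
    rw [HahnSeries.coeff_single_mul_add]
  rw [H, add_mul, HahnSeries.coeff_add, h, h, sub_zero]

variable (hA : IsSymmetrizableGCM A d)

theorem pairTens_inl_E (i : ι) (l : ℤ) (y z : Uplus d R) (w : TwistedSquare d R) :
    pairTens (Uplus.form R hA) y z (inl (Eplus d R i l) * w) =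
      (v ^ (-2 : ℤ) - 1)⁻¹ * pairTens (Uplus.form R hA) (Uplus.FPrime R hA i l y) z w := by
  induction w using TwistedSquare.induction with
  | add x y hx hy => rw [mul_add, map_add, map_add, hx, hy, mul_add]
  | weight α β a b _ _ =>
    rw [inl_mul_tens]
    exact (congrArg (· * _) (Uplus.form_E_mul_left hA i l a y)).trans (mul_assoc _ _ _)

theorem pairTens_inr_E (i : ι) (l : ℤ) (t : ℕ) (y z : Uplus d R) (w : TwistedSquare d R) :
    pairTens (Uplus.form R hA) y z (inl (thetaZ d R i t) * (inr (Eplus d R i l) * w)) =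
      (v ^ (-2 : ℤ) - 1)⁻¹ * pairTens (Uplus.form R hA) (Uplus.coTheta R hA i t y)
        (Uplus.FPrime R hA i l z) w := by
  induction w using TwistedSquare.induction with
  | add x y hx hy => rw [mul_add, mul_add, map_add, map_add, hx, hy, mul_add]
  | weight α β a b _ _ =>
    rw [inr_E_mul_tens hA, inl_mul_tens, ← theta_apply]
    change Uplus.form R hA _ y * Uplus.form R hA _ z = _ * (Uplus.form R hA a _ * Uplus.form R hA b _)
    rw [Uplus.form_theta, Uplus.form_E_mul_left]
    ring

theorem pairTens_H (i : ι) (s : ℕ) (y z : Uplus d R) (w : TwistedSquare d R) :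
    pairTens (Uplus.form R hA) y z (inl (Uplus.H d R i s) * w) =
      pairTens (Uplus.form R hA) (Uplus.der R hA i s y) z w ∧
    pairTens (Uplus.form R hA) y z (inr (Uplus.H d R i s) * w) =
      pairTens (Uplus.form R hA) y (Uplus.der R hA i s z) w := by
  induction w using TwistedSquare.induction with
  | add x y hx hy =>
    rw [mul_add, mul_add, map_add, map_add, map_add, map_add, hx.1, hx.2, hy.1, hy.2]
    exact ⟨rfl, rfl⟩
  | weight α β a b _ _ =>
    rw [inl_mul_tens, inr_H_mul_tens]
    exact ⟨congrArg (· * _) (Uplus.form_H_mul_left hA i s a y),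
      congrArg (_ * ·) (Uplus.form_H_mul_left hA i s b z)⟩

/-- Induction on `x`. A generator on the left of `x` is transferred to `y` and `z` through its
adjoints, and the coproduct of the generator then becomes the Leibniz rule of its adjoint on `y *
z`: `FPrime_mul` for `E_{i,l}`, `der_mul` for `H_{i,s}`. -/
theorem hasFinsum_pairTens (x y z : Uplus d R) :
    HasFinsum (fun p => pairTens (Uplus.form R hA) y z ((Δ R hA x).coeff p))
      (Uplus.form R hA x (y * z)) := by
  induction x using Uplus.induction generalizing y z with
  | one =>
    have h : ∀ p, pairTens (Uplus.form R hA) y z ((Δ R hA 1).coeff p) =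
        if p = 0 then Uplus.form R hA 1 (y * z) else 0 := by
      intro p
      rw [map_one, HahnSeries.coeff_one]
      split_ifs
      · rw [Uplus.form_one_left, map_mul, ← Uplus.form_one_left, ← Uplus.form_one_left]
        rfl
      · exact map_zero _
    simp only [h]
    exact HasFinsum.single _ _
  | add x x' hx hx' =>
    simp only [map_add, HahnSeries.coeff_add, LinearMap.add_apply]
    exact (hx y z).add (hx' y z)
  | smul c x hx =>
    simp only [map_smul, HahnSeries.coeff_smul, LinearMap.smul_apply, smul_eq_mul]
    exact (hx y z).const_mul c
  | mul_E i l x hx =>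
    obtain ⟨N, hN⟩ := Uplus.FPrime_eventually hA i l z
    have h : ∀ p, pairTens (Uplus.form R hA) y z ((Δ R hA (Eplus d R i l * x)).coeff p) =
        (v ^ (-2 : ℤ) - 1)⁻¹ * (pairTens (Uplus.form R hA) (Uplus.FPrime R hA i l y) z
          ((Δ R hA x).coeff (p - l)) + ∑ t ∈ Finset.range N, pairTens (Uplus.form R hA)
            (Uplus.coTheta R hA i t y) (Uplus.FPrime R hA i (l - t) z) ((Δ R hA x).coeff (p - t))) := by
      intro p
      rw [map_mul, Δ_E, coeff_E_mul (N := N), pairTens_inl_E, mul_add, Finset.mul_sum]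
      · simp only [pairTens_inr_E]
      · intro t ht
        rw [pairTens_inr_E, hN t ht]
        have h : pairTens (Uplus.form R hA) (Uplus.coTheta R hA i t y) 0 = 0 :=
          TensorProduct.ext' fun a b => (congrArg (_ * ·) (map_zero (Uplus.form R hA b))).trans (mul_zero _)
        rw [h]
        exact mul_zero _
    simp only [h]
    rw [Uplus.form_E_mul_left, Uplus.FPrime_mul hA i l y z hN, map_add, map_sum]
    exact (((hx _ _).shift l).add (HasFinsum.sum _ fun t : ℕ => (hx _ _).shift t)).const_mul _
  | mul_H i s x hx =>
    have h : ∀ p, pairTens (Uplus.form R hA) y z ((Δ R hA (Uplus.H d R i s * x)).coeff p) =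
        pairTens (Uplus.form R hA) (Uplus.der R hA i s y) z ((Δ R hA x).coeff (p - s)) +
          pairTens (Uplus.form R hA) y (Uplus.der R hA i s z) ((Δ R hA x).coeff p) := by
      intro p
      rw [map_mul, Δ_H, coeff_H_mul, map_add, (pairTens_H hA i s y z _).1,
        (pairTens_H hA i s y z _).2]
    simp only [h]
    rw [Uplus.form_H_mul_left, Uplus.der_mul, map_add, add_comm]
    exact ((hx _ _).shift s).add (hx _ _)

theorem isHopfPairing : IsHopfPairing (Δ R hA).toLinearMap (Uplus.form R hA) where
  symm := Uplus.form_symm hA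
  one_one := by rw [Uplus.form_one_left, map_one]
  E_E := Uplus.form_E_E hA
  H_H i j m n hm hn := by
    have h1 := Uplus.form_H_H (R := R) hA i j m n
    rw [Uplus.H_pos i m hm, Uplus.H_pos j n hn] at h1
    rw [h1, hcoef, div_div, Int.cast_natCast]
  E_H i j k m hm := by
    have h1 := Uplus.form_E_H (R := R) hA i j k m
    rwa [Uplus.H_pos j m hm] at h1
  finite x y z := (hasFinsum_pairTens hA x y z).1
  hopf x y z := (hasFinsum_pairTens hA x y z).2.symm

end Coproduct

end Hopf

/-- The logarithm is determined by the exponential. -/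
theorem eq_of_expCoeff_eq {S : Type*} [Ring S] [Algebra Scalar S] {x y : ℕ → S}
    (hx : ∀ s t, Commute (x s) (x t)) (hy : ∀ s t, Commute (y s) (y t))
    (h : ∀ n, expCoeff x n = expCoeff y n) {s : ℕ} (hs : 0 < s) : x s = y s := by
  have h1 : expSeries x = expSeries y := by
    ext n
    rw [coeff_expSeries, coeff_expSeries, h]
  have h2 := eul_expSeries hx
  rw [h1, eul_expSeries hy] at h2
  have h3 := congrArg (PowerSeries.coeff s) (congrArg (· * expSeries (fun n => -y n)) h2)
  simp only [mul_assoc] at h3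
  rw [show expSeries y * expSeries (fun n => -y n) = 1 from expSeries_mul_neg hy, mul_one, mul_one,
    coeff_eul_tailSeries, coeff_eul_tailSeries] at h3
  obtain ⟨s, rfl⟩ := Nat.exists_eq_succ_of_ne_zero hs.ne'
  exact (natCast_mul_cancel h3).symm

/-! ### Uniqueness of the coproduct, the pairing with `E_{i,n}`, and the contraction. -/

section Uniqueness

variable {ι : Type*} [Fintype ι] [DecidableEq ι] {A : Matrix ι ι ℤ} {d : ι → ℕ}
  {V : Type*} [AddCommGroup V] [Module ℂ V] {R : Realization A V}

open TwistedSquare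

namespace Coproduct

variable (hA : IsSymmetrizableGCM A d)

/-- The coproduct is prescribed on the `θ` and not on the `H`; taking logarithms of commuting
exponentials (`eq_of_expCoeff_eq`) recovers its values on all generators. -/
theorem eq_of_isTwistedCoproduct {Δ' : Uplus d R →ₗ[Scalar] CompletedSquare d R}
    (h : IsTwistedCoproduct Δ') : Δ' = (Δ R hA).toLinearMap := by
  have h0 := isTwistedCoproduct (R := R) hA
  let D : Uplus d R →ₐ[Scalar] CompletedSquare d R := AlgHom.ofLinearMap Δ' h.map_one h.map_mul
  have hθ : ∀ i n, D (thetaPlus d R i n) = Δ R hA (thetaPlus d R i n) := fun i n => by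
    ext p
    exact (h.map_theta i n p).trans (h0.map_theta i n p).symm
  have h2 : (fun i s => D (Uplus.H d R i s)) = fun i s => Δ R hA (Uplus.H d R i s) := by
    funext i s
    rcases Nat.eq_zero_or_pos s with rfl | hs
    · rw [(Uplus.isPlus d R).H_zero, map_zero, map_zero]
    · have hc : ∀ (f : Uplus d R →ₐ[Scalar] CompletedSquare d R) (s t : ℕ),
          Commute (f ((v⁻¹ - v) • Uplus.H d R i s)) (f ((v⁻¹ - v) • Uplus.H d R i t)) := fun f s t =>
        Commute.map ((Commute.smul_left ((Uplus.isPlus d R).H_H i i s t) _).smul_right _) f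
      have h3 := eq_of_expCoeff_eq (hc D) (hc (Δ R hA)) (fun n => by
        rw [← map_expCoeff, ← map_expCoeff, ← thetaPlus_eq, hθ]) hs
      simp only [map_smul] at h3
      exact smul_right_injective _ generic_v.qint_den_ne h3
  have h4 : D = Δ R hA := Uplus.algHom_ext (fun i l => by
    ext p
    exact (h.map_E i l p).trans (h0.map_E i l p).symm) fun i s => congrFun (congrFun h2 i) s
  exact LinearMap.ext fun x => DFunLike.congr_fun h4 x

omit [Fintype ι] [DecidableEq ι] in
theorem expCoeff_zero_eq {S : Type*} [Ring S] [Algebra Scalar S] (n : ℕ) :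
    expCoeff (fun _ => (0 : S)) n = if n = 0 then 1 else 0 := by
  have h := congrArg (PowerSeries.coeff n) (expSeries_zero (S := S))
  rwa [coeff_expSeries, PowerSeries.coeff_one] at h

theorem map_thetaZ_of_map_H {f : Uplus d R →ₐ[Scalar] Scalar} (hf : ∀ i s, f (Uplus.H d R i s) = 0)
    (i : ι) (t : ℤ) : f (thetaZ d R i t) = if t = 0 then 1 else 0 := by
  rcases lt_or_ge t 0 with ht | ht
  · rw [thetaZ_neg i ht, map_zero, if_neg ht.ne]
  · lift t to ℕ using ht
    rw [thetaZ_natCast, thetaPlus_eq, map_expCoeff]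
    simp only [map_smul, hf, smul_zero, expCoeff_zero_eq, Nat.cast_eq_zero]

section Pairing

variable {B : Uplus d R →ₗ[Scalar] Uplus d R →ₗ[Scalar] Scalar}
  (hB : IsHopfPairing (Δ R hA).toLinearMap B)

include hB

theorem pairing_one_mul (y z : Uplus d R) : B 1 (y * z) = B 1 y * B 1 z := by
  rw [hB.hopf, finsum_eq_single _ 0 fun p hp => ?_]
  · have : ((Δ R hA).toLinearMap 1).coeff 0 = tens d R 1 1 := by
      rw [(isTwistedCoproduct hA).map_one, HahnSeries.coeff_single_same]
    rw [this]
    rfl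
  · rw [(isTwistedCoproduct hA).map_one, HahnSeries.coeff_single_of_ne hp, map_zero]

theorem pairing_H_mul (i : ι) (s : ℕ) (y z : Uplus d R) :
    B (Uplus.H d R i s) (y * z) =
      B (Uplus.H d R i s) y * B 1 z + B 1 y * B (Uplus.H d R i s) z := by
  have h1 : ∀ p, pairTens B y z (((Δ R hA).toLinearMap (Uplus.H d R i s)).coeff p) =
      (if p = s then B (Uplus.H d R i s) y * B 1 z else 0) +
        if p = 0 then B 1 y * B (Uplus.H d R i s) z else 0 := by
    intro p
    rw [AlgHom.toLinearMap_apply, Δ_H, H, HahnSeries.coeff_add, map_add, HahnSeries.coeff_single,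
      HahnSeries.coeff_single]
    congr 1 <;> split_ifs <;> rfl
  rw [hB.hopf, finsum_congr h1]
  exact ((HasFinsum.single _ _).add (HasFinsum.single _ _)).2

theorem pairing_E_mul (i : ι) (n : ℤ) (y z : Uplus d R) :
    HasFinsum (fun p => B (thetaZ d R i p) y * B (Eplus d R i (n - p)) z)
      (B (Eplus d R i n) (y * z) - B (Eplus d R i n) y * B 1 z) := by
  have h1 : ∀ p, pairTens B y z (((Δ R hA).toLinearMap (Eplus d R i n)).coeff p) =
      (if p = n then B (Eplus d R i n) y * B 1 z else 0) +
        B (thetaZ d R i p) y * B (Eplus d R i (n - p)) z := by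
    intro p
    rw [AlgHom.toLinearMap_apply, Δ_E, coeff_E, map_add, inl_mul_inr]
    congr 1
    split_ifs
    · rfl
    · exact map_zero _
  have h2 : HasFinsum _ _ := ⟨hB.finite (Eplus d R i n) y z, (hB.hopf _ y z).symm⟩
  have h3 := h2.add ((HasFinsum.single n (B (Eplus d R i n) y * B 1 z)).map (-AddMonoidHom.id _))
  rw [sub_eq_add_neg]
  convert h3 using 1
  · funext p
    rw [h1]
    split_ifs <;> simp
  · rfl

theorem pairing_H_one (i : ι) (s : ℕ) : B (Uplus.H d R i s) 1 = 0 := by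
  have h1 := pairing_H_mul hA hB i s 1 1
  rw [mul_one, hB.one_one, mul_one, one_mul] at h1
  exact left_eq_add.1 h1

theorem pairing_one_theta (i : ι) (t : ℤ) : B 1 (thetaZ d R i t) = if t = 0 then 1 else 0 :=
  map_thetaZ_of_map_H (f := AlgHom.ofLinearMap (B 1) hB.one_one (pairing_one_mul hA hB))
    (fun i s => (hB.symm _ _).trans (pairing_H_one hA hB i s)) i t

/-- In the Hopf identity for `y = z = 1` the summand `θ_{i,0} ⊗ E_{i,n}` contributes the pairing
once more, so the pairing equals twice itself. -/
theorem pairing_E_one (i : ι) (n : ℤ) : B (Eplus d R i n) 1 = 0 := by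
  have h1 := pairing_E_mul hA hB i n 1 1
  have h2 : ∀ p, B (thetaZ d R i p) 1 * B (Eplus d R i (n - p)) 1 =
      if p = 0 then B (Eplus d R i n) 1 else 0 := by
    intro p
    rw [hB.symm, pairing_one_theta hA hB]
    split_ifs with h
    · rw [h, one_mul, sub_zero]
    · exact zero_mul _
  simp only [h2] at h1
  have h3 := h1.2
  rw [(HasFinsum.single _ _).2, mul_one, hB.one_one, mul_one, sub_self] at h3
  exact h3

theorem pairing_one (y : Uplus d R) : B 1 y = Uplus.counit R hA y := by
  induction y using Uplus.induction with
  | one => rw [hB.one_one, map_one]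
  | add x y hx hy => rw [map_add, map_add, hx, hy]
  | smul c x hx => rw [map_smul, map_smul, hx]
  | mul_E i l x _ =>
    rw [pairing_one_mul hA hB, hB.symm, pairing_E_one hA hB, map_mul, Uplus.counit_E, zero_mul, zero_mul]
  | mul_H i s x _ =>
    rw [pairing_one_mul hA hB, hB.symm, pairing_H_one hA hB, map_mul, Uplus.counit_H, zero_mul, zero_mul]

theorem pairing_E_H (i j : ι) (n : ℤ) (s : ℕ) : B (Eplus d R i n) (Uplus.H d R j s) = 0 := by
  rcases Nat.eq_zero_or_pos s with rfl | hs
  · rw [(Uplus.isPlus d R).H_zero, map_zero]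
  · rw [Uplus.H_pos j s hs, hB.E_H]

theorem pairing_H (i : ι) (s : ℕ) (y : Uplus d R) :
    B (Uplus.H d R i s) y = Uplus.counit R hA (Uplus.der R hA i s y) := by
  induction y using Uplus.induction with
  | one => rw [pairing_H_one hA hB, Uplus.der_one, map_zero]
  | add x y hx hy => rw [map_add, map_add, map_add, hx, hy]
  | smul c x hx => rw [map_smul, map_smul, map_smul, hx]
  | mul_E j l x hx =>
    rw [pairing_H_mul hA hB, pairing_one hA hB, pairing_one hA hB, hB.symm, pairing_E_H hA hB,
      Uplus.der_mul, Uplus.der_E]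
    simp
  | mul_H j t x hx =>
    rw [pairing_H_mul hA hB, pairing_one hA hB, pairing_one hA hB, Uplus.der_mul, Uplus.der_H,
      map_add, map_mul, map_mul, Uplus.counit_H, zero_mul, zero_mul, zero_add, add_zero]
    congr 1
    rcases Nat.eq_zero_or_pos s with rfl | hs
    · rw [(Uplus.isPlus d R).H_zero, map_zero, Nat.cast_zero, hcoef_zero, zero_div]
      split_ifs <;> simp
    rcases Nat.eq_zero_or_pos t with rfl | ht
    · rw [(Uplus.isPlus d R).H_zero, map_zero, if_neg hs.ne, map_zero]
    rw [Uplus.H_pos i s hs, Uplus.H_pos j t ht, hB.H_H]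
    by_cases h : s = t
    · subst h
      rw [if_pos rfl, if_pos rfl, map_smul, map_one, smul_eq_mul, mul_one, hcoef, div_div,
        Int.cast_natCast]
    · rw [if_neg h, if_neg (Ne.symm h), map_zero]

theorem pairing_theta_H (i j : ι) (t : ℤ) (s : ℕ) :
    B (thetaZ d R i t) (Uplus.H d R j s) = if t = s then hcoef A d i j s else 0 := by
  rcases Nat.eq_zero_or_pos s with rfl | hs
  · rw [(Uplus.isPlus d R).H_zero, map_zero, Nat.cast_zero, hcoef_zero, ite_self]
  have h1 := DFunLike.congr_fun (Uplus.der_mul_theta (R := R) hA j i hs t) 1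
  simp only [Module.End.mul_apply, LinearMap.add_apply, LinearMap.smul_apply, theta_apply, map_one,
    mul_one, Uplus.der_one, map_zero, zero_add] at h1
  rw [hB.symm, pairing_H hA hB, h1, map_smul, map_thetaZ_of_map_H (Uplus.counit_H hA), smul_eq_mul,
    hcoef_symm hA i j, mul_ite, mul_one, mul_zero]
  simp only [sub_eq_zero]

theorem pairing_E_H_mul (i j : ι) (n : ℤ) (s : ℕ) (y : Uplus d R) :
    B (Eplus d R i n) (Uplus.H d R j s * y) = hcoef A d i j s * B (Eplus d R i (n - s)) y := by
  have h1 := pairing_E_mul hA hB i n (Uplus.H d R j s) y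
  have h2 : ∀ p, B (thetaZ d R i p) (Uplus.H d R j s) * B (Eplus d R i (n - p)) y =
      if p = s then hcoef A d i j s * B (Eplus d R i (n - s)) y else 0 := by
    intro p
    rw [pairing_theta_H hA hB]
    split_ifs with h
    · rw [h]
    · exact zero_mul _
  simp only [h2] at h1
  rw [pairing_E_H hA hB, zero_mul, sub_zero] at h1
  exact h1.2.symm.trans (HasFinsum.single _ _).2

/-- Left multiplication by `H_{j,s}` preserves the elements orthogonal to every `E_{i,n}`. The
operators with this property form a subalgebra, which contains `θ_{j,t}`; it is applied to `1`. -/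
theorem pairing_E_theta (i j : ι) (n t : ℤ) : B (Eplus d R i n) (thetaZ d R j t) = 0 := by
  rcases lt_or_ge t 0 with ht | ht
  · rw [thetaZ_neg j ht, map_zero]
  lift t to ℕ using ht
  let Q : Subalgebra Scalar (Uplus d R) :=
    { carrier := {x | ∀ y, (∀ n, B (Eplus d R i n) y = 0) → ∀ n, B (Eplus d R i n) (x * y) = 0}
      mul_mem' := fun {a b} ha hb y hy n => by rw [mul_assoc]; exact ha _ (hb _ hy) n
      add_mem' := fun {a b} ha hb y hy n => by rw [add_mul, map_add, ha y hy, hb y hy, add_zero]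
      algebraMap_mem' := fun c y hy n => by rw [← Algebra.smul_def, map_smul, hy, smul_zero] }
  have h1 : thetaPlus d R j t ∈ Q := by
    rw [thetaPlus_eq]
    refine expCoeff_mem Q (fun s => Q.smul_mem (fun y hy n => ?_) _) t
    rw [pairing_E_H_mul hA hB, hy, mul_zero]
  have h2 := h1 1 (pairing_E_one hA hB i) n
  rwa [mul_one, ← thetaZ_natCast] at h2

theorem pairing_E_E_mul (i j : ι) (n l : ℤ) (y : Uplus d R) :
    B (Eplus d R i n) (Eplus d R j l * y) =
      B (Eplus d R i n) (Eplus d R j l) * Uplus.counit R hA y := by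
  have h1 := pairing_E_mul hA hB i n (Eplus d R j l) y
  have h2 : ∀ p, B (thetaZ d R i p) (Eplus d R j l) * B (Eplus d R i (n - p)) y = 0 := fun p => by
    rw [hB.symm, pairing_E_theta hA hB, zero_mul]
  simp only [h2] at h1
  rw [← pairing_one hA hB]
  exact (sub_eq_zero.1 (h1.2.symm.trans HasFinsum.zero.2))

/-- Every Hopf pairing agrees with `form` on the `E_{i,n}`. -/
theorem pairing_E (i : ι) (n : ℤ) : B (Eplus d R i n) = Uplus.form R hA (Eplus d R i n) := by
  have h0 := isHopfPairing (R := R) hA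
  ext y
  induction y using Uplus.induction generalizing n with
  | one => rw [pairing_E_one hA hB, pairing_E_one hA h0]
  | add x y hx hy => rw [map_add, map_add, hx, hy]
  | smul c x hx => rw [map_smul, map_smul, hx]
  | mul_E j l x _ => rw [pairing_E_E_mul hA hB, pairing_E_E_mul hA h0, hB.E_E, h0.E_E]
  | mul_H j s x hx => rw [pairing_E_H_mul hA hB, pairing_E_H_mul hA h0, hx]

end Pairing

/-! ### Contraction of the coproduct -/

theorem contractFirst_counit (x : Uplus d R) (p : ℤ) :
    contractFirst (Uplus.counit R hA).toLinearMap ((Δ R hA x).coeff p) = if p = 0 then x else 0 := by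
  induction x using Uplus.induction generalizing p with
  | one =>
    rw [map_one, HahnSeries.coeff_one]
    split_ifs
    · change Uplus.counit R hA 1 • (1 : Uplus d R) = 1
      rw [map_one, one_smul]
    · exact map_zero _
  | add x y hx hy =>
    rw [map_add, HahnSeries.coeff_add, map_add, hx, hy]
    split_ifs <;> simp
  | smul c x hx =>
    rw [map_smul, HahnSeries.coeff_smul, map_smul, hx, smul_ite, smul_zero]
  | mul_E j l x hx =>
    have h1 : ∀ w, contractFirst (Uplus.counit R hA).toLinearMap (inl (Eplus d R j l) * w) = 0 := by
      intro w
      induction w using TwistedSquare.induction with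
      | add x y hx hy => rw [mul_add, map_add, hx, hy, add_zero]
      | weight α β a b _ _ =>
        rw [inl_mul_tens]
        change Uplus.counit R hA (Eplus d R j l * a) • b = 0
        rw [map_mul, Uplus.counit_E, zero_mul]
        exact zero_smul Scalar b
    have h2 : ∀ (t : ℕ) w, contractFirst (Uplus.counit R hA).toLinearMap (inl (thetaZ d R j t) *
        (inr (Eplus d R j (l - t)) * w)) = if t = 0 then
          Eplus d R j l * contractFirst (Uplus.counit R hA).toLinearMap w else 0 := by
      intro t w
      induction w using TwistedSquare.induction with
      | add x y hx hy =>
        rw [mul_add, mul_add, map_add, map_add, hx, hy]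
        split_ifs <;> simp [mul_add]
      | weight α β a b _ _ =>
        rw [inr_E_mul_tens hA, inl_mul_tens]
        change Uplus.counit R hA (thetaZ d R j t * Uplus.wt R hA _ a) • (Eplus d R j (l - t) * b) =
          if t = 0 then Eplus d R j l * (Uplus.counit R hA a • b) else 0
        have h3 : (Uplus.counit R hA).comp (Uplus.wt R hA fun k => v ^ (-bMat A d j k)) =
            Uplus.counit R hA := Uplus.algHom_ext (fun i l => by simp) fun i s => by simp
        rw [map_mul, map_thetaZ_of_map_H (Uplus.counit_H hA), ← DFunLike.congr_fun h3 a]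
        simp only [Nat.cast_eq_zero]
        split_ifs with h
        · subst h
          rw [one_mul, Nat.cast_zero, sub_zero, mul_smul_comm]
          rfl
        · rw [zero_mul]
          exact zero_smul Scalar _
    rw [map_mul, Δ_E, coeff_E_mul (N := 1), h1, zero_add, Finset.sum_range_one, h2, if_pos rfl,
      Nat.cast_zero, sub_zero, hx, mul_ite, mul_zero]
    intro t ht
    rw [h2, if_neg (by omega)]
  | mul_H j s x hx =>
    have h1 : ∀ w, contractFirst (Uplus.counit R hA).toLinearMap (inl (Uplus.H d R j s) * w) = 0 ∧
        contractFirst (Uplus.counit R hA).toLinearMap (inr (Uplus.H d R j s) * w) =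
          Uplus.H d R j s * contractFirst (Uplus.counit R hA).toLinearMap w := by
      intro w
      induction w using TwistedSquare.induction with
      | add x y hx hy =>
        rw [mul_add, mul_add, map_add, map_add, map_add, hx.1, hx.2, hy.1, hy.2, mul_add, add_zero]
        exact ⟨rfl, rfl⟩
      | weight α β a b _ _ =>
        rw [inl_mul_tens, inr_H_mul_tens]
        refine ⟨?_, (mul_smul_comm (Uplus.counit R hA a) (Uplus.H d R j s) b).symm⟩
        change Uplus.counit R hA (Uplus.H d R j s * a) • b = 0
        rw [map_mul, Uplus.counit_H, zero_mul]
        exact zero_smul Scalar b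
    rw [map_mul, Δ_H, coeff_H_mul, map_add, (h1 _).1, (h1 _).2, hx, zero_add, mul_ite, mul_zero]

theorem form_E_theta (i j : ι) (n : ℤ) (t : ℕ) (x : Uplus d R) :
    Uplus.form R hA (Eplus d R i n) (Uplus.theta R hA j t x) =
      gcoef A d i j t * Uplus.form R hA (Eplus d R i (n - t)) x := by
  have h1 := DFunLike.congr_fun (Uplus.coTheta_mul_mulOp_E (R := R) hA j i t n (N := t + 1)
    (by push_cast; omega)) 1
  simp only [Module.End.mul_apply, Uplus.mulOp_apply, LinearMap.sum_apply, LinearMap.smul_apply,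
    mul_one, Uplus.coTheta_one] at h1
  rw [Finset.sum_eq_single t] at h1
  · rw [Uplus.form_symm, Uplus.form_theta, h1, map_smul, Uplus.form_symm, sub_self, if_pos rfl,
      mul_one, smul_eq_mul, gcoef_symm hA i j]
  · intro s _ hs
    rw [if_neg (by omega), mul_zero]
    exact smul_zero _
  · simp

/-- Induction on `x`: contracting the coproduct of a generator reproduces the left Leibniz rules
`FPrime_E_mul` and `FPrime_H_mul`. The contribution sits in the single degree `n`, because `E_{i,n}`
pairs only with loop degree `n`. -/
theorem contractFirst_form_E (i : ι) (n : ℤ) (x : Uplus d R) (p : ℤ) :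
    contractFirst (Uplus.form R hA (Eplus d R i n)) ((Δ R hA x).coeff p) =
      if p = n then (v ^ (-2 : ℤ) - 1)⁻¹ • Uplus.FPrime R hA i n x else 0 := by
  induction x using Uplus.induction generalizing n p with
  | one =>
    rw [map_one, HahnSeries.coeff_one, Uplus.FPrime_one, smul_zero, ite_self]
    split_ifs
    · change Uplus.form R hA (Eplus d R i n) 1 • (1 : Uplus d R) = 0
      rw [Uplus.form_one_right, Uplus.counit_E]
      exact zero_smul Scalar _
    · exact map_zero _
  | add x y hx hy =>
    rw [map_add, HahnSeries.coeff_add, map_add, hx, hy, map_add]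
    split_ifs <;> simp
  | smul c x hx =>
    rw [map_smul, HahnSeries.coeff_smul, map_smul, hx, map_smul, smul_ite, smul_zero, smul_comm c]
  | mul_E j l x hx =>
    have h1 : ∀ w, contractFirst (Uplus.form R hA (Eplus d R i n)) (inl (Eplus d R j l) * w) =
        if i = j ∧ n = l then
          (v ^ (-2 : ℤ) - 1)⁻¹ • contractFirst (Uplus.counit R hA).toLinearMap w else 0 := by
      intro w
      induction w using TwistedSquare.induction with
      | add x y hx hy =>
        rw [mul_add, map_add, map_add, hx, hy]
        split_ifs <;> simp
      | weight α β a b _ _ =>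
        rw [inl_mul_tens]
        change Uplus.form R hA (Eplus d R i n) (Eplus d R j l * a) • b =
          if i = j ∧ n = l then (v ^ (-2 : ℤ) - 1)⁻¹ • (Uplus.counit R hA a • b) else 0
        rw [pairing_E_E_mul hA (isHopfPairing hA), Uplus.form_E_E, one_div]
        split_ifs
        · rw [smul_smul]
        · rw [zero_mul]
          exact zero_smul Scalar b
    have h2 : ∀ (t : ℕ) w, contractFirst (Uplus.form R hA (Eplus d R i n)) (inl (thetaZ d R j t) *
        (inr (Eplus d R j (l - t)) * w)) = gcoef A d i j t • (Eplus d R j (l - t) *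
          contractFirst (Uplus.form R hA (Eplus d R i (n - t))) w) := by
      intro t w
      induction w using TwistedSquare.induction with
      | add x y hx hy => rw [mul_add, mul_add, map_add, map_add, hx, hy, mul_add, smul_add]
      | weight α β a b _ _ =>
        rw [inr_E_mul_tens hA, inl_mul_tens, ← theta_apply]
        change Uplus.form R hA (Eplus d R i n) (Uplus.theta R hA j t a) • (Eplus d R j (l - t) * b) =
          gcoef A d i j t • (Eplus d R j (l - t) * (Uplus.form R hA (Eplus d R i (n - t)) a • b))
        rw [form_E_theta, mul_smul_comm, smul_smul]
    obtain ⟨N, hN⟩ := Uplus.FPrime_eventually hA i n x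
    have h3 : ∀ t : ℕ, contractFirst (Uplus.form R hA (Eplus d R i n)) (inl (thetaZ d R j t) *
        (inr (Eplus d R j (l - t)) * (Δ R hA x).coeff (p - t))) = if p = n then
          (v ^ (-2 : ℤ) - 1)⁻¹ • (gcoef A d i j t • (Eplus d R j (l - t) *
            Uplus.FPrime R hA i (n - t) x)) else 0 := by
      intro t
      rw [h2, hx]
      simp only [sub_left_inj]
      split_ifs
      · rw [mul_smul_comm, smul_comm]
      · rw [mul_zero, smul_zero]
    rw [map_mul, Δ_E, coeff_E_mul (N := N), h1, contractFirst_counit,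
      Uplus.FPrime_E_mul hA i n j l x hN]
    · simp only [h3]
      by_cases hp : p = n
      · simp only [if_pos hp, smul_add, Finset.smul_sum]
        congr 1
        by_cases h : i = j ∧ n = l
        · rw [if_pos h, if_pos (by omega), if_pos h]
        · rw [if_neg h, if_neg h, smul_zero]
      · simp only [if_neg hp, Finset.sum_const_zero, add_zero]
        split_ifs
        · omega
        · exact smul_zero _
        · rfl
    · intro t ht
      rw [h3, hN t ht, mul_zero, smul_zero, smul_zero, ite_self]
  | mul_H j s x hx =>
    have h1 : ∀ w, contractFirst (Uplus.form R hA (Eplus d R i n)) (inl (Uplus.H d R j s) * w) =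
          hcoef A d i j s • contractFirst (Uplus.form R hA (Eplus d R i (n - s))) w ∧
        contractFirst (Uplus.form R hA (Eplus d R i n)) (inr (Uplus.H d R j s) * w) =
          Uplus.H d R j s * contractFirst (Uplus.form R hA (Eplus d R i n)) w := by
      intro w
      induction w using TwistedSquare.induction with
      | add x y hx hy =>
        rw [mul_add, mul_add, map_add, map_add, map_add, map_add, hx.1, hx.2, hy.1, hy.2, mul_add,
          smul_add]
        exact ⟨rfl, rfl⟩
      | weight α β a b _ _ =>
        rw [inl_mul_tens, inr_H_mul_tens]
        refine ⟨?_, (mul_smul_comm (Uplus.form R hA (Eplus d R i n) a) (Uplus.H d R j s) b).symm⟩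
        change Uplus.form R hA (Eplus d R i n) (Uplus.H d R j s * a) • b =
          hcoef A d i j s • (Uplus.form R hA (Eplus d R i (n - s)) a • b)
        rw [pairing_E_H_mul hA (isHopfPairing hA), smul_smul]
    rw [map_mul, Δ_H, coeff_H_mul, map_add, (h1 _).1, (h1 _).2, hx, hx, Uplus.FPrime_H_mul]
    simp only [sub_left_inj]
    split_ifs
    · rw [smul_add, mul_smul_comm, smul_comm, add_comm]
    · rw [smul_zero, mul_zero, add_zero]

end Coproduct

end Uniqueness

theorem serreForm_eq_zero_of_intertwined {M N : Type*} [AddCommGroup M] [Module Scalar M]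
    [AddCommGroup N] [Module Scalar N] (f : N →ₗ[Scalar] M) (hf : Function.Injective f) {u : Scalar}
    {r : ℕ} {x : Fin r → Module.End Scalar N} {y : Module.End Scalar N}
    {x' : Fin r → Module.End Scalar M} {y' : Module.End Scalar M}
    (hx : ∀ a n, f (x a n) = x' a (f n)) (hy : ∀ n, f (y n) = y' (f n))
    (h : serreForm u r x' y' = 0) : serreForm u r x y = 0 := by
  let Q : Subalgebra Scalar (Module.End Scalar N × Module.End Scalar M) :=
    { carrier := {z | ∀ n, f (z.1 n) = z.2 (f n)}
      mul_mem' := fun {a b} ha hb n => (ha _).trans (congrArg a.2 (hb n))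
      add_mem' := fun {a b} ha hb n => (map_add f _ _).trans (congrArg₂ (· + ·) (ha n) (hb n))
      algebraMap_mem' := fun c n => map_smul f c n }
  have h1 : serreForm u r (fun a => (x a, x' a)) (y, y') ∈ Q := serreForm_mem Q u hx hy
  rw [serreForm_prod, h] at h1
  exact LinearMap.ext fun n => hf ((h1 n).trans (map_zero f).symm)

/-! ### Restriction to the subalgebra generated by the `E_{i,l}`. -/

section Restriction

variable {ι : Type*} [Fintype ι] [DecidableEq ι] {A : Matrix ι ι ℤ} {d : ι → ℕ}
  {V : Type*} [AddCommGroup V] [Module ℂ V] {R : Realization A V} (hA : IsSymmetrizableGCM A d)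

namespace Uplus

/-- The left Leibniz rule produces nothing but letters `E` and values of `F'` on the remaining
factor, so the subalgebra is preserved. -/
theorem FPrime_mem (i : ι) (n : ℤ) {x : Uplus d R} (hx : x ∈ Un d R) : FPrime R hA i n x ∈ Un d R := by
  suffices h : ∀ y ∈ Un d R, (∀ n, FPrime R hA i n y ∈ Un d R) → ∀ n, FPrime R hA i n (x * y) ∈ Un d R by
    simpa using h 1 (Un d R).one_mem (fun n => by rw [FPrime_one]; exact (Un d R).zero_mem) n
  induction hx using Algebra.adjoin_induction with
  | mem x hx =>
    obtain ⟨j, l, rfl⟩ := hx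
    intro y hy h n
    obtain ⟨N, hN⟩ := FPrime_eventually hA i n y
    rw [FPrime_E_mul hA i n j l y hN]
    refine (Un d R).add_mem ?_ ((Un d R).sum_mem fun t _ => (Un d R).smul_mem ((Un d R).mul_mem
      (Algebra.subset_adjoin ⟨j, _, rfl⟩) (h _)) _)
    split_ifs
    exacts [hy, (Un d R).zero_mem]
  | algebraMap c =>
    intro y _ h n
    rw [← Algebra.smul_def, map_smul]
    exact (Un d R).smul_mem (h n) c
  | add a b _ _ ha hb =>
    intro y hy h n
    rw [add_mul, map_add]
    exact (Un d R).add_mem (ha y hy h n) (hb y hy h n)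
  | mul a b _ hb' ha hb =>
    intro y hy h n
    rw [mul_assoc]
    exact ha _ ((Un d R).mul_mem hb' hy) (hb y hy h) n

variable (R) in
/-- The operator `F'_{i,n}` on the subalgebra generated by the `E_{j,l}`. -/
def FPrimeUn (i : ι) (n : ℤ) : Module.End Scalar (Un d R) :=
  { toFun := fun x => ⟨FPrime R hA i n x, FPrime_mem hA i n x.2⟩
    map_add' := fun x y => Subtype.ext (map_add (FPrime R hA i n) (x : Uplus d R) y)
    map_smul' := fun c x => Subtype.ext (map_smul (FPrime R hA i n) c (x : Uplus d R)) }

theorem FPrimeUn_quad (i j : ι) (l m : ℤ) :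
    FPrimeUn R hA i (l + 1) * FPrimeUn R hA j m -
        v ^ bMat A d i j • (FPrimeUn R hA j m * FPrimeUn R hA i (l + 1)) =
      v ^ bMat A d i j • (FPrimeUn R hA i l * FPrimeUn R hA j (m + 1)) -
        FPrimeUn R hA j (m + 1) * FPrimeUn R hA i l := by
  refine LinearMap.ext fun x => Subtype.ext ?_
  have h := DFunLike.congr_fun (congrArg MulOpposite.unop ((isCurrents_op_FPrime (R := R) hA).quad i j l m))
    (x : Uplus d R)
  change v ^ bMat A d i j • FPrime R hA j m (FPrime R hA i (l + 1) x) -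
      FPrime R hA i (l + 1) (FPrime R hA j m x) = FPrime R hA j (m + 1) (FPrime R hA i l x) -
        v ^ bMat A d i j • FPrime R hA i l (FPrime R hA j (m + 1) x) at h
  change FPrime R hA i (l + 1) (FPrime R hA j m x) -
      v ^ bMat A d i j • FPrime R hA j m (FPrime R hA i (l + 1) x) =
    v ^ bMat A d i j • FPrime R hA i l (FPrime R hA j (m + 1) x) -
      FPrime R hA j (m + 1) (FPrime R hA i l x)
  rw [← neg_sub, h, neg_sub]

theorem FPrimeUn_serre (i j : ι) (hij : i ≠ j) (r : ℕ) (hr : (r : ℤ) = 1 - A i j) (l : Fin r → ℤ)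
    (l' : ℤ) : serreSum (v ^ d i) (FPrimeUn R hA i) (FPrimeUn R hA j l') r l = 0 := by
  have h1 : serreForm (v ^ d i) r (fun a => FPrime R hA i (l a)) (FPrime R hA j l') = 0 := by
    refine MulOpposite.op_injective ?_
    rw [op_serreForm, ← serreSum_eq (X := fun n => MulOpposite.op (FPrime R hA i n)),
      (isCurrents_op_FPrime hA).serre i j hij r hr l l', smul_zero, MulOpposite.op_zero]
  rw [serreSum_eq]
  exact serreForm_eq_zero_of_intertwined (Un d R).val.toLinearMap Subtype.val_injective
    (fun _ _ => rfl) (fun _ => rfl) h1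

end Uplus

theorem Coproduct.isFPrime {B : Uplus d R →ₗ[Scalar] Uplus d R →ₗ[Scalar] Scalar}
    (hB : IsHopfPairing (Δ R hA).toLinearMap B) (i : ι) (n : ℤ) :
    IsFPrime (Δ R hA).toLinearMap B i n (Uplus.FPrimeUn R hA i n) := by
  intro x
  rw [pairing_E hA hB]
  have h1 : HasFinsum (fun p => contractFirst (Uplus.form R hA (Eplus d R i n))
      (((Δ R hA).toLinearMap (x : Uplus d R)).coeff p))
      ((v ^ (-2 : ℤ) - 1)⁻¹ • Uplus.FPrime R hA i n x) := by
    simp only [AlgHom.toLinearMap_apply, contractFirst_form_E]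
    exact HasFinsum.single _ _
  refine ⟨h1.1, ?_⟩
  have h2 : v ^ (-2 : ℤ) - 1 ≠ 0 := by
    rw [zpow_neg, ← inv_zpow]
    exact sub_ne_zero.2 (generic_v.inv.pow_ne_one 2 two_pos)
  rw [h1.2, smul_smul, mul_inv_cancel₀ h2]
  exact (one_smul Scalar _).symm

end Restriction

end QuantumLoop

end

open QuantumLoop in
theorem mainTheorem5 {ι : Type*} [Fintype ι] [DecidableEq ι] {A : Matrix ι ι ℤ} {d : ι → ℕ}
    (hA : IsSymmetrizableGCM A d) {V : Type*} [AddCommGroup V] [Module ℂ V]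
    (R : Realization A V) :
    (∃ (Δ : Uplus d R →ₗ[Scalar] CompletedSquare d R)
        (B : Uplus d R →ₗ[Scalar] Uplus d R →ₗ[Scalar] Scalar),
      IsTwistedCoproduct Δ ∧ IsHopfPairing Δ B) ∧
    ∀ (Δ : Uplus d R →ₗ[Scalar] CompletedSquare d R)
        (B : Uplus d R →ₗ[Scalar] Uplus d R →ₗ[Scalar] Scalar),
      IsTwistedCoproduct Δ → IsHopfPairing Δ B →
      ∃ F' : ι → ℤ → Module.End Scalar (Un d R),
        (∀ i n, IsFPrime Δ B i n (F' i n)) ∧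
        (∀ (i j : ι) (l m : ℤ),
          F' i (l + 1) * F' j m - v ^ bMat A d i j • (F' j m * F' i (l + 1)) =
            v ^ bMat A d i j • (F' i l * F' j (m + 1)) - F' j (m + 1) * F' i l) ∧
        (∀ (i j : ι), i ≠ j → ∀ r : ℕ, (r : ℤ) = 1 - A i j → ∀ (l : Fin r → ℤ) (l' : ℤ),
          serreSum (v ^ d i) (F' i) (F' j l') r l = 0) := by
  refine ⟨⟨_, _, Coproduct.isTwistedCoproduct hA, Coproduct.isHopfPairing hA⟩, ?_⟩
  intro Δ B hΔ hB
  -- The given coproduct is the constructed one. The given pairing need not be compared in full with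
  -- the constructed form: only its values with `E_{i,n}` enter.
  obtain rfl := Coproduct.eq_of_isTwistedCoproduct hA hΔ
  exact ⟨Uplus.FPrimeUn R hA, fun i n => Coproduct.isFPrime hA hB i n,
    fun i j l m => Uplus.FPrimeUn_quad hA i j l m,
    fun i j hij r hr l l' => Uplus.FPrimeUn_serre hA i j hij r hr l l'⟩
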